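/- Let $P$ be a hyperbolic pair of pants, i.e. a compact hyperbolic surface with geodesic boundary, homeomorphic to a sphere minus three open discs, with boundary components $c_1,c_2,c_3$ (all closed geodesics, no cusps). For each $c_i$ choose a positive way of spiraling, i.e. an orientation of $c_i$. A measured geodesic lamination on $P$ is a subset $L$ of the interior of $P$, closed in the interior, foliated by complete simple pairwise disjoint geodesics (the leaves), together with a transverse measure: to each compact embedded arc $c$ in the interior transverse to the leaves is assigned a finite Borel measure $\mu_c$ with support $c\cap L$, such that $\mu_{c'}=\mu_c|_{c'}$ for transverse arcs $c'\subset c$, and such that $\mu_c$ and $\mu_{c'}$ have the same total mass if $c$ and $c'$ are homotopic through transverse arcs whose endpoints each stay in one stratum (a leaf or a component of the complement of $L$). The empty lamination is allowed, and arcs ending on the boundary may have infinite mass. For each such lamination $\lambda$ and each $i$ there is a collar of $c_i$ in which every leaf that enters it spirals around $c_i$, all in the same direction, and in which the total mass of the geodesic loop based at $x$ and parallel to $c_i$ does not depend on the point $x$ of the collar (with $x\notin\partial P$). This total mass is the mass $m_\lambda(c_i)\ge 0$. The signed mass $\overline m_\lambda(c_i)$ is the real number with $|\overline m_\lambda(c_i)|=m_\lambda(c_i)$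 which, when non-zero, is positive if the leaves near $c_i$ spiral in the positive way and negative otherwise. Then the signed masses are well defined, and the map $$\lambda\longmapsto(\overline m_\lambda(c_1),\overline m_\lambda(c_2),\overline m_\lambda(c_3))$$ is a bijection from the set of measured geodesic laminations on $P$ onto $\mathbb R^3$. -/

import Mathlib

open Set Filter Topology MeasureTheory UpperHalfPlane
open scoped MatrixGroups

noncomputable section

namespace PantsLamination

/-! ### Hyperbolic plane -/

/-- A complete geodesic of the hyperbolic plane: the image of an arclength parametrized
bi-infinite geodesic, i.e. of an isometric embedding of the real line. -/
def IsCompleteGeodesic (ℓ : Set ℍ) : Prop :=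
  ∃ γ : ℝ → ℍ, Isometry γ ∧ range γ = ℓ

/-- The geodesic segment joining two points of the hyperbolic plane. -/
def segm (x y : ℍ) : Set ℍ := {z | dist x z + dist z y = dist x y}

/-- Geodesic convexity. -/
def GeodConvex (S : Set ℍ) : Prop := ∀ x ∈ S, ∀ y ∈ S, segm x y ⊆ S

/-- `g` is hyperbolic and `α` is an arclength parametrization of its axis
(in either of the two directions): `g` translates along `α` by some `T ≠ 0`. -/
def IsAxis (g : SL(2, ℝ)) (α : ℝ → ℍ) : Prop :=
  Isometry α ∧ ∃ T : ℝ, T ≠ 0 ∧ ∀ t, g • α t = α (t + T)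

/-- The complete geodesic `ℓ` has a ray asymptotic to the positive end of the
arclength parametrized geodesic `α`. -/
def AsymptoticTo (ℓ : Set ℍ) (α : ℝ → ℍ) : Prop :=
  ∃ γ : ℝ → ℍ, Isometry γ ∧ range γ = ℓ ∧ Tendsto (fun t => dist (γ t) (α t)) atTop (𝓝 0)

/-! ### Hyperbolic pairs of pants -/

/-- The fundamental group of a pair of pants is free of rank two; these are the classes of the
three (compatibly oriented) boundary components, whose product is `1`. -/
def peripheral : Fin 3 → FreeGroup (Fin 2) :=
  ![FreeGroup.of 0, FreeGroup.of 1, (FreeGroup.of 0 * FreeGroup.of 1)⁻¹]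

/-- The convex core of the group of isometries `ρ (π₁)`: the smallest nonempty closed
geodesically convex invariant subset of the hyperbolic plane. -/
def convexCore (ρ : FreeGroup (Fin 2) →* SL(2, ℝ)) : Set ℍ :=
  ⋂₀ {S | S.Nonempty ∧ IsClosed S ∧ GeodConvex S ∧ ∀ g, ∀ z ∈ S, ρ g • z ∈ S}

/-- A hyperbolic pair of pants with geodesic boundary (no cusps), given by its holonomy
representation: a discrete representation of the fundamental group by orientation-preserving
isometries of the hyperbolic plane, faithful as such (that is, in `PSL(2, ℝ)`), such that the
image of each peripheral element is hyperbolic and its axis is a boundary curve of the convex core.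
The surface is the quotient of the convex core by the group. As the fundamental group is free,
each representation in `PSL(2, ℝ)` is induced by one in `SL(2, ℝ)`; all notions below depend only
on the action on `ℍ`. -/
structure HyperbolicPants where
  hol : FreeGroup (Fin 2) →* SL(2, ℝ)
  faithful : ∀ g, (∀ z : ℍ, hol g • z = z) → g = 1
  discrete : DiscreteTopology hol.range
  boundary : ∀ i, ∃ α : ℝ → ℍ, IsAxis (hol (peripheral i)) α ∧ range α ⊆ frontier (convexCore hol)

namespace HyperbolicPants

variable (P : HyperbolicPants)

/-- The universal cover of the interior of the pair of pants: the interior of the convex core. -/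
def cover : Set ℍ := interior (convexCore P.hol)

/-- `f`, restricted to `[0,1]`, is a regular `C¹` parametrization of an embedded arc in the
cover of the interior of the surface, transverse to each of the geodesics in `𝓛`. -/
structure IsTransverseParam (𝓛 : Set (Set ℍ)) (f : ℝ → ℍ) : Prop where
  contDiff : ContDiff ℝ 1 (fun t => (f t : ℂ))
  injOn : InjOn f (Icc 0 1)
  mem_cover : ∀ t ∈ Icc (0 : ℝ) 1, f t ∈ P.cover
  regular : ∀ t ∈ Icc (0 : ℝ) 1, deriv (fun t => (f t : ℂ)) t ≠ 0
  transverse : ∀ t ∈ Icc (0 : ℝ) 1, ∀ γ : ℝ → ℍ, Isometry γ → range γ ∈ 𝓛 → ∀ s, γ s = f t →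
    LinearIndependent ℝ ![deriv (fun s => (γ s : ℂ)) s, deriv (fun t => (f t : ℂ)) t]

/-- A compact arc (as a set of points) transverse to each of the geodesics in `𝓛`. -/
def IsTransverseArc (𝓛 : Set (Set ℍ)) (c : Set ℍ) : Prop :=
  ∃ f : ℝ → ℍ, P.IsTransverseParam 𝓛 f ∧ f '' Icc 0 1 = c

/-- A homotopy (of class `C¹`, parametrized by `s ∈ [0,1]`) through transverse arcs,
during which the two endpoints stay in their strata: they neither leave nor enter a leaf. -/
structure IsTransverseHomotopy (𝓛 : Set (Set ℍ)) (F : ℝ × ℝ → ℍ) : Prop where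
  contDiff : ContDiff ℝ 1 (fun p => (F p : ℂ))
  transverse : ∀ s ∈ Icc (0 : ℝ) 1, P.IsTransverseParam 𝓛 (fun t => F (s, t))
  left_stratum : ∀ s ∈ Icc (0 : ℝ) 1, ∀ ℓ ∈ 𝓛, F (s, 0) ∈ ℓ ↔ F (0, 0) ∈ ℓ
  right_stratum : ∀ s ∈ Icc (0 : ℝ) 1, ∀ ℓ ∈ 𝓛, F (s, 1) ∈ ℓ ↔ F (0, 1) ∈ ℓ

/-- A measured geodesic lamination on the interior of the pair of pants, described through its
lift to the universal cover. The support `⋃₀ leaves` is a closed subset of the (open) surface,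
foliated by complete geodesics; the leaves downstairs are simple and disjoint, i.e. the lifted
leaves are pairwise disjoint. The transverse measure assigns to each compact transverse arc `c` a
finite Borel measure with support `c ∩ ⋃₀ leaves`, compatibly with restriction to subarcs and with
total mass invariant under homotopy through transverse arcs. (To sets which are not transverse arcs
we let it assign the zero measure, so that equality of laminations means what it should.) -/
structure MeasuredLamination where
  leaves : Set (Set ℍ)
  isGeodesic : ∀ ℓ ∈ leaves, IsCompleteGeodesic ℓ
  subset_cover : ∀ ℓ ∈ leaves, ℓ ⊆ P.cover
  disjoint : ∀ ℓ ∈ leaves, ∀ ℓ' ∈ leaves, ℓ ≠ ℓ' → Disjoint ℓ ℓ'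
  closed : closure (⋃₀ leaves) ∩ P.cover ⊆ ⋃₀ leaves
  leaves_invariant : ∀ g, ∀ ℓ ∈ leaves, (fun z => P.hol g • z) '' ℓ ∈ leaves
  μ : Set ℍ → Measure ℍ
  μ_junk : ∀ c, ¬ P.IsTransverseArc leaves c → μ c = 0
  μ_finite : ∀ c, IsFiniteMeasure (μ c)
  μ_support : ∀ c, P.IsTransverseArc leaves c → (μ c).support = c ∩ ⋃₀ leaves
  μ_restrict : ∀ c c', P.IsTransverseArc leaves c → P.IsTransverseArc leaves c' → c' ⊆ c →
    μ c' = (μ c).restrict c'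
  μ_homotopy : ∀ F : ℝ × ℝ → ℍ, P.IsTransverseHomotopy leaves F →
    μ ((fun t => F (0, t)) '' Icc 0 1) univ = μ ((fun t => F (1, t)) '' Icc 0 1) univ
  μ_invariant : ∀ g c, μ ((fun z => P.hol g • z) '' c) = (μ c).map (fun z => P.hol g • z)

variable {P}

/-- `m` is the signed mass of the `i`-th boundary component for the lamination `Λ`, where `α` is an
oriented parametrization of the lift of this component which is the axis of
`P.hol (peripheral i)`; the orientation given by `α` is the positive way of spiraling.
There is a collar (of width `r`) of the boundary component such that each leaf which enters it
spirals around the component, each geodesic loop parallel to the component and based at a point of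
the collar has mass `|m|`, and the leaves spiral in the positive (negative) way if `m > 0` (`m < 0`).
The loop based at `x` lifts to the segment from `x` to its translate by the peripheral element,
whose endpoints are the same point of the loop, so that one of them is left out. -/
def MeasuredLamination.HasSignedMass (Λ : P.MeasuredLamination) (i : Fin 3) (α : ℝ → ℍ)
    (m : ℝ) : Prop :=
  ∃ r > 0,
    (∀ ℓ ∈ Λ.leaves, (∃ x ∈ ℓ, Metric.infDist x (range α) < r) →
      (AsymptoticTo ℓ α ∨ AsymptoticTo ℓ (fun t => α (-t))) ∧
      (0 < m → AsymptoticTo ℓ α) ∧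
      (m < 0 → AsymptoticTo ℓ (fun t => α (-t)))) ∧
    ∀ x ∈ P.cover, Metric.infDist x (range α) < r →
      P.IsTransverseArc Λ.leaves (segm x (P.hol (peripheral i) • x)) ∧
      Λ.μ (segm x (P.hol (peripheral i) • x))
        (segm x (P.hol (peripheral i) • x) \ {P.hol (peripheral i) • x}) = ENNReal.ofReal |m|

end HyperbolicPants

end PantsLamination

end

noncomputable section

namespace PantsLamination

/-! ### The hyperbolic plane as the space of positive definite binary forms -/

/-! A pair of pants is the double of a right-angled hexagon along its three seams, so its holonomy
group has index two in the group generated by the reflections in three disjoint geodesics; up to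
scalars, the peripheral elements are the products of two of these reflections. The reflections are
found algebraically: the normalized commutator of two peripheral matrices inverts both of them under
conjugation, and the position of the boundary axes forces the product of the three peripheral traces
to be negative (`trace_sign`), which makes the three geodesics bound a common region (`exists_hex`).
A limit point is then coded by the seams that separate it from the successive tiles, and the code
determines it (`exists_separating`).

Comparing the codes of the two ends of a geodesic that does not cross its translates shows that both
ends spiral around boundary components and that the geodesic follows one of six simple arcs: an arc
joining two components, or an arc from a component to itself which goes between the other two
(`Leaf.classify`, `exists_base`). The only other possibility, a boundary geodesic, does not lie in
the interior. Two of the six leaves cross exactly when their arcs have to (`Compat`). The directions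
of spiraling are irrelevant for this, since an end of a boundary axis can be replaced by a point of
the gap of the limit set behind the axis (`Frame.dichotomy`). In one lamination all leaves at a
given component spiral in the same direction, because otherwise a boundary translate of one leaf
would cross another (`not_both`).

It follows that the leaves are locally finite, that a transverse measure is a sum of atoms, and that
the atom is constant along each leaf (`exists_wt`). A lamination is therefore a choice of directions
and of weights on pairwise compatible arcs. Conversely such weights define a lamination by counting
intersections (`WtSys.lamination`), whose homotopy invariance is the persistence of nondegenerate
zeros (`ZeroFamily.encard_zeros_eq`).

A loop close to a boundary component meets each class of lifts spiraling around it exactly once, so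
the mass is the sum of the weights of the arcs ending there, an arc with both ends there counting
twice (`exists_mass`, `mass_eq`). Compatible weights correspond bijectively to triples of
nonnegative masses: at most one self-arc occurs, its weight is half the excess of one mass over the
sum of the other two, and the remaining weights solve a linear system (`CompatWeights.ext`,
`exists_compatWeights`). The signs of the masses record the directions of spiraling, which are
immaterial where the mass vanishes. -/

/-- Vectors of the plane; a nonzero vector represents an ideal point of `ℍ`. -/
abbrev V2 := Fin 2 → ℝ

/-- The standard area form. -/
def br (u v : V2) : ℝ := u 0 * v 1 - u 1 * v 0

/-- The positive definite form attached to a point of `ℍ`. -/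
def bq (z : ℍ) (u v : V2) : ℝ :=
  u 1 * v 1 * (z.re ^ 2 + z.im ^ 2) - (u 0 * v 1 + u 1 * v 0) * z.re + u 0 * v 0

/-- The complete geodesic with ideal endpoints `u` and `v`. -/
def geo (u v : V2) : Set ℍ := {z | bq z u v = 0}

/-- The squared norm of the denominator of a Möbius transformation. -/
def dn (g : SL(2, ℝ)) (z : ℍ) : ℝ := (g 1 0 * z.re + g 1 1) ^ 2 + (g 1 0 * z.im) ^ 2

/-- The linear action on the plane. -/
def act (g : SL(2, ℝ)) (u : V2) : V2 := ![g 0 0 * u 0 + g 0 1 * u 1, g 1 0 * u 0 + g 1 1 * u 1]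

@[simp] lemma act_zero (g : SL(2, ℝ)) (u : V2) : act g u 0 = g 0 0 * u 0 + g 0 1 * u 1 := rfl
@[simp] lemma act_one (g : SL(2, ℝ)) (u : V2) : act g u 1 = g 1 0 * u 0 + g 1 1 * u 1 := rfl

lemma sl_det (g : SL(2, ℝ)) : g 0 0 * g 1 1 - g 0 1 * g 1 0 = 1 := by
  have := g.det_coe
  rwa [Matrix.det_fin_two] at this

lemma act_mul (g h : SL(2, ℝ)) (u : V2) : act (g * h) u = act g (act h u) := by
  ext i
  fin_cases i <;> simp [act, Matrix.mul_apply, Fin.sum_univ_two] <;> ring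

@[simp] lemma one_act (u : V2) : act 1 u = u := by
  ext i
  fin_cases i <;> simp [act]

lemma act_inv_act (g : SL(2, ℝ)) (u : V2) : act g⁻¹ (act g u) = u := by
  rw [← act_mul]; simp

lemma act_act_inv (g : SL(2, ℝ)) (u : V2) : act g (act g⁻¹ u) = u := by
  rw [← act_mul]; simp

lemma br_act (g : SL(2, ℝ)) (u v : V2) : br (act g u) (act g v) = br u v := by
  have := sl_det g
  simp only [br, act_zero, act_one]
  linear_combination (u 0 * v 1 - u 1 * v 0) * this

lemma act_smul (g : SL(2, ℝ)) (k : ℝ) (u : V2) : act g (k • u) = k • act g u := by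
  ext i
  fin_cases i <;> simp [act] <;> ring

lemma act_add (g : SL(2, ℝ)) (u v : V2) : act g (u + v) = act g u + act g v := by
  ext i
  fin_cases i <;> simp [act] <;> ring

lemma dn_pos (g : SL(2, ℝ)) (z : ℍ) : 0 < dn g z := by
  have h := sl_det g
  have hz := z.im_pos
  unfold dn
  by_cases hc : g 1 0 = 0
  · have : g 1 1 ≠ 0 := by
      rintro h1
      rw [hc, h1] at h
      simp at h
    have : 0 < (g 1 1) ^ 2 := by positivity
    rw [hc]
    linarith
  · have : 0 < (g 1 0 * z.im) ^ 2 := by positivity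
    positivity

lemma coe_sl_smul (g : SL(2, ℝ)) (z : ℍ) :
    ((g • z : ℍ) : ℂ) = ((g 0 0 : ℂ) * z + g 0 1) / ((g 1 0 : ℂ) * z + g 1 1) := by
  simpa using coe_specialLinearGroup_apply g z

lemma dn_eq (g : SL(2, ℝ)) (z : ℍ) : Complex.normSq ((g 1 0 : ℂ) * z + g 1 1) = dn g z := by
  simp [Complex.normSq_apply, dn]; ring

lemma sl_im (g : SL(2, ℝ)) (z : ℍ) : (g • z).im = z.im / dn g z := by
  have h := sl_det g
  rw [← coe_im, coe_sl_smul, Complex.div_im, dn_eq]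
  have := (dn_pos g z).ne'
  simp
  field_simp
  linear_combination h

lemma sl_re (g : SL(2, ℝ)) (z : ℍ) : (g • z).re =
    ((g 0 0 * z.re + g 0 1) * (g 1 0 * z.re + g 1 1) + g 0 0 * g 1 0 * z.im ^ 2) / dn g z := by
  rw [← coe_re, coe_sl_smul, Complex.div_re, dn_eq]
  have := (dn_pos g z).ne'
  simp
  field_simp

/-- A point is a definite quadratic form normalized by its value on `e1`, and the group acts on
forms by change of variables; `dn` restores the normalization. All incidence relations `bq z u v =
0` are therefore equivariant. -/
lemma bq_smul (g : SL(2, ℝ)) (z : ℍ) (u v : V2) :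
    bq (g • z) (act g u) (act g v) = bq z u v / dn g z := by
  have h := sl_det g
  have hd := (dn_pos g z).ne'
  have h1 : g 0 0 * g 1 1 = 1 + g 0 1 * g 1 0 := by linarith
  have hns : (g • z).re ^ 2 + (g • z).im ^ 2 =
      ((g 0 0 * z.re + g 0 1) ^ 2 + (g 0 0 * z.im) ^ 2) / dn g z := by
    rw [sl_re, sl_im]
    field_simp
    simp only [dn]
    linear_combination
      (-(g 0 0 * g 1 1 - g 0 1 * g 1 0 + 1) * z.im ^ 2) * h
  rw [bq, hns, sl_re, bq]
  field_simp
  simp only [act_zero, act_one]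
  unfold dn
  linear_combination ((u 1 * v 1 * (z.re ^ 2 + z.im ^ 2) - (u 0 * v 1 + u 1 * v 0) * z.re + u 0 * v 0) *
    (g 0 0 * g 1 1 - g 0 1 * g 1 0 + 1)) * h

lemma bq_smul' (g : SL(2, ℝ)) (z : ℍ) (u v : V2) :
    bq (g • z) u v = bq z (act g⁻¹ u) (act g⁻¹ v) / dn g z := by
  rw [← bq_smul, act_act_inv, act_act_inv]

lemma bq_comm (z : ℍ) (u v : V2) : bq z u v = bq z v u := by
  unfold bq; ring

lemma geo_comm (u v : V2) : geo u v = geo v u := by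
  ext z; simp [geo, bq_comm z u v]

lemma mem_geo_smul (g : SL(2, ℝ)) (z : ℍ) (u v : V2) :
    g • z ∈ geo (act g u) (act g v) ↔ z ∈ geo u v := by
  simp [geo, bq_smul, (dn_pos g z).ne']

lemma mem_geo_smul' (g : SL(2, ℝ)) (z : ℍ) (u v : V2) :
    g • z ∈ geo u v ↔ z ∈ geo (act g⁻¹ u) (act g⁻¹ v) := by
  simp [geo, bq_smul', (dn_pos g z).ne']

lemma image_geo (g : SL(2, ℝ)) (u v : V2) :
    (fun z => g • z) '' geo u v = geo (act g u) (act g v) := by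
  ext z
  constructor
  · rintro ⟨w, hw, rfl⟩
    exact (mem_geo_smul g w u v).2 hw
  · intro hz
    refine ⟨g⁻¹ • z, ?_, by simp⟩
    rw [← mem_geo_smul g]
    simpa using hz

lemma bq_smul_left (z : ℍ) (k : ℝ) (u v : V2) : bq z (k • u) v = k * bq z u v := by
  simp [bq]; ring

lemma geo_smul_left {k : ℝ} (hk : k ≠ 0) (u v : V2) : geo (k • u) v = geo u v := by
  ext z; simp [geo, bq_smul_left, hk]

lemma geo_smul_right {k : ℝ} (hk : k ≠ 0) (u v : V2) : geo u (k • v) = geo u v := by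
  rw [geo_comm, geo_smul_left hk, geo_comm]

lemma bq_self_pos (z : ℍ) {u : V2} (hu : u ≠ 0) : 0 < bq z u u := by
  have hz := z.im_pos
  have : bq z u u = (u 1 * z.re - u 0) ^ 2 + (u 1 * z.im) ^ 2 := by unfold bq; ring
  rw [this]
  by_cases h : u 1 = 0
  · have : u 0 ≠ 0 := by
      intro h0; apply hu; ext i; fin_cases i <;> simp [h, h0]
    have : 0 < u 0 ^ 2 := by positivity
    rw [h]; linarith
  · have : 0 < (u 1 * z.im) ^ 2 := by positivity
    positivity

/-- The standard basis. -/
def e1 : V2 := ![1, 0]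
/-- The standard basis. -/
def e2 : V2 := ![0, 1]

@[simp] lemma e1_zero : e1 0 = 1 := rfl
@[simp] lemma e1_one : e1 1 = 0 := rfl
@[simp] lemma e2_zero : e2 0 = 0 := rfl
@[simp] lemma e2_one : e2 1 = 1 := rfl

lemma br_e1_e2 : br e1 e2 = 1 := by simp [br]

lemma bq_e1_e2 (z : ℍ) : bq z e1 e2 = -z.re := by simp [bq]

lemma mem_geo_e (z : ℍ) : z ∈ geo e1 e2 ↔ z.re = 0 := by simp [geo, bq_e1_e2]

/-- The point `i e ^ t`. -/
def iexp (t : ℝ) : ℍ := ⟨⟨0, Real.exp t⟩, Real.exp_pos t⟩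

@[simp] lemma iexp_re (t : ℝ) : (iexp t).re = 0 := rfl
@[simp] lemma iexp_im (t : ℝ) : (iexp t).im = Real.exp t := rfl

lemma isometry_iexp : Isometry iexp := isometry_vertical_line 0

/-- The matrix with given columns. -/
def ofCols (u v : V2) (h : br u v = 1) : SL(2, ℝ) :=
  ⟨!![u 0, v 0; u 1, v 1], by rw [Matrix.det_fin_two_of]; unfold br at h; linarith⟩

lemma act_ofCols_e1 (u v : V2) (h : br u v = 1) : act (ofCols u v h) e1 = u := by
  ext i; fin_cases i <;> simp [act, ofCols]

lemma act_ofCols_e2 (u v : V2) (h : br u v = 1) : act (ofCols u v h) e2 = v := by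
  ext i; fin_cases i <;> simp [act, ofCols]

lemma exists_act_e {u v : V2} (h : br u v ≠ 0) :
    ∃ g : SL(2, ℝ), act g e1 = u ∧ act g e2 = (br u v)⁻¹ • v := by
  have : br u ((br u v)⁻¹ • v) = 1 := by
    have : br u ((br u v)⁻¹ • v) = (br u v)⁻¹ * br u v := by simp [br]; ring
    rw [this, inv_mul_cancel₀ h]
  exact ⟨ofCols _ _ this, act_ofCols_e1 _ _ _, act_ofCols_e2 _ _ _⟩

lemma exists_geo_eq_image {u v : V2} (h : br u v ≠ 0) :
    ∃ g : SL(2, ℝ), act g e1 = u ∧ act g e2 = (br u v)⁻¹ • v ∧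
      geo u v = geo (act g e1) (act g e2) := by
  obtain ⟨g, h1, h2⟩ := exists_act_e h
  refine ⟨g, h1, h2, ?_⟩
  rw [h1, h2, geo_smul_right (inv_ne_zero h)]

/-- The diagonal matrix translating along the imaginary axis by `t`. -/
def diagT (t : ℝ) : SL(2, ℝ) :=
  ⟨!![Real.exp (t / 2), 0; 0, Real.exp (-(t / 2))], by
    rw [Matrix.det_fin_two_of, ← Real.exp_add]; simp⟩

lemma ext_re_im {z w : ℍ} (h1 : z.re = w.re) (h2 : z.im = w.im) : z = w :=
  UpperHalfPlane.ext (Complex.ext h1 h2)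

lemma diagT_re (t : ℝ) (z : ℍ) : (diagT t • z).re = Real.exp t * z.re := by
  rw [sl_re]
  simp [dn, diagT]
  rw [Real.exp_neg, show Real.exp t = Real.exp (t / 2) * Real.exp (t / 2) by
    rw [← Real.exp_add]; ring_nf]
  field_simp

lemma diagT_im (t : ℝ) (z : ℍ) : (diagT t • z).im = Real.exp t * z.im := by
  rw [sl_im]
  simp [dn, diagT]
  rw [Real.exp_neg, show Real.exp t = Real.exp (t / 2) * Real.exp (t / 2) by
    rw [← Real.exp_add]; ring_nf]
  field_simp

lemma diagT_iexp (s t : ℝ) : diagT s • iexp t = iexp (t + s) := by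
  apply ext_re_im
  · simp [diagT_re]
  · rw [diagT_im]; simp [Real.exp_add, mul_comm]

lemma geo_e_eq_range : geo e1 e2 = range iexp := by
  ext z
  rw [mem_geo_e]
  constructor
  · intro h
    refine ⟨Real.log z.im, ext_re_im h.symm ?_⟩
    simp [Real.exp_log z.im_pos]
  · rintro ⟨t, rfl⟩; rfl

lemma geo_act_e (g : SL(2, ℝ)) : geo (act g e1) (act g e2) = range fun t => g • iexp t := by
  rw [← image_geo, geo_e_eq_range, ← range_comp]; rfl

/-- Any two points lie on a geodesic. -/
lemma exists_re_eq_zero (x y : ℍ) : ∃ g : SL(2, ℝ), (g • x).re = 0 ∧ (g • y).re = 0 := by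
  suffices ∃ u v, br u v = 1 ∧ x ∈ geo u v ∧ y ∈ geo u v by
    obtain ⟨u, v, h, hx, hy⟩ := this
    refine ⟨(ofCols u v h)⁻¹, ?_, ?_⟩ <;> rw [← mem_geo_e, mem_geo_smul', inv_inv,
      act_ofCols_e1, act_ofCols_e2] <;> assumption
  by_cases hxy : x.re = y.re
  · refine ⟨e1, ![x.re, 1], by simp [br], ?_, ?_⟩ <;> simp [geo, bq, hxy]
  -- Centre and radius of the Euclidean circle through both points which is orthogonal to the real
  -- line.
  · set c := ((x.re ^ 2 + x.im ^ 2) - (y.re ^ 2 + y.im ^ 2)) / (2 * (x.re - y.re)) with hc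
    set r := Real.sqrt ((x.re - c) ^ 2 + x.im ^ 2) with hr
    have hpos : 0 < (x.re - c) ^ 2 + x.im ^ 2 := by have := x.im_pos; positivity
    have hr0 : 0 < r := Real.sqrt_pos.2 hpos
    have hr2 : r ^ 2 = (x.re - c) ^ 2 + x.im ^ 2 := Real.sq_sqrt hpos.le
    have hc' : c * (2 * (x.re - y.re)) = (x.re ^ 2 + x.im ^ 2) - (y.re ^ 2 + y.im ^ 2) := by
      rw [hc, div_mul_cancel₀]; intro h; apply hxy; linarith
    clear_value c
    -- The ideal endpoints `c + r` and `c - r`, the first scaled to make the bracket `1`.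
    refine ⟨![(c + r) / (2 * r), 1 / (2 * r)], ![c - r, 1], ?_, ?_, ?_⟩
    · simp [br]; field_simp; ring
    · simp [geo, bq]; field_simp; linear_combination -hr2
    · simp [geo, bq]; field_simp; linear_combination -hr2 + hc'

lemma bq_eq_of_re_zero {x : ℍ} (hx : x.re = 0) (u v : V2) :
    bq x u v = u 1 * v 1 * x.im ^ 2 + u 0 * v 0 := by
  simp [bq, hx]

lemma dist_of_re_zero {x y : ℍ} (hx : x.re = 0) (hy : y.re = 0) :
    dist x y = |Real.log x.im - Real.log y.im| := by
  rw [dist_of_re_eq (by rw [hx, hy]), Real.dist_eq]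

lemma smul_mem_segm (g : SL(2, ℝ)) {x y z : ℍ} : g • z ∈ segm (g • x) (g • y) ↔ z ∈ segm x y := by
  simp [segm, dist_smul]

/-- Projecting `z` to the axis along a horizontal line does not increase the distances to `x` and
`y`. Equality in the triangle inequality forces equality in the projection, hence `z` is its own
projection. -/
lemma re_eq_zero_of_mem_segm {x y z : ℍ} (hx : x.re = 0) (hy : y.re = 0) (h : z ∈ segm x y) :
    z.re = 0 := by
  have h1 := dist_log_im_le x z
  have h2 := dist_log_im_le z y
  have h3 := dist_triangle (Real.log x.im) (Real.log z.im) (Real.log y.im)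
  have h4 : dist x y = dist (Real.log x.im) (Real.log y.im) := dist_of_re_eq (by rw [hx, hy])
  have h5 : dist x z + dist z y = dist x y := h
  have h6 : dist x z = dist (Real.log x.im) (Real.log z.im) := by linarith
  let w : ℍ := ⟨⟨0, z.im⟩, z.im_pos⟩
  have h7 : dist x w = dist x z := by
    rw [h6]; exact dist_of_re_eq (by rw [hx]; rfl)
  have h8 := congrArg Real.cosh h7
  rw [cosh_dist, cosh_dist] at h8
  have hw : w.im = z.im := rfl
  rw [hw] at h8
  have := x.im_pos
  have := z.im_pos
  field_simp at h8
  rw [Complex.dist_eq, Complex.dist_eq, ← Complex.normSq_eq_norm_sq, ← Complex.normSq_eq_norm_sq,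
    Complex.normSq_apply, Complex.normSq_apply] at h8
  simp only [Complex.sub_re, Complex.sub_im, coe_re, coe_im, hx, hw] at h8
  have hw' : w.re = 0 := rfl
  rw [hw'] at h8
  nlinarith

lemma mem_segm_iff_of_re_zero {x y z : ℍ} (hx : x.re = 0) (hy : y.re = 0) (hz : z.re = 0) :
    z ∈ segm x y ↔ (x.im ≤ z.im ∧ z.im ≤ y.im) ∨ (y.im ≤ z.im ∧ z.im ≤ x.im) := by
  have px := x.im_pos
  have py := y.im_pos
  have pz := z.im_pos
  rw [← Real.log_le_log_iff px pz, ← Real.log_le_log_iff pz py, ← Real.log_le_log_iff py pz,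
    ← Real.log_le_log_iff pz px]
  simp only [segm, mem_ofPred_eq, dist_of_re_zero hx hz, dist_of_re_zero hz hy,
    dist_of_re_zero hx hy]
  grind

/-- Segments are cut out by the cone spanned by the forms of the endpoints. -/
lemma mem_segm_iff {x y z : ℍ} :
    z ∈ segm x y ↔ ∃ s t : ℝ, 0 ≤ s ∧ 0 ≤ t ∧ ∀ u v, bq z u v = s * bq x u v + t * bq y u v := by
  obtain ⟨g, hx, hy⟩ := exists_re_eq_zero x y
  rw [← smul_mem_segm g]
  have key : g • z ∈ segm (g • x) (g • y) ↔ ∃ s t : ℝ, 0 ≤ s ∧ 0 ≤ t ∧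
      ∀ u v, bq (g • z) u v = s * bq (g • x) u v + t * bq (g • y) u v := by
    have px := (g • x).im_pos
    have py := (g • y).im_pos
    have pz := (g • z).im_pos
    constructor
    · intro h
      have hz := re_eq_zero_of_mem_segm hx hy h
      rw [mem_segm_iff_of_re_zero hx hy hz] at h
      simp only [bq_eq_of_re_zero hx, bq_eq_of_re_zero hy, bq_eq_of_re_zero hz]
      have : (g • z).im ^ 2 ∈ segment ℝ ((g • x).im ^ 2) ((g • y).im ^ 2) := by
        rw [segment_eq_uIcc, mem_uIcc]
        rcases h with h | h
        · left; constructor <;> nlinarith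
        · right; constructor <;> nlinarith
      obtain ⟨s, t, hs, ht, hst, h⟩ := this
      refine ⟨s, t, hs, ht, fun u v => ?_⟩
      rw [← h]
      simp only [smul_eq_mul]
      linear_combination (-u 0 * v 0) * hst
    · rintro ⟨s, t, hs, ht, h⟩
      have hz : (g • z).re = 0 := by
        have := h e1 e2
        simp only [bq_e1_e2, hx, hy] at this
        linarith
      rw [mem_segm_iff_of_re_zero hx hy hz]
      simp only [bq_eq_of_re_zero hx, bq_eq_of_re_zero hy, bq_eq_of_re_zero hz] at h
      have h1 := h e1 e1
      have h2 := h e2 e2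
      simp at h1 h2
      have ht' : t = 1 - s := by linarith
      rcases le_total (g • x).im (g • y).im with hxy | hxy
      · left
        have : (g • x).im ^ 2 ≤ (g • y).im ^ 2 := by gcongr
        constructor <;> refine le_of_sq_le_sq ?_ (by positivity) <;> rw [h2, ht'] <;> nlinarith
      · right
        have : (g • y).im ^ 2 ≤ (g • x).im ^ 2 := by gcongr
        constructor <;> refine le_of_sq_le_sq ?_ (by positivity) <;> rw [h2, ht'] <;> nlinarith
  rw [key]
  have dx := dn_pos g x
  have dy := dn_pos g y
  have dz := dn_pos g z
  constructor
  · rintro ⟨s, t, hs, ht, h⟩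
    refine ⟨s * dn g z / dn g x, t * dn g z / dn g y, by positivity, by positivity, fun u v => ?_⟩
    have := h (act g u) (act g v)
    simp only [bq_smul] at this
    field_simp at this ⊢
    linarith
  · rintro ⟨s, t, hs, ht, h⟩
    refine ⟨s * dn g x / dn g z, t * dn g y / dn g z, by positivity, by positivity, fun u v => ?_⟩
    simp only [bq_smul', h]
    field_simp

lemma eq_of_bq_eq {x y : ℍ} {s : ℝ} (h : ∀ u v, bq x u v = s * bq y u v) : x = y := by
  have h1 := h e1 e1
  have h2 := h e1 e2
  have h3 := h e2 e2
  simp [bq] at h1 h2 h3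
  subst h1
  have h4 : x.re = y.re := by linarith
  refine ext_re_im h4 ?_
  rw [h4] at h3
  have := x.im_pos
  have := y.im_pos
  nlinarith

/-- Solves the relation of `mem_segm_iff` for an endpoint, in order to extend a geodesic beyond a
known segment. -/
lemma right_bq_of_mem_segm {x y z : ℍ} (h : z ∈ segm x y) (hne : z ≠ x) :
    ∃ a b : ℝ, ∀ u v, bq y u v = a * bq x u v + b * bq z u v := by
  obtain ⟨s, t, -, -, h⟩ := mem_segm_iff.1 h
  have ht : t ≠ 0 := by
    rintro rfl
    exact hne (eq_of_bq_eq (s := s) (by simpa using h))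
  refine ⟨-s / t, 1 / t, fun u v => ?_⟩
  rw [h]; field_simp; ring

/-- Arclength parametrized geodesics are translates of the imaginary axis. -/
lemma Isometry.exists_eq_smul_iexp {γ : ℝ → ℍ} (hγ : Isometry γ) :
    ∃ g : SL(2, ℝ), ∀ t, γ t = g • iexp t := by
  obtain ⟨g, h0, h1⟩ := exists_re_eq_zero (γ 0) (γ 1)
  have hd : ∀ s t, dist (γ s) (γ t) = |s - t| := fun s t => by rw [hγ.dist_eq, Real.dist_eq]
  have hinj : ∀ {s t}, s ≠ t → γ s ≠ γ t := fun h => hγ.injective.ne h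
  -- Whichever of `γ 0`, `γ 1`, `γ t` lies between the other two, the three forms are linearly
  -- dependent. A linear condition valid at times `0` and `1`, such as lying on the imaginary axis,
  -- thus propagates to all times.
  have hbq : ∀ t, ∃ a b : ℝ, ∀ u v, bq (γ t) u v = a * bq (γ 0) u v + b * bq (γ 1) u v := by
    intro t
    rcases le_total t 0 with ht | ht
    · have : γ 0 ∈ segm (γ 1) (γ t) := by
        simp only [segm, mem_ofPred_eq, hd]
        rw [abs_of_nonneg, abs_of_nonneg, abs_of_nonneg] <;> linarith
      obtain ⟨a, b, h⟩ := right_bq_of_mem_segm this (hinj zero_ne_one)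
      exact ⟨b, a, fun u v => by rw [h, add_comm]⟩
    rcases le_total t 1 with ht' | ht'
    · have : γ t ∈ segm (γ 0) (γ 1) := by
        simp only [segm, mem_ofPred_eq, hd]
        rw [abs_of_nonpos, abs_of_nonpos, abs_of_nonpos] <;> linarith
      obtain ⟨a, b, -, -, h⟩ := mem_segm_iff.1 this
      exact ⟨a, b, h⟩
    · have : γ 1 ∈ segm (γ 0) (γ t) := by
        simp only [segm, mem_ofPred_eq, hd]
        rw [abs_of_nonpos, abs_of_nonpos, abs_of_nonpos] <;> linarith
      exact right_bq_of_mem_segm this (hinj one_ne_zero)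
  have hre : ∀ t, (g • γ t).re = 0 := by
    intro t
    obtain ⟨a, b, h⟩ := hbq t
    rw [← mem_geo_e, mem_geo_smul'] at h0 h1 ⊢
    simp only [geo, mem_ofPred_eq] at h0 h1 ⊢
    rw [h, h0, h1]; ring
  obtain ⟨g, hre, hlt⟩ : ∃ g : SL(2, ℝ), (∀ t, (g • γ t).re = 0) ∧ (g • γ 0).im < (g • γ 1).im := by
    rcases lt_trichotomy (g • γ 0).im (g • γ 1).im with h | h | h
    · exact ⟨g, hre, h⟩
    · exact absurd (smul_left_cancel g (ext_re_im (by rw [hre, hre]) h)) (hinj zero_ne_one)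
    · let S : SL(2, ℝ) := ⟨!![0, -1; 1, 0], by simp⟩
      have hS : ∀ t, ((S * g) • γ t).im = 1 / (g • γ t).im := by
        intro t
        rw [mul_smul, sl_im]
        simp [S, dn, hre]
        have := (g • γ t).im_pos
        field_simp
      refine ⟨S * g, fun t => ?_, ?_⟩
      · rw [mul_smul, sl_re]; simp [S, hre]
      · rw [hS, hS]
        exact one_div_lt_one_div_of_lt (g • γ 1).im_pos h
  have hdist : ∀ s t, |Real.log (g • γ s).im - Real.log (g • γ t).im| = |s - t| := by
    intro s t
    rw [← dist_of_re_zero (hre s) (hre t), dist_smul, hd]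
  have hlog : Real.log (g • γ 0).im < Real.log (g • γ 1).im := Real.log_lt_log (g • γ 0).im_pos hlt
  set c := Real.log (g • γ 0).im with hc
  -- On a line the distances to two given points determine the position.
  have hf : ∀ t, Real.log (g • γ t).im = c + t := by
    intro t
    have a1 := hdist t 0
    have a2 := hdist t 1
    have a3 := hdist 1 0
    rw [← hc] at a1 a3
    rw [sub_zero] at a1
    rw [sub_zero, abs_one] at a3
    clear_value c
    generalize Real.log (g • γ t).im = p at *
    generalize Real.log (g • γ 1).im = q at *
    have hq : q = c + 1 := by
      rw [abs_of_pos (by linarith)] at a3; linarith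
    subst hq
    rcases abs_cases (p - c) with h | h <;> rcases abs_cases (p - (c + 1)) with h' | h' <;>
      rcases abs_cases t with h'' | h'' <;> rcases abs_cases (t - 1) with h''' | h''' <;> linarith
  refine ⟨g⁻¹ * diagT c, fun t => ?_⟩
  rw [mul_smul, eq_inv_smul_iff, diagT_iexp]
  refine ext_re_im (by rw [hre]; rfl) ?_
  rw [iexp_im, add_comm, ← hf, Real.exp_log (g • γ t).im_pos]

/-! ### Geodesics and their endpoints -/

lemma isCompleteGeodesic_iff {ℓ : Set ℍ} :
    IsCompleteGeodesic ℓ ↔ ∃ g : SL(2, ℝ), ℓ = geo (act g e1) (act g e2) := by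
  constructor
  · rintro ⟨γ, hγ, rfl⟩
    obtain ⟨g, hg⟩ := Isometry.exists_eq_smul_iexp hγ
    refine ⟨g, ?_⟩
    rw [geo_act_e]
    exact congrArg range (funext hg)
  · rintro ⟨g, rfl⟩
    exact ⟨fun t => g • iexp t, (isometry_smul ℍ g).comp isometry_iexp, (geo_act_e g).symm⟩

lemma isCompleteGeodesic_geo {u v : V2} (h : br u v ≠ 0) : IsCompleteGeodesic (geo u v) := by
  obtain ⟨g, -, -, hg⟩ := exists_geo_eq_image h
  exact isCompleteGeodesic_iff.2 ⟨g, hg⟩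

lemma IsCompleteGeodesic.exists_geo {ℓ : Set ℍ} (h : IsCompleteGeodesic ℓ) :
    ∃ u v, br u v ≠ 0 ∧ ℓ = geo u v := by
  obtain ⟨g, rfl⟩ := isCompleteGeodesic_iff.1 h
  exact ⟨_, _, by rw [br_act, br_e1_e2]; exact one_ne_zero, rfl⟩

lemma br_self (u : V2) : br u u = 0 := by unfold br; ring

lemma br_anticomm (u v : V2) : br u v = -br v u := by unfold br; ring

lemma br_smul_left (k : ℝ) (u v : V2) : br (k • u) v = k * br u v := by
  simp [br]; ring

lemma br_smul_right (k : ℝ) (u v : V2) : br u (k • v) = k * br u v := by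
  simp [br]; ring

lemma br_add_left (u u' v : V2) : br (u + u') v = br u v + br u' v := by
  simp [br]; ring

lemma br_add_right (u v v' : V2) : br u (v + v') = br u v + br u v' := by
  simp [br]; ring

lemma left_ne_zero_of_br {u v : V2} (h : br u v ≠ 0) : u ≠ 0 := by
  rintro rfl; simp [br] at h

lemma right_ne_zero_of_br {u v : V2} (h : br u v ≠ 0) : v ≠ 0 := by
  rintro rfl; simp [br] at h

lemma exists_smul_of_br_eq_zero {u v : V2} (hu : u ≠ 0) (h : br u v = 0) : ∃ k : ℝ, v = k • u := by
  unfold br at h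
  by_cases h0 : u 0 = 0
  · have h1 : u 1 ≠ 0 := by
      intro h1; apply hu; ext i; fin_cases i <;> simp [h0, h1]
    refine ⟨v 1 / u 1, ?_⟩
    have : v 0 = 0 := by
      have : u 1 * v 0 = 0 := by rw [h0] at h; linarith
      exact (mul_eq_zero.1 this).resolve_left h1
    ext i; fin_cases i <;> simp [h0, this, h1]
  · refine ⟨v 0 / u 0, ?_⟩
    ext i; fin_cases i
    · simp [h0]
    · simp; field_simp; linarith

lemma exists_ne_zero_smul_of_br_eq_zero {u v : V2} (hu : u ≠ 0) (hv : v ≠ 0) (h : br u v = 0) :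
    ∃ k : ℝ, k ≠ 0 ∧ v = k • u := by
  obtain ⟨k, rfl⟩ := exists_smul_of_br_eq_zero hu h
  exact ⟨k, by rintro rfl; simp at hv, rfl⟩

lemma br_eq_zero_trans {u v w : V2} (hv : v ≠ 0) (h1 : br u v = 0) (h2 : br v w = 0) :
    br u w = 0 := by
  obtain ⟨k, rfl⟩ := exists_smul_of_br_eq_zero hv h2
  rw [br_smul_right, h1, mul_zero]

/-- Negative if the geodesics cross, positive if they are disjoint without a common endpoint. -/
def cr (u v u' v' : V2) : ℝ := br u u' * br u v' * br v u' * br v v'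

lemma cr_act (g : SL(2, ℝ)) (u v u' v' : V2) :
    cr (act g u) (act g v) (act g u') (act g v') = cr u v u' v' := by
  simp [cr, br_act]

lemma cr_comm (u v u' v' : V2) : cr u v u' v' = cr u' v' u v := by
  unfold cr
  rw [br_anticomm u u', br_anticomm u v', br_anticomm v u', br_anticomm v v']; ring

lemma cr_swap_left (u v u' v' : V2) : cr u v u' v' = cr v u u' v' := by
  unfold cr; ring

lemma cr_swap_right (u v u' v' : V2) : cr u v u' v' = cr u v v' u' := by
  unfold cr; ring

lemma cr_smul_right (k : ℝ) (u v u' v' : V2) : cr u (k • v) u' v' = k ^ 2 * cr u v u' v' := by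
  simp only [cr, br_smul_left]; ring

lemma cr_e (u v : V2) : cr e1 e2 u v = u 0 * u 1 * v 0 * v 1 := by
  simp [cr, br]; ring

/-- After moving the first geodesic to the imaginary axis, `cr` is the product of the coordinates of
the other two ends; it is negative when these ends lie on opposite sides of `0`, and the
intersection point can be written down. If `br u v = 0` then `cr` is a square, so that case does not
occur. -/
lemma geo_inter_of_cr_neg {u v u' v' : V2} (h : cr u v u' v' < 0) :
    (geo u v ∩ geo u' v').Nonempty := by
  by_cases huv : br u v = 0
  · have hu : u ≠ 0 := by rintro rfl; simp [cr, br] at h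
    obtain ⟨k, rfl⟩ := exists_smul_of_br_eq_zero hu huv
    have : cr u (k • u) u' v' = k ^ 2 * (br u u' * br u v') ^ 2 := by
      simp only [cr, br_smul_left]; ring
    rw [this] at h
    exact absurd h (not_lt.2 (by positivity))
  obtain ⟨g, h1, h2, h3⟩ := exists_geo_eq_image huv
  have hcr : cr (act g e1) (act g e2) u' v' < 0 := by
    rw [h1, h2, cr_smul_right]
    exact mul_neg_of_pos_of_neg (by have := inv_ne_zero huv; positivity) h
  rw [← act_act_inv g u', ← act_act_inv g v', cr_act, cr_e] at hcr
  rw [h3, ← act_act_inv g u', ← act_act_inv g v', ← image_geo, ← image_geo, ← image_inter (MulAction.injective g)]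
  refine Nonempty.image _ ?_
  set p := act g⁻¹ u'
  set q := act g⁻¹ v'
  have hq : p 1 * q 1 ≠ 0 := fun hq => by
    have : p 0 * p 1 * q 0 * q 1 = p 0 * q 0 * (p 1 * q 1) := by ring
    rw [this, hq, mul_zero] at hcr; exact lt_irrefl _ hcr
  have hpos : 0 < -(p 0 * q 0) / (p 1 * q 1) := by
    have : -(p 0 * q 0) / (p 1 * q 1) = -(p 0 * p 1 * q 0 * q 1) / (p 1 * q 1) ^ 2 := by
      field_simp
    rw [this]
    exact div_pos (by linarith) (by positivity)
  refine ⟨⟨⟨0, Real.sqrt (-(p 0 * q 0) / (p 1 * q 1))⟩, Real.sqrt_pos.2 hpos⟩, ?_, ?_⟩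
  · rw [mem_geo_e]; rfl
  · rw [geo, mem_ofPred_eq, bq_eq_of_re_zero rfl]
    have : (⟨⟨0, Real.sqrt (-(p 0 * q 0) / (p 1 * q 1))⟩, Real.sqrt_pos.2 hpos⟩ : ℍ).im ^ 2 =
      -(p 0 * q 0) / (p 1 * q 1) := Real.sq_sqrt hpos.le
    rw [this, mul_comm (p 1 * q 1), div_mul_cancel₀ _ hq]
    ring

/-- In the normal form the incidence relation turns `cr` into minus a square, which vanishes only if
the other ends are also `0` and infinity. -/
lemma cr_of_mem {u v u' v' : V2} (huv : br u v ≠ 0) (huv' : br u' v' ≠ 0) {z : ℍ}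
    (h : z ∈ geo u v) (h' : z ∈ geo u' v') :
    cr u v u' v' < 0 ∨ geo u v = geo u' v' := by
  obtain ⟨g, h1, h2, h3⟩ := exists_geo_eq_image huv
  have hcr : cr (act g e1) (act g e2) u' v' = (br u v)⁻¹ ^ 2 * cr u v u' v' := by
    rw [h1, h2, cr_smul_right]
  have hpos : 0 < (br u v)⁻¹ ^ 2 := by have := inv_ne_zero huv; positivity
  rw [h3]
  rw [← act_act_inv g u', ← act_act_inv g v', cr_act, cr_e] at hcr
  rw [← act_act_inv g u', ← act_act_inv g v', br_act] at huv'
  rw [act_act_inv, act_act_inv] at hcr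
  rw [← smul_inv_smul g z] at h h'
  rw [h3, mem_geo_smul, mem_geo_e] at h
  rw [mem_geo_smul', geo, mem_ofPred_eq, bq_eq_of_re_zero h] at h'
  have hz := (g⁻¹ • z).im_pos
  have hu' : u' = act g (act g⁻¹ u') := (act_act_inv g u').symm
  have hv' : v' = act g (act g⁻¹ v') := (act_act_inv g v').symm
  set p := act g⁻¹ u'
  set q := act g⁻¹ v'
  set y := (g⁻¹ • z).im
  unfold br at huv'
  by_cases hpq : p 1 * q 1 = 0
  · right
    rw [hpq, zero_mul, zero_add] at h'
    rw [hu', hv', ← image_geo, ← image_geo]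
    congr 1
    ext w
    rw [mem_geo_e, geo, mem_ofPred_eq, bq, hpq, h']
    have : p 0 * q 1 + p 1 * q 0 ≠ 0 := by
      intro h0
      rcases mul_eq_zero.1 hpq with h | h <;> rcases mul_eq_zero.1 h' with h' | h' <;>
        simp [h, h'] at h0 huv' <;> tauto
    simp [this]
  · left
    have : p 0 * p 1 * q 0 * q 1 = -((p 1 * q 1) ^ 2 * y ^ 2) := by
      linear_combination (p 1 * q 1) * h'
    have h4 : 0 < (p 1 * q 1) ^ 2 * y ^ 2 := by positivity
    by_contra h5
    have := mul_nonneg hpos.le (not_lt.1 h5)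
    linarith

/-- Two points of the imaginary axis already force the forms `p 1 * q 1` and `p 0 * q 0` to vanish;
the degenerate case where the second locus is the whole plane is excluded by the point `1 + i`. -/
lemma eq_endpoints_of_geo_eq {u v u' v' : V2} (huv : br u v ≠ 0) (h : geo u v = geo u' v') :
    (br u u' = 0 ∧ br v v' = 0) ∨ (br u v' = 0 ∧ br v u' = 0) := by
  obtain ⟨g, h1, h2, h3⟩ := exists_geo_eq_image huv
  have key : ∀ t, iexp t ∈ geo (act g⁻¹ u') (act g⁻¹ v') := by
    intro t
    rw [← mem_geo_smul', ← h, h3, mem_geo_smul, mem_geo_e]; rfl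
  have hu : u = act g e1 := h1.symm
  have hv : v = br u v • act g e2 := by rw [h2, smul_smul, mul_inv_cancel₀ huv, one_smul]
  generalize br u v = k at hv
  rw [hv, hu, br_smul_left, br_smul_left, ← act_act_inv g u', ← act_act_inv g v', br_act, br_act, br_act, br_act]
  set p := act g⁻¹ u'
  set q := act g⁻¹ v'
  have a := key 0
  have b := key 1
  simp only [geo, mem_ofPred_eq, bq, iexp_re, iexp_im, Real.exp_zero] at a b
  have hexp : (1 : ℝ) < Real.exp 1 := Real.one_lt_exp_iff.2 one_pos
  have c : p 1 * q 1 = 0 := by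
    have : p 1 * q 1 * (Real.exp 1 ^ 2 - 1) = 0 := by linarith
    exact (mul_eq_zero.1 this).resolve_right (by nlinarith)
  have d : p 0 * q 0 = 0 := by linarith
  by_cases f : p 1 * q 0 + p 0 * q 1 = 0
  · exfalso
    have : (geo u v : Set ℍ) = univ := by
      rw [h, ← act_act_inv g u', ← act_act_inv g v', ← image_geo]
      apply eq_univ_of_forall
      intro z
      refine ⟨g⁻¹ • z, ?_, by simp⟩
      change bq _ p q = 0
      rw [bq, c, d]
      linear_combination -(g⁻¹ • z).re * f
    rw [h3, ← image_geo] at this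
    obtain ⟨w, hw, hw'⟩ : g • ((1 : ℝ) +ᵥ iexp 0) ∈ (fun z => g • z) '' geo e1 e2 := this ▸ mem_univ _
    rw [smul_left_cancel g hw', mem_geo_e] at hw
    simp at hw
  · simp only [br, e1_zero, e1_one, e2_zero, e2_one]
    rcases mul_eq_zero.1 c with h | h <;> rcases mul_eq_zero.1 d with h' | h' <;>
      simp [h, h'] at f ⊢

/-! ### Asymptotic geodesics -/

/-- The unipotent matrix translating by `r`. -/
def unip (r : ℝ) : SL(2, ℝ) := ⟨!![1, r; 0, 1], by simp⟩

lemma unip_re (r : ℝ) (z : ℍ) : (unip r • z).re = z.re + r := by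
  rw [sl_re]; simp [unip, dn]

lemma unip_im (r : ℝ) (z : ℍ) : (unip r • z).im = z.im := by
  rw [sl_im]; simp [unip, dn]

lemma geo_e1 {w : V2} (hw : w 1 ≠ 0) : geo e1 w = range fun t => unip (w 0 / w 1) • iexp t := by
  ext z
  simp only [geo, mem_ofPred_eq, bq, e1_zero, e1_one, mem_range]
  constructor
  · intro h
    refine ⟨Real.log z.im, ext_re_im ?_ ?_⟩
    · rw [unip_re, iexp_re]; field_simp; linarith
    · rw [unip_im, iexp_im, Real.exp_log z.im_pos]
  · rintro ⟨t, rfl⟩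
    rw [unip_re, iexp_re]; field_simp; ring

lemma tendsto_dist_unip (r : ℝ) : Tendsto (fun t => dist (unip r • iexp t) (iexp t)) atTop (𝓝 0) := by
  have h1 : Tendsto (fun t : ℝ => |r| / Real.exp t) atTop (𝓝 0) :=
    tendsto_const_nhds.div_atTop Real.tendsto_exp_atTop
  refine squeeze_zero (fun _ => dist_nonneg) (fun t => ?_) h1
  refine (dist_le_dist_coe_div_sqrt _ _).trans ?_
  rw [unip_im, Real.sqrt_mul_self (iexp t).im_pos.le, iexp_im]
  gcongr
  rw [Complex.dist_eq]
  have : ((unip r • iexp t : ℍ) : ℂ) - (iexp t : ℂ) = (r : ℂ) := by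
    apply Complex.ext
    · simp [unip_re]
    · simp [unip_im]
  rw [this, Complex.norm_real, Real.norm_eq_abs]

/-- With the common end at infinity both geodesics are vertical lines, whose distance at height `exp
t` is at most a constant over `exp t`. -/
lemma asymptoticTo_geo {g : SL(2, ℝ)} {u v : V2} (huv : br u v ≠ 0) (h : br u (act g e1) = 0) :
    AsymptoticTo (geo u v) (fun t => g • iexp t) := by
  have hu := left_ne_zero_of_br huv
  have he : act g e1 ≠ 0 := fun h0 => by
    have := br_act g e1 e2
    rw [h0, br_e1_e2] at this
    simp [br] at this
  obtain ⟨k, hk, rfl⟩ := exists_ne_zero_smul_of_br_eq_zero he hu (by rw [br_anticomm, h, neg_zero])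
  rw [geo_smul_left hk]
  rw [br_smul_left] at huv
  have hv := (mul_ne_zero_iff.1 huv).2
  rw [← act_act_inv g v, br_act] at hv
  have hw : (act g⁻¹ v) 1 ≠ 0 := by simpa [br] using hv
  refine ⟨fun t => g • (unip ((act g⁻¹ v) 0 / (act g⁻¹ v) 1) • iexp t), ?_, ?_, ?_⟩
  · exact (isometry_smul ℍ g).comp ((isometry_smul ℍ _).comp isometry_iexp)
  · rw [← act_act_inv g v, ← image_geo, act_act_inv, geo_e1 hw, ← range_comp]; rfl
  · simpa only [dist_smul] using tendsto_dist_unip _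

/-- The difference of the two sides is a square which vanishes at the foot of the perpendicular, the
point of the axis of modulus `|z|`. -/
lemma cosh_dist_iexp_ge (z : ℍ) (t : ℝ) :
    1 + (z.re / z.im) ^ 2 ≤ Real.cosh (dist z (iexp t)) ^ 2 := by
  have hz := z.im_pos
  have ht := Real.exp_pos t
  rw [cosh_dist, Complex.dist_eq, ← Complex.normSq_eq_norm_sq, Complex.normSq_apply]
  simp only [Complex.sub_re, Complex.sub_im, coe_re, coe_im, iexp_re, iexp_im]
  have : 1 + ((z.re - 0) * (z.re - 0) + (z.im - Real.exp t) * (z.im - Real.exp t)) /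
    (2 * z.im * Real.exp t) = (z.re ^ 2 + z.im ^ 2 + Real.exp t ^ 2) / (2 * z.im * Real.exp t) := by
    field_simp; ring
  rw [this, div_pow, div_pow, ← sub_nonneg]
  have : (z.re ^ 2 + z.im ^ 2 + Real.exp t ^ 2) ^ 2 / (2 * z.im * Real.exp t) ^ 2 -
    (1 + z.re ^ 2 / z.im ^ 2) = (z.re ^ 2 + z.im ^ 2 - Real.exp t ^ 2) ^ 2 / (2 * z.im * Real.exp t) ^ 2 := by
    field_simp; ring
  rw [this]
  positivity

/-- With the end of the ray at infinity, a geodesic not ending there is a half-circle of bounded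
height, while the ray climbs to arbitrary height. -/
lemma br_eq_zero_of_asymptoticTo {g : SL(2, ℝ)} {u v : V2}
    (h : AsymptoticTo (geo u v) (fun t => g • iexp t)) :
    br u (act g e1) = 0 ∨ br v (act g e1) = 0 := by
  obtain ⟨γ, hγ, hr, hlim⟩ := h
  rw [← act_act_inv g u, ← act_act_inv g v, br_act, br_act]
  have hmem : ∀ t, g⁻¹ • γ t ∈ geo (act g⁻¹ u) (act g⁻¹ v) := by
    intro t
    rw [← mem_geo_smul g, smul_inv_smul, act_act_inv, act_act_inv, ← hr]
    exact mem_range_self t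
  set p := act g⁻¹ u
  set q := act g⁻¹ v
  have hlim' : Tendsto (fun t => dist (g⁻¹ • γ t) (iexp t)) atTop (𝓝 0) := by
    refine hlim.congr fun t => ?_
    rw [← dist_smul g (g⁻¹ • γ t), smul_inv_smul]
  by_contra hcon
  push Not at hcon
  have hpq : p 1 * q 1 ≠ 0 := by
    simp [br] at hcon; exact mul_ne_zero hcon.1 hcon.2
  -- the imaginary part tends to infinity along the ray, while the geodesic is bounded
  have hb : ∃ M : ℝ, ∀ z ∈ geo p q, z.im ≤ M := by
    refine ⟨|(p 0 * q 1 + p 1 * q 0) / (p 1 * q 1)| + |p 0 * q 0 / (p 1 * q 1)| + 1, fun z hz => ?_⟩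
    have hz : bq z p q = 0 := hz
    have : z.im ^ 2 = (p 0 * q 1 + p 1 * q 0) / (p 1 * q 1) * z.re - z.re ^ 2 - p 0 * q 0 / (p 1 * q 1) := by
      unfold bq at hz
      have h0 : p 1 * q 1 * (z.im ^ 2 - ((p 0 * q 1 + p 1 * q 0) / (p 1 * q 1) * z.re - z.re ^ 2 -
          p 0 * q 0 / (p 1 * q 1))) = 0 := by
        rw [div_mul_eq_mul_div, mul_sub, mul_sub, mul_sub, mul_div_cancel₀ _ hpq,
          mul_div_cancel₀ _ hpq]
        linarith
      linarith [(mul_eq_zero.1 h0).resolve_left hpq]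
    set s := (p 0 * q 1 + p 1 * q 0) / (p 1 * q 1)
    set d := p 0 * q 0 / (p 1 * q 1)
    have h1 := neg_abs_le d
    have h2 := abs_nonneg s
    have h3 := abs_nonneg d
    have h4 : s ^ 2 = |s| ^ 2 := (sq_abs s).symm
    apply le_of_sq_le_sq _ (by positivity)
    nlinarith [sq_nonneg (s / 2 - z.re)]
  obtain ⟨M, hM⟩ := hb
  have h1 : ∀ᶠ t in atTop, dist (g⁻¹ • γ t) (iexp t) < 1 := hlim'.eventually (gt_mem_nhds one_pos)
  have h2 : ∀ᶠ t in atTop, M * Real.exp 1 < Real.exp t :=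
    Real.tendsto_exp_atTop.eventually (eventually_gt_atTop _)
  obtain ⟨t, ht1, ht2⟩ := (h1.and h2).exists
  have h3 := im_le_im_mul_exp_dist (iexp t) (g⁻¹ • γ t)
  rw [iexp_im, dist_comm] at h3
  have h4 := hM _ (hmem t)
  have h5 : Real.exp (dist (g⁻¹ • γ t) (iexp t)) ≤ Real.exp 1 := Real.exp_le_exp.2 ht1.le
  have h6 := (g⁻¹ • γ t).im_pos
  have h7 : (g⁻¹ • γ t).im * Real.exp (dist (g⁻¹ • γ t) (iexp t)) ≤ M * Real.exp 1 := by
    gcongr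
    linarith
  linarith

/-- The matrix rotating by a half-turn around `i`. -/
def rotS : SL(2, ℝ) := ⟨!![0, -1; 1, 0], by simp⟩

lemma rotS_smul_iexp (t : ℝ) : rotS • iexp t = iexp (-t) := by
  apply ext_re_im
  · rw [sl_re]; simp [rotS]
  · rw [sl_im]; simp [rotS, dn, Real.exp_neg]; field_simp

lemma act_rotS_e1 : act rotS e1 = e2 := by
  ext i; fin_cases i <;> simp [act, rotS]

lemma act_rotS_e2 : act rotS e2 = -e1 := by
  ext i; fin_cases i <;> simp [act, rotS]

lemma smul_iexp_neg (g : SL(2, ℝ)) :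
    (fun t => g • iexp (-t)) = fun t => (g * rotS) • iexp t := by
  funext t; rw [mul_smul, rotS_smul_iexp]

/-! ### Convexity -/

lemma geodConvex_preimage {S : Set ℍ} (h : GeodConvex S) (g : SL(2, ℝ)) :
    GeodConvex ((fun z => g • z) ⁻¹' S) := fun x hx y hy _ hz =>
  h (g • x) hx (g • y) hy ((smul_mem_segm g).2 hz)

/-- The squared modulus. -/
def np (z : ℍ) : ℝ := z.re ^ 2 + z.im ^ 2

lemma np_gt (z : ℍ) : z.re ^ 2 < np z := by
  have := z.im_pos
  have : 0 < z.im ^ 2 := by positivity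
  unfold np; linarith

lemma eq_of_re_np {z w : ℍ} (h1 : z.re = w.re) (h2 : np z = np w) : z = w := by
  refine ext_re_im h1 ?_
  unfold np at h2
  rw [h1] at h2
  have := z.im_pos
  have := w.im_pos
  nlinarith

/-- In the coordinates `(Re z, |z| ^ 2)` segments are affine segments. -/
lemma mem_segm_of_affine {x y z : ℍ} {s t : ℝ} (hs : 0 ≤ s) (ht : 0 ≤ t) (hst : s + t = 1)
    (h1 : z.re = s * x.re + t * y.re) (h2 : np z = s * np x + t * np y) : z ∈ segm x y := by
  refine mem_segm_iff.2 ⟨s, t, hs, ht, fun u v => ?_⟩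
  unfold np at h2
  unfold bq
  linear_combination (u 1 * v 1) * h2 - (u 0 * v 1 + u 1 * v 0) * h1 - (u 0 * v 0) * hst

lemma exists_re_np {a n : ℝ} (h : a ^ 2 < n) : ∃ z : ℍ, z.re = a ∧ np z = n := by
  have h' : 0 < n - a ^ 2 := by linarith
  refine ⟨⟨⟨a, Real.sqrt (n - a ^ 2)⟩, Real.sqrt_pos.2 h'⟩, rfl, ?_⟩
  change a ^ 2 + Real.sqrt (n - a ^ 2) ^ 2 = n
  rw [Real.sq_sqrt h'.le]; ring

lemma exists_mem_segm (x y : ℍ) {s t : ℝ} (hs : 0 ≤ s) (ht : 0 ≤ t) (hst : s + t = 1) :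
    ∃ z ∈ segm x y, z.re = s * x.re + t * y.re ∧ np z = s * np x + t * np y := by
  have : (s * x.re + t * y.re) ^ 2 < s * np x + t * np y := by
    have hx := np_gt x
    have hy := np_gt y
    obtain rfl : t = 1 - s := by linarith
    have key : 0 < s * (np x - x.re ^ 2) + (1 - s) * (np y - y.re ^ 2) := by
      rcases eq_or_lt_of_le hs with rfl | hs'
      · linarith
      · have := mul_pos hs' (sub_pos.2 hx)
        have := mul_nonneg ht (sub_pos.2 hy).le
        linarith
    nlinarith [mul_nonneg hs (mul_nonneg ht (sq_nonneg (x.re - y.re)))]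
  obtain ⟨z, h1, h2⟩ := exists_re_np this
  exact ⟨z, mem_segm_of_affine hs ht hst h1 h2, h1, h2⟩

/-- A convex set containing the imaginary axis and a point to its right contains a whole
half-neighbourhood of the axis. -/
lemma mem_of_axis_of_point {S : Set ℍ} (h : GeodConvex S) (haxis : geo e1 e2 ⊆ S) {w : ℍ} (hw : w ∈ S)
    {z : ℍ} {t : ℝ} (ht : 0 ≤ t) (ht1 : t < 1) (hz : z.re = t * w.re) (hn : t * np w < np z) :
    z ∈ S := by
  have h1 : 0 < 1 - t := by linarith
  have hpos : (0 : ℝ) ^ 2 < (np z - t * np w) / (1 - t) := by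
    rw [zero_pow two_ne_zero]; exact div_pos (by linarith) h1
  -- In the affine coordinates `y` is the point where the line from `w` through `z` meets the axis.
  obtain ⟨y, hy1, hy2⟩ := exists_re_np hpos
  refine h w hw y (haxis ((mem_geo_e y).2 hy1)) ?_
  refine mem_segm_of_affine ht h1.le (by ring) ?_ ?_
  · rw [hz, hy1]; ring
  · rw [hy2]; field_simp; ring

lemma continuous_np : Continuous np := by
  unfold np
  have := continuous_re
  have := continuous_im
  fun_prop

/-- One point of the set on each side of the axis yields a half-neighbourhood of every point of the
axis on each side. -/
lemma axis_subset_interior {S : Set ℍ} (h : GeodConvex S) (haxis : geo e1 e2 ⊆ S) {w w' : ℍ}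
    (hw : w ∈ S) (hw' : w' ∈ S) (hpos : 0 < w.re) (hneg : w'.re < 0) :
    geo e1 e2 ⊆ interior S := by
  intro z hz
  rw [mem_geo_e] at hz
  rw [mem_interior_iff_mem_nhds]
  have hnz := np_gt z
  have hzp : 0 < np z := lt_of_le_of_lt (sq_nonneg _) hnz
  have o1 : ∀ᶠ y in 𝓝 z, y.re / w.re < 1 :=
    (continuous_re.div_const _).continuousAt.eventually (gt_mem_nhds (by simp [hz]))
  have o2 : ∀ᶠ y in 𝓝 z, y.re / w'.re < 1 :=
    (continuous_re.div_const _).continuousAt.eventually (gt_mem_nhds (by simp [hz]))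
  have o3 : ∀ᶠ y in 𝓝 z, 0 < np y - y.re / w.re * np w :=
    (continuous_np.sub ((continuous_re.div_const _).mul_const _)).continuousAt.eventually
      (lt_mem_nhds (by simpa [hz] using hzp))
  have o4 : ∀ᶠ y in 𝓝 z, 0 < np y - y.re / w'.re * np w' :=
    (continuous_np.sub ((continuous_re.div_const _).mul_const _)).continuousAt.eventually
      (lt_mem_nhds (by simpa [hz] using hzp))
  filter_upwards [o1, o2, o3, o4] with y h1 h2 h3 h4
  rcases le_total 0 y.re with hy | hy
  · exact mem_of_axis_of_point h haxis hw (t := y.re / w.re) (by positivity) h1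
      (by field_simp) (by linarith)
  · exact mem_of_axis_of_point h haxis hw' (t := y.re / w'.re) (div_nonneg_of_nonpos hy hneg.le) h2
      (by field_simp [hneg.ne]) (by linarith)

/-- Near an axis contained in a convex set, the interior accumulates on the axis. -/
lemma exists_mem_interior_near_axis {S : Set ℍ} (h : GeodConvex S) (haxis : geo e1 e2 ⊆ S) {w : ℍ}
    (hw : w ∈ S) (hw0 : w.re ≠ 0) {r : ℝ} (hr : 0 < r) :
    ∃ z ∈ interior S, Metric.infDist z (geo e1 e2) < r := by
  have hI : iexp 0 ∈ geo e1 e2 := (mem_geo_e _).2 rfl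
  have hnI : np (iexp 0) = 1 := by simp [np]
  have key : {z : ℍ | 0 < z.re / w.re ∧ z.re / w.re < 1 ∧ 0 < np z - z.re / w.re * np w} ⊆
      interior S := by
    apply interior_maximal
    · rintro z ⟨h1, h2, h3⟩
      exact mem_of_axis_of_point h haxis hw (t := z.re / w.re) h1.le h2 (by field_simp) (by linarith)
    · have c1 := continuous_re.div_const w.re
      refine (isOpen_lt continuous_const c1).inter ((isOpen_lt c1 continuous_const).inter
        (isOpen_lt continuous_const (continuous_np.sub (c1.mul_const _))))
  have hlim : Tendsto (fun t : ℝ => unip (t * w.re) • iexp 0) (𝓝 0) (𝓝 (iexp 0)) := by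
    have hc : Continuous fun t : ℝ => unip (t * w.re) • iexp 0 := by
      have : (fun t : ℝ => unip (t * w.re) • iexp 0) = fun t : ℝ => ((t * w.re : ℝ) +ᵥ iexp 0) := by
        funext t
        apply ext_re_im
        · rw [unip_re]; simp
        · rw [unip_im]; simp
      rw [this]
      apply isEmbedding_coe.continuous_iff.2
      have : (UpperHalfPlane.coe ∘ fun t : ℝ => ((t * w.re : ℝ) +ᵥ iexp 0)) =
        fun t : ℝ => ((t * w.re : ℝ) : ℂ) + (iexp 0 : ℂ) := by funext t; simp
      rw [this]
      fun_prop
    have := hc.tendsto 0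
    have h0 : unip (0 * w.re) • iexp 0 = iexp 0 := by
      apply ext_re_im
      · rw [unip_re]; simp
      · rw [unip_im]
    rwa [h0] at this
  have e1' : ∀ᶠ t : ℝ in 𝓝[>] 0, unip (t * w.re) • iexp 0 ∈ Metric.ball (iexp 0) r :=
    (hlim.mono_left nhdsWithin_le_nhds).eventually (Metric.ball_mem_nhds _ hr)
  have e2' : ∀ᶠ t : ℝ in 𝓝[>] 0, 0 < np (unip (t * w.re) • iexp 0) - t * np w := by
    have : Tendsto (fun t : ℝ => np (unip (t * w.re) • iexp 0) - t * np w) (𝓝 0) (𝓝 (1 - 0 * np w)) := by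
      rw [← hnI]
      exact ((continuous_np.tendsto _).comp hlim).sub (tendsto_id.mul_const _)
    exact (this.mono_left nhdsWithin_le_nhds).eventually (lt_mem_nhds (by simp))
  have e3' : ∀ᶠ t : ℝ in 𝓝[>] 0, t < 1 := nhdsWithin_le_nhds (gt_mem_nhds one_pos)
  obtain ⟨t, ⟨⟨h1, h2⟩, h3⟩, h4⟩ := (((e1'.and e2').and e3').and self_mem_nhdsWithin).exists
  have hre : (unip (t * w.re) • iexp 0).re / w.re = t := by
    rw [unip_re]; simp [hw0]
  refine ⟨_, key ⟨?_, ?_, ?_⟩, (Metric.infDist_le_dist_of_mem hI).trans_lt h1⟩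
  · rw [hre]; exact h4
  · rw [hre]; exact h3
  · rw [hre]; exact h2

/-! ### Points of geodesics in terms of the ideal endpoints -/

/-- `(A, B, D)` are homogeneous coordinates of the point `z`. -/
def Rep (z : ℍ) (A B D : ℝ) : Prop := 0 < D ∧ z.re * D = B ∧ np z * D = A

lemma exists_rep {A B D : ℝ} (hD : 0 < D) (h : B ^ 2 < A * D) : ∃ z : ℍ, Rep z A B D := by
  have : (B / D) ^ 2 < A / D := by
    rw [div_pow, div_lt_div_iff₀ (by positivity) hD]; nlinarith
  obtain ⟨z, h1, h2⟩ := exists_re_np this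
  exact ⟨z, hD, by rw [h1]; field_simp, by rw [h2]; field_simp⟩

lemma Rep.mem_segm {x y z : ℍ} {A B D A' B' D' : ℝ} (hx : Rep x A B D) (hy : Rep y A' B' D')
    (hz : Rep z (A + A') (B + B') (D + D')) : z ∈ segm x y := by
  obtain ⟨h1, h2, h3⟩ := hx
  obtain ⟨h1', h2', h3'⟩ := hy
  obtain ⟨h1'', h2'', h3''⟩ := hz
  refine mem_segm_of_affine (s := D / (D + D')) (t := D' / (D + D')) (by positivity) (by positivity)
    (by field_simp) ?_ ?_
  · field_simp; linarith
  · field_simp; linarith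

lemma Rep.bq {z : ℍ} {A B D : ℝ} (hz : Rep z A B D) (u v : V2) :
    D * bq z u v = u 1 * v 1 * A - (u 0 * v 1 + u 1 * v 0) * B + u 0 * v 0 * D := by
  obtain ⟨h1, h2, h3⟩ := hz
  unfold np at h3
  unfold PantsLamination.bq
  rw [← h2, ← h3]; ring

/-- The determinant of `s u uᵀ + t v vᵀ` is `s t (br u v)²`. -/
lemma gram_pos {u v : V2} (h : br u v ≠ 0) {s t : ℝ} (hs : 0 < s) (ht : 0 < t) :
    0 < s * u 1 ^ 2 + t * v 1 ^ 2 ∧ (s * (u 0 * u 1) + t * (v 0 * v 1)) ^ 2 <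
      (s * u 0 ^ 2 + t * v 0 ^ 2) * (s * u 1 ^ 2 + t * v 1 ^ 2) := by
  constructor
  · by_cases hu : u 1 = 0
    · have hv : v 1 ≠ 0 := fun hv => h (by simp [br, hu, hv])
      have : 0 < v 1 ^ 2 := by positivity
      nlinarith [mul_pos ht this, mul_nonneg hs.le (sq_nonneg (u 1))]
    · have : 0 < u 1 ^ 2 := by positivity
      nlinarith [mul_pos hs this, mul_nonneg ht.le (sq_nonneg (v 1))]
  · have : (s * u 0 ^ 2 + t * v 0 ^ 2) * (s * u 1 ^ 2 + t * v 1 ^ 2) -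
      (s * (u 0 * u 1) + t * (v 0 * v 1)) ^ 2 = s * t * br u v ^ 2 := by unfold br; ring
    have h2 : 0 < s * t * br u v ^ 2 := by positivity
    linarith

/-- Points are definite symmetric matrices up to scale and ideal points are the squares `u uᵀ`; a
geodesic is the open segment between the squares of its two ends. -/
lemma exists_rep_geo {u v : V2} (h : br u v ≠ 0) {s t : ℝ} (hs : 0 < s) (ht : 0 < t) :
    ∃ z ∈ geo u v, Rep z (s * u 0 ^ 2 + t * v 0 ^ 2) (s * (u 0 * u 1) + t * (v 0 * v 1))
      (s * u 1 ^ 2 + t * v 1 ^ 2) := by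
  obtain ⟨h1, h2⟩ := gram_pos h hs ht
  obtain ⟨z, hz⟩ := exists_rep h1 h2
  refine ⟨z, ?_, hz⟩
  have := hz.bq u v
  have h3 : (s * u 1 ^ 2 + t * v 1 ^ 2) * bq z u v = 0 := by rw [this]; ring
  exact (mul_eq_zero.1 h3).resolve_left h1.ne'

lemma rep_of_mem_geo {u v : V2} (h : br u v ≠ 0) {z : ℍ} (hz : z ∈ geo u v) :
    ∃ s t : ℝ, 0 < s ∧ 0 < t ∧ Rep z (s * u 0 ^ 2 + t * v 0 ^ 2) (s * (u 0 * u 1) + t * (v 0 * v 1))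
      (s * u 1 ^ 2 + t * v 1 ^ 2) := by
  have hu := bq_self_pos z (left_ne_zero_of_br h)
  have hv := bq_self_pos z (right_ne_zero_of_br h)
  have huv : bq z u v = 0 := hz
  have hb : 0 < br u v ^ 2 := by positivity
  refine ⟨bq z v v / br u v ^ 2, bq z u u / br u v ^ 2, by positivity, by positivity, ?_⟩
  have key : bq z v v / br u v ^ 2 * u 1 ^ 2 + bq z u u / br u v ^ 2 * v 1 ^ 2 = 1 := by
    field_simp
    have : bq z v v * u 1 ^ 2 + bq z u u * v 1 ^ 2 = br u v ^ 2 + 2 * u 1 * v 1 * bq z u v := by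
      unfold bq br; ring
    rw [this, huv]; ring
  refine ⟨by rw [key]; exact one_pos, ?_, ?_⟩
  · rw [key]
    field_simp
    have : bq z v v * u 0 * u 1 + bq z u u * v 0 * v 1 =
      br u v ^ 2 * z.re + (u 0 * v 1 + u 1 * v 0) * bq z u v := by
      unfold bq br; ring
    rw [huv] at this
    linarith
  · rw [key]
    field_simp
    have : bq z v v * u 0 ^ 2 + bq z u u * v 0 ^ 2 =
      br u v ^ 2 * np z + 2 * u 0 * v 0 * bq z u v := by
      unfold bq br np; ring
    rw [huv] at this
    linarith

lemma tendsto_of_re_np {ι : Type*} {l : Filter ι} {f : ι → ℍ} {z : ℍ}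
    (h1 : Tendsto (fun i => (f i).re) l (𝓝 z.re)) (h2 : Tendsto (fun i => np (f i)) l (𝓝 (np z))) :
    Tendsto f l (𝓝 z) := by
  rw [isEmbedding_coe.tendsto_nhds_iff]
  have him : ∀ w : ℍ, w.im = Real.sqrt (np w - w.re ^ 2) := fun w => by
    rw [np, add_sub_cancel_left, Real.sqrt_sq w.im_pos.le]
  have h3 : Tendsto (fun i => (f i).im) l (𝓝 z.im) := by
    simp_rw [him]
    exact (Real.continuous_sqrt.tendsto _).comp (h2.sub (h1.pow 2))
  have : (UpperHalfPlane.coe ∘ f) = fun i => ((f i).re : ℂ) + ((f i).im : ℂ) * Complex.I := by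
    funext i; exact (Complex.re_add_im _).symm
  rw [this, show (z : ℂ) = (z.re : ℂ) + (z.im : ℂ) * Complex.I from (Complex.re_add_im _).symm]
  exact (Complex.continuous_ofReal.tendsto _ |>.comp h1).add
    ((Complex.continuous_ofReal.tendsto _ |>.comp h3).mul_const _)

lemma Rep.tendsto {ι : Type*} {l : Filter ι} {f : ι → ℍ} {z : ℍ} {A B D : ℝ} {A' B' D' : ι → ℝ}
    (hz : Rep z A B D) (hf : ∀ᶠ i in l, Rep (f i) (A' i) (B' i) (D' i)) (hA : Tendsto A' l (𝓝 A))
    (hB : Tendsto B' l (𝓝 B)) (hD : Tendsto D' l (𝓝 D)) : Tendsto f l (𝓝 z) := by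
  have e1 : z.re = B / D := by rw [← hz.2.1, mul_div_cancel_right₀ _ hz.1.ne']
  have e2 : np z = A / D := by rw [← hz.2.2, mul_div_cancel_right₀ _ hz.1.ne']
  refine tendsto_of_re_np ?_ ?_
  · rw [e1]
    refine (hB.div hD hz.1.ne').congr' ?_
    filter_upwards [hf] with i hi
    simp [← hi.2.1, mul_div_cancel_right₀ _ hi.1.ne']
  · rw [e2]
    refine (hA.div hD hz.1.ne').congr' ?_
    filter_upwards [hf] with i hi
    simp [← hi.2.2, mul_div_cancel_right₀ _ hi.1.ne']

/-- The geodesic joining ideal points of a closed convex set is contained in this set. -/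
lemma geo_subset_of_ideal {S : Set ℍ} (h : GeodConvex S) (hS : IsClosed S) {u u' v v' : V2}
    (hu : br u u' ≠ 0) (hv : br v v' ≠ 0) (huv : br u v ≠ 0) (h1 : geo u u' ⊆ S)
    (h2 : geo v v' ⊆ S) : geo u v ⊆ S := by
  intro z hz
  obtain ⟨s, t, hs, ht, hrep⟩ := rep_of_mem_geo huv hz
  -- Adding `ε` times the square of the other end replaces each ideal endpoint by a genuine point of
  -- `S`. The sum of the two matrices is a point of the segment between them, and it tends to `z` as
  -- `ε` tends to `0`.
  have key : ∀ ε : ℝ, 0 < ε → ∃ w ∈ S,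
      Rep w (s * u 0 ^ 2 + ε * u' 0 ^ 2 + (t * v 0 ^ 2 + ε * v' 0 ^ 2))
        (s * (u 0 * u 1) + ε * (u' 0 * u' 1) + (t * (v 0 * v 1) + ε * (v' 0 * v' 1)))
        (s * u 1 ^ 2 + ε * u' 1 ^ 2 + (t * v 1 ^ 2 + ε * v' 1 ^ 2)) := by
    intro ε hε
    obtain ⟨x, hx, hxr⟩ := exists_rep_geo hu hs hε
    obtain ⟨y, hy, hyr⟩ := exists_rep_geo hv ht hε
    obtain ⟨a1, a2⟩ := gram_pos hu hs hε
    obtain ⟨b1, b2⟩ := gram_pos hv ht hε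
    have : ∃ w, Rep w (s * u 0 ^ 2 + ε * u' 0 ^ 2 + (t * v 0 ^ 2 + ε * v' 0 ^ 2))
        (s * (u 0 * u 1) + ε * (u' 0 * u' 1) + (t * (v 0 * v 1) + ε * (v' 0 * v' 1)))
        (s * u 1 ^ 2 + ε * u' 1 ^ 2 + (t * v 1 ^ 2 + ε * v' 1 ^ 2)) := by
      obtain ⟨w, -, hw⟩ := exists_mem_segm x y
        (s := (s * u 1 ^ 2 + ε * u' 1 ^ 2) / (s * u 1 ^ 2 + ε * u' 1 ^ 2 + (t * v 1 ^ 2 + ε * v' 1 ^ 2)))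
        (t := (t * v 1 ^ 2 + ε * v' 1 ^ 2) / (s * u 1 ^ 2 + ε * u' 1 ^ 2 + (t * v 1 ^ 2 + ε * v' 1 ^ 2)))
        (by positivity) (by positivity) (by field_simp)
      refine ⟨w, add_pos a1 b1, ?_, ?_⟩
      · rw [hw.1, ← hxr.2.1, ← hyr.2.1]; field_simp
      · rw [hw.2, ← hxr.2.2, ← hyr.2.2]; field_simp
    obtain ⟨w, hw⟩ := this
    exact ⟨w, h x (h1 hx) y (h2 hy) (hxr.mem_segm hyr hw), hw⟩
  have : ∀ ε : ℝ, ∃ w, 0 < ε → w ∈ S ∧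
      Rep w (s * u 0 ^ 2 + ε * u' 0 ^ 2 + (t * v 0 ^ 2 + ε * v' 0 ^ 2))
        (s * (u 0 * u 1) + ε * (u' 0 * u' 1) + (t * (v 0 * v 1) + ε * (v' 0 * v' 1)))
        (s * u 1 ^ 2 + ε * u' 1 ^ 2 + (t * v 1 ^ 2 + ε * v' 1 ^ 2)) := by
    intro ε
    by_cases hε : 0 < ε
    · obtain ⟨w, hw⟩ := key ε hε
      exact ⟨w, fun _ => hw⟩
    · exact ⟨I, fun h => absurd h hε⟩
  choose f hf using this
  have hlim : ∀ a b c d : ℝ, Tendsto (fun ε : ℝ => a + ε * b + (c + ε * d)) (𝓝[>] 0) (𝓝 (a + c)) := by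
    intro a b c d
    have : Continuous fun ε : ℝ => a + ε * b + (c + ε * d) := by fun_prop
    have := this.tendsto 0
    simp only [zero_mul, add_zero] at this
    exact this.mono_left nhdsWithin_le_nhds
  have : Tendsto f (𝓝[>] 0) (𝓝 z) := by
    refine hrep.tendsto (eventually_mem_nhdsWithin.mono fun ε hε => (hf ε hε).2) ?_ ?_ ?_ <;>
      exact hlim _ _ _ _
  exact hS.mem_of_tendsto this (eventually_mem_nhdsWithin.mono fun ε hε => (hf ε hε).1)

lemma smul_mem_interior_of_preimage (g : SL(2, ℝ)) {S : Set ℍ} {z : ℍ}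
    (h : z ∈ interior ((fun z : ℍ => g • z) ⁻¹' S)) : g • z ∈ interior S := by
  rw [show (fun z : ℍ => g • z) = Homeomorph.smul g from rfl, ← Homeomorph.preimage_interior] at h
  exact h

lemma geo_subset_interior {S : Set ℍ} (h : GeodConvex S) {u v : V2} (huv : br u v ≠ 0)
    (h1 : geo u v ⊆ S) {w w' : ℍ} (hw : w ∈ S) (hw' : w' ∈ S) (hneg : bq w u v * bq w' u v < 0) :
    geo u v ⊆ interior S := by
  obtain ⟨g, a1, a2⟩ := exists_act_e huv
  have hg2 : v = br u v • act g e2 := by rw [a2, smul_smul, mul_inv_cancel₀ huv, one_smul]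
  have key : ∀ z : ℍ, bq (g • z) u v = -(br u v / dn g z) * z.re := fun z => by
    conv_lhs => rw [hg2, ← a1, bq_comm, bq_smul_left, bq_comm, bq_smul, bq_e1_e2, a1]
    ring
  have haxis : geo e1 e2 ⊆ (fun z : ℍ => g • z) ⁻¹' S := by
    intro z hz
    apply h1
    change bq _ _ _ = 0
    rw [key, (mem_geo_e z).1 hz, mul_zero]
  have hwz : ∀ z : ℍ, g • (g⁻¹ • z) = z := fun z => smul_inv_smul g z
  have hneg' : (g⁻¹ • w).re * (g⁻¹ • w').re < 0 := by
    rw [← hwz w, ← hwz w', key, key] at hneg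
    have d1 := dn_pos g (g⁻¹ • w)
    have d2 := dn_pos g (g⁻¹ • w')
    have : -(br u v / dn g (g⁻¹ • w)) * (g⁻¹ • w).re * (-(br u v / dn g (g⁻¹ • w')) * (g⁻¹ • w').re) =
      (br u v ^ 2 / (dn g (g⁻¹ • w) * dn g (g⁻¹ • w'))) * ((g⁻¹ • w).re * (g⁻¹ • w').re) := by
      field_simp
    rw [this] at hneg
    exact neg_of_mul_neg_right hneg (by positivity)
  have hsub : geo e1 e2 ⊆ interior ((fun z : ℍ => g • z) ⁻¹' S) := by
    have m1 : g⁻¹ • w ∈ (fun z : ℍ => g • z) ⁻¹' S := by change g • _ ∈ S; rwa [hwz]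
    have m2 : g⁻¹ • w' ∈ (fun z : ℍ => g • z) ⁻¹' S := by change g • _ ∈ S; rwa [hwz]
    rcases mul_neg_iff.1 hneg' with ⟨p1, p2⟩ | ⟨p1, p2⟩
    · exact axis_subset_interior (geodConvex_preimage h g) haxis m1 m2 p1 p2
    · exact axis_subset_interior (geodConvex_preimage h g) haxis m2 m1 p2 p1
  intro z hz
  have : g⁻¹ • z ∈ geo e1 e2 := by
    rw [mem_geo_e]
    have hz' : bq z u v = 0 := hz
    rw [← hwz z, key] at hz'
    have := dn_pos g (g⁻¹ • z)
    rcases mul_eq_zero.1 hz' with h0 | h0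
    · exfalso
      have : br u v / dn g (g⁻¹ • z) ≠ 0 := by positivity
      exact this (neg_eq_zero.1 h0)
    · exact h0
  have h2 := hsub this
  rw [← hwz z]
  exact smul_mem_interior_of_preimage g h2

/-- Near the end `p` the sign of `bq · u v` is that of `br u p * br v p`. The weight `(|b| + 1) / a`
on the square of `p` is large enough to dominate the contribution `b` of the other end. -/
lemma ideal_side {u v p p' : V2} (h : br p p' ≠ 0) {ε : ℝ} (hε : 0 < ε * (br u p * br v p)) :
    ∃ w ∈ geo p p', 0 < ε * bq w u v := by
  set a := ε * (br u p * br v p)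
  set b := ε * (br u p' * br v p')
  obtain ⟨w, hw, hr⟩ := exists_rep_geo h (s := (|b| + 1) / a) (t := 1) (by positivity) one_pos
  refine ⟨w, hw, ?_⟩
  have h1 := hr.bq u v
  have hD := hr.1
  have h2 : ((|b| + 1) / a * p 1 ^ 2 + 1 * p' 1 ^ 2) * (ε * bq w u v) = (|b| + 1) / a * a + b := by
    rw [mul_left_comm, h1]; simp only [a, b, br]; ring
  rw [div_mul_cancel₀ _ hε.ne'] at h2
  have h3 := neg_abs_le b
  by_contra h4
  have := mul_nonneg hD.le (neg_nonneg.2 (not_lt.1 h4))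
  linarith

lemma nonneg_of_geo_subset {u v p p' : V2} (h : br p p' ≠ 0) {ε : ℝ}
    (hs : ∀ z ∈ geo p p', 0 ≤ ε * bq z u v) : 0 ≤ ε * (br u p * br v p) := by
  by_contra h0
  obtain ⟨w, hw, h1⟩ := ideal_side (ε := -ε) (u := u) (v := v) h (by linarith)
  linarith [hs w hw]

lemma geo_subset_interior_of_ideal {S : Set ℍ} (h : GeodConvex S) {u v p p' q q' : V2}
    (huv : br u v ≠ 0) (hp : br p p' ≠ 0) (hq : br q q' ≠ 0) (h1 : geo u v ⊆ S) (h2 : geo p p' ⊆ S)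
    (h3 : geo q q' ⊆ S) (hneg : br u p * br v p * (br u q * br v q) < 0) :
    geo u v ⊆ interior S := by
  have key : ∀ {p p' q q' : V2}, br p p' ≠ 0 → br q q' ≠ 0 → geo p p' ⊆ S → geo q q' ⊆ S →
      0 < br u p * br v p → br u q * br v q < 0 → geo u v ⊆ interior S := by
    intro p p' q q' hp hq h2 h3 n1 n2
    obtain ⟨w, hw, hw1⟩ := ideal_side (ε := 1) (u := u) (v := v) hp (by linarith)
    obtain ⟨w', hw', hw1'⟩ := ideal_side (ε := -1) (u := u) (v := v) hq (by linarith)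
    exact geo_subset_interior h huv h1 (h2 hw) (h3 hw')
      (mul_neg_of_pos_of_neg (by linarith) (by linarith))
  rcases mul_neg_iff.1 hneg with ⟨n1, n2⟩ | ⟨n1, n2⟩
  · exact key hp hq h2 h3 n1 n2
  · exact key hq hp h3 h2 n2 n1

/-- If the set had points strictly on both sides, `geo_subset_interior` would put the geodesic into
the interior. -/
lemma one_side_of_geo_subset_frontier {S : Set ℍ} (h : GeodConvex S) (hS : IsClosed S) {u v : V2}
    (huv : br u v ≠ 0) (hf : geo u v ⊆ frontier S) :
    ∃ ε : ℝ, (ε = 1 ∨ ε = -1) ∧ ∀ z ∈ S, 0 ≤ ε * bq z u v := by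
  by_contra hcon
  push Not at hcon
  obtain ⟨w, hw, h1⟩ := hcon 1 (Or.inl rfl)
  obtain ⟨w', hw', h2⟩ := hcon (-1) (Or.inr rfl)
  have hsub := geo_subset_interior h huv (hf.trans hS.frontier_subset) hw hw'
    (mul_neg_of_neg_of_pos (by linarith) (by linarith))
  obtain ⟨g, a1, a2, a3⟩ := exists_geo_eq_image huv
  have hz : g • iexp 0 ∈ geo u v := by rw [a3, geo_act_e]; exact ⟨0, rfl⟩
  exact (hf hz).2 (hsub hz)

/-! ### Axes of hyperbolic elements -/

/-- Comparing real and imaginary parts at two points of the axis shows that the matrix is diagonal.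
-/
lemma eq_diagT_mul {m : SL(2, ℝ)} {T : ℝ} (h : ∀ t, m • iexp t = iexp (t + T)) :
    m 0 1 = 0 ∧ m 1 0 = 0 ∧ m 0 0 = m 1 1 * Real.exp T := by
  have hr : ∀ t, m 0 1 * m 1 1 + m 0 0 * m 1 0 * Real.exp t ^ 2 = 0 := fun t => by
    have := congrArg UpperHalfPlane.re (h t)
    rw [sl_re, iexp_re, div_eq_iff (dn_pos _ _).ne'] at this
    simpa using this
  have hi : ∀ t, m 1 1 ^ 2 + m 1 0 ^ 2 * Real.exp t ^ 2 = Real.exp (-T) := fun t => by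
    have := congrArg UpperHalfPlane.im (h t)
    rw [sl_im, iexp_im, div_eq_iff (dn_pos _ _).ne', iexp_im, Real.exp_add] at this
    simp only [dn, iexp_re, iexp_im] at this
    have h0 := Real.exp_pos t
    rw [Real.exp_neg]
    have h1 := Real.exp_pos T
    field_simp
    have h2 : Real.exp t * (1 - Real.exp T * (m 1 1 ^ 2 + m 1 0 ^ 2 * Real.exp t ^ 2)) = 0 := by
      linear_combination this
    linarith [(mul_eq_zero.1 h2).resolve_left h0.ne']
  have hexp : (1 : ℝ) < Real.exp 1 := Real.one_lt_exp_iff.2 one_pos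
  have i0 := hi 0
  have i1 := hi 1
  have r0 := hr 0
  rw [Real.exp_zero] at i0 r0
  have hd := sl_det m
  have c0 : m 1 0 ^ 2 = 0 := by
    have : m 1 0 ^ 2 * (Real.exp 1 ^ 2 - 1) = 0 := by linarith
    exact (mul_eq_zero.1 this).resolve_right (by nlinarith)
  have c : m 1 0 = 0 := by simpa using c0
  rw [c] at hd r0
  have d : m 1 1 ≠ 0 := by rintro h0; rw [h0] at hd; simp at hd
  have b : m 0 1 = 0 := by
    have : m 0 1 * m 1 1 = 0 := by linarith
    exact (mul_eq_zero.1 this).resolve_right d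
  refine ⟨b, c, ?_⟩
  rw [c0] at i0
  have h1 : m 1 1 ^ 2 * Real.exp T = 1 := by
    rw [show m 1 1 ^ 2 = Real.exp (-T) by linarith, ← Real.exp_add]; simp
  have h2 : m 1 1 * (m 0 0 - m 1 1 * Real.exp T) = 0 := by linear_combination hd - h1
  linarith [(mul_eq_zero.1 h2).resolve_left d]

/-- Conjugating the axis to the imaginary axis diagonalizes the matrix, so the ends of the axis are
eigenvectors; nonzero translation length means that the eigenvalues differ in modulus. -/
lemma IsAxis.exists_eigen {g : SL(2, ℝ)} {α : ℝ → ℍ} (h : IsAxis g α) :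
    ∃ (k : SL(2, ℝ)) (l : ℝ), l ≠ 0 ∧ l ^ 2 ≠ 1 ∧ (∀ t, α t = k • iexp t) ∧
      act g (act k e1) = l • act k e1 ∧ act g (act k e2) = l⁻¹ • act k e2 := by
  obtain ⟨hα, T, hT, h⟩ := h
  obtain ⟨k, hk⟩ := Isometry.exists_eq_smul_iexp hα
  have hm : ∀ t, (k⁻¹ * g * k) • iexp t = iexp (t + T) := fun t => by
    rw [mul_smul, mul_smul, ← hk, h, hk, inv_smul_smul]
  obtain ⟨b, c, ad⟩ := eq_diagT_mul hm
  have hg : ∀ u, act g (act k u) = act k (act (k⁻¹ * g * k) u) := fun u => by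
    rw [act_mul, act_mul, act_act_inv]
  have hd := sl_det (k⁻¹ * g * k)
  set m := k⁻¹ * g * k
  rw [b, c] at hd
  have hm0 : m 0 0 ≠ 0 := by rintro h0; rw [h0] at hd; simp at hd
  refine ⟨k, m 0 0, hm0, ?_, hk, ?_, ?_⟩
  · intro h1
    have : Real.exp T = 1 := by
      have e1 : m 0 0 * (m 0 0 - m 1 1) = 0 := by linear_combination h1 - hd
      have e2 : m 0 0 = m 1 1 := by linarith [(mul_eq_zero.1 e1).resolve_left hm0]
      rw [e2] at ad hm0
      field_simp at ad
      linarith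
    exact hT (Real.exp_eq_one_iff _ |>.1 this)
  · rw [hg, ← act_smul]; congr 1; ext i; fin_cases i <;> simp [act, c]
  · rw [hg, ← act_smul]; congr 1; ext i; fin_cases i <;> simp [act, b]
    field_simp; linarith

/-! ### Triples of reflections -/

/-- The linear action of a matrix. -/
def mact (A : Matrix (Fin 2) (Fin 2) ℝ) (u : V2) : V2 :=
  ![A 0 0 * u 0 + A 0 1 * u 1, A 1 0 * u 0 + A 1 1 * u 1]

@[simp] lemma mact_zero (A : Matrix (Fin 2) (Fin 2) ℝ) (u : V2) :
    mact A u 0 = A 0 0 * u 0 + A 0 1 * u 1 := rfl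
@[simp] lemma mact_one (A : Matrix (Fin 2) (Fin 2) ℝ) (u : V2) :
    mact A u 1 = A 1 0 * u 0 + A 1 1 * u 1 := rfl

lemma act_eq_mact (g : SL(2, ℝ)) (u : V2) : act g u = mact (g : Matrix (Fin 2) (Fin 2) ℝ) u := rfl

lemma mact_mul (A B : Matrix (Fin 2) (Fin 2) ℝ) (u : V2) : mact (A * B) u = mact A (mact B u) := by
  ext i
  fin_cases i <;> simp [mact, Matrix.mul_apply, Fin.sum_univ_two] <;> ring

lemma mact_smul (A : Matrix (Fin 2) (Fin 2) ℝ) (k : ℝ) (u : V2) :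
    mact A (k • u) = k • mact A u := by
  ext i
  fin_cases i <;> simp [mact] <;> ring

lemma mact_add (A : Matrix (Fin 2) (Fin 2) ℝ) (u v : V2) : mact A (u + v) = mact A u + mact A v := by
  ext i
  fin_cases i <;> simp [mact] <;> ring

lemma smul_mact (A : Matrix (Fin 2) (Fin 2) ℝ) (k : ℝ) (u : V2) :
    mact (k • A) u = k • mact A u := by
  ext i
  fin_cases i <;> simp [mact] <;> ring

/-- Minus half the trace of the product of two traceless matrices. -/
def mpair (A B : Matrix (Fin 2) (Fin 2) ℝ) : ℝ :=
  -(A 0 0 * B 0 0 + (A 0 1 * B 1 0 + A 1 0 * B 0 1) / 2)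

/-- The trace of the product of three traceless matrices. -/
def mtri (A B C : Matrix (Fin 2) (Fin 2) ℝ) : ℝ :=
  A 0 0 * (B 0 1 * C 1 0 - B 1 0 * C 0 1) + A 0 1 * (B 1 0 * C 0 0 - B 0 0 * C 1 0) +
    A 1 0 * (B 0 0 * C 0 1 - B 0 1 * C 0 0)

/-- Three reflections in pairwise disjoint geodesics, given by matrices of determinant `-1`, oriented
so that the three geodesics bound a region. -/
structure Hex where
  X : Fin 3 → Matrix (Fin 2) (Fin 2) ℝ
  tr : ∀ i, X i 1 1 = -X i 0 0
  det : ∀ i, X i 0 0 ^ 2 + X i 0 1 * X i 1 0 = 1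
  pair : ∀ i j, i ≠ j → 1 < mpair (X i) (X j)
  pos : ∃ v : V2, v ≠ 0 ∧ ∀ i, 0 ≤ br v (mact (X (i + 1)) (mact (X (i + 2)) v)) /
    mtri (X i) (X (i + 1)) (X (i + 2))

namespace Hex

variable (H : Hex)

/-- The reflection in the `i`-th seam. -/
def xa (i : Fin 3) (v : V2) : V2 := mact (H.X i) v

/-- The coefficients of the square of a vector with respect to the reflections. -/
def th (i : Fin 3) (v : V2) : ℝ := br v (mact (H.X (i + 1)) (mact (H.X (i + 2)) v)) /
    mtri (H.X i) (H.X (i + 1)) (H.X (i + 2))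

/-- The quadratic form whose zeros are the endpoints of the `i`-th seam. -/
def nf (i : Fin 3) (v : V2) : ℝ := br v (H.xa i v)

/-- The hyperbolic cosine of the distance of two seams. -/
def c (i j : Fin 3) : ℝ := mpair (H.X i) (H.X j)

lemma c_comm (i j : Fin 3) : H.c i j = H.c j i := by unfold c mpair; ring

lemma one_lt_c {i j : Fin 3} (h : i ≠ j) : 1 < H.c i j := H.pair i j h

lemma xa_xa (i : Fin 3) (v : V2) : H.xa i (H.xa i v) = v := by
  have h1 := H.tr i
  have h2 := H.det i
  ext j; fin_cases j
  · simp [xa, mact]; rw [h1]; linear_combination v 0 * h2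
  · simp [xa, mact]; rw [h1]; linear_combination v 1 * h2

lemma xa_smul (i : Fin 3) (k : ℝ) (v : V2) : H.xa i (k • v) = k • H.xa i v := mact_smul _ _ _

lemma xa_add (i : Fin 3) (u v : V2) : H.xa i (u + v) = H.xa i u + H.xa i v := mact_add _ _ _

lemma br_xa (i : Fin 3) (u v : V2) : br (H.xa i u) (H.xa i v) = -br u v := by
  have h1 := H.tr i
  have h2 := H.det i
  simp only [xa, br, mact_zero, mact_one, h1]
  linear_combination (-(u 0 * v 1 - u 1 * v 0)) * h2

lemma br_xa_left (i : Fin 3) (u v : V2) : br (H.xa i u) v = -br u (H.xa i v) := by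
  have := H.br_xa i u (H.xa i v)
  rw [H.xa_xa] at this
  exact this

lemma cr_xa (i : Fin 3) (u v u' v' : V2) :
    cr (H.xa i u) (H.xa i v) (H.xa i u') (H.xa i v') = cr u v u' v' := by
  simp only [cr, br_xa]; ring

lemma nf_xa (i : Fin 3) (v : V2) : H.nf i (H.xa i v) = -H.nf i v := by
  simp only [nf]; rw [H.xa_xa, br_anticomm]

lemma nf_smul (i : Fin 3) (k : ℝ) (v : V2) : H.nf i (k • v) = k ^ 2 * H.nf i v := by
  simp only [nf, xa_smul, br_smul_left, br_smul_right]; ring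

lemma th_smul (i : Fin 3) (k : ℝ) (v : V2) : H.th i (k • v) = k ^ 2 * H.th i v := by
  simp only [th, mact_smul, br_smul_left, br_smul_right]; ring

end Hex

/-- An enumeration of the three indices. -/
def Dist (i j k : Fin 3) : Prop := i ≠ j ∧ j ≠ k ∧ k ≠ i

namespace Dist

variable {i j k : Fin 3}

lemma rot (h : Dist i j k) : Dist j k i := ⟨h.2.1, h.2.2, h.1⟩
lemma swap (h : Dist i j k) : Dist j i k := ⟨h.1.symm, h.2.2.symm, h.2.1.symm⟩
lemma swap' (h : Dist i j k) : Dist i k j := h.rot.rot.swap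
lemma cases (h : Dist i j k) : (j = i + 1 ∧ k = i + 2) ∨ (j = i + 2 ∧ k = i + 1) := by
  unfold Dist at h; revert i j k; decide
lemma eq_or (h : Dist i j k) (l : Fin 3) : l = i ∨ l = j ∨ l = k := by
  unfold Dist at h; revert i j k l; decide
lemma cyc (i : Fin 3) : Dist i (i + 1) (i + 2) := by
  unfold Dist; revert i; decide
lemma exists_of_ne (h : i ≠ j) : ∃ k, Dist i j k := by
  unfold Dist; revert i j; decide
lemma sum (h : Dist i j k) (f : Fin 3 → ℝ) : ∑ l, f l = f i + f j + f k := by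
  have : (Finset.univ : Finset (Fin 3)) = {i, j, k} := by
    unfold Dist at h; revert i j k; decide
  rw [this, Finset.sum_insert, Finset.sum_pair h.2.1, add_assoc]
  simp [h.1, h.2.2.symm]

end Dist

namespace Hex

variable (H : Hex)

/-- `mtri` is the volume form on traceless matrices, so its square is a multiple of the Gram
determinant for the trace form. -/
lemma mtri_sq_aux (A B C : Matrix (Fin 2) (Fin 2) ℝ) : mtri A B C ^ 2 =
    -4 * ((A 0 0 ^ 2 + A 0 1 * A 1 0) * (B 0 0 ^ 2 + B 0 1 * B 1 0) * (C 0 0 ^ 2 + C 0 1 * C 1 0)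
      - (A 0 0 ^ 2 + A 0 1 * A 1 0) * mpair B C ^ 2 - (C 0 0 ^ 2 + C 0 1 * C 1 0) * mpair A B ^ 2
      - (B 0 0 ^ 2 + B 0 1 * B 1 0) * mpair C A ^ 2 - 2 * mpair A B * mpair B C * mpair C A) := by
  unfold mtri mpair; ring

lemma mtri_sq (i j k : Fin 3) : mtri (H.X i) (H.X j) (H.X k) ^ 2 =
    4 * (H.c i j ^ 2 + H.c j k ^ 2 + H.c k i ^ 2 + 2 * H.c i j * H.c j k * H.c k i - 1) := by
  have h1 := H.det i
  have h2 := H.det j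
  have h3 := H.det k
  have h4 := mtri_sq_aux (H.X i) (H.X j) (H.X k)
  rw [← c, ← c, ← c] at h4
  linear_combination
    (-4 * (H.X j 0 0 ^ 2 + H.X j 0 1 * H.X j 1 0) * (H.X k 0 0 ^ 2 + H.X k 0 1 * H.X k 1 0) +
      4 * H.c j k ^ 2) * h1 +
    (-4 * (H.X k 0 0 ^ 2 + H.X k 0 1 * H.X k 1 0) + 4 * H.c k i ^ 2) * h2 +
    (-4 + 4 * H.c i j ^ 2) * h3 + h4

lemma mtri_ne_zero {i j k : Fin 3} (h : Dist i j k) : mtri (H.X i) (H.X j) (H.X k) ≠ 0 := by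
  intro h0
  have := H.mtri_sq i j k
  rw [h0] at this
  have h1 := H.one_lt_c h.1
  have h2 := H.one_lt_c h.2.1
  have h3 := H.one_lt_c h.2.2
  have : 0 < H.c i j * H.c j k * H.c k i := by positivity
  nlinarith

lemma th_mul {i j k : Fin 3} (h : Dist i j k) (v : V2) :
    H.th i v * mtri (H.X i) (H.X j) (H.X k) = br v (H.xa j (H.xa k v)) := by
  rcases h.cases with ⟨rfl, rfl⟩ | ⟨rfl, rfl⟩
  · rw [th, div_mul_cancel₀ _ (H.mtri_ne_zero h)]; rfl
  · rw [th, show mtri (H.X i) (H.X (i + 2)) (H.X (i + 1)) = -mtri (H.X i) (H.X (i + 1)) (H.X (i + 2)) by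
      unfold mtri; ring, mul_neg, div_mul_cancel₀ _ (H.mtri_ne_zero (Dist.cyc i))]
    simp only [xa, br, mact_zero, mact_one, H.tr]
    ring

/-- Cramer's rule in the space of traceless matrices: the nilpotent matrix `w ↦ br v w • v` is
expanded in the basis of the three reflections. The `th` are thus linear coordinates on squares of
vectors. -/
lemma th_sum {i j k : Fin 3} (h : Dist i j k) (v : V2) :
    (H.th i v * H.X i 0 0 + H.th j v * H.X j 0 0 + H.th k v * H.X k 0 0 = -(v 0 * v 1)) ∧
    (H.th i v * H.X i 0 1 + H.th j v * H.X j 0 1 + H.th k v * H.X k 0 1 = v 0 ^ 2) ∧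
    (H.th i v * H.X i 1 0 + H.th j v * H.X j 1 0 + H.th k v * H.X k 1 0 = -v 1 ^ 2) := by
  have h1 := H.th_mul h v
  have h2 := H.th_mul h.rot v
  have h3 := H.th_mul h.rot.rot v
  have h0 := H.mtri_ne_zero h
  rw [show mtri (H.X j) (H.X k) (H.X i) = mtri (H.X i) (H.X j) (H.X k) by unfold mtri; ring] at h2
  rw [show mtri (H.X k) (H.X i) (H.X j) = mtri (H.X i) (H.X j) (H.X k) by unfold mtri; ring] at h3
  set t := mtri (H.X i) (H.X j) (H.X k) with ht
  refine ⟨?_, ?_, ?_⟩ <;> apply mul_right_cancel₀ h0 <;> rw [add_mul, add_mul]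
  · rw [mul_right_comm, h1, mul_right_comm, h2, mul_right_comm, h3, ht]
    simp only [xa, br, mact_zero, mact_one, H.tr, mtri]
    ring
  · rw [mul_right_comm, h1, mul_right_comm, h2, mul_right_comm, h3, ht]
    simp only [xa, br, mact_zero, mact_one, H.tr, mtri]
    ring
  · rw [mul_right_comm, h1, mul_right_comm, h2, mul_right_comm, h3, ht]
    simp only [xa, br, mact_zero, mact_one, H.tr, mtri]
    ring

/-- Pairing the expansion of `th_sum` with the `i`-th reflection. The sign of `nf i v` tells on
which side of the `i`-th seam `v` lies. -/
lemma nf_eq {i j k : Fin 3} (h : Dist i j k) (v : V2) :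
    H.nf i v = 2 * H.th i v - 2 * H.c i j * H.th j v - 2 * H.c i k * H.th k v := by
  obtain ⟨h1, h2, h3⟩ := H.th_sum h v
  have h4 := H.det i
  simp only [nf, xa, br, mact_zero, mact_one, H.tr, c, mpair]
  linear_combination (-2 * H.X i 0 0) * h1 + (-H.X i 1 0) * h2 + (-H.X i 0 1) * h3 + 2 * H.th i v * h4

/-- The trace pairing of the two nilpotent matrices attached to `u` and `v`, computed with `th_sum`
for `v`. -/
lemma br_sq {i j k : Fin 3} (h : Dist i j k) (u v : V2) :
    br u v ^ 2 = -(H.th i v * H.nf i u + H.th j v * H.nf j u + H.th k v * H.nf k u) := by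
  obtain ⟨h1, h2, h3⟩ := H.th_sum h v
  simp only [nf, xa, br, mact_zero, mact_one, H.tr]
  linear_combination (-2 * u 0 * u 1) * h1 - (u 1 ^ 2) * h2 + u 0 ^ 2 * h3

/-- As in the geometric representation of a Coxeter group, each reflection changes only its own
coordinate; `th_xa_self` gives the change. -/
lemma th_xa_ne {i j : Fin 3} (h : i ≠ j) (v : V2) : H.th j (H.xa i v) = H.th j v := by
  obtain ⟨k, hk⟩ := Dist.exists_of_ne h
  have h0 := H.mtri_ne_zero hk.swap
  apply mul_right_cancel₀ h0
  rw [H.th_mul hk.swap, H.th_mul hk.swap, H.br_xa]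
  simp only [xa, br, mact_zero, mact_one, H.tr]
  ring

lemma th_xa_self (i : Fin 3) (v : V2) : H.th i (H.xa i v) = H.th i v - H.nf i v := by
  have h1 := H.nf_eq (Dist.cyc i) v
  have h2 := H.nf_eq (Dist.cyc i) (H.xa i v)
  rw [H.nf_xa, H.th_xa_ne (Dist.cyc i).1, H.th_xa_ne (Dist.cyc i).2.2.symm] at h2
  linarith

/-- The cyclic order of three ideal points is the orientation of their squares, that is, a
determinant in the coordinates `th`. -/
lemma orient_eq {i j k : Fin 3} (h : Dist i j k) (u v w : V2) :
    br u v * br v w * br w u = mtri (H.X i) (H.X j) (H.X k) *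
      (H.th i u * (H.th j v * H.th k w - H.th k v * H.th j w) -
       H.th j u * (H.th i v * H.th k w - H.th k v * H.th i w) +
       H.th k u * (H.th i v * H.th j w - H.th j v * H.th i w)) := by
  obtain ⟨a1, a2, a3⟩ := H.th_sum h u
  obtain ⟨b1, b2, b3⟩ := H.th_sum h v
  obtain ⟨c1, c2, c3⟩ := H.th_sum h w
  have : br u v * br v w * br w u =
      (-(u 0 * u 1)) * (v 0 ^ 2 * (-w 1 ^ 2) - (-v 1 ^ 2) * w 0 ^ 2) -
      (u 0 ^ 2) * ((-(v 0 * v 1)) * (-w 1 ^ 2) - (-v 1 ^ 2) * (-(w 0 * w 1))) +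
      (-u 1 ^ 2) * ((-(v 0 * v 1)) * w 0 ^ 2 - v 0 ^ 2 * (-(w 0 * w 1))) := by
    unfold br; ring
  rw [this, ← a1, ← a2, ← a3, ← b1, ← b2, ← b3, ← c1, ← c2, ← c3]
  unfold mtri
  ring

end Hex

/-! ### Coding of limit points -/

namespace Hex

variable (H : Hex)

/-- Successive application of the reflections of a word. -/
def run : List (Fin 3) → V2 → V2
  | [], v => v
  | i :: w, v => run w (H.xa i v)

@[simp] lemma run_nil (v : V2) : H.run [] v = v := rfl
@[simp] lemma run_cons (i : Fin 3) (w : List (Fin 3)) (v : V2) :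
    H.run (i :: w) v = H.run w (H.xa i v) := rfl

lemma run_append (w w' : List (Fin 3)) (v : V2) : H.run (w ++ w') v = H.run w' (H.run w v) := by
  induction w generalizing v with
  | nil => rfl
  | cons i w ih => exact ih _

lemma run_reverse_run (w : List (Fin 3)) (v : V2) : H.run w.reverse (H.run w v) = v := by
  induction w generalizing v with
  | nil => rfl
  | cons i w ih => rw [List.reverse_cons, run_append, run_cons H i w, ih, run_cons, run_nil, xa_xa]

lemma run_run_reverse (w : List (Fin 3)) (v : V2) : H.run w (H.run w.reverse v) = v := by
  have := H.run_reverse_run w.reverse v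
  rwa [List.reverse_reverse] at this

lemma run_smul (w : List (Fin 3)) (k : ℝ) (v : V2) : H.run w (k • v) = k • H.run w v := by
  induction w generalizing v with
  | nil => rfl
  | cons i w ih => rw [run_cons, xa_smul, ih, run_cons]

lemma run_add (w : List (Fin 3)) (u v : V2) : H.run w (u + v) = H.run w u + H.run w v := by
  induction w generalizing u v with
  | nil => rfl
  | cons i w ih => rw [run_cons, xa_add, ih]; rfl

lemma br_run (w : List (Fin 3)) (u v : V2) :
    br (H.run w u) (H.run w v) = (-1) ^ w.length * br u v := by
  induction w generalizing u v with
  | nil => simp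
  | cons i w ih => rw [run_cons, run_cons, ih, br_xa, List.length_cons, pow_succ]; ring

lemma xa_ne_zero (i : Fin 3) {v : V2} (h : v ≠ 0) : H.xa i v ≠ 0 := fun h0 => h <| by
  rw [← H.xa_xa i v, h0]
  ext j; fin_cases j <;> simp [xa, mact]

lemma run_ne_zero (w : List (Fin 3)) {v : V2} (h : v ≠ 0) : H.run w v ≠ 0 := by
  induction w generalizing v with
  | nil => exact h
  | cons i w ih => exact ih (H.xa_ne_zero i h)

/-- The vectors all of whose translates lie in the positive cone. -/
def K (v : V2) : Prop := v ≠ 0 ∧ ∀ w k, 0 ≤ H.th k (H.run w v)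

variable {H}

lemma K.th_nonneg {v : V2} (h : H.K v) (k : Fin 3) : 0 ≤ H.th k v := h.2 [] k

lemma K.xa {v : V2} (h : H.K v) (i : Fin 3) : H.K (H.xa i v) :=
  ⟨H.xa_ne_zero i h.1, fun w k => h.2 (i :: w) k⟩

lemma K.run {v : V2} (h : H.K v) (w : List (Fin 3)) : H.K (H.run w v) :=
  ⟨H.run_ne_zero w h.1, fun w' k => by rw [← run_append]; exact h.2 _ k⟩

lemma K.smul {v : V2} (h : H.K v) {k : ℝ} (hk : k ≠ 0) : H.K (k • v) := by
  refine ⟨smul_ne_zero hk h.1, fun w i => ?_⟩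
  rw [run_smul, th_smul]
  have := h.2 w i
  positivity

lemma eq_zero_of_th (h : ∀ i, H.th i v = 0) : v = 0 := by
  obtain ⟨-, h2, h3⟩ := H.th_sum (Dist.cyc 0) v
  simp only [h, zero_mul, zero_add] at h2 h3
  ext j; fin_cases j
  · simpa using h2.symm
  · simpa using h3.symm

/-- The combination is a binary quadratic form whose discriminant has the sign of `1 - c ^ 2`, hence
it is definite. Its sign is read off at the vector provided by `Hex.pos`. As a consequence the
closed half-planes behind two different seams share no ideal point. -/
lemma neg_def {i j : Fin 3} (hij : i ≠ j) {v : V2} (hv : v ≠ 0) :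
    H.c i j * H.nf i v + H.nf j v < 0 := by
  obtain ⟨k, hk⟩ := Dist.exists_of_ne hij
  have hc := H.one_lt_c hij
  set a := H.c i j * H.X i 0 0 + H.X j 0 0 with ha
  set b := H.c i j * H.X i 0 1 + H.X j 0 1 with hb
  set g := H.c i j * H.X i 1 0 + H.X j 1 0 with hg
  have hQ : ∀ u, H.c i j * H.nf i u + H.nf j u = g * u 0 ^ 2 - 2 * a * u 0 * u 1 - b * u 1 ^ 2 := by
    intro u
    simp only [nf, xa, br, mact_zero, mact_one, H.tr, ha, hb, hg]; ring
  have hd : a ^ 2 + b * g = 1 - H.c i j ^ 2 := by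
    have h1 := H.det i
    have h2 := H.det j
    have h3 : H.X i 0 0 * H.X j 0 0 + (H.X i 0 1 * H.X j 1 0 + H.X i 1 0 * H.X j 0 1) / 2 = -H.c i j := by
      unfold c mpair; ring
    rw [ha, hb, hg]
    linear_combination (H.c i j) ^ 2 * h1 + h2 + 2 * H.c i j * h3
  have hd' : a ^ 2 + b * g < 0 := by rw [hd]; nlinarith
  have hg0 : g ≠ 0 := by
    rintro h0; rw [h0] at hd'; nlinarith [sq_nonneg a]
  have key : ∀ u : V2, u ≠ 0 → 0 < g * (H.c i j * H.nf i u + H.nf j u) := by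
    intro u hu
    have : g * (H.c i j * H.nf i u + H.nf j u) =
        (g * u 0 - a * u 1) ^ 2 + (-(a ^ 2 + b * g)) * u 1 ^ 2 := by rw [hQ]; ring
    rw [this]
    by_cases h1 : u 1 = 0
    · have h0 : u 0 ≠ 0 := fun h0 => hu (by ext l; fin_cases l <;> simp [h0, h1])
      rw [h1]
      have : 0 < (g * u 0) ^ 2 := by positivity
      simpa using this
    · have : 0 < u 1 ^ 2 := by positivity
      nlinarith [sq_nonneg (g * u 0 - a * u 1), mul_pos (neg_pos.2 hd') this]
  obtain ⟨v0, hv0, hpos⟩ := H.pos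
  have e1 := H.nf_eq hk v0
  have e2 := H.nf_eq hk.swap v0
  have hneg : H.c i j * H.nf i v0 + H.nf j v0 ≤ 0 := by
    rw [e1, e2, H.c_comm j i]
    have p1 : 0 ≤ H.th j v0 := hpos j
    have p2 : 0 ≤ H.th k v0 := hpos k
    have q1 := H.one_lt_c hk.2.1
    have q2 := H.one_lt_c hk.2.2.symm
    have : 0 ≤ (H.c i j * H.c i k + H.c j k) * H.th k v0 := by positivity
    nlinarith [mul_nonneg p1 (show 0 ≤ H.c i j ^ 2 - 1 by nlinarith)]
  have hgneg : g < 0 := by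
    by_contra h0
    have := key v0 hv0
    nlinarith [not_lt.1 h0]
  have := key v hv
  by_contra h0
  nlinarith [not_lt.1 h0]

lemma nf_neg {i j : Fin 3} (hij : i ≠ j) {v : V2} (hv : v ≠ 0) (h : 0 ≤ H.nf i v) : H.nf j v < 0 := by
  have := H.neg_def hij hv
  have := H.one_lt_c hij
  nlinarith

lemma head_unique {i j : Fin 3} {v : V2} (hv : v ≠ 0) (hi : 0 < H.nf i v) (hj : 0 < H.nf j v) :
    i = j := by
  by_contra h
  exact absurd (nf_neg h hv hi.le) (not_lt.2 hj.le)

/-- If all `nf` were nonpositive, `br_sq` for `u = v` would make every product `th l v * nf l v`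
vanish. At most one `nf` is zero, so at most one coordinate survives, and then `nf_eq` kills it too.
-/
lemma K.exists_head {v : V2} (h : H.K v) : ∃ i, 0 < H.nf i v := by
  by_contra hcon
  push Not at hcon
  have key := H.br_sq (Dist.cyc 0) v v
  rw [br_self] at key
  have p : ∀ l, 0 ≤ H.th l v * -H.nf l v := fun l =>
    mul_nonneg (h.th_nonneg l) (by linarith [hcon l])
  have z : ∀ l, H.th l v * H.nf l v = 0 := by
    have a0 := p 0
    have a1 := p (0 + 1)
    have a2 := p (0 + 2)
    intro l
    rcases (Dist.cyc 0).eq_or l with rfl | rfl | rfl <;> nlinarith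
  obtain ⟨i, hi⟩ : ∃ i, ∀ j, j ≠ i → H.nf j v < 0 := by
    by_cases hz : ∃ i, H.nf i v = 0
    · obtain ⟨i, hi⟩ := hz
      exact ⟨i, fun j hj => nf_neg hj.symm h.1 hi.ge⟩
    · push Not at hz
      exact ⟨0, fun j _ => lt_of_le_of_ne (hcon j) (hz j)⟩
  have t : ∀ j, j ≠ i → H.th j v = 0 := fun j hj =>
    (mul_eq_zero.1 (z j)).resolve_right (hi j hj).ne
  have hd := Dist.cyc i
  have e := H.nf_eq hd v
  rw [t _ hd.1.symm, t _ hd.2.2] at e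
  have := hcon i
  have := h.th_nonneg i
  refine h.1 (eq_zero_of_th (H := H) fun l => ?_)
  rcases hd.eq_or l with rfl | rfl | rfl
  · linarith
  · exact t _ hd.1.symm
  · exact t _ hd.2.2

/-- Immediate from `nf_eq`, because the pairings `c` exceed `1`. -/
lemma K.dominant {i j k : Fin 3} (hd : Dist i j k) {v : V2} (h : H.K v) (hi : 0 < H.nf i v) :
    H.th j v + H.th k v < H.th i v := by
  have e := H.nf_eq hd v
  have a := H.one_lt_c hd.1
  have b := H.one_lt_c hd.2.2.symm
  nlinarith [h.th_nonneg j, h.th_nonneg k]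

/-- Limit points behind the three different seams have the cyclic order of the seams: by
`K.dominant` the coordinate matrix in `orient_eq` has dominant diagonal, hence positive determinant.
-/
lemma orient {i j k : Fin 3} (hd : Dist i j k) {u v w : V2} (hu : H.K u) (hv : H.K v) (hw : H.K w)
    (iu : 0 < H.nf i u) (jv : 0 < H.nf j v) (kw : 0 < H.nf k w) :
    0 < mtri (H.X i) (H.X j) (H.X k) * (br u v * br v w * br w u) := by
  rw [H.orient_eq hd, ← mul_assoc]
  have hm := H.mtri_ne_zero hd
  have a := hu.dominant hd iu
  have b := hv.dominant hd.rot jv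
  have c := hw.dominant hd.rot.rot kw
  refine mul_pos (mul_self_pos.2 hm) ?_
  have a2 := hu.th_nonneg j
  have a3 := hu.th_nonneg k
  have b1 := hv.th_nonneg i
  have b3 := hv.th_nonneg k
  have c1 := hw.th_nonneg i
  have c2 := hw.th_nonneg j
  generalize H.th i u = u1 at *
  generalize H.th j u = u2 at *
  generalize H.th k u = u3 at *
  generalize H.th i v = v1 at *
  generalize H.th j v = v2 at *
  generalize H.th k v = v3 at *
  generalize H.th i w = w1 at *
  generalize H.th j w = w2 at *
  generalize H.th k w = w3 at *
  have e1 : 0 < v2 * w3 - v3 * w2 := by nlinarith [mul_nonneg b3 c2]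
  have e2 : 0 ≤ (v2 - v1) * w3 - v3 * (w2 - w1) := by
    nlinarith [mul_nonneg b3 c1, mul_nonneg b3 c2]
  have e3 : 0 ≤ v2 * (w3 - w1) - w2 * (v3 - v1) := by
    nlinarith [mul_nonneg c2 b1, mul_nonneg c2 b3]
  nlinarith [mul_nonneg a2 e2, mul_nonneg a3 e3, mul_pos (sub_pos.2 a) e1]

lemma exists_c_bound (H : Hex) : ∃ B : ℝ, 1 < B ∧ ∀ i j, i ≠ j → H.c i j ≤ B ∧ 1 + 1 / B ≤ H.c i j := by
  have h1 := H.one_lt_c (i := 0) (j := 1) (by decide)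
  have h2 := H.one_lt_c (i := 1) (j := 2) (by decide)
  have h3 := H.one_lt_c (i := 2) (j := 0) (by decide)
  set x := H.c 0 1
  set y := H.c 1 2
  set z := H.c 2 0
  have p1 : 0 < 1 / (x - 1) := by have := sub_pos.2 h1; positivity
  have p2 : 0 < 1 / (y - 1) := by have := sub_pos.2 h2; positivity
  have p3 : 0 < 1 / (z - 1) := by have := sub_pos.2 h3; positivity
  set B := x + y + z + 1 / (x - 1) + 1 / (y - 1) + 1 / (z - 1) with hB
  have q : ∀ t : ℝ, 1 < t → 1 / (t - 1) ≤ B → 1 + 1 / B ≤ t := by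
    intro t ht hb
    have h0 := sub_pos.2 ht
    have h5 : 0 < B := by linarith
    have : 1 / B ≤ t - 1 := by
      rw [div_le_iff₀ h5]
      rw [div_le_iff₀ h0] at hb
      linarith
    linarith
  refine ⟨B, by linarith, ?_⟩
  have k1 : x ≤ B ∧ 1 + 1 / B ≤ x := ⟨by linarith, q x h1 (by linarith)⟩
  have k2 : y ≤ B ∧ 1 + 1 / B ≤ y := ⟨by linarith, q y h2 (by linarith)⟩
  have k3 : z ≤ B ∧ 1 + 1 / B ≤ z := ⟨by linarith, q z h3 (by linarith)⟩
  intro i j hij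
  fin_cases i <;> fin_cases j <;> first | exact absurd rfl hij | assumption |
    (rw [H.c_comm]; assumption)

/-- The size of a vector in the positive cone. -/
def size (H : Hex) (v : V2) : ℝ := H.th 0 v + H.th 1 v + H.th 2 v

lemma size_eq {i j k : Fin 3} (hd : Dist i j k) (v : V2) :
    H.size v = H.th i v + H.th j v + H.th k v := by
  rw [← hd.sum (fun l => H.th l v), Fin.sum_univ_three]; rfl

lemma K.size_nonneg {v : V2} (h : H.K v) : 0 ≤ H.size v := by
  have := h.th_nonneg 0
  have := h.th_nonneg 1
  have := h.th_nonneg 2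
  unfold size; linarith

/-- Reflecting in the first letter lowers the size by `nf i v`. Since a second letter exists, `nf j`
is positive after the reflection, and this inequality bounds the whole size by a constant times `nf
i v`. -/
lemma exists_decay (H : Hex) : ∃ r : ℝ, 0 ≤ r ∧ r < 1 ∧
    ∀ i v, H.K v → 0 < H.nf i v → H.size (H.xa i v) ≤ r * H.size v := by
  obtain ⟨B, hB, hb⟩ := H.exists_c_bound
  -- The sum of the bounds for `y + z` and for `x` obtained in `f3` and `f4`, rounded up.
  set M := B ^ 2 / 4 + B ^ 3 / 4 + 1 with hM
  have hM1 : 1 < M := by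
    have : 0 < B ^ 2 / 4 + B ^ 3 / 4 := by positivity
    linarith
  refine ⟨1 - 1 / M, ?_, ?_, fun i v hv hi => ?_⟩
  · have : 1 / M ≤ 1 := by rw [div_le_one (by linarith)]; exact hM1.le
    linarith
  · have : 0 < 1 / M := by positivity
    linarith
  obtain ⟨j, hj⟩ := (hv.xa i).exists_head
  have hij : i ≠ j := by
    rintro rfl
    rw [nf_xa] at hj; linarith
  obtain ⟨k, hd⟩ := Dist.exists_of_ne hij
  have s1 : H.size (H.xa i v) = H.size v - H.nf i v := by
    rw [size_eq hd, size_eq hd, th_xa_self, th_xa_ne _ hd.1, th_xa_ne _ hd.2.2.symm]; ring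
  have e1 := H.nf_eq hd v
  have e2 := H.nf_eq hd.swap (H.xa i v)
  rw [th_xa_self, th_xa_ne _ hd.1, th_xa_ne _ hd.2.2.symm] at e2
  rw [e2, H.c_comm j i] at hj
  have tj := hv.th_nonneg j
  have tk := hv.th_nonneg k
  obtain ⟨b1, b2⟩ := hb i j hd.1
  obtain ⟨b3, b4⟩ := hb i k hd.2.2.symm
  obtain ⟨b5, b6⟩ := hb j k hd.2.1
  have hpB : 0 < 1 / B := by positivity
  rw [s1, size_eq hd]
  generalize H.th i v = x at *
  generalize H.th j v = y at *
  generalize H.th k v = z at *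
  generalize H.nf i v = a at *
  generalize H.c i j = c1 at *
  generalize H.c i k = c2 at *
  generalize H.c j k = c3 at *
  have f1 : (c1 ^ 2 - 1) * y + (c1 * c2 + c3) * z < c1 * a / 2 := by
    have : x = a / 2 + c1 * y + c2 * z := by linarith
    rw [this] at hj
    nlinarith
  have f2 : 1 / B * (y + z) ≤ B * a / 4 := by
    have g1 : 2 * (1 / B) ≤ c1 ^ 2 - 1 := by nlinarith
    have g2 : 2 * (1 / B) ≤ c1 * c2 + c3 := by
      have : 1 / B ≤ 1 := by rw [div_le_one (by linarith)]; exact hB.le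
      nlinarith
    have g3 := mul_le_mul_of_nonneg_right g1 tj
    have g4 := mul_le_mul_of_nonneg_right g2 tk
    have g5 := mul_le_mul_of_nonneg_right b1 hi.le
    linarith
  have f3 : y + z ≤ B ^ 2 * a / 4 := by
    have := mul_le_mul_of_nonneg_left f2 (show (0 : ℝ) ≤ B by linarith)
    rw [← mul_assoc, mul_one_div_cancel (by linarith)] at this
    linarith
  have f4 : x ≤ B ^ 3 * a / 4 + a / 2 := by
    have g1 := mul_le_mul_of_nonneg_right b1 tj
    have g2 := mul_le_mul_of_nonneg_right b3 tk
    have g3 := mul_le_mul_of_nonneg_left f3 (show (0 : ℝ) ≤ B by linarith)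
    have : B * (B ^ 2 * a / 4) = B ^ 3 * a / 4 := by ring
    linarith
  have f5 : x + y + z ≤ M * a := by
    have : M * a = B ^ 2 * a / 4 + B ^ 3 * a / 4 + a := by rw [hM]; ring
    linarith
  have f6 : 1 / M * (x + y + z) ≤ a := by
    rw [one_div_mul_eq_div, div_le_iff₀ (by linarith)]; linarith
  linarith

/-- By `br_sq`, since `-nf` is bounded by the coordinates times the largest pairing. -/
lemma br_sq_le (H : Hex) : ∃ B : ℝ, 0 ≤ B ∧ ∀ u v, H.K u → H.K v →
    br u v ^ 2 ≤ B * (H.size u * H.size v) := by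
  obtain ⟨B, hB, hb⟩ := H.exists_c_bound
  refine ⟨2 * B, by linarith, fun u v hu hv => ?_⟩
  have key : ∀ i, -H.nf i u ≤ 2 * B * H.size u := by
    intro i
    have hd := Dist.cyc i
    rw [H.nf_eq hd, size_eq hd]
    have t1 := hu.th_nonneg i
    have g1 := mul_le_mul_of_nonneg_right (hb _ _ hd.1).1 (hu.th_nonneg (i + 1))
    have g2 := mul_le_mul_of_nonneg_right (hb _ _ hd.2.2.symm).1 (hu.th_nonneg (i + 2))
    nlinarith
  rw [H.br_sq (Dist.cyc 0), show 2 * B * (H.size u * H.size v) = 2 * B * H.size u * H.size v by ring,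
    size_eq (Dist.cyc 0) v]
  have g0 := mul_le_mul_of_nonneg_left (key 0) (hv.th_nonneg 0)
  have g1 := mul_le_mul_of_nonneg_left (key (0 + 1)) (hv.th_nonneg (0 + 1))
  have g2 := mul_le_mul_of_nonneg_left (key (0 + 2)) (hv.th_nonneg (0 + 2))
  linarith

/-- The code of the vector starts with the given word. -/
def St (H : Hex) : List (Fin 3) → V2 → Prop
  | [], _ => True
  | i :: w, v => 0 < H.nf i v ∧ St H w (H.xa i v)

@[simp] lemma St_nil (v : V2) : H.St [] v := trivial
@[simp] lemma St_cons (i : Fin 3) (w : List (Fin 3)) (v : V2) :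
    H.St (i :: w) v ↔ 0 < H.nf i v ∧ H.St w (H.xa i v) := Iff.rfl

lemma St_append {w w' : List (Fin 3)} {v : V2} :
    H.St (w ++ w') v ↔ H.St w v ∧ H.St w' (H.run w v) := by
  induction w generalizing v with
  | nil => simp
  | cons i w ih => simp [ih, and_assoc]

lemma St_unique {w w' : List (Fin 3)} {v : V2} (hv : v ≠ 0) (h : H.St w v) (h' : H.St w' v)
    (hl : w.length = w'.length) : w = w' := by
  induction w generalizing w' v with
  | nil => exact (List.length_eq_zero_iff.1 hl.symm).symm
  | cons i w ih =>
    cases w' with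
    | nil => simp at hl
    | cons j w' =>
      obtain rfl := head_unique hv h.1 h'.1
      rw [ih (H.xa_ne_zero i hv) h.2 h'.2 (by simpa using hl)]

/-- Limit points are determined by their codes. -/
lemma exists_separating {u v : V2} (hu : H.K u) (hv : H.K v) (huv : br u v ≠ 0) :
    ∃ w i j, i ≠ j ∧ H.St (w ++ [i]) u ∧ H.St (w ++ [j]) v := by
  by_contra hcon
  obtain ⟨r, r0, r1, hr⟩ := H.exists_decay
  obtain ⟨B, B0, hB⟩ := H.br_sq_le
  -- If the codes never differ, following the common code shrinks both sizes geometrically, while it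
  -- preserves `br u v ^ 2`, which is bounded by the product of the sizes.
  have key : ∀ n : ℕ, ∃ w, H.St w u ∧ H.St w v ∧ H.size (H.run w u) ≤ r ^ n * H.size u ∧
      H.size (H.run w v) ≤ r ^ n * H.size v := by
    intro n
    induction n with
    | zero => exact ⟨[], trivial, trivial, by simp, by simp⟩
    | succ n ih =>
      obtain ⟨w, h1, h2, h3, h4⟩ := ih
      obtain ⟨i, hi⟩ := (hu.run w).exists_head
      obtain ⟨j, hj⟩ := (hv.run w).exists_head
      have hij : i = j := by
        by_contra hij
        exact hcon ⟨w, i, j, hij, St_append.2 ⟨h1, hi, trivial⟩, St_append.2 ⟨h2, hj, trivial⟩⟩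
      subst hij
      refine ⟨w ++ [i], St_append.2 ⟨h1, hi, trivial⟩, St_append.2 ⟨h2, hj, trivial⟩, ?_, ?_⟩
      · rw [run_append, pow_succ']
        have := hr i _ (hu.run w) hi
        have := mul_le_mul_of_nonneg_left h3 r0
        simp only [run_cons, run_nil]; linarith
      · rw [run_append, pow_succ']
        have := hr i _ (hv.run w) hj
        have := mul_le_mul_of_nonneg_left h4 r0
        simp only [run_cons, run_nil]; linarith
  have bound : ∀ n : ℕ, br u v ^ 2 ≤ B * (H.size u * H.size v) * r ^ n := by
    intro n
    obtain ⟨w, -, -, h3, h4⟩ := key n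
    have h5 := hB _ _ (hu.run w) (hv.run w)
    rw [br_run, mul_pow, ← pow_mul, mul_comm w.length, pow_mul, neg_one_sq, one_pow, one_mul] at h5
    have h6 : H.size (H.run w v) ≤ H.size v := by
      refine h4.trans ?_
      have := pow_le_one₀ (n := n) r0 r1.le
      have := hv.size_nonneg
      nlinarith
    have h7 := mul_le_mul h3 h6 (hv.run w).size_nonneg
      (mul_nonneg (pow_nonneg r0 n) hu.size_nonneg)
    have := mul_le_mul_of_nonneg_left h7 B0
    linarith
  have hlim : Tendsto (fun n : ℕ => B * (H.size u * H.size v) * r ^ n) atTop (𝓝 0) := by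
    simpa using (tendsto_pow_atTop_nhds_zero_of_lt_one r0 r1).const_mul (B * (H.size u * H.size v))
  have := ge_of_tendsto' hlim bound
  have : 0 < br u v ^ 2 := by positivity
  linarith

/-- The alternating word. -/
def altw : ℕ → Fin 3 → Fin 3 → List (Fin 3)
  | 0, _, _ => []
  | n + 1, i, j => i :: altw n j i

lemma length_altw (n : ℕ) (i j : Fin 3) : (altw n i j).length = n := by
  induction n generalizing i j with
  | zero => rfl
  | succ n ih => simp [altw, ih]

lemma br_eq_zero_of_alt {i j : Fin 3} {u v : V2} (hu : H.K u) (hv : H.K v)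
    (h1 : ∀ n, H.St (altw n i j) u) (h2 : ∀ n, H.St (altw n i j) v) : br u v = 0 := by
  by_contra h
  obtain ⟨w, a, b, hab, ha, hb⟩ := exists_separating hu hv h
  have e1 := St_unique hu.1 ha (h1 (w.length + 1)) (by simp [length_altw])
  have e2 := St_unique hv.1 hb (h2 (w.length + 1)) (by simp [length_altw])
  rw [← e2] at e1
  exact hab (by simpa using e1)

/-- A code starting with `k` would make the coordinate `th k` dominant, hence positive. -/
lemma K.head_of_th {i j k : Fin 3} (hd : Dist i j k) {v : V2} (h : H.K v) (h0 : H.th k v = 0) :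
    0 < H.nf i v ∨ 0 < H.nf j v := by
  obtain ⟨l, hl⟩ := h.exists_head
  rcases hd.eq_or l with rfl | rfl | rfl
  · exact Or.inl hl
  · exact Or.inr hl
  · have := h.dominant hd.rot.rot hl
    have := h.th_nonneg i
    have := h.th_nonneg j
    linarith

/-- The reflections in the other two seams preserve `th k v = 0`, so `k` never occurs and the code
alternates. These points are the ends of the axis of the product of the reflections `i` and `j`. -/
lemma K.alt_of_th {i j k : Fin 3} (hd : Dist i j k) {v : V2} (h : H.K v) (h0 : H.th k v = 0)
    (hi : 0 < H.nf i v) (n : ℕ) : H.St (altw n i j) v := by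
  induction n generalizing i j v with
  | zero => trivial
  | succ n ih =>
    have h1 : H.th k (H.xa i v) = 0 := by rwa [th_xa_ne _ hd.2.2.symm]
    refine ⟨hi, ih hd.swap (h.xa i) h1 ?_⟩
    refine ((h.xa i).head_of_th hd h1).resolve_left ?_
    rw [nf_xa]; linarith

/-- The zeros of a coefficient in a fixed half-plane are proportional. -/
lemma K.br_eq_zero_of_th {i j k : Fin 3} (hd : Dist i j k) {u v : V2} (hu : H.K u) (hv : H.K v)
    (u0 : H.th k u = 0) (v0 : H.th k v = 0) (ui : 0 < H.nf i u) (vi : 0 < H.nf i v) : br u v = 0 :=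
  br_eq_zero_of_alt hu hv (hu.alt_of_th hd u0 ui) (hv.alt_of_th hd v0 vi)

end Hex

/-! ### Classification of simple geodesics -/

namespace Hex

variable {H : Hex}

/-- The pair of endpoints of a simple geodesic of the surface. -/
structure Leaf (H : Hex) (u v : V2) : Prop where
  left : H.K u
  right : H.K v
  ne : br u v ≠ 0
  simple : ∀ w : List (Fin 3), Even w.length → 0 ≤ cr u v (H.run w u) (H.run w v)

lemma Leaf.symm {u v : V2} (h : H.Leaf u v) : H.Leaf v u where
  left := h.right
  right := h.left
  ne := by rw [br_anticomm]; exact neg_ne_zero.2 h.ne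
  simple w hw := by rw [cr_swap_left, cr_swap_right]; exact h.simple w hw

lemma Leaf.xa {u v : V2} (h : H.Leaf u v) (i : Fin 3) : H.Leaf (H.xa i u) (H.xa i v) where
  left := h.left.xa i
  right := h.right.xa i
  ne := by rw [br_xa]; exact neg_ne_zero.2 h.ne
  simple w hw := by
    have := h.simple (i :: w ++ [i]) (by simpa [Nat.even_add_one] using hw)
    rw [run_append, run_append] at this
    simp only [run_cons, run_nil] at this
    rw [← H.cr_xa i, xa_xa, xa_xa] at this
    exact this

lemma Leaf.run {u v : V2} (h : H.Leaf u v) (w : List (Fin 3)) : H.Leaf (H.run w u) (H.run w v) := by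
  induction w generalizing u v with
  | nil => exact h
  | cons i w ih => exact ih (h.xa i)

lemma nf_xa_pos {i j : Fin 3} (hij : i ≠ j) {v : V2} (hv : v ≠ 0) (h : 0 < H.nf i v) :
    0 < H.nf j (H.xa j v) := by
  rw [nf_xa]; linarith [nf_neg hij hv h.le]

lemma K.exists_next {i : Fin 3} {v : V2} (hv : H.K v) (h : 0 < H.nf i v) :
    ∃ j, j ≠ i ∧ 0 < H.nf j (H.xa i v) := by
  obtain ⟨j, hj⟩ := (hv.xa i).exists_head
  refine ⟨j, ?_, hj⟩
  rintro rfl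
  rw [nf_xa] at hj; linarith

/-- A simple geodesic which turns back along a boundary component spirals around it. -/
lemma Leaf.th_eq_zero {i j k : Fin 3} (hd : Dist i j k) {u v : V2} (h : H.Leaf u v)
    (hu : 0 < H.nf k u) (hv : H.St [i, j, i] v) : H.th k v = 0 := by
  obtain ⟨v1, v2, v3, -⟩ := hv
  by_contra h0
  have t1 : 0 < H.th k v := lt_of_le_of_ne (h.right.th_nonneg k) (Ne.symm h0)
  have t2 : 0 < H.th k u := by
    have := h.left.dominant hd.rot.rot hu
    linarith [h.left.th_nonneg i, h.left.th_nonneg j]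
  have hm := H.mtri_ne_zero hd.rot.rot.swap'
  have m1 := H.th_mul hd.rot.rot.swap' v
  have m2 := H.th_mul hd.rot.rot.swap' u
  have a1 : 0 < H.nf i (H.xa i u) := nf_xa_pos hd.2.2 h.left.1 hu
  have a2 : 0 < H.nf j (H.xa j (H.xa i u)) := nf_xa_pos hd.1 (h.left.xa i).1 a1
  -- The translate by the product of the reflections `i` and `j`, with ends `x` and `z`. If `th k v`
  -- is nonzero, the brackets `br u x` and `br v z` have the same sign by `th_mul`, and two cyclic
  -- orders give the remaining two brackets opposite signs. The geodesic would cross its translate.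
  have hs := h.simple [i, j] ⟨1, rfl⟩
  simp only [run_cons, run_nil] at hs
  have kx := (h.left.xa i).xa j
  have kz := (h.right.xa i).xa j
  have b : br (H.xa j (H.xa i v)) (H.xa j (H.xa i u)) = -br u v := by
    rw [br_xa, br_xa, neg_neg, br_anticomm]
  set x := H.xa j (H.xa i u)
  set z := H.xa j (H.xa i v)
  have o1 := orient hd.rot kx h.left h.right a2 hu v1
  have o2 := orient hd.rot kx h.left kz a2 hu v3
  rw [b] at o2
  have o3 := mul_pos o1 o2
  have p1 : 0 < br u x * br v z := by
    rw [← m1, ← m2]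
    have : 0 < mtri (H.X k) (H.X j) (H.X i) ^ 2 := by positivity
    nlinarith [mul_pos (mul_pos t1 t2) this]
  have p2 : br u z * br v x < 0 := by
    by_contra hcon
    have : 0 ≤ (mtri (H.X j) (H.X k) (H.X i) * br x u * br u v) ^ 2 * (br u z * br v x) := by
      have := not_lt.1 hcon; positivity
    nlinarith
  unfold cr at hs
  nlinarith [mul_pos p1 (neg_pos.2 p2)]

/-- A simple geodesic does not wind around periodically with period three. -/
lemma Leaf.not_period {p q x : Fin 3} (hd : Dist p q x) {u v : V2} (h : H.Leaf u v)
    (hu : 0 < H.nf p u) (hv : H.St [x, q, p, x, q] v) : False := by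
  obtain ⟨v1, v2, v3, v4, v5, -⟩ := hv
  -- Two applications of `orient` show that the geodesic would cross its translate by this word.
  have hs := h.simple [x, q, p, x] ⟨2, rfl⟩
  simp only [run_cons, run_nil] at hs
  have a1 : 0 < H.nf x (H.xa x u) := nf_xa_pos hd.2.2.symm h.left.1 hu
  have a2 := nf_xa_pos hd.2.1.symm (h.left.xa x).1 a1
  have a3 := nf_xa_pos hd.1.symm ((h.left.xa x).xa q).1 a2
  have ku := ((h.left.xa x).xa q).xa p
  have kv := (((h.right.xa x).xa q).xa p).xa x
  set y := H.xa p (H.xa q (H.xa x u))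
  set z := H.xa x (H.xa p (H.xa q (H.xa x v)))
  have o1 := orient hd h.left kv h.right hu v5 v1
  have o2 := orient hd ku (h.right.xa x) (h.left.xa x) a3 v2 a1
  have e1 : br y (H.xa x v) = -br (H.xa x y) v := by
    rw [H.br_xa_left x y v, neg_neg]
  have e2 : br (H.xa x u) y = -br u (H.xa x y) := H.br_xa_left _ _ _
  rw [e1, H.br_xa x v u, e2] at o2
  have o3 := mul_pos o1 o2
  unfold cr at hs
  have e3 := br_anticomm (H.xa x y) v
  have e4 := br_anticomm z v
  rw [e3, e4, br_anticomm v u] at o3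
  nlinarith [mul_nonneg (sq_nonneg (mtri (H.X p) (H.X q) (H.X x) * br u v)) hs]

/-- The two kinds of simple geodesics, up to symmetries of the tiling. -/
def Kind (H : Hex) (u v : V2) : Prop :=
  (∃ i j, i ≠ j ∧ H.th i u = 0 ∧ H.th j v = 0) ∨
  (∃ i k, i ≠ k ∧ H.th k v = 0 ∧ br u (H.xa k (H.xa i v)) = 0) ∨
  (∃ i k, i ≠ k ∧ H.th k u = 0 ∧ br v (H.xa k (H.xa i u)) = 0)

lemma Kind.symm {u v : V2} (h : H.Kind u v) : H.Kind v u := by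
  rcases h with ⟨i, j, h1, h2, h3⟩ | h | h
  · exact Or.inl ⟨j, i, h1.symm, h3, h2⟩
  · exact Or.inr (Or.inr h)
  · exact Or.inr (Or.inl h)

lemma St_shift {a b : Fin 3} {v : V2} (hv : v ≠ 0) {w : List (Fin 3)} (hab : b ≠ a)
    (h : H.St (b :: w) v) : H.St (a :: b :: w) (H.xa a v) := by
  refine ⟨nf_xa_pos hab hv h.1, ?_⟩
  rwa [xa_xa]

/-- The end `v` spirals around the component opposite to `k`. The next letters of the code of `u`
decide: a turn around another component gives the first kind, a turn around the same component makes
`u` a translate of `v`, and the remaining continuation has period three and is impossible. -/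
lemma Leaf.exists_kind_of_turn {i j k : Fin 3} (hd : Dist i j k) {u v : V2} (h : H.Leaf u v)
    (hu : 0 < H.nf k u) (hv : H.St [i, j, i] v) : ∃ w, H.Kind (H.run w u) (H.run w v) := by
  have tv := h.th_eq_zero hd hu hv
  have v0 := h.right.1
  have u0 := h.left.1
  have kv := h.right.alt_of_th hd tv hv.1
  obtain ⟨a, ha, hua⟩ := h.left.exists_next hu
  rcases (hd.eq_or a) with rfl | rfl | rfl
  · refine ⟨[], Or.inl ⟨j, k, hd.2.1, ?_, tv⟩⟩
    have : H.th j (H.xa a u) = 0 := by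
      refine (h.symm.xa a).th_eq_zero hd.swap' hv.2.1 ⟨nf_xa_pos ha.symm u0 hu, ?_, ?_, trivial⟩
      · rwa [xa_xa]
      · rwa [xa_xa]
    rwa [th_xa_ne _ hd.1] at this
  · obtain ⟨b, hb, hub⟩ := (h.left.xa k).exists_next hua
    rcases (hd.eq_or b) with rfl | rfl | rfl
    · obtain ⟨c, hc, huc⟩ := ((h.left.xa k).xa a).exists_next hub
      rcases (hd.eq_or c) with rfl | rfl | rfl
      · exact absurd rfl hc
      · refine ⟨[], Or.inr (Or.inl ⟨b, k, hd.2.2.symm, tv, ?_⟩)⟩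
        have t : H.th k (H.xa k u) = 0 :=
          (h.symm.xa k).th_eq_zero hd.swap (nf_xa_pos hd.2.2.symm v0 hv.1) ⟨hua, hub, huc, trivial⟩
        have tv' : H.th k (H.xa b v) = 0 := by rwa [th_xa_ne _ hd.2.2.symm]
        have := K.br_eq_zero_of_th hd.swap (h.left.xa k) (h.right.xa b) t tv' hua hv.2.1
        rw [br_xa_left] at this
        simpa using this
      · exfalso
        have l := ((h.xa c).xa a).xa b
        refine l.not_period (p := c) (q := a) (x := b) hd.rot.rot.swap' huc ?_
        have s1 := St_shift v0 hd.2.2.symm (kv 2)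
        have s2 := St_shift (h.right.xa c).1 hd.2.1.symm s1
        exact St_shift ((h.right.xa c).xa a).1 hd.1.symm s2
    · exact absurd rfl hb
    · refine ⟨[], Or.inl ⟨i, b, hd.2.2.symm, ?_, tv⟩⟩
      exact h.symm.th_eq_zero hd.rot.swap hv.1 ⟨hu, hua, hub, trivial⟩
  · exact absurd rfl ha

/-- Reading one or two more letters of both codes, either one end turns back as seen from a
neighbouring tile, or the codes contain a stretch of period three. -/
lemma Leaf.exists_kind_of_three {i j k : Fin 3} (hd : Dist i j k) {u v : V2} (h : H.Leaf u v)
    (hu : 0 < H.nf k u) (hv : H.St [i, j] v) : ∃ w, H.Kind (H.run w u) (H.run w v) := by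
  obtain ⟨v1, v2, -⟩ := hv
  have u0 := h.left.1
  obtain ⟨a, ha, hva⟩ := (h.right.xa i).exists_next v2
  rcases (hd.eq_or a) with rfl | rfl | rfl
  · exact h.exists_kind_of_turn hd hu ⟨v1, v2, hva, trivial⟩
  · exact absurd rfl ha
  obtain ⟨b, hb, hub⟩ := h.left.exists_next hu
  rcases (hd.eq_or b) with rfl | rfl | rfl
  · obtain ⟨w, hw⟩ := (h.xa b).symm.exists_kind_of_turn hd.swap' v2
      (St_shift u0 hb.symm ⟨hu, hub, trivial⟩)
    exact ⟨b :: w, hw.symm⟩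
  · obtain ⟨c, hc, hvc⟩ := ((h.right.xa i).xa b).exists_next hva
    rcases (hd.eq_or c) with rfl | rfl | rfl
    · exact ((h.xa a).not_period hd.rot.swap' hub
        (St_shift h.right.1 hd.2.2.symm ⟨v1, v2, hva, hvc, trivial⟩)).elim
    · obtain ⟨w, hw⟩ := (h.xa i).exists_kind_of_turn hd.rot (nf_xa_pos hd.2.2 u0 hu)
        ⟨v2, hva, hvc, trivial⟩
      exact ⟨i :: w, hw⟩
    · exact absurd rfl hc
  · exact absurd rfl hb

/-- When no translate is of one of the kinds, the next letter of `v` cannot be the third seam `j`,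
so it is the seam behind which `u` lies. The reflected leaf satisfies the same hypotheses with `i`
and `k` exchanged. -/
lemma Leaf.exists_three {i j k : Fin 3} (hd : Dist i j k) {u v : V2} (h : H.Leaf u v)
    (hu : 0 < H.nf k u) (hv : 0 < H.nf i v)
    (hno : ∀ w, ¬ H.Kind (H.run w u) (H.run w v)) (n : ℕ) :
    H.St (altw n i k) v := by
  induction n generalizing i k u v with
  | zero => trivial
  | succ n ih =>
    refine ⟨hv, ih hd.rot.rot.swap' (h.xa i) (nf_xa_pos hd.2.2 h.left.1 hu) ?_
      fun w hw => hno (i :: w) hw⟩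
    obtain ⟨a, ha, hva⟩ := h.right.exists_next hv
    rcases (hd.eq_or a) with rfl | rfl | rfl
    · exact absurd rfl ha
    · obtain ⟨w, hw⟩ := h.exists_kind_of_three hd hu ⟨hv, hva, trivial⟩
      exact absurd hw (hno w)
    · exact hva

/-- Every boundary component has an axis. -/
def HasEnds (H : Hex) : Prop := ∀ k, ∃ v, H.K v ∧ H.th k v = 0

lemma HasEnds.exists_end (hE : H.HasEnds) {i j k : Fin 3} (hd : Dist i j k) :
    ∃ v, H.K v ∧ H.th k v = 0 ∧ 0 < H.nf i v := by
  obtain ⟨v, hv, h0⟩ := hE k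
  rcases hv.head_of_th hd h0 with h | h
  · exact ⟨v, hv, h0, h⟩
  · refine ⟨H.xa j v, hv.xa j, by rwa [th_xa_ne _ hd.2.1], ?_⟩
    refine ((hv.xa j).head_of_th hd (by rwa [th_xa_ne _ hd.2.1])).resolve_right ?_
    rw [nf_xa]; linarith

/-- Converse of `K.alt_of_th`: the end of the axis provided by `HasEnds` has the same code, and
codes determine points. -/
lemma HasEnds.th_eq_zero (hE : H.HasEnds) {i j k : Fin 3} (hd : Dist i j k) {v : V2} (hv : H.K v)
    (h : ∀ n, H.St (altw n i j) v) : H.th k v = 0 := by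
  obtain ⟨u, hu, u0, ui⟩ := hE.exists_end hd
  obtain ⟨c, rfl⟩ := exists_smul_of_br_eq_zero hu.1
    (br_eq_zero_of_alt hu hv (hu.alt_of_th hd u0 ui) h)
  rw [th_smul, u0, mul_zero]

lemma St.of_run {w : List (Fin 3)} {i : Fin 3} {v : V2} (h : H.St (w ++ [i]) v) :
    0 < H.nf i (H.run w v) := (St_append.1 h).2.1

lemma Kind.xa_aux {i k : Fin 3} {u v : V2} (hik : i ≠ k) (hv : v ≠ 0) (h2 : H.th k v = 0)
    (h3 : br u (H.xa k (H.xa i v)) = 0) :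
    H.th k (H.xa k u) = 0 ∧ br (H.xa k v) (H.xa k (H.xa i (H.xa k u))) = 0 := by
  obtain ⟨c, rfl⟩ := exists_smul_of_br_eq_zero (H.xa_ne_zero k (H.xa_ne_zero i hv))
    (by rw [br_anticomm, h3, neg_zero])
  rw [xa_smul, xa_xa, th_smul, th_xa_ne _ hik, h2, xa_smul, xa_xa, xa_smul, br_smul_right, br_self]
  simp

/-- A suitable single reflection preserves the kinds. It serves to turn a word of odd length into
one of even length, which comes from the holonomy group. -/
lemma Kind.xa {u v : V2} (hu : u ≠ 0) (hv : v ≠ 0) (h : H.Kind u v) : ∃ i, H.Kind (H.xa i u) (H.xa i v) := by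
  rcases h with ⟨i, j, h1, h2, h3⟩ | ⟨i, k, h1, h2, h3⟩ | ⟨i, k, h1, h2, h3⟩
  · obtain ⟨k, hk⟩ := Dist.exists_of_ne h1
    exact ⟨k, Or.inl ⟨i, j, h1, by rwa [th_xa_ne _ hk.2.2], by rwa [th_xa_ne _ hk.2.1.symm]⟩⟩
  · exact ⟨k, Or.inr (Or.inr ⟨i, k, h1, Kind.xa_aux h1 hv h2 h3⟩)⟩
  · exact ⟨k, Or.inr (Or.inl ⟨i, k, h1, Kind.xa_aux h1 hu h2 h3⟩)⟩

/-- The classification of simple geodesics of the surface. -/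
theorem Leaf.classify (hE : H.HasEnds) {u v : V2} (h : H.Leaf u v) :
    (∃ w : List (Fin 3), Even w.length ∧ H.Kind (H.run w u) (H.run w v)) ∨
    ∃ (w : List (Fin 3)) (k : Fin 3), Even w.length ∧ H.th k (H.run w u) = 0 ∧
      H.th k (H.run w v) = 0 := by
  by_cases hno : ∃ w, H.Kind (H.run w u) (H.run w v)
  · left
    obtain ⟨w, hw⟩ := hno
    by_cases he : Even w.length
    · exact ⟨w, he, hw⟩
    · obtain ⟨i, hi⟩ := hw.xa (h.left.run w).1 (h.right.run w).1
      refine ⟨w ++ [i], by simpa [Nat.even_add_one] using he, ?_⟩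
      simpa [run_append] using hi
  · right
    push Not at hno
    obtain ⟨w, k, i, hki, hk, hi⟩ := exists_separating h.left h.right h.ne
    have hk := hk.of_run
    have hi := hi.of_run
    obtain ⟨j, hd⟩ := Dist.exists_of_ne hki
    have hl := h.run w
    have hno' : ∀ w', ¬ H.Kind (H.run w' (H.run w u)) (H.run w' (H.run w v)) := fun w' => by
      rw [← run_append, ← run_append]; exact hno _
    have tv := hE.th_eq_zero hd.swap hl.right (hl.exists_three hd.rot hk hi hno')
    have tu := hE.th_eq_zero hd hl.left
      (hl.symm.exists_three hd.swap.rot hi hk fun w' hw => hno' w' hw.symm)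
    by_cases he : Even w.length
    · exact ⟨w, j, he, tu, tv⟩
    · refine ⟨w ++ [i], j, by simpa [Nat.even_add_one] using he, ?_, ?_⟩
      · simpa [run_append, th_xa_ne _ hd.2.1] using tu
      · simpa [run_append, th_xa_ne _ hd.2.1] using tv

end Hex

/-! ### Endpoints of the boundary axes -/

lemma br_ne_zero_of_cr_neg {u v u' v' : V2} (h : cr u v u' v' < 0) : br u v ≠ 0 := by
  intro huv
  have hu : u ≠ 0 := by rintro rfl; simp [cr, br] at h
  obtain ⟨k, rfl⟩ := exists_smul_of_br_eq_zero hu huv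
  have : cr u (k • u) u' v' = k ^ 2 * (br u u' * br u v') ^ 2 := by
    simp only [cr, br_smul_left]; ring
  rw [this] at h
  exact absurd h (not_lt.2 (by positivity))

lemma Dist.unique {i j k k' : Fin 3} (h : Dist i j k) (h' : Dist i j k') : k = k' := by
  unfold Dist at h h'; revert i j k k'; decide

namespace Hex

variable {H : Hex}

lemma nf_add_smul (i : Fin 3) (x b : V2) (d : ℝ) : H.nf i (x + d • b) =
    H.nf i x + d * (br x (H.xa i b) + br b (H.xa i x)) + d ^ 2 * H.nf i b := by
  simp only [nf, xa_add, xa_smul, br_add_left, br_add_right, br_smul_left, br_smul_right]; ring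

/-- Reduced words move the outside of a half-plane into another half-plane. -/
lemma nf_run_pos {w : List (Fin 3)} {l : Fin 3} {v : V2} (hw : (l :: w).IsChain (· ≠ ·)) (hv : v ≠ 0)
    (hl : H.nf l v < 0) {w' : List (Fin 3)} {h : Fin 3} (he : l :: w = w' ++ [h]) :
    0 < H.nf h (H.run (l :: w) v) := by
  induction w generalizing l v w' with
  | nil =>
    cases w' with
    | nil =>
      obtain rfl : l = h := by simpa using he
      rw [run_cons, run_nil, nf_xa]; linarith
    | cons a w' => simp at he
  | cons m w ih =>
    rw [List.isChain_cons_cons] at hw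
    have h1 : 0 < H.nf l (H.xa l v) := by rw [nf_xa]; linarith
    cases w' with
    | nil => simp at he
    | cons a w' =>
      simp only [List.cons_append, List.cons.injEq] at he
      exact ih hw.2 (H.xa_ne_zero l hv) (nf_neg hw.1 (H.xa_ne_zero l hv) h1.le) he.2

/-- Cancels equal adjacent letters, which changes neither the action nor the parity of the length.
-/
lemma exists_reduced (H : Hex) (w : List (Fin 3)) : ∃ w' : List (Fin 3), w'.IsChain (· ≠ ·) ∧
    (∀ v, H.run w' v = H.run w v) ∧ (Even w'.length ↔ Even w.length) := by
  induction w with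
  | nil => exact ⟨[], by simp, fun _ => rfl, Iff.rfl⟩
  | cons i w ih =>
    obtain ⟨w', h1, h2, h3⟩ := ih
    cases w' with
    | nil => exact ⟨[i], by simp, fun v => by simpa using h2 (H.xa i v), by
        simp only [List.length_cons, Nat.even_add_one, h3]⟩
    | cons j w' =>
      by_cases hij : i = j
      · subst hij
        refine ⟨w', h1.tail, fun v => ?_, ?_⟩
        · rw [run_cons, ← h2, run_cons, xa_xa]
        · rw [List.length_cons, Nat.even_add_one, ← h3, List.length_cons, Nat.even_add_one, not_not]
      · refine ⟨i :: j :: w', List.isChain_cons_cons.2 ⟨hij, h1⟩, fun v => ?_, ?_⟩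
        · rw [run_cons, h2, run_cons]
        · rw [List.length_cons, Nat.even_add_one, h3, List.length_cons, Nat.even_add_one]

/-- The reflections in the two seams orthogonal to a boundary axis exchange its two ends. -/
lemma K.head_xa {i j k l : Fin 3} (hd : Dist i j k) {v : V2} (h : H.K v) (h0 : H.th k v = 0)
    (hi : 0 < H.nf i v) (hl : l ≠ k) : 0 < H.nf j (H.xa l v) ∧ H.th k (H.xa l v) = 0 := by
  have h1 : H.th k (H.xa l v) = 0 := by rwa [th_xa_ne _ hl]
  refine ⟨?_, h1⟩
  rcases hd.eq_or l with rfl | rfl | rfl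
  · refine ((h.xa l).head_of_th hd h1).resolve_left ?_
    rw [nf_xa]; linarith
  · rw [nf_xa]; linarith [nf_neg hd.1 h.1 hi.le]
  · exact absurd rfl hl

lemma nf_pos_of_br {i : Fin 3} {u v : V2} (hu : u ≠ 0) (hv : v ≠ 0) (h : br u v = 0)
    (hi : 0 < H.nf i u) : 0 < H.nf i v := by
  obtain ⟨c, hc, rfl⟩ := exists_ne_zero_smul_of_br_eq_zero hu hv h
  rw [nf_smul]; positivity

/-- A translate of an end of a boundary axis is an end of a boundary axis only for the obvious
reasons. -/
lemma stab_of_chain {w : List (Fin 3)} (hw : w.IsChain (· ≠ ·)) {i j k i' j' k' : Fin 3}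
    (hd : Dist i j k) (hd' : Dist i' j' k') {v v' : V2} (hv : H.K v) (hv' : H.K v')
    (t : H.th k v = 0) (t' : H.th k' v' = 0) (n : 0 < H.nf i v) (n' : 0 < H.nf i' v')
    (h : br (H.run w v) v' = 0) :
    k = k' ∧ (Even w.length ↔ i = i') ∧ ∀ l ∈ w, l ≠ k := by
  induction hn : w.length generalizing w i j i' j' v v' with
  | zero =>
    obtain rfl := List.length_eq_zero_iff.1 hn
    obtain rfl := head_unique hv'.1 (nf_pos_of_br hv.1 hv'.1 h n) n'
    have a := (hv.head_xa hd t n hd.2.2.symm).1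
    have a' := (hv'.head_xa hd' t' n' hd'.2.2.symm).1
    have b := nf_pos_of_br (hv.xa i).1 (hv'.xa i).1 (by rw [br_xa]; simpa using h) a
    obtain rfl := head_unique (hv'.xa i).1 b a'
    exact ⟨hd.unique hd', by simp, by simp⟩
  | succ N ih =>
    cases w with
    | nil => simp at hn
    | cons l w =>
      by_cases hl : l = k
      · subst hl
        obtain ⟨w1, m, he⟩ : ∃ w1 m, l :: w = w1 ++ [m] :=
          ⟨_, _, (List.dropLast_append_getLast (List.cons_ne_nil l w)).symm⟩
        -- When the first letter is `k` it cannot be absorbed on the left. If the last letter is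
        -- `k'`, ping-pong puts the image of `v` behind the seam `k'`, where `v'` is not; otherwise
        -- the last letter is moved to `v'`.
        by_cases hm : m = k'
        · exfalso
          subst hm
          have h1 := nf_run_pos hw hv.1 (nf_neg hd.2.2.symm hv.1 n.le) he
          have h2 := nf_pos_of_br (hv.run _).1 hv'.1 h h1
          exact hd'.2.2 (head_unique hv'.1 h2 n')
        · obtain ⟨a, b⟩ := hv'.head_xa hd' t' n' hm
          rw [he, run_append, run_cons, run_nil, br_xa_left, neg_eq_zero] at h
          have hc : w1.IsChain (· ≠ ·) := by rw [he] at hw; exact hw.left_of_append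
          have hlen : w1.length = N := by
            have := congrArg List.length he
            rw [hn] at this; simpa using this.symm
          obtain ⟨e1, e2, e3⟩ := ih hc hd hd'.swap hv (hv'.xa m) t b n a h hlen
          subst e1
          refine ⟨rfl, ?_, ?_⟩
          · rw [Nat.even_add_one, e2]
            rcases hd'.eq_or i with h | h | h
            · simp [h, hd'.1]
            · simp [h, hd'.1.symm]
            · exact absurd h.symm hd.2.2
          · rw [he]
            intro l' hl'
            rcases List.mem_append.1 hl' with h | h
            · exact e3 l' h
            · rwa [List.mem_singleton.1 h]
      · obtain ⟨a, b⟩ := hv.head_xa hd t n hl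
        have hlen : w.length = N := by simpa using hn
        obtain ⟨e1, e2, e3⟩ := ih hw.tail hd.swap hd' (hv.xa l) hv' b t' a n' h hlen
        subst e1
        refine ⟨rfl, ?_, ?_⟩
        · rw [Nat.even_add_one, e2]
          rcases hd.eq_or i' with h | h | h
          · simp [h, hd.1.symm]
          · simp [h, hd.1]
          · exact absurd h.symm hd'.2.2
        · intro l' hl'
          rcases List.mem_cons.1 hl' with rfl | h
          · exact hl
          · exact e3 l' h

/-- A choice of representatives of the endpoints of the three boundary axes, normalized so that
their sums lie in the gaps of the limit set. -/
structure Frame (H : Hex) where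
  en : Bool → Fin 3 → V2
  K : ∀ s i, H.K (en s i)
  th : ∀ s i, H.th (i + 2) (en s i) = 0
  head : ∀ i, 0 < H.nf i (en true i) ∧ 0 < H.nf (i + 1) (en false i)
  side : ∀ i f, H.K f → 0 ≤ br (en true i) f * br (en false i) f
  gap : ∀ i k, H.nf k (en true i + en false i) < 0

/-- The reflection `i` exchanges the two ends, so `a + b` is an endpoint of the seam `i` and lies
strictly outside the other two half-planes. A small move along `b`, in the direction making the
linear term of `nf i` nonpositive, leaves the half-plane `i` as well, because the quadratic term is
negative. -/
lemma exists_gap {i j k : Fin 3} (hd : Dist i j k) {a b : V2} (hb : b ≠ 0)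
    (hi : 0 < H.nf i a) (hj : 0 < H.nf j b) {s : ℝ} (hs : s = 1 ∨ s = -1) (hab : b = s • H.xa i a) :
    ∃ c : ℝ, 0 < c ∧ ∀ l, H.nf l (a + c • b) < 0 := by
  have hss : s * s = 1 := by rcases hs with rfl | rfl <;> norm_num
  have hib : H.nf i b < 0 := nf_neg hd.1.symm hb hj.le
  set x := a + b with hx
  have hxx : H.xa i x = s • x := by
    rw [hx, hab, xa_add, xa_smul, xa_xa, smul_add, smul_smul, hss, one_smul, add_comm]
  have hx0 : x ≠ 0 := by
    intro h0
    have : a = (-1 : ℝ) • b := by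
      rw [neg_one_smul]; exact eq_neg_of_add_eq_zero_left h0
    rw [this, nf_smul] at hi
    linarith
  have h0 : H.nf i x = 0 := by rw [nf, hxx, br_smul_right, br_self, mul_zero]
  have hN : ∀ l, l ≠ i → ∀ᶠ d : ℝ in 𝓝 0, H.nf l (x + d • b) < 0 := by
    intro l hl
    have hneg := nf_neg hl.symm hx0 h0.ge
    have hc : Continuous fun d : ℝ => H.nf l (x + d • b) := by
      simp only [nf_add_smul]; fun_prop
    refine hc.continuousAt.eventually (gt_mem_nhds ?_)
    simpa using hneg
  obtain ⟨r, hr, hball⟩ := Metric.eventually_nhds_iff.1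
    ((hN j hd.1.symm).and ((hN k hd.2.2).and (lt_mem_nhds (show (-1 : ℝ) < 0 by norm_num))))
  have key : ∀ d : ℝ, d ≠ 0 → |d| < r → d * (br x (H.xa i b) + br b (H.xa i x)) ≤ 0 →
      ∃ c : ℝ, 0 < c ∧ ∀ l, H.nf l (a + c • b) < 0 := by
    intro d hd0 hdr hle
    obtain ⟨q1, q2, q3⟩ := hball (y := d) (by simpa using hdr)
    refine ⟨1 + d, by linarith, fun l => ?_⟩
    have e : a + (1 + d) • b = x + d • b := by rw [hx, add_smul, one_smul, add_assoc]
    rw [e]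
    rcases hd.eq_or l with rfl | rfl | rfl
    · rw [nf_add_smul, h0]
      have : d ^ 2 * H.nf l b < 0 := mul_neg_of_pos_of_neg (by positivity) hib
      linarith
    · exact q1
    · exact q2
  rcases le_total (br x (H.xa i b) + br b (H.xa i x)) 0 with h | h
  · exact key (r / 2) (by positivity) (by rw [abs_of_pos (by positivity)]; linarith)
      (mul_nonpos_of_nonneg_of_nonpos (by positivity) h)
  · exact key (-(r / 2)) (by simp [hr.ne']) (by rw [abs_neg, abs_of_pos (by positivity)]; linarith)
      (by nlinarith)

/-- The coefficient vanishing on the ends of an axis, in terms of these ends. -/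
lemma th_eq_of_zero {i j k : Fin 3} (hd : Dist i j k) {a b : V2} (ha : a ≠ 0) (hb : b ≠ 0)
    (hab : br a b ≠ 0) (ta : H.th k a = 0) (tb : H.th k b = 0) :
    ∃ κ : ℝ, ∀ f, H.th k f = κ * (br a f * br b f) := by
  have hd' := hd.rot.rot
  have hm := H.mtri_ne_zero hd'
  have ea := H.th_mul hd' a
  have eb := H.th_mul hd' b
  rw [ta, zero_mul] at ea
  rw [tb, zero_mul] at eb
  obtain ⟨p, hp⟩ := exists_smul_of_br_eq_zero ha ea.symm
  obtain ⟨q, hq⟩ := exists_smul_of_br_eq_zero hb eb.symm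
  refine ⟨(p - q) / (br a b * mtri (H.X k) (H.X i) (H.X j)), fun f => ?_⟩
  have hf : br a b • f = br f b • a - br f a • b := by
    ext l; fin_cases l <;> simp [br] <;> ring
  have e := H.th_mul hd' f
  have e2 : br a b * br f (H.xa i (H.xa j f)) = br f (H.xa i (H.xa j (br a b • f))) := by
    rw [xa_smul, xa_smul, br_smul_right]
  rw [hf, sub_eq_add_neg, ← _root_.neg_smul, xa_add, xa_smul, xa_smul, xa_add, xa_smul, xa_smul, hp, hq,
    br_add_right, br_smul_right, br_smul_right, br_smul_right, br_smul_right, ← e] at e2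
  field_simp
  rw [br_anticomm a f, br_anticomm b f]
  linear_combination e2

/-- By `th_eq_of_zero` the coordinate vanishing on an axis is a multiple `κ` of the product of
brackets with its ends. The sign `s` makes that product nonnegative on limit points, and the
positive factor `c` puts the sum of the ends into the gap. -/
theorem HasEnds.exists_frame (hE : H.HasEnds) : Nonempty H.Frame := by
  have key : ∀ i, ∃ a b, H.K a ∧ H.K b ∧ H.th (i + 2) a = 0 ∧ H.th (i + 2) b = 0 ∧
      0 < H.nf i a ∧ 0 < H.nf (i + 1) b ∧ (∀ f, H.K f → 0 ≤ br a f * br b f) ∧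
      ∀ k, H.nf k (a + b) < 0 := by
    intro i
    have hd := Dist.cyc i
    obtain ⟨a, ha, ta, na⟩ := hE.exists_end hd
    obtain ⟨nb, tb⟩ := ha.head_xa hd ta na hd.2.2.symm
    have hb := ha.xa i
    have hab : br a (H.xa i a) ≠ 0 := na.ne'
    obtain ⟨κ, hκ⟩ := th_eq_of_zero hd ha.1 hb.1 hab ta tb
    obtain ⟨f0, hf0, -, n0⟩ := hE.exists_end hd.rot.rot
    have t0 : 0 < H.th (i + 2) f0 := by
      have := hf0.dominant hd.rot.rot n0
      linarith [hf0.th_nonneg i, hf0.th_nonneg (i + 1)]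
    have hκ0 : κ ≠ 0 := by
      rintro rfl
      rw [hκ, zero_mul] at t0
      exact lt_irrefl _ t0
    obtain ⟨s, hs, hsκ⟩ : ∃ s : ℝ, (s = 1 ∨ s = -1) ∧ 0 < s * κ := by
      rcases lt_or_gt_of_ne hκ0 with h | h
      · exact ⟨-1, Or.inr rfl, by linarith⟩
      · exact ⟨1, Or.inl rfl, by linarith⟩
    have hs0 : s ≠ 0 := by rcases hs with rfl | rfl <;> norm_num
    have hss : 0 < s ^ 2 := by positivity
    obtain ⟨c, hc, hgap⟩ := exists_gap hd (smul_ne_zero hs0 hb.1) na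
      (by rw [nf_smul]; positivity) hs rfl
    refine ⟨a, c • (s • H.xa i a), ha, (hb.smul hs0).smul hc.ne', ta, ?_, na, ?_, ?_, hgap⟩
    · rw [th_smul, th_smul, tb]; simp
    · rw [nf_smul, nf_smul]; positivity
    · intro f hf
      have h1 := hf.th_nonneg (i + 2)
      rw [hκ] at h1
      rw [br_smul_left, br_smul_left]
      have h2 : 0 ≤ c * (s * κ) * (κ * (br a f * br (H.xa i a) f)) := by positivity
      have h3 : c * (s * κ) * (κ * (br a f * br (H.xa i a) f)) =
        κ ^ 2 * (br a f * (c * (s * br (H.xa i a) f))) := by ring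
      rw [h3] at h2
      exact nonneg_of_mul_nonneg_right h2 (by positivity)
  choose a b h1 h2 h3 h4 h5 h6 h7 h8 using key
  exact ⟨⟨fun s => if s then a else b, fun s i => by cases s <;> simp [h1, h2],
    fun s i => by cases s <;> simp [h3, h4], fun i => ⟨by simpa using h5 i, by simpa using h6 i⟩,
    fun i f hf => by simpa using h7 i f hf, fun i k => by simpa using h8 i k⟩⟩

end Hex

/-! ### Crossings of the candidate leaves -/

namespace Hex

variable {H : Hex}

lemma th_run_of_forall {k : Fin 3} {w : List (Fin 3)} (h : ∀ l ∈ w, l ≠ k) (v : V2) :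
    H.th k (H.run w v) = H.th k v := by
  induction w generalizing v with
  | nil => rfl
  | cons l w ih =>
    rw [run_cons, ih (fun m hm => h m (List.mem_cons_of_mem _ hm)),
      th_xa_ne _ (h l List.mem_cons_self)]

lemma br_run_run (w w' : List (Fin 3)) (u v : V2) :
    br (H.run w u) (H.run w' v) = (-1) ^ w'.length * br (H.run (w ++ w'.reverse) u) v := by
  rw [← br_run, run_append, run_run_reverse]

/-- Pairs of points separated by a seam span disjoint geodesics. -/
lemma cr_pos_of_separated {h : Fin 3} {x y x' y' : V2} (hx : H.nf h x < 0) (hy : H.nf h y < 0)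
    (hx' : 0 < H.nf h x') (hy' : 0 < H.nf h y') : 0 < cr x y x' y' := by
  have key : ∀ u v : V2, br u v ^ 2 - br u (H.xa h v) ^ 2 = -(H.nf h u * H.nf h v) := by
    intro u v
    have := H.det h
    simp only [nf, xa, br, mact_zero, mact_one, H.tr]
    linear_combination (-(u 0 * v 1 - u 1 * v 0) ^ 2) * this
  -- The identity plus a reflection has rank one, so this bilinear form is a product of two linear
  -- forms.
  have rank : (br x x' + br x (H.xa h x')) * (br y y' + br y (H.xa h y')) =
      (br x y' + br x (H.xa h y')) * (br y x' + br y (H.xa h x')) := by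
    have := H.det h
    simp only [xa, br, mact_zero, mact_one, H.tr]
    linear_combination (-(x 0 * y 1 - x 1 * y 0) * (x' 0 * y' 1 - x' 1 * y' 0)) * this
  have pos : ∀ u v : V2, H.nf h u < 0 → 0 < H.nf h v → 0 < br u v * (br u v + br u (H.xa h v)) := by
    intro u v hu hv
    have h1 := key u v
    have h2 := mul_pos (neg_pos.2 hu) hv
    nlinarith [sq_nonneg (br u v + br u (H.xa h v))]
  have p1 := mul_pos (pos x x' hx hx') (pos y y' hy hy')
  have p2 := mul_pos (pos x y' hx hy') (pos y x' hy hx')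
  have p3 := mul_pos p1 p2
  have e : br x x' * (br x x' + br x (H.xa h x')) * (br y y' * (br y y' + br y (H.xa h y'))) *
      (br x y' * (br x y' + br x (H.xa h y')) * (br y x' * (br y x' + br y (H.xa h x')))) =
      cr x y x' y' * (((br x x' + br x (H.xa h x')) * (br y y' + br y (H.xa h y'))) *
      ((br x y' + br x (H.xa h y')) * (br y x' + br y (H.xa h x')))) := by
    unfold cr; ring
  rw [e, ← rank] at p3
  exact pos_of_mul_pos_left p3 (mul_self_nonneg _)

namespace Frame

variable (F : H.Frame)

/-- The seam next to an end of an axis. -/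
def hd (s : Bool) (i : Fin 3) : Fin 3 := if s then i else i + 1

lemma dist_hd (s : Bool) (i : Fin 3) : Dist (hd s i) (hd (!s) i) (i + 2) := by
  cases s
  · exact (Dist.cyc i).swap
  · exact Dist.cyc i

lemma hd_inj {s s' : Bool} {i : Fin 3} (h : hd s i = hd s' i) : s = s' := by
  revert s s' i; decide

lemma nf_hd (s : Bool) (i : Fin 3) : 0 < H.nf (hd s i) (F.en s i) := by
  cases s
  · exact (F.head i).2
  · exact (F.head i).1

lemma eq_of_th {v : V2} (hv : H.K v) {i : Fin 3} (h : H.th (i + 2) v = 0) :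
    ∃ s, br v (F.en s i) = 0 := by
  rcases hv.head_of_th (Dist.cyc i) h with h1 | h1
  · exact ⟨true, hv.br_eq_zero_of_th (Dist.cyc i) (F.K _ _) h (F.th _ _) h1 (F.head i).1⟩
  · exact ⟨false, hv.br_eq_zero_of_th (Dist.cyc i).swap (F.K _ _) h (F.th _ _) h1 (F.head i).2⟩

lemma stab {w : List (Fin 3)} {s s' : Bool} {i i' : Fin 3}
    (h : br (H.run w (F.en s i)) (F.en s' i') = 0) :
    i = i' ∧ (Even w.length ↔ s = s') ∧ ∀ v, H.th (i + 2) (H.run w v) = H.th (i + 2) v := by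
  obtain ⟨w', hc, hr, he⟩ := H.exists_reduced w
  rw [← hr] at h
  obtain ⟨h1, h2, h3⟩ := stab_of_chain hc (dist_hd s i) (dist_hd s' i') (F.K _ _) (F.K _ _) (F.th _ _)
    (F.th _ _) (F.nf_hd _ _) (F.nf_hd _ _) h
  have hi : i = i' := add_right_cancel h1
  subst hi
  refine ⟨rfl, ?_, fun v => ?_⟩
  · rw [← he, h2]
    exact ⟨hd_inj, fun h => h ▸ rfl⟩
  · rw [← hr, th_run_of_forall h3]

lemma br_run_eq_zero {w : List (Fin 3)} {s s' : Bool} {i i' : Fin 3}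
    (h : br (H.run w (F.en s i)) (F.en s' i') = 0) (t t' : Bool) :
    br (H.run w (F.en t i)) (F.en t' i) = 0 ↔ (Even w.length ↔ t = t') := by
  refine ⟨fun h' => (F.stab h').2.1, fun h' => ?_⟩
  obtain ⟨-, -, h3⟩ := F.stab h
  obtain ⟨t'', ht⟩ := F.eq_of_th ((F.K t i).run w) ((h3 _).trans (F.th t i))
  have := (F.stab ht).2.1
  rw [this] at h'
  have : t' = t'' := by
    cases t <;> cases t' <;> cases t'' <;> simp_all
  rwa [this]

/-- A point in the gap of the limit set bounded by the ends of an axis. -/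
def x (i : Fin 3) : V2 := F.en true i + F.en false i

lemma side_run (w : List (Fin 3)) (i : Fin 3) {f : V2} (hf : H.K f) :
    0 ≤ br (H.run w (F.en true i)) f * br (H.run w (F.en false i)) f := by
  have h := F.side i _ (hf.run w.reverse)
  rw [← H.run_run_reverse w f, br_run, br_run]
  have h2 : ((-1 : ℝ) ^ w.length) * (-1) ^ w.length = 1 := by
    rw [← mul_pow]; norm_num
  calc (0 : ℝ) ≤ _ := h
    _ = _ := by linear_combination (-(br (F.en true i) (H.run w.reverse f) *
      br (F.en false i) (H.run w.reverse f))) * h2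

/-- Either the two translated axes coincide, or the ends of one lie on one side of the other. In the
second case all four brackets between ends have the same sign as the bracket of the gap points, so
crossings can be tested on gap points regardless of the chosen ends. -/
lemma dichotomy (w w' : List (Fin 3)) (i i' : Fin 3) :
    (i = i' ∧ ∀ s s', br (H.run w (F.en s i)) (H.run w' (F.en s' i')) = 0 ↔
      (Even (w.length + w'.length) ↔ s = s')) ∨
    ∀ s s', 0 < br (H.run w (F.en s i)) (H.run w' (F.en s' i')) *
      br (H.run w (F.x i)) (H.run w' (F.x i')) := by
  by_cases hz : ∃ s s', br (H.run w (F.en s i)) (H.run w' (F.en s' i')) = 0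
  · left
    obtain ⟨s, s', h⟩ := hz
    have hp : ((-1 : ℝ) ^ w'.length) ≠ 0 := pow_ne_zero _ (by norm_num)
    rw [br_run_run] at h
    have h0 := (mul_eq_zero.1 h).resolve_left hp
    obtain rfl := (F.stab h0).1
    refine ⟨rfl, fun t t' => ?_⟩
    rw [br_run_run, mul_eq_zero, or_iff_right hp, F.br_run_eq_zero h0, List.length_append,
      List.length_reverse]
  · right
    push Not at hz
    have h1 : ∀ s', 0 < br (H.run w (F.en true i)) (H.run w' (F.en s' i')) *
        br (H.run w (F.en false i)) (H.run w' (F.en s' i')) := fun s' =>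
      lt_of_le_of_ne (F.side_run w i ((F.K s' i').run w')) (mul_ne_zero (hz _ _) (hz _ _)).symm
    have h2 : ∀ s, 0 < br (H.run w (F.en s i)) (H.run w' (F.en true i')) *
        br (H.run w (F.en s i)) (H.run w' (F.en false i')) := fun s => by
      have h := F.side_run w' i' ((F.K s i).run w)
      rw [br_anticomm (H.run w' (F.en true i')), br_anticomm (H.run w' (F.en false i')),
        neg_mul_neg] at h
      exact lt_of_le_of_ne h (mul_ne_zero (hz _ _) (hz _ _)).symm
    have e : br (H.run w (F.x i)) (H.run w' (F.x i')) =
        br (H.run w (F.en true i)) (H.run w' (F.en true i')) +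
        br (H.run w (F.en true i)) (H.run w' (F.en false i')) +
        br (H.run w (F.en false i)) (H.run w' (F.en true i')) +
        br (H.run w (F.en false i)) (H.run w' (F.en false i')) := by
      simp only [x, run_add, br_add_left, br_add_right]; ring
    have a1 := h1 true
    have a2 := h1 false
    have a3 := h2 true
    have a4 := h2 false
    rw [e]
    have hne := hz true true
    generalize hB : (fun s s' => br (H.run w (F.en s i)) (H.run w' (F.en s' i'))) = B at *
    have hB' : ∀ s s', br (H.run w (F.en s i)) (H.run w' (F.en s' i')) = B s s' := fun s s' => by
      rw [← hB]
    simp only [hB'] at *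
    rcases lt_or_gt_of_ne hne with n | n
    · have n1 := neg_of_mul_pos_right a1 n.le
      have n2 := neg_of_mul_pos_right a3 n.le
      have n3 := neg_of_mul_pos_right a2 n2.le
      intro s s'
      refine mul_pos_of_neg_of_neg ?_ (by linarith)
      cases s <;> cases s' <;> assumption
    · have n1 := pos_of_mul_pos_right a1 n.le
      have n2 := pos_of_mul_pos_right a3 n.le
      have n3 := pos_of_mul_pos_right a2 n2.le
      intro s s'
      refine mul_pos ?_ (by linarith)
      cases s <;> cases s' <;> assumption

/-- The translate by a word of the chosen end of the `i`-th axis, or of the other end of this axis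
for words of odd length. -/
def vert (ε : Fin 3 → Bool) (w : List (Fin 3)) (i : Fin 3) : V2 :=
  H.run w (F.en (if Even w.length then ε i else !(ε i)) i)

lemma vert_K (ε : Fin 3 → Bool) (w : List (Fin 3)) (i : Fin 3) : H.K (F.vert ε w i) :=
  (F.K _ _).run _

lemma vert_append (ε : Fin 3 → Bool) {w w' : List (Fin 3)} (h : Even w'.length) (i : Fin 3) :
    F.vert ε (w ++ w') i = H.run w' (F.vert ε w i) := by
  unfold vert
  rw [run_append]
  simp only [List.length_append, Nat.even_add, h, iff_true]

lemma vert_dichotomy (ε : Fin 3 → Bool) (w w' : List (Fin 3)) (i i' : Fin 3) :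
    br (F.vert ε w i) (F.vert ε w' i') = 0 ∨ 0 < br (F.vert ε w i) (F.vert ε w' i') *
      br (H.run w (F.x i)) (H.run w' (F.x i')) := by
  rcases F.dichotomy w w' i i' with ⟨rfl, h⟩ | h
  · left
    unfold vert
    rw [h, Nat.even_add]
    by_cases h1 : Even w.length <;> by_cases h2 : Even w'.length <;> simp [h1, h2]
  · exact Or.inr (h _ _)

/-- A vanishing bracket makes `cr` zero; otherwise all four factors have the signs of those for the
gap points. -/
lemma cr_vert_nonneg (ε : Fin 3 → Bool) {w₁ w₂ w₃ w₄ : List (Fin 3)} {i₁ i₂ i₃ i₄ : Fin 3}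
    (h : 0 ≤ cr (H.run w₁ (F.x i₁)) (H.run w₂ (F.x i₂)) (H.run w₃ (F.x i₃)) (H.run w₄ (F.x i₄))) :
    0 ≤ cr (F.vert ε w₁ i₁) (F.vert ε w₂ i₂) (F.vert ε w₃ i₃) (F.vert ε w₄ i₄) := by
  unfold cr at *
  rcases F.vert_dichotomy ε w₁ w₃ i₁ i₃ with h1 | h1
  · rw [h1]; simp
  rcases F.vert_dichotomy ε w₁ w₄ i₁ i₄ with h2 | h2
  · rw [h2]; simp
  rcases F.vert_dichotomy ε w₂ w₃ i₂ i₃ with h3 | h3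
  · rw [h3]; simp
  rcases F.vert_dichotomy ε w₂ w₄ i₂ i₄ with h4 | h4
  · rw [h4]; simp
  have h5 := mul_pos (mul_pos (mul_pos h1 h2) h3) h4
  by_contra hcon
  have h6 := mul_nonpos_of_nonpos_of_nonneg (not_le.1 hcon).le h
  nlinarith

lemma nf_x (i k : Fin 3) : H.nf k (F.x i) < 0 := F.gap i k

lemma x_ne_zero (i : Fin 3) : F.x i ≠ 0 := fun h => by
  have := F.nf_x i 0
  rw [h, nf] at this
  simp [br] at this

lemma run_x_pos {w w' : List (Fin 3)} {h : Fin 3} (hw : w.IsChain (· ≠ ·)) (he : w = w' ++ [h])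
    (i : Fin 3) : 0 < H.nf h (H.run w (F.x i)) := by
  cases w with
  | nil => simp at he
  | cons l w => exact nf_run_pos hw (F.x_ne_zero i) (F.nf_x i l) he

/-- The geodesics crossing one tile only are disjoint from their translates. -/
lemma cr_EE (w : List (Fin 3)) (i j : Fin 3) :
    0 ≤ cr (F.x i) (F.x (i + 1)) (H.run w (F.x j)) (H.run w (F.x (j + 1))) := by
  obtain ⟨w, hc, hr, -⟩ := H.exists_reduced w
  rw [← hr, ← hr]
  rcases List.eq_nil_or_concat w with rfl | ⟨w', h, rfl⟩
  · have : i = j ∨ i = j + 1 ∨ i + 1 = j ∨ i + 1 = j + 1 := by revert i j; decide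
    unfold cr
    rcases this with h | h | h | h <;> simp [h, br_self]
  · simp only [List.concat_eq_append] at *
    exact (cr_pos_of_separated (F.nf_x _ _) (F.nf_x _ _) (F.run_x_pos hc rfl _)
      (F.run_x_pos hc rfl _)).le

lemma nf_xa_x {h : Fin 3} (k i : Fin 3) (hk : h ≠ k) : H.nf h (H.xa k (F.x i)) < 0 := by
  refine nf_neg hk.symm (H.xa_ne_zero _ (F.x_ne_zero i)) ?_
  rw [nf_xa]; linarith [F.nf_x i k]

/-- The arc from `x i` to its mirror image crosses only the seam `i + 2`. A reduced word not ending
in `i + 2` moves the other arc behind a different seam. A word ending in `i + 2` is reduced to this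
case by reflecting both arcs, which reverses the first one. -/
lemma cr_SE (w : List (Fin 3)) (i j : Fin 3) (hij : i = j ∨ i = j + 1) :
    0 ≤ cr (F.x i) (H.xa (i + 2) (F.x i)) (H.run w (F.x j)) (H.run w (F.x (j + 1))) := by
  obtain ⟨w, hc, hr, -⟩ := H.exists_reduced w
  rw [← hr, ← hr]
  have key : ∀ w : List (Fin 3), w.IsChain (· ≠ ·) → (∀ w', w ≠ w' ++ [i + 2]) →
      0 ≤ cr (F.x i) (H.xa (i + 2) (F.x i)) (H.run w (F.x j)) (H.run w (F.x (j + 1))) := by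
    intro w hc hl
    rcases List.eq_nil_or_concat w with rfl | ⟨w', h, rfl⟩
    · unfold cr
      rcases hij with h | h <;> simp [h, br_self]
    · simp only [List.concat_eq_append] at *
      have hk : h ≠ i + 2 := by rintro rfl; exact hl w' rfl
      exact (cr_pos_of_separated (F.nf_x _ _) (F.nf_xa_x _ _ hk) (F.run_x_pos hc rfl _)
        (F.run_x_pos hc rfl _)).le
  by_cases hl : ∃ w', w = w' ++ [i + 2]
  · obtain ⟨w', rfl⟩ := hl
    rw [← H.cr_xa (i + 2), xa_xa, cr_swap_left, run_append, run_append, run_cons, run_nil, run_cons,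
      run_nil, xa_xa, xa_xa]
    refine key w' hc.left_of_append fun w'' h => ?_
    rw [h] at hc
    simp [List.isChain_append] at hc
  · push Not at hl
    exact key w hc hl

/-- As for `cr_SE`, but an initial letter `i + 2` must be removed too; it reverses the second arc.
-/
lemma cr_SS (w : List (Fin 3)) (i : Fin 3) :
    0 ≤ cr (F.x i) (H.xa (i + 2) (F.x i)) (H.run w (F.x i)) (H.run w (H.xa (i + 2) (F.x i))) := by
  obtain ⟨w, hc, hr, -⟩ := H.exists_reduced w
  rw [← hr, ← hr]
  have key : ∀ w : List (Fin 3), w.IsChain (· ≠ ·) → (∀ w', w ≠ w' ++ [i + 2]) →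
      (∀ w', w ≠ (i + 2) :: w') →
      0 ≤ cr (F.x i) (H.xa (i + 2) (F.x i)) (H.run w (F.x i)) (H.run w (H.xa (i + 2) (F.x i))) := by
    intro w hc hl hf
    rcases List.eq_nil_or_concat w with rfl | ⟨w', h, he⟩
    · unfold cr
      simp [br_self]
    · simp only [List.concat_eq_append] at he
      have hk : h ≠ i + 2 := by rintro rfl; exact hl w' he
      refine (cr_pos_of_separated (F.nf_x _ _) (F.nf_xa_x _ _ hk) (F.run_x_pos hc he _) ?_).le
      cases w with
      | nil => simp at he
      | cons l w =>
        have : l ≠ i + 2 := by rintro rfl; exact hf w rfl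
        exact nf_run_pos hc (H.xa_ne_zero _ (F.x_ne_zero i)) (F.nf_xa_x _ _ this) he
  have key2 : ∀ w : List (Fin 3), w.IsChain (· ≠ ·) → (∀ w', w ≠ w' ++ [i + 2]) →
      0 ≤ cr (F.x i) (H.xa (i + 2) (F.x i)) (H.run w (F.x i)) (H.run w (H.xa (i + 2) (F.x i))) := by
    intro w hc hl
    by_cases hf : ∃ w', w = (i + 2) :: w'
    · obtain ⟨w', rfl⟩ := hf
      rw [run_cons, run_cons, xa_xa, cr_swap_right]
      refine key w' hc.tail (fun w'' h => hl ((i + 2) :: w'') (by rw [h]; rfl)) fun w'' h => ?_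
      rw [h, List.isChain_cons_cons] at hc
      exact hc.1 rfl
    · push Not at hf
      exact key w hc hl hf
  by_cases hl : ∃ w', w = w' ++ [i + 2]
  · obtain ⟨w', rfl⟩ := hl
    rw [← H.cr_xa (i + 2), xa_xa, cr_swap_left, run_append, run_append, run_cons, run_nil, run_cons,
      run_nil, xa_xa, xa_xa]
    refine key2 w' hc.left_of_append fun w'' h => ?_
    rw [h] at hc
    simp [List.isChain_append] at hc
  · push Not at hl
    exact key2 w hc hl

/-- The orientation of a pair of gaps does not depend on the representatives. -/
lemma sign_br {w w' : List (Fin 3)} {i i' : Fin 3} (hi : i ≠ i') (s s' t t' : Bool) :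
    SignType.sign (br (H.run w (F.en s i)) (H.run w' (F.en s' i'))) =
    SignType.sign (br (H.run w (F.en t i)) (H.run w' (F.en t' i'))) := by
  rcases F.dichotomy w w' i i' with ⟨h, -⟩ | h
  · exact absurd h hi
  · have h1 := h s s'
    have h2 := h t t'
    rcases mul_pos_iff.1 h1 with ⟨a, b⟩ | ⟨a, b⟩ <;> rcases mul_pos_iff.1 h2 with ⟨c, d⟩ | ⟨c, d⟩
    · rw [sign_pos a, sign_pos c]
    · exact absurd b d.not_gt
    · exact absurd b d.not_gt
    · rw [sign_neg a, sign_neg c]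

end Frame

lemma sign_orient {i j k : Fin 3} (hd : Dist i j k) {u v w : V2} (hu : H.K u) (hv : H.K v) (hw : H.K w)
    (iu : 0 < H.nf i u) (jv : 0 < H.nf j v) (kw : 0 < H.nf k w) :
    SignType.sign (mtri (H.X i) (H.X j) (H.X k)) * (SignType.sign (br u v) *
      SignType.sign (br v w) * SignType.sign (br w u)) = 1 := by
  have := sign_pos (orient hd hu hv hw iu jv kw)
  simpa only [sign_mul] using this

lemma sign_br_swap (u v : V2) : SignType.sign (br u v) = -SignType.sign (br v u) := by
  rw [br_anticomm, Left.sign_neg]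

namespace Frame

variable (F : H.Frame)

/-- Two cyclic orders from `sign_orient` determine the sign of `cr`. They are applied to
conveniently chosen ends, which is legitimate by `sign_br`, and the rest is a finite check on signs.
-/
lemma cr_SE_neg (ε : Fin 3 → Bool) (i : Fin 3) :
    cr (F.vert ε [] i) (F.vert ε [i + 2] i) (F.vert ε [] (i + 1)) (F.vert ε [] (i + 2)) < 0 := by
  have hd := Dist.cyc i
  have kx := (F.K true i).xa (i + 2)
  have nx : 0 < H.nf (i + 2) (H.xa (i + 2) (F.en true i)) := nf_xa_pos hd.2.2.symm (F.K true i).1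
    (F.head i).1
  have hb : 0 < H.nf i (F.en false (i + 2)) := by
    have := (F.head (i + 2)).2
    rwa [(by decide : ∀ i : Fin 3, i + 2 + 1 = i) i] at this
  have o1 := sign_orient hd (F.K true i) (F.K true (i + 1)) (F.K true (i + 2)) (F.head i).1
    (F.head (i + 1)).1 (F.head (i + 2)).1
  have o2 := sign_orient hd.rot.rot.swap' kx (F.K true (i + 1)) (F.K false (i + 2)) nx
    (F.head (i + 1)).1 hb
  rw [show mtri (H.X (i + 2)) (H.X (i + 1)) (H.X i) = -mtri (H.X i) (H.X (i + 1)) (H.X (i + 2)) by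
    unfold mtri; ring, Left.sign_neg] at o2
  have s1 := F.sign_br (w := []) (w' := []) hd.2.1 true false true true
  have r1 := F.sign_br (w := []) (w' := []) hd.1 (ε i) (ε (i + 1)) true true
  have r2 := F.sign_br (w := []) (w' := []) hd.2.2.symm (ε i) (ε (i + 2)) true true
  have r3 := F.sign_br (w := [i + 2]) (w' := []) hd.1 (!ε i) (ε (i + 1)) true true
  have r4 := F.sign_br (w := [i + 2]) (w' := []) hd.2.2.symm (!ε i) (ε (i + 2)) true false
  simp only [run_nil, run_cons] at s1 r1 r2 r3 r4
  rw [← sign_eq_neg_one_iff]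
  unfold cr vert
  simp only [sign_mul, List.length_nil, Even.zero, if_true, run_nil, List.length_singleton,
    Nat.not_even_one, if_false, run_cons]
  rw [r1, r2, r3, r4]
  rw [s1, sign_br_swap _ (H.xa (i + 2) (F.en true i))] at o2
  rw [sign_br_swap (F.en true (i + 2))] at o1
  generalize SignType.sign (mtri (H.X i) (H.X (i + 1)) (H.X (i + 2))) = m at *
  generalize SignType.sign (br (F.en true i) (F.en true (i + 1))) = a1 at *
  generalize SignType.sign (br (F.en true (i + 1)) (F.en true (i + 2))) = a2 at *
  generalize SignType.sign (br (F.en true i) (F.en true (i + 2))) = a3 at *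
  generalize SignType.sign (br (H.xa (i + 2) (F.en true i)) (F.en true (i + 1))) = a4 at *
  generalize SignType.sign (br (H.xa (i + 2) (F.en true i)) (F.en false (i + 2))) = a5 at *
  clear * - o1 o2
  revert m a1 a2 a3 a4 a5
  decide

/-- As for `cr_SE_neg`; the bracket between two different translates of the same axis is compared by
means of `dichotomy`. -/
lemma cr_SS_neg (ε : Fin 3 → Bool) (i : Fin 3) :
    cr (F.vert ε [] i) (F.vert ε [i + 2] i) (F.vert ε [] (i + 1)) (F.vert ε [i] (i + 1)) < 0 := by
  have hd := Dist.cyc i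
  have kx := (F.K true i).xa (i + 2)
  have nx : 0 < H.nf (i + 2) (H.xa (i + 2) (F.en true i)) := nf_xa_pos hd.2.2.symm (F.K true i).1
    (F.head i).1
  have ky := (F.K true (i + 1)).xa i
  have ny : 0 < H.nf i (H.xa i (F.en true (i + 1))) := nf_xa_pos hd.1.symm (F.K true (i + 1)).1
    (F.head (i + 1)).1
  have o1 := sign_orient hd (F.K true i) (F.K true (i + 1)) kx (F.head i).1 (F.head (i + 1)).1 nx
  have o2 := sign_orient hd.swap (F.K false i) ky kx (F.head i).2 ny nx
  rw [show mtri (H.X (i + 1)) (H.X i) (H.X (i + 2)) = -mtri (H.X i) (H.X (i + 1)) (H.X (i + 2)) by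
    unfold mtri; ring, Left.sign_neg] at o2
  have s1 : SignType.sign (br (H.xa (i + 2) (F.en true i)) (F.en false i)) =
      SignType.sign (br (H.xa (i + 2) (F.en true i)) (F.en true i)) := by
    rcases F.dichotomy [i + 2] [] i i with ⟨-, h⟩ | h
    · exfalso
      have := (h true false).2 (by simp)
      simp only [run_cons, run_nil] at this
      have n1 := nf_pos_of_br kx.1 (F.K false i).1 this nx
      exact hd.2.1 (head_unique (F.K false i).1 (F.head i).2 n1)
    · have h1 := h true false
      have h2 := h true true
      simp only [run_cons, run_nil] at h1 h2
      rcases mul_pos_iff.1 h1 with ⟨a, b⟩ | ⟨a, b⟩ <;> rcases mul_pos_iff.1 h2 with ⟨c, d⟩ | ⟨c, d⟩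
      · rw [sign_pos a, sign_pos c]
      · exact absurd b d.not_gt
      · exact absurd b d.not_gt
      · rw [sign_neg a, sign_neg c]
  have s2 := F.sign_br (w := [i + 2]) (w' := [i]) hd.1 (!ε i) (!ε (i + 1)) true true
  have r1 := F.sign_br (w := []) (w' := []) hd.1 (ε i) (ε (i + 1)) true true
  have r2 := F.sign_br (w := []) (w' := [i]) hd.1 (ε i) (!ε (i + 1)) false true
  have r3 := F.sign_br (w := [i + 2]) (w' := []) hd.1 (!ε i) (ε (i + 1)) true true
  simp only [run_nil, run_cons] at s2 r1 r2 r3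
  rw [← sign_eq_neg_one_iff]
  unfold cr vert
  simp only [sign_mul, List.length_nil, Even.zero, if_true, run_nil, List.length_singleton,
    Nat.not_even_one, if_false, run_cons]
  rw [r1, r2, r3, s2]
  rw [s1, sign_br_swap (H.xa i _)] at o2
  rw [sign_br_swap (F.en true (i + 1))] at o1
  generalize SignType.sign (mtri (H.X i) (H.X (i + 1)) (H.X (i + 2))) = m at *
  generalize SignType.sign (br (F.en true i) (F.en true (i + 1))) = a1 at *
  generalize SignType.sign (br (H.xa (i + 2) (F.en true i)) (F.en true i)) = a2 at *
  generalize SignType.sign (br (F.en false i) (H.xa i (F.en true (i + 1)))) = a3 at *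
  generalize SignType.sign (br (H.xa (i + 2) (F.en true i)) (F.en true (i + 1))) = a4 at *
  generalize SignType.sign (br (H.xa (i + 2) (F.en true i)) (H.xa i (F.en true (i + 1)))) = a5 at *
  clear * - o1 o2
  revert m a1 a2 a3 a4 a5
  decide

end Frame

end Hex

/-! ### Traces of the peripheral elements -/

/-- The trace. -/
def trc (g : SL(2, ℝ)) : ℝ := g 0 0 + g 1 1

lemma trc_mul_br (g : SL(2, ℝ)) (u v : V2) :
    trc g * br u v = br (act g u) v + br u (act g v) := by
  simp only [trc, br, act_zero, act_one]; ring

lemma trc_inv (g : SL(2, ℝ)) : trc g⁻¹ = trc g := by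
  simp [trc, Matrix.SpecialLinearGroup.SL2_inv_expl]; ring

lemma ext_act {g h : SL(2, ℝ)} (H : ∀ v, act g v = act h v) : g = h := by
  have h1 := H e1
  have h2 := H e2
  ext i j
  fin_cases i <;> fin_cases j
  · simpa using congrFun h1 0
  · simpa using congrFun h2 0
  · simpa using congrFun h1 1
  · simpa using congrFun h2 1

/-- Eigenvectors of a hyperbolic element, with the side of its axis on which the surface lies. -/
structure Eig (g : SL(2, ℝ)) (e e' : V2) (l : ℝ) : Prop where
  br : br e e' = 1
  ne : l ≠ 0
  left : act g e = l • e
  right : act g e' = l⁻¹ • e'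

lemma expand_basis {e e' : V2} (h : br e e' = 1) (v : V2) : v = br v e' • e - br v e • e' := by
  unfold br at *
  ext i; fin_cases i <;> simp
  · linear_combination (-v 0) * h
  · linear_combination (-v 1) * h

namespace Eig

variable {g h : SL(2, ℝ)} {e e' f f' : V2} {l m : ℝ}

lemma trc (E : Eig g e e' l) : trc g = l + l⁻¹ := by
  have := trc_mul_br g e e'
  rw [E.br, E.left, E.right, br_smul_left, br_smul_right, E.br] at this
  linarith

/-- The sign of `br v (g v)` tells on which side of the axis of `g` the ideal point `v` lies. This
links the side conditions with the coordinates `th` of a hexagon. -/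
lemma br_act (E : Eig g e e' l) (v : V2) :
    PantsLamination.br v (act g v) = (l - l⁻¹) * (PantsLamination.br e v * PantsLamination.br e' v) := by
  conv_lhs => rw [expand_basis E.br v, sub_eq_add_neg, ← _root_.neg_smul, act_add, act_smul, act_smul,
    E.left, E.right]
  simp only [br_add_left, br_add_right, br_smul_left, br_smul_right, br_self, E.br,
    br_anticomm e' e, br_anticomm v e, br_anticomm v e']
  ring

lemma commute (E : Eig g e e' l) {p q : ℝ} (h1 : act h e = p • e) (h2 : act h e' = q • e') :
    g * h = h * g := by
  refine ext_act fun v => ?_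
  rw [act_mul, act_mul, expand_basis E.br v, sub_eq_add_neg, ← _root_.neg_smul]
  simp only [act_add, act_smul, E.left, E.right, h1, h2]
  rw [smul_comm l p, smul_comm l⁻¹ q]

/-- The position of two axes each of which lies on one side of the other. -/
lemma pair (E : Eig g e e' l) (F : Eig h f f' m) (hc : g * h ≠ h * g) {δ ε : ℝ}
    (hδ : δ ^ 2 = 1) (hε : ε ^ 2 = 1)
    (s1 : 0 ≤ ε * (PantsLamination.br e f * PantsLamination.br e' f))
    (s2 : 0 ≤ ε * (PantsLamination.br e f' * PantsLamination.br e' f'))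
    (s3 : 0 ≤ δ * (PantsLamination.br f e * PantsLamination.br f' e))
    (s4 : 0 ≤ δ * (PantsLamination.br f e' * PantsLamination.br f' e'))
    (hl : l ^ 2 ≠ 1) (hm : m ^ 2 ≠ 1) :
    ε * (l - l⁻¹) * (δ * (m - m⁻¹)) * (PantsLamination.trc (g * h) -
      PantsLamination.trc g * PantsLamination.trc h / 2) < 0 ∧
    (PantsLamination.trc g ^ 2 - 4) * (PantsLamination.trc h ^ 2 - 4) ≤
      4 * (PantsLamination.trc (g * h) - PantsLamination.trc g * PantsLamination.trc h / 2) ^ 2 := by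
  have hT : PantsLamination.trc (g * h) - PantsLamination.trc g * PantsLamination.trc h / 2 =
      -((l - l⁻¹) * (m - m⁻¹)) * (PantsLamination.br e f * PantsLamination.br e' f' +
        PantsLamination.br e f' * PantsLamination.br e' f) / 2 := by
    have h1 := trc_mul_br (g * h) f f'
    rw [act_mul, act_mul, F.left, F.right, act_smul, act_smul, F.br, mul_one, br_smul_left,
      br_smul_right, expand_basis E.br f, expand_basis E.br f'] at h1
    simp only [sub_eq_add_neg, ← _root_.neg_smul, act_add, act_smul, E.left, E.right, br_add_left,
      br_add_right, br_smul_left, br_smul_right, br_self, E.br, br_anticomm e' e] at h1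
    have h2 : PantsLamination.br e f * PantsLamination.br e' f' -
      PantsLamination.br e f' * PantsLamination.br e' f = 1 := by
      have := congrArg₂ (· * ·) E.br F.br
      simp only [mul_one] at this
      rw [← this]; unfold PantsLamination.br; ring
    rw [E.trc, F.trc, h1, br_anticomm f e, br_anticomm f e', br_anticomm f' e, br_anticomm f' e']
    linear_combination ((l + l⁻¹) * (m + m⁻¹) / 2) * h2
  have hP : PantsLamination.br e f * PantsLamination.br e' f' -
      PantsLamination.br e f' * PantsLamination.br e' f = 1 := by
    have := congrArg₂ (· * ·) E.br F.br
    simp only [mul_one] at this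
    rw [← this]; unfold PantsLamination.br; ring
  have p1 : ¬(PantsLamination.br e f = 0 ∧ PantsLamination.br e' f' = 0) := by
    rintro ⟨h1, h2⟩
    obtain ⟨c, hc0, hc1⟩ := exists_ne_zero_smul_of_br_eq_zero (right_ne_zero_of_br (v := f) (u := f')
      (by rw [br_anticomm, F.br]; norm_num)) (left_ne_zero_of_br (by rw [E.br]; norm_num))
      (by rw [br_anticomm, h1, neg_zero])
    obtain ⟨d, hd0, hd1⟩ := exists_ne_zero_smul_of_br_eq_zero (right_ne_zero_of_br (u := f) (v := f')
      (by rw [F.br]; norm_num)) (right_ne_zero_of_br (u := e) (by rw [E.br]; norm_num))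
      (by rw [br_anticomm, h2, neg_zero])
    refine hc (E.commute (p := m) (q := m⁻¹) ?_ ?_)
    · rw [hc1, act_smul, F.left, smul_comm]
    · rw [hd1, act_smul, F.right, smul_comm]
  have p2 : ¬(PantsLamination.br e f' = 0 ∧ PantsLamination.br e' f = 0) := by
    rintro ⟨h1, h2⟩
    obtain ⟨c, hc0, hc1⟩ := exists_ne_zero_smul_of_br_eq_zero (right_ne_zero_of_br (v := f') (u := f)
      (by rw [F.br]; norm_num)) (left_ne_zero_of_br (by rw [E.br]; norm_num))
      (by rw [br_anticomm, h1, neg_zero])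
    obtain ⟨d, hd0, hd1⟩ := exists_ne_zero_smul_of_br_eq_zero (left_ne_zero_of_br (u := f) (v := f')
      (by rw [F.br]; norm_num)) (right_ne_zero_of_br (u := e) (by rw [E.br]; norm_num))
      (by rw [br_anticomm, h2, neg_zero])
    refine hc (E.commute (p := m⁻¹) (q := m) ?_ ?_)
    · rw [hc1, act_smul, F.right, smul_comm]
    · rw [hd1, act_smul, F.left, smul_comm]
  rw [br_anticomm f e, br_anticomm f' e, neg_mul_neg] at s3
  rw [br_anticomm f e', br_anticomm f' e', neg_mul_neg] at s4
  have hl' : l - l⁻¹ ≠ 0 := by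
    intro h0
    apply hl
    have := E.ne
    field_simp at h0
    linarith
  have hm' : m - m⁻¹ ≠ 0 := by
    intro h0
    apply hm
    have := F.ne
    field_simp at h0
    linarith
  rw [hT]
  generalize PantsLamination.br e f = A at *
  generalize PantsLamination.br e' f' = B at *
  generalize PantsLamination.br e f' = C at *
  generalize PantsLamination.br e' f = D at *
  -- The product of two side conditions is this quantity times a square, and by `p2` one of the two
  -- available squares is nonzero.
  have q1 : 0 ≤ ε * δ * (A * B) := by
    have k1 : 0 ≤ ε * δ * (A * B) * C ^ 2 := by
      have := mul_nonneg s2 s3; linarith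
    have k2 : 0 ≤ ε * δ * (A * B) * D ^ 2 := by
      have := mul_nonneg s1 s4; linarith
    by_cases hC : C = 0
    · have hD : D ≠ 0 := fun hD => p2 ⟨hC, hD⟩
      exact nonneg_of_mul_nonneg_left k2 (by positivity)
    · exact nonneg_of_mul_nonneg_left k1 (by positivity)
  have q2 : 0 ≤ ε * δ * (C * D) := by
    have k1 : 0 ≤ ε * δ * (C * D) * A ^ 2 := by
      have := mul_nonneg s1 s3; linarith
    have k2 : 0 ≤ ε * δ * (C * D) * B ^ 2 := by
      have := mul_nonneg s2 s4; linarith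
    by_cases hA : A = 0
    · have hB : B ≠ 0 := fun hB => p1 ⟨hA, hB⟩
      exact nonneg_of_mul_nonneg_left k2 (by positivity)
    · exact nonneg_of_mul_nonneg_left k1 (by positivity)
  have hεδ : (ε * δ) ^ 2 = 1 := by rw [mul_pow, hε, hδ, one_mul]
  have q3 : 0 ≤ A * B * (C * D) := by
    have := mul_nonneg q1 q2
    have e : ε * δ * (A * B) * (ε * δ * (C * D)) = (ε * δ) ^ 2 * (A * B * (C * D)) := by ring
    rwa [e, hεδ, one_mul] at this
  have q4 : 0 < ε * δ * (A * B + C * D) := by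
    have hne : ε * δ ≠ 0 := by intro h0; rw [h0] at hεδ; norm_num at hεδ
    refine lt_of_le_of_ne (by linarith) fun h0 => ?_
    have z1 : ε * δ * (A * B) = 0 := by linarith
    have z2 : ε * δ * (C * D) = 0 := by linarith
    have z3 := (mul_eq_zero.1 z1).resolve_left hne
    have z4 := (mul_eq_zero.1 z2).resolve_left hne
    rw [z3, z4] at hP
    norm_num at hP
  have hlm : 0 < ((l - l⁻¹) * (m - m⁻¹)) ^ 2 := by positivity
  constructor
  · have e : ε * (l - l⁻¹) * (δ * (m - m⁻¹)) * (-((l - l⁻¹) * (m - m⁻¹)) * (A * B + C * D) / 2) =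
      -(((l - l⁻¹) * (m - m⁻¹)) ^ 2 * (ε * δ * (A * B + C * D)) / 2) := by ring
    rw [e]
    have := mul_pos hlm q4
    linarith
  · have e1 : PantsLamination.trc g ^ 2 - 4 = (l - l⁻¹) ^ 2 := by
      have := E.ne
      rw [E.trc]; field_simp; ring
    have e2 : PantsLamination.trc h ^ 2 - 4 = (m - m⁻¹) ^ 2 := by
      have := F.ne
      rw [F.trc]; field_simp; ring
    rw [e1, e2, ← mul_pow]
    have e3 : 4 * (-((l - l⁻¹) * (m - m⁻¹)) * (A * B + C * D) / 2) ^ 2 =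
      ((l - l⁻¹) * (m - m⁻¹)) ^ 2 * ((A * B - C * D) ^ 2 + 4 * (A * B * (C * D))) := by ring
    rw [e3, hP]
    nlinarith [mul_nonneg hlm.le q3]

lemma four_lt (E : Eig g e e' l) (hl : l ^ 2 ≠ 1) : 4 < PantsLamination.trc g ^ 2 := by
  have h0 := E.ne
  have hl' : l - l⁻¹ ≠ 0 := by
    intro h0
    apply hl
    have := E.ne
    field_simp at h0
    linarith
  have e1 : PantsLamination.trc g ^ 2 - 4 = (l - l⁻¹) ^ 2 := by
    rw [E.trc]; field_simp; ring
  have : 0 < (l - l⁻¹) ^ 2 := by positivity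
  linarith

end Eig

/-- The first two differences being negative, so is `z - x * y / 2`. The polynomial in `hk` is
decreasing in `z` between `y` and `x * y / 2`, so it is at most its value `(x - 2) * (x + 2 - y ^
2)` at `z = y`, which is negative. -/
lemma trace_sign_aux {x y z : ℝ} (hx : 2 < x) (hxy : x ≤ y) (hyz : y ≤ z)
    (hT : (z - x * y / 2) * (x - y * z / 2) * (y - z * x / 2) < 0)
    (hk : 0 ≤ x ^ 2 + y ^ 2 + z ^ 2 - x * y * z - 4) : False := by
  have h1 : x - y * z / 2 < 0 := by nlinarith
  have h2 : y - z * x / 2 < 0 := by nlinarith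
  have h3 : z - x * y / 2 < 0 := by
    have := mul_pos_of_neg_of_neg h1 h2
    by_contra h
    have := mul_nonneg (not_lt.1 h) this.le
    linarith
  have h4 : 0 ≤ (x - 2) * (x + 2 - y ^ 2) := by
    nlinarith [mul_nonneg (sub_nonneg.2 hyz) (show 0 ≤ x * y - z - y by nlinarith)]
  have h5 : x + 2 - y ^ 2 < 0 := by nlinarith
  nlinarith

lemma trace_sign_pos {x y z : ℝ} (hx : 2 < x) (hy : 2 < y) (hz : 2 < z)
    (hT : (z - x * y / 2) * (x - y * z / 2) * (y - z * x / 2) < 0)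
    (hk : 0 ≤ x ^ 2 + y ^ 2 + z ^ 2 - x * y * z - 4) : False := by
  rcases le_total x y with h1 | h1 <;> rcases le_total y z with h2 | h2 <;>
    rcases le_total x z with h3 | h3
  · exact trace_sign_aux hx h1 h2 hT hk
  · exact trace_sign_aux hx h1 h2 hT hk
  · exact trace_sign_aux hx h3 h2 (by linarith) (by linarith)
  · exact trace_sign_aux hz h3 h1 (by linarith) (by linarith)
  · exact trace_sign_aux hy h1 h3 (by linarith) (by linarith)
  · exact trace_sign_aux hy h2 h3 (by linarith) (by linarith)
  · exact trace_sign_aux hz h2 h1 (by linarith) (by linarith)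
  · exact trace_sign_aux hz h2 h1 (by linarith) (by linarith)

/-- Changing two signs at a time preserves all hypotheses, so a positive product would reduce to
three traces greater than `2`, excluded by `trace_sign_pos`. -/
lemma trace_sign {x y z : ℝ} (hx : 4 < x ^ 2) (hy : 4 < y ^ 2) (hz : 4 < z ^ 2)
    (hT : (z - x * y / 2) * (x - y * z / 2) * (y - z * x / 2) < 0)
    (hk : 0 ≤ x ^ 2 + y ^ 2 + z ^ 2 - x * y * z - 4) : x * y * z < 0 := by
  have key : ∀ t : ℝ, 4 < t ^ 2 → 2 < t ∨ 2 < -t := fun t ht => by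
    by_contra hcon
    push Not at hcon
    nlinarith
  rcases key x hx with a | a <;> rcases key y hy with b | b <;> rcases key z hz with c | c
  · exact (trace_sign_pos a b c hT hk).elim
  · exact mul_neg_of_pos_of_neg (mul_pos (by linarith) (by linarith)) (by linarith)
  · exact mul_neg_of_neg_of_pos (mul_neg_of_pos_of_neg (by linarith) (by linarith)) (by linarith)
  · exact (trace_sign_pos a b c (by linarith) (by linarith)).elim
  · exact mul_neg_of_neg_of_pos (mul_neg_of_neg_of_pos (by linarith) (by linarith)) (by linarith)
  · exact (trace_sign_pos a b c (by linarith) (by linarith)).elim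
  · exact (trace_sign_pos a b c (by linarith) (by linarith)).elim
  · exact mul_neg_of_pos_of_neg (mul_pos_of_neg_of_neg (by linarith) (by linarith)) (by linarith)

/-! ### The reflection group of a pair of pants -/

section Core

variable (ρ : FreeGroup (Fin 2) →* SL(2, ℝ))

lemma geodConvex_convexCore : GeodConvex (convexCore ρ) := fun _ hx _ hy _ hz S hS =>
  hS.2.2.1 _ (hx S hS) _ (hy S hS) hz

lemma isClosed_convexCore : IsClosed (convexCore ρ) := isClosed_sInter fun _ hS => hS.2.1

lemma smul_mem_convexCore (g : FreeGroup (Fin 2)) {z : ℍ} (hz : z ∈ convexCore ρ) :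
    ρ g • z ∈ convexCore ρ := fun S hS => hS.2.2.2 g z (hz S hS)

/-- Ideal points of the convex core. -/
def Ideal (v : V2) : Prop := ∃ v', br v v' ≠ 0 ∧ geo v v' ⊆ convexCore ρ

variable {ρ}

lemma Ideal.act {v : V2} (h : Ideal ρ v) (g : FreeGroup (Fin 2)) :
    Ideal ρ (PantsLamination.act (ρ g) v) := by
  obtain ⟨v', h1, h2⟩ := h
  refine ⟨PantsLamination.act (ρ g) v', by rwa [br_act], ?_⟩
  rw [← image_geo]
  rintro _ ⟨z, hz, rfl⟩
  exact smul_mem_convexCore ρ g (h2 hz)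

lemma Ideal.geo_subset {u v : V2} (hu : Ideal ρ u) (hv : Ideal ρ v) (huv : br u v ≠ 0) :
    geo u v ⊆ convexCore ρ := by
  obtain ⟨u', h1, h2⟩ := hu
  obtain ⟨v', h3, h4⟩ := hv
  exact geo_subset_of_ideal (geodConvex_convexCore ρ) (isClosed_convexCore ρ) h1 h3 huv h2 h4

end Core

/-- Two different transpositions of three letters do not commute. -/
lemma free_ne : FreeGroup.of (0 : Fin 2) * FreeGroup.of 1 ≠ FreeGroup.of 1 * FreeGroup.of 0 := by
  intro h
  have := congrArg (FreeGroup.lift (![Equiv.swap 0 1, Equiv.swap 1 2] : Fin 2 → Equiv.Perm (Fin 3))) h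
  simp only [map_mul, FreeGroup.lift_apply_of] at this
  revert this
  decide

lemma peripheral_not_commute {i j : Fin 3} (hij : i ≠ j) :
    peripheral i * peripheral j ≠ peripheral j * peripheral i := by
  set a := FreeGroup.of (0 : Fin 2) with ha
  set b := FreeGroup.of (1 : Fin 2) with hb
  have h0 : a * b ≠ b * a := free_ne
  have h1 : a * (a * b)⁻¹ ≠ (a * b)⁻¹ * a := fun h => h0 <| by
    have : Commute a (a * b)⁻¹ := h
    have h2 := Commute.inv_right_iff.1 this
    have h3 : a * (a * b) = a * b * a := h2
    rw [mul_assoc a b a] at h3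
    exact mul_left_cancel h3
  have h2 : b * (a * b)⁻¹ ≠ (a * b)⁻¹ * b := fun h => h0 <| by
    have : Commute b (a * b)⁻¹ := h
    have h2 := Commute.inv_right_iff.1 this
    have h3 : b * (a * b) = a * b * b := h2
    rw [← mul_assoc b a b] at h3
    exact (mul_right_cancel h3).symm
  fin_cases i <;> fin_cases j
  · exact absurd rfl hij
  · exact h0
  · exact h1
  · exact h0.symm
  · exact absurd rfl hij
  · exact h2
  · exact h1.symm
  · exact h2.symm
  · exact absurd rfl hij

lemma eig_of_isAxis {g : SL(2, ℝ)} {α : ℝ → ℍ} (h : IsAxis g α) :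
    ∃ (k : SL(2, ℝ)) (l : ℝ), l ^ 2 ≠ 1 ∧ (∀ t, α t = k • iexp t) ∧
      Eig g (act k e1) (act k e2) l ∧ range α = geo (act k e1) (act k e2) := by
  obtain ⟨k, l, h1, h2, h3, h4, h5⟩ := h.exists_eigen
  refine ⟨k, l, h2, h3, ⟨by rw [br_act, br_e1_e2], h1, h4, h5⟩, ?_⟩
  rw [geo_act_e]
  exact congrArg range (funext h3)

namespace HyperbolicPants

variable (P : HyperbolicPants)

lemma hol_injective : Function.Injective P.hol := by
  rw [injective_iff_map_eq_one]
  intro g hg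
  exact P.faithful g fun z => by rw [hg, one_smul]

/-- The ends of a boundary axis are eigenvectors. The convex core lies on one side of the axis, and
`ε` records this side for all ideal points of the core. -/
lemma exists_eig (i : Fin 3) : ∃ e e' l ε, Eig (P.hol (peripheral i)) e e' l ∧ l ^ 2 ≠ 1 ∧
    ε ^ 2 = (1 : ℝ) ∧ Ideal P.hol e ∧ Ideal P.hol e' ∧ geo e e' ⊆ frontier (convexCore P.hol) ∧
    ∀ v, Ideal P.hol v → 0 ≤ ε * (br e v * br e' v) := by
  obtain ⟨α, hα, hf⟩ := P.boundary i
  obtain ⟨k, l, h1, -, E, hr⟩ := eig_of_isAxis hα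
  rw [hr] at hf
  have hb : br (act k e1) (act k e2) ≠ 0 := by rw [E.br]; norm_num
  have hb' : br (act k e2) (act k e1) ≠ 0 := by rw [br_anticomm, E.br]; norm_num
  have hsub := hf.trans (isClosed_convexCore P.hol).frontier_subset
  obtain ⟨ε, hε, hs⟩ := one_side_of_geo_subset_frontier (geodConvex_convexCore P.hol)
    (isClosed_convexCore P.hol) hb hf
  refine ⟨_, _, l, ε, E, h1, by rcases hε with rfl | rfl <;> norm_num, ⟨_, hb, hsub⟩,
    ⟨_, hb', by rwa [geo_comm]⟩, hf, fun v ⟨v', hv, hv'⟩ => ?_⟩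
  exact nonneg_of_geo_subset hv fun z hz => hs z (hv' hz)

end HyperbolicPants

/-! ### Reflections obtained from a commutator -/

section Mat

variable {A B : Matrix (Fin 2) (Fin 2) ℝ}

lemma bracket_mul_left (A B : Matrix (Fin 2) (Fin 2) ℝ) :
    (A * B - B * A) * A = A.adjugate * (A * B - B * A) := by
  ext i j
  fin_cases i <;> fin_cases j <;>
    simp [Matrix.adjugate_fin_two, Matrix.mul_apply, Fin.sum_univ_two] <;> ring

lemma bracket_mul_right (A B : Matrix (Fin 2) (Fin 2) ℝ) :
    (A * B - B * A) * B = B.adjugate * (A * B - B * A) := by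
  ext i j
  fin_cases i <;> fin_cases j <;>
    simp [Matrix.adjugate_fin_two, Matrix.mul_apply, Fin.sum_univ_two] <;> ring

/-- Traces of three elements of `SL₂` with product one. -/
def disc (x y z : ℝ) : ℝ := x ^ 2 + y ^ 2 + z ^ 2 - x * y * z - 4

/-- A commutator is traceless, so its square is scalar; the scalar is a polynomial in the traces. -/
lemma bracket_sq (hA : A.det = 1) (hB : B.det = 1) : (A * B - B * A) * (A * B - B * A) =
    disc A.trace B.trace (A * B).trace • (1 : Matrix (Fin 2) (Fin 2) ℝ) := by
  rw [Matrix.det_fin_two] at hA hB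
  have key : ((A * B - B * A) * (A * B - B * A)) 0 0 = disc A.trace B.trace (A * B).trace := by
    simp [disc, Matrix.trace_fin_two, Matrix.mul_apply, Fin.sum_univ_two]
    linear_combination ((A 0 0 + A 1 1) ^ 2 - 4) * hB +
      ((B 0 0 + B 1 1) ^ 2 - 4 * (B 0 0 * B 1 1 - B 0 1 * B 1 0)) * hA
  have h2 : (A * B - B * A) 1 1 = -(A * B - B * A) 0 0 := by
    simp [Matrix.mul_apply, Fin.sum_univ_two]; ring
  generalize A * B - B * A = c at *
  rw [← key]
  ext i j
  fin_cases i <;> fin_cases j <;> simp [Matrix.mul_apply, Fin.sum_univ_two, h2] <;> ring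

/-- The normalized commutator `Y` is an involution conjugating `A` and `B` to their inverses. Hence
`A * Y`, `Y` and `Y * B` are involutions whose consecutive products are `A`, `B` and the inverse of
`A * B`; the signs `s` and `t` remain free. -/
lemma exists_reflections (hA : A.det = 1) (hB : B.det = 1)
    (hD : 0 < disc A.trace B.trace (A * B).trace) {s t : ℝ} (hs : s ^ 2 = 1) (ht : t ^ 2 = 1) :
    ∃ X : Fin 3 → Matrix (Fin 2) (Fin 2) ℝ, (∀ i, X i 1 1 = -X i 0 0) ∧
      (∀ i, X i 0 0 ^ 2 + X i 0 1 * X i 1 0 = 1) ∧ X 0 * X 1 = s • A ∧ X 1 * X 2 = t • B ∧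
      X 2 * X 0 = (s * t) • (A * B).adjugate := by
  set D := disc A.trace B.trace (A * B).trace with hDef
  set r := (Real.sqrt D)⁻¹ with hr
  have hrD : r * r * D = 1 := by
    rw [hr, ← mul_inv, Real.mul_self_sqrt hD.le, inv_mul_cancel₀ hD.ne']
  set Y : Matrix (Fin 2) (Fin 2) ℝ := r • (A * B - B * A) with hY
  have hYY : Y * Y = 1 := by
    rw [hY, smul_mul_smul_comm, bracket_sq hA hB, smul_smul, hrD, one_smul]
  have hYA : Y * A = A.adjugate * Y := by
    rw [hY, smul_mul_assoc, bracket_mul_left, mul_smul_comm]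
  have hYB : Y * B = B.adjugate * Y := by
    rw [hY, smul_mul_assoc, bracket_mul_right, mul_smul_comm]
  have hAA : A * A.adjugate = 1 := by rw [Matrix.mul_adjugate, hA, one_smul]
  have hBB : B.adjugate * B = 1 := by rw [Matrix.adjugate_mul, hB, one_smul]
  have trY : Y 1 1 = -Y 0 0 := by
    simp [hY, Matrix.mul_apply, Fin.sum_univ_two]; ring
  have trA : (A * Y) 1 1 = -(A * Y) 0 0 := by
    simp [hY, Matrix.mul_apply, Fin.sum_univ_two]; ring
  have trB : (Y * B) 1 1 = -(Y * B) 0 0 := by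
    simp [hY, Matrix.mul_apply, Fin.sum_univ_two]; ring
  have sqA : (A * Y) * (A * Y) = 1 := by
    rw [mul_assoc, ← mul_assoc Y A Y, hYA, mul_assoc A.adjugate, hYY, mul_one, hAA]
  have sqB : (Y * B) * (Y * B) = 1 := by
    rw [hYB, mul_assoc, ← hYB, ← mul_assoc Y Y, hYY, one_mul, hBB]
  have ent : ∀ Z : Matrix (Fin 2) (Fin 2) ℝ, Z 1 1 = -Z 0 0 → Z * Z = 1 →
      Z 0 0 ^ 2 + Z 0 1 * Z 1 0 = 1 := fun Z _ h2 => by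
    have := congrFun (congrFun h2 0) 0
    simp [Matrix.mul_apply, Fin.sum_univ_two] at this
    linarith
  have scal : ∀ (Z : Matrix (Fin 2) (Fin 2) ℝ) (k : ℝ), k ^ 2 = 1 → Z * Z = 1 →
      (k • Z) * (k • Z) = 1 := fun Z k hk h => by
    rw [smul_mul_smul_comm, h, ← sq, hk, one_smul]
  have scal' : ∀ (Z : Matrix (Fin 2) (Fin 2) ℝ) (k : ℝ), Z 1 1 = -Z 0 0 →
      (k • Z) 1 1 = -(k • Z) 0 0 := fun Z k h => by
    simp [h]
  refine ⟨![s • (A * Y), Y, t • (Y * B)], ?_, ?_, ?_, ?_, ?_⟩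
  · intro i
    fin_cases i
    · exact scal' _ _ trA
    · exact trY
    · exact scal' _ _ trB
  · intro i
    fin_cases i
    · exact ent _ (scal' _ _ trA) (scal _ _ hs sqA)
    · exact ent _ trY hYY
    · exact ent _ (scal' _ _ trB) (scal _ _ ht sqB)
  · change (s • (A * Y)) * Y = s • A
    rw [smul_mul_assoc, mul_assoc, hYY, mul_one]
  · change Y * (t • (Y * B)) = t • B
    rw [mul_smul_comm, ← mul_assoc, hYY, one_mul]
  · change (t • (Y * B)) * (s • (A * Y)) = (s * t) • (A * B).adjugate
    rw [smul_mul_smul_comm, mul_comm t s, hYB, mul_assoc, ← mul_assoc Y A, hYA, mul_assoc _ Y Y, hYY,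
      mul_one, Matrix.adjugate_mul_distrib]

lemma mpair_eq (hA : A 1 1 = -A 0 0) (hB : B 1 1 = -B 0 0) : mpair A B = -(A * B).trace / 2 := by
  simp [mpair, Matrix.trace_fin_two, Matrix.mul_apply, Fin.sum_univ_two, hA, hB]; ring

lemma mpair_comm (A B : Matrix (Fin 2) (Fin 2) ℝ) : mpair A B = mpair B A := by
  unfold mpair; ring

end Mat

lemma exists_sign {x : ℝ} (hx : x ≠ 0) : ∃ s : ℝ, s ^ 2 = 1 ∧ s * x < 0 := by
  rcases lt_or_gt_of_ne hx with h | h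
  · exact ⟨1, by norm_num, by linarith⟩
  · exact ⟨-1, by norm_num, by linarith⟩

lemma one_lt_of_sign {x s : ℝ} (hs : s ^ 2 = 1) (h : s * x < 0) (hx : 4 < x ^ 2) :
    1 < -(s * x) / 2 := by
  have : (s * x) ^ 2 = x ^ 2 := by rw [mul_pow, hs, one_mul]
  nlinarith

lemma mtri_cyc (A B C : Matrix (Fin 2) (Fin 2) ℝ) : mtri A B C = mtri B C A := by
  unfold mtri; ring

lemma mtri_neg (A B C : Matrix (Fin 2) (Fin 2) ℝ) : mtri (-A) (-B) (-C) = -mtri A B C := by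
  unfold mtri; simp; ring

namespace HyperbolicPants

variable (P : HyperbolicPants)

/-- The reflections of `H` generate a group containing the holonomy group of `P`. -/
structure IsHex (H : Hex) : Prop where
  peripheral : ∀ i, ∃ s : ℝ, s ≠ 0 ∧
    ∀ v, act (P.hol (peripheral i)) v = s • H.xa i (H.xa (i + 1) v)
  th_nonneg : ∀ v, Ideal P.hol v → ∀ k, 0 ≤ H.th k v

/-- The `T i` carry the side of the axis on which the core lies. The pairwise inequalities multiply
to the sign condition of `trace_sign`, and the negativity of the product of traces then makes all `T
i * x i` have one sign. -/
lemma common_sign {x T : Fin 3 → ℝ} (hlt : ∀ i, 4 < x i ^ 2)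
    (q01 : T 0 * T 1 * (x 2 - x 0 * x 1 / 2) < 0) (q12 : T 1 * T 2 * (x 0 - x 1 * x 2 / 2) < 0)
    (q20 : T 2 * T 0 * (x 1 - x 2 * x 0 / 2) < 0)
    (r01 : (x 0 ^ 2 - 4) * (x 1 ^ 2 - 4) ≤ 4 * (x 2 - x 0 * x 1 / 2) ^ 2) :
    x 0 * x 1 * x 2 < 0 ∧ ∃ σ : ℝ, σ ^ 2 = 1 ∧ ∀ i, 0 < σ * (T i * x i) := by
  have hprod : (x 2 - x 0 * x 1 / 2) * (x 0 - x 1 * x 2 / 2) * (x 1 - x 2 * x 0 / 2) < 0 := by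
    have h1 := mul_neg_of_pos_of_neg (mul_pos_of_neg_of_neg q01 q12) q20
    have h2 : 0 ≤ (T 0 * T 1 * T 2) ^ 2 := sq_nonneg _
    by_contra hcon
    push Not at hcon
    refine absurd (mul_nonneg h2 hcon) (not_le.2 (lt_of_eq_of_lt ?_ h1))
    ring
  have hdisc : 0 ≤ x 0 ^ 2 + x 1 ^ 2 + x 2 ^ 2 - x 0 * x 1 * x 2 - 4 := by linarith
  have hneg := trace_sign (hlt 0) (hlt 1) (hlt 2) hprod hdisc
  have hcom : ∀ p q r t : ℝ, p * q * r < 0 → t * (r - p * q / 2) < 0 → 0 < t * (p * q) := by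
    intro p q r t h1 h2
    have h3 : p * q * (r - p * q / 2) < 0 := by
      have := sq_nonneg (p * q)
      linarith
    refine pos_of_mul_pos_left (b := (r - p * q / 2) ^ 2) ?_ (sq_nonneg _)
    exact (mul_pos_of_neg_of_neg h2 h3).trans_eq (by ring)
  have k01 := hcom _ _ _ _ hneg q01
  have k12 := hcom _ _ _ _ (by linarith : x 1 * x 2 * x 0 < 0) q12
  obtain ⟨σ, hσ, hσ0⟩ := exists_sign (x := -(T 1 * x 1)) (by
    intro h
    have h0 : T 0 * T 1 * (x 0 * x 1) = T 0 * x 0 * (T 1 * x 1) := by ring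
    rw [h0, neg_eq_zero.1 h, mul_zero] at k01
    exact lt_irrefl _ k01)
  have h1 : 0 < σ * (T 1 * x 1) := by linarith
  have hh : ∀ y, 0 < y * (T 1 * x 1) → 0 < σ * y := fun y hy => by
    refine pos_of_mul_pos_left (b := σ * (T 1 * x 1)) ?_ h1.le
    have : σ * y * (σ * (T 1 * x 1)) = σ ^ 2 * (y * (T 1 * x 1)) := by ring
    rw [this, hσ, one_mul]
    exact hy
  refine ⟨hneg, σ, hσ, fun i => ?_⟩
  fin_cases i
  · exact hh _ (by simpa using lt_of_lt_of_eq k01 (by ring))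
  · exact h1
  · exact hh _ (by simpa using lt_of_lt_of_eq k12 (by ring))

/-- The pairing of consecutive reflections is minus half a signed trace, so `S i` must make all
signed traces negative. This is consistent because the product of the traces is negative. The common
sign `σ` then makes the ideal points of the core lie in the positive cone. -/
lemma exists_hex : ∃ H : Hex, P.IsHex H := by
  choose e e' l ε hE hl hε he he' hfr hside using P.exists_eig
  set g := fun i => P.hol (PantsLamination.peripheral i) with hg
  set x := fun i => trc (g i) with hx
  have hlt : ∀ i, 4 < x i ^ 2 := fun i => (hE i).four_lt (hl i)
  have hx0 : ∀ i, x i ≠ 0 := fun i h => by have := hlt i; rw [h] at this; norm_num at this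
  set T : Fin 3 → ℝ := fun i => ε i * (l i - (l i)⁻¹) with hT
  have hpair : ∀ i j, i ≠ j → T i * T j * (trc (g i * g j) - x i * x j / 2) < 0 ∧
      (x i ^ 2 - 4) * (x j ^ 2 - 4) ≤ 4 * (trc (g i * g j) - x i * x j / 2) ^ 2 := fun i j hij => by
    have hc : g i * g j ≠ g j * g i := fun h => peripheral_not_commute hij <| P.hol_injective <| by
      rw [map_mul, map_mul]; exact h
    have := (hE i).pair (hE j) hc (hε j) (hε i) (hside i _ (he j)) (hside i _ (he' j))
      (hside j _ (he i)) (hside j _ (he' i)) (hl i) (hl j)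
    refine ⟨lt_of_eq_of_lt ?_ this.1, this.2⟩
    simp only [hT]; ring
  have h01 : trc (g 0 * g 1) = x 2 := by
    rw [hx]; simp only [hg]; rw [← trc_inv, ← map_mul, ← map_inv]; rfl
  have h12 : trc (g 1 * g 2) = x 0 := by
    rw [hx]; simp only [hg]; rw [← trc_inv (P.hol (PantsLamination.peripheral 0)), ← map_mul, ← map_inv]
    congr 2; simp [PantsLamination.peripheral]
  have h20 : trc (g 2 * g 0) = x 1 := by
    rw [hx]; simp only [hg]; rw [← trc_inv (P.hol (PantsLamination.peripheral 1)), ← map_mul, ← map_inv]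
    congr 2; simp [PantsLamination.peripheral]
  obtain ⟨q01, r01⟩ := hpair 0 1 (by decide)
  obtain ⟨q12, -⟩ := hpair 1 2 (by decide)
  obtain ⟨q20, -⟩ := hpair 2 0 (by decide)
  rw [h01] at q01 r01
  rw [h12] at q12
  rw [h20] at q20
  obtain ⟨hneg, σ, hσ, hσi⟩ := common_sign hlt q01 q12 q20 r01
  have hside' : ∀ v, Ideal P.hol v → ∀ i, 0 ≤ σ * (x i * br v (act (g i) v)) := fun v hv i => by
    have h1 : 0 ≤ T i * br v (act (g i) v) := by
      rw [(hE i).br_act]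
      have := mul_nonneg (sq_nonneg (l i - (l i)⁻¹)) (hside i v hv)
      simp only [hT]; linarith
    have h2 := mul_nonneg (hσi i).le h1
    have hTi : 0 < T i ^ 2 := by
      have := hσi i
      refine sq_pos_of_ne_zero fun h => ?_
      rw [h] at this; norm_num at this
    nlinarith
  obtain ⟨s, hs, hs0⟩ := exists_sign (hx0 0)
  obtain ⟨t, ht, ht0⟩ := exists_sign (hx0 1)
  have hst0 : s * t * x 2 < 0 := by
    have h1 := mul_pos_of_neg_of_neg hs0 ht0
    have h2 : s * x 0 * (t * x 1) * (s * t * x 2) = x 0 * x 1 * x 2 := by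
      linear_combination (t ^ 2 * x 0 * x 1 * x 2) * hs + x 0 * x 1 * x 2 * ht
    nlinarith
  set S : Fin 3 → ℝ := ![s, t, s * t] with hS
  have hSx : ∀ i, S i ^ 2 = 1 ∧ S i * x i < 0 := by
    intro i
    fin_cases i
    · exact ⟨hs, hs0⟩
    · exact ⟨ht, ht0⟩
    · refine ⟨?_, hst0⟩
      change (s * t) ^ 2 = 1
      rw [mul_pow, hs, ht, one_mul]
  have htr : ∀ k : SL(2, ℝ), (k : Matrix (Fin 2) (Fin 2) ℝ).trace = trc k := fun k => by
    rw [Matrix.trace_fin_two]; rfl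
  obtain ⟨X, X1, X2, X3, X4, X5⟩ := exists_reflections (g 0).2 (g 1).2 (by
    rw [← Matrix.SpecialLinearGroup.coe_mul, htr, htr, htr, h01]
    change 0 < disc (x 0) (x 1) (x 2)
    have := hlt 0
    unfold disc; nlinarith [sq_nonneg (x 1), sq_nonneg (x 2)]) hs ht
  have hX : ∀ i, X i * X (i + 1) = S i • (g i : Matrix (Fin 2) (Fin 2) ℝ) := by
    intro i
    fin_cases i
    · exact X3
    · exact X4
    · have : (g 2 : Matrix (Fin 2) (Fin 2) ℝ) = ((g 0 : Matrix (Fin 2) (Fin 2) ℝ) * g 1).adjugate := by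
        rw [← Matrix.SpecialLinearGroup.coe_mul, ← Matrix.SpecialLinearGroup.coe_inv]
        simp only [hg]
        rw [← map_mul, ← map_inv]; rfl
      change X 2 * X 0 = (s * t) • (g 2 : Matrix (Fin 2) (Fin 2) ℝ)
      rw [X5, this]
  clear X3 X4 X5
  -- Negating all three reflections preserves their products and changes the sign of `mtri`.
  obtain ⟨X, X1, X2, hX, hM⟩ : ∃ X : Fin 3 → Matrix (Fin 2) (Fin 2) ℝ, (∀ i, X i 1 1 = -X i 0 0) ∧
      (∀ i, X i 0 0 ^ 2 + X i 0 1 * X i 1 0 = 1) ∧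
      (∀ i, X i * X (i + 1) = S i • (g i : Matrix (Fin 2) (Fin 2) ℝ)) ∧
      0 ≤ mtri (X 0) (X 1) (X 2) * -σ := by
    by_cases h : 0 ≤ mtri (X 0) (X 1) (X 2) * -σ
    · exact ⟨X, X1, X2, hX, h⟩
    · refine ⟨fun i => -X i, fun i => by simp [X1], fun i => by simpa using X2 i, fun i => ?_, ?_⟩
      · rw [neg_mul_neg]; exact hX i
      · rw [mtri_neg]; linarith
  have hMi : ∀ i, mtri (X i) (X (i + 1)) (X (i + 2)) = mtri (X 0) (X 1) (X 2) := by
    intro i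
    fin_cases i
    · rfl
    · change mtri (X 1) (X 2) (X 0) = _
      rw [← mtri_cyc]
    · change mtri (X 2) (X 0) (X 1) = _
      rw [mtri_cyc]
  have hmact : ∀ i v, mact (X i) (mact (X (i + 1)) v) = S i • act (g i) v := fun i v => by
    rw [← mact_mul, hX, smul_mact, act_eq_mact]
  have hnn : ∀ v, Ideal P.hol v → ∀ i, 0 ≤ br v (mact (X (i + 1)) (mact (X (i + 2)) v)) /
      mtri (X i) (X (i + 1)) (X (i + 2)) := fun v hv i => by
    have h1 : i + 2 = i + 1 + 1 := by rw [add_assoc]; rfl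
    rw [hMi, h1, hmact, br_smul_right]
    have hσ' : -σ ≠ 0 := by
      intro h; have : σ = 0 := by linarith
      rw [this] at hσ; norm_num at hσ
    rw [← mul_div_mul_right _ _ hσ']
    refine div_nonneg ?_ hM
    obtain ⟨hS1, hS2⟩ := hSx (i + 1)
    have h3 := hside' v hv (i + 1)
    have h4 : 0 < x (i + 1) ^ 2 := by have := hlt (i + 1); linarith
    nlinarith [mul_nonneg h3 (neg_pos.2 hS2).le]
  have hpos1 : ∀ i, 1 < mpair (X i) (X (i + 1)) := fun i => by
    rw [mpair_eq (X1 _) (X1 _), hX, Matrix.trace_smul, htr, smul_eq_mul]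
    exact one_lt_of_sign (hSx i).1 (hSx i).2 (hlt i)
  refine ⟨⟨X, X1, X2, ?_, e 0, ?_, hnn _ (he 0)⟩, ⟨fun i => ⟨S i, ?_, fun v => ?_⟩, hnn⟩⟩
  · intro i j hij
    fin_cases i <;> fin_cases j
    · exact absurd rfl hij
    · exact hpos1 0
    · rw [mpair_comm]; exact hpos1 2
    · rw [mpair_comm]; exact hpos1 0
    · exact absurd rfl hij
    · exact hpos1 1
    · exact hpos1 2
    · rw [mpair_comm]; exact hpos1 1
    · exact absurd rfl hij
  · intro h
    have := (hE 0).br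
    rw [h] at this; simp [br] at this
  · intro h; have := (hSx i).1; rw [h] at this; norm_num at this
  · change act (g i) v = S i • mact (X i) (mact (X (i + 1)) v)
    rw [hmact, smul_smul, ← sq, (hSx i).1, one_smul]

end HyperbolicPants

lemma geo_congr {u u' v v' : V2} (hu : u ≠ 0) (hu' : u' ≠ 0) (hv : v ≠ 0) (hv' : v' ≠ 0)
    (h : br u u' = 0) (h' : br v v' = 0) : geo u v = geo u' v' := by
  obtain ⟨k, hk, rfl⟩ := exists_ne_zero_smul_of_br_eq_zero hu hu' h
  obtain ⟨l, hl, rfl⟩ := exists_ne_zero_smul_of_br_eq_zero hv hv' h'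
  rw [geo_smul_left hk, geo_smul_right hl]

/-! ### The dictionary between words and holonomy -/

namespace Hex

variable {H : Hex}

/-- The word `w` acts projectively as the matrix `g`. -/
def Rep (H : Hex) (w : List (Fin 3)) (g : SL(2, ℝ)) : Prop :=
  ∃ s : ℝ, s ≠ 0 ∧ ∀ v, act g v = s • H.run w v

lemma Rep.one : H.Rep [] 1 := ⟨1, one_ne_zero, fun v => by simp⟩

lemma Rep.mul {w w' : List (Fin 3)} {g g' : SL(2, ℝ)} (h : H.Rep w g) (h' : H.Rep w' g') :
    H.Rep (w ++ w') (g' * g) := by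
  obtain ⟨s, hs, e⟩ := h
  obtain ⟨s', hs', e'⟩ := h'
  refine ⟨s' * s, mul_ne_zero hs' hs, fun v => ?_⟩
  rw [act_mul, e, e', run_append, run_smul, smul_smul]

lemma Rep.inv {w : List (Fin 3)} {g : SL(2, ℝ)} (h : H.Rep w g) : H.Rep w.reverse g⁻¹ := by
  obtain ⟨s, hs, e⟩ := h
  refine ⟨s⁻¹, inv_ne_zero hs, fun v => ?_⟩
  have : v = act g (s⁻¹ • H.run w.reverse v) := by
    rw [e, run_smul, run_run_reverse, smul_smul, mul_inv_cancel₀ hs, one_smul]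
  conv_lhs => rw [this]
  rw [act_inv_act]

lemma Rep.congr {w w' : List (Fin 3)} {g : SL(2, ℝ)} (h : H.Rep w g)
    (hw : ∀ v, H.run w' v = H.run w v) : H.Rep w' g := by
  obtain ⟨s, hs, e⟩ := h
  exact ⟨s, hs, fun v => by rw [e, hw]⟩

lemma Rep.image_geo {w : List (Fin 3)} {g : SL(2, ℝ)} (h : H.Rep w g) (u v : V2) :
    (fun z => g • z) '' geo u v = geo (H.run w u) (H.run w v) := by
  obtain ⟨s, hs, e⟩ := h
  rw [PantsLamination.image_geo, e, e, geo_smul_left hs, geo_smul_right hs]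

lemma rep_pair_self (i : Fin 3) : H.Rep [i, i] 1 :=
  Hex.Rep.one.congr fun v => by simp [H.xa_xa]

/-- Words in some letters of even length are products of words of length two. -/
lemma exists_rep_of_pairs {L : Fin 3 → Prop} {S : Subgroup SL(2, ℝ)}
    (hL : ∀ i j, L i → L j → ∃ g ∈ S, H.Rep [i, j] g) :
    ∀ w : List (Fin 3), Even w.length → (∀ l ∈ w, L l) → ∃ g ∈ S, H.Rep w g
  | [], _, _ => ⟨1, S.one_mem, Rep.one⟩
  | [_], h, _ => absurd h (by simp)
  | i :: j :: w, h, hl => by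
    obtain ⟨g, hg, hr⟩ := hL i j (hl i (by simp)) (hl j (by simp))
    obtain ⟨g', hg', hr'⟩ := exists_rep_of_pairs hL w
      (by simpa [Nat.even_add_one] using h) fun l h => hl l (by simp [h])
    exact ⟨g' * g, S.mul_mem hg' hg, hr.mul hr'⟩

end Hex

namespace HyperbolicPants

variable {P : HyperbolicPants} {H : Hex}

namespace IsHex

lemma rep_peripheral (hH : P.IsHex H) (i : Fin 3) : H.Rep [i + 1, i] (P.hol (PantsLamination.peripheral i)) :=
  hH.peripheral i

lemma exists_word (hH : P.IsHex H) (g : FreeGroup (Fin 2)) :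
    ∃ w : List (Fin 3), Even w.length ∧ H.Rep w (P.hol g) := by
  have hof : ∀ i : Fin 2, ∃ w : List (Fin 3), Even w.length ∧ H.Rep w (P.hol (FreeGroup.of i)) := by
    intro i
    fin_cases i
    · exact ⟨_, ⟨1, rfl⟩, hH.rep_peripheral 0⟩
    · exact ⟨_, ⟨1, rfl⟩, hH.rep_peripheral 1⟩
  refine FreeGroup.induction_on g ?_ hof ?_ ?_
  · exact ⟨[], by simp, by rw [map_one]; exact Hex.Rep.one⟩
  · rintro i ⟨w, h1, h2⟩
    exact ⟨w.reverse, by simpa using h1, by rw [map_inv]; exact h2.inv⟩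
  · rintro g g' ⟨w, h1, h2⟩ ⟨w', h1', h2'⟩
    exact ⟨w' ++ w, by simpa using h1'.add h1, by rw [map_mul]; exact h2'.mul h2⟩

lemma exists_rep (hH : P.IsHex H) {w : List (Fin 3)} (hw : Even w.length) : ∃ g, H.Rep w (P.hol g) := by
  have hp : ∀ i j : Fin 3, True → True → ∃ g ∈ P.hol.range, H.Rep [i, j] g := by
    intro i j _ _
    rcases (by decide : ∀ i j : Fin 3, i = j ∨ i = j + 1 ∨ j = i + 1) i j with rfl | rfl | rfl
    · exact ⟨1, P.hol.range.one_mem, Hex.rep_pair_self i⟩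
    · exact ⟨_, ⟨_, rfl⟩, hH.rep_peripheral j⟩
    · exact ⟨_, P.hol.range.inv_mem ⟨_, rfl⟩, (hH.rep_peripheral i).inv⟩
  obtain ⟨_, ⟨g, rfl⟩, hg⟩ := Hex.exists_rep_of_pairs hp w hw fun _ _ => trivial
  exact ⟨g, hg⟩

/-- Words in the two seams orthogonal to the `i`-th axis, taken two letters at a time, are powers of
the boundary translation. -/
lemma exists_zpow (hH : P.IsHex H) {i : Fin 3} {w : List (Fin 3)} (hw : Even w.length) (hl : ∀ l ∈ w, l ≠ i + 2) :
    ∃ n : ℤ, H.Rep w (P.hol (PantsLamination.peripheral i ^ n)) := by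
  have hp : ∀ k l : Fin 3, k ≠ i + 2 → l ≠ i + 2 →
      ∃ g ∈ Subgroup.zpowers (P.hol (PantsLamination.peripheral i)), H.Rep [k, l] g := by
    intro k l hk hl
    rcases (by decide : ∀ i k l : Fin 3, k ≠ i + 2 → l ≠ i + 2 →
      k = l ∨ (k = i + 1 ∧ l = i) ∨ (k = i ∧ l = i + 1)) i k l hk hl with
      rfl | ⟨rfl, rfl⟩ | ⟨rfl, rfl⟩
    · exact ⟨1, Subgroup.one_mem _, Hex.rep_pair_self k⟩
    · exact ⟨_, Subgroup.mem_zpowers _, hH.rep_peripheral l⟩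
    · exact ⟨_, Subgroup.inv_mem _ (Subgroup.mem_zpowers _), (hH.rep_peripheral k).inv⟩
  obtain ⟨_, ⟨n, rfl⟩, hg⟩ := Hex.exists_rep_of_pairs hp w hw hl
  exact ⟨n, by rw [map_zpow]; exact hg⟩

lemma th_eq_zero_iff (hH : P.IsHex H) (i : Fin 3) (v : V2) :
    H.th (i + 2) v = 0 ↔ br v (act (P.hol (PantsLamination.peripheral i)) v) = 0 := by
  obtain ⟨s, hs, e⟩ := hH.peripheral i
  have := H.th_mul (Dist.cyc i).rot.rot v
  rw [e, br_smul_right, mul_eq_zero, or_iff_right hs, ← this, mul_eq_zero,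
    or_iff_left (H.mtri_ne_zero (Dist.cyc i).rot.rot)]

/-- Words of even length come from the holonomy, which preserves ideal points of the core. For a
word of odd length, one further letter different from `k` does not affect the coordinate `th k`. -/
lemma K_of_ideal (hH : P.IsHex H) {v : V2} (hv : v ≠ 0) (h : Ideal P.hol v) : H.K v := by
  have even : ∀ w : List (Fin 3), Even w.length → ∀ k, 0 ≤ H.th k (H.run w v) := by
    intro w hw k
    obtain ⟨g, s, hs, e⟩ := hH.exists_rep hw
    have := hH.th_nonneg _ (h.act g) k
    rw [e, H.th_smul] at this
    exact nonneg_of_mul_nonneg_right this (by positivity)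
  refine ⟨hv, fun w k => ?_⟩
  by_cases hw : Even w.length
  · exact even w hw k
  · have := even (w ++ [k + 1]) (by simp [Nat.even_add_one, hw]) k
    rw [H.run_append, H.run_cons, H.run_nil, H.th_xa_ne ((by decide : ∀ k : Fin 3, k + 1 ≠ k) k)] at this
    exact this

lemma hasEnds (hH : P.IsHex H) : H.HasEnds := by
  intro k
  obtain ⟨e, e', l, ε, hE, -, -, he, -⟩ := P.exists_eig (k + 1)
  have h0 : e ≠ 0 := by
    rintro rfl
    have := hE.br
    simp [br] at this
  refine ⟨e, hH.K_of_ideal h0 he, ?_⟩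
  have := (hH.th_eq_zero_iff (k + 1) e).2 (by rw [hE.left, br_smul_right, br_self, mul_zero])
  rwa [(by decide : ∀ k : Fin 3, k + 1 + 2 = k) k] at this

end IsHex

end HyperbolicPants

lemma Ideal.congr {ρ : FreeGroup (Fin 2) →* SL(2, ℝ)} {u v : V2} (h : Ideal ρ u) (hu : u ≠ 0)
    (hv : v ≠ 0) (huv : br u v = 0) : Ideal ρ v := by
  obtain ⟨k, hk, rfl⟩ := exists_ne_zero_smul_of_br_eq_zero hu hv huv
  obtain ⟨u', h1, h2⟩ := h
  exact ⟨u', by rw [br_smul_left]; exact mul_ne_zero hk h1, by rwa [geo_smul_left hk]⟩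

lemma Eig.br_eq_zero {g : SL(2, ℝ)} {e e' v : V2} {l : ℝ} (E : Eig g e e' l) (hl : l ^ 2 ≠ 1)
    (h : PantsLamination.br v (act g v) = 0) :
    PantsLamination.br e v = 0 ∨ PantsLamination.br e' v = 0 := by
  rw [E.br_act, mul_eq_zero, mul_eq_zero] at h
  refine h.resolve_left fun h0 => hl ?_
  have := E.ne
  field_simp at h0
  linarith

lemma smul_eq_of_act_eq {g : SL(2, ℝ)} {c : ℝ} (h : ∀ v, act g v = c • v) (z : ℍ) : g • z = z := by
  have h1 := h e1
  have h2 := h e2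
  have a := congrFun h1 0
  have b := congrFun h1 1
  have d := congrFun h2 0
  have e := congrFun h2 1
  simp at a b d e
  have hd := g.2
  rw [Matrix.det_fin_two, a, b, d, e] at hd
  have hc : c ^ 2 = 1 := by linarith
  have hdn : dn g z = 1 := by unfold dn; rw [b, e, ← hc]; ring
  apply ext_re_im
  · rw [sl_re, hdn, a, b, d, e]
    linear_combination z.re * hc
  · rw [sl_im, hdn, div_one]

/-! ### The six candidate leaves, and why there are no others -/

namespace HyperbolicPants

variable (P : HyperbolicPants)

/-- A system of reflections for `P` with a choice of the ends of the boundary axes. -/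
structure Model where
  H : Hex
  hex : P.IsHex H
  F : H.Frame

lemma exists_model : Nonempty P.Model := by
  obtain ⟨H, hH⟩ := P.exists_hex
  obtain ⟨F⟩ := hH.hasEnds.exists_frame
  exact ⟨⟨H, hH, F⟩⟩

namespace Model

variable {P} (M : P.Model)

lemma en_ne_zero (s : Bool) (i : Fin 3) : M.F.en s i ≠ 0 := (M.F.K s i).1

lemma br_en_ne_zero (i : Fin 3) (s : Bool) : br (M.F.en s i) (M.F.en (!s) i) ≠ 0 := fun h => by
  have := (M.F.stab (w := []) h).2.1
  cases s <;> simp at this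

lemma rep_unique {w : List (Fin 3)} {g g' : FreeGroup (Fin 2)} (h : M.H.Rep w (P.hol g))
    (h' : M.H.Rep w (P.hol g')) : g = g' := by
  obtain ⟨s, hs, e⟩ := h
  obtain ⟨s', hs', e'⟩ := h'
  refine inv_mul_eq_one.1 (P.faithful (g⁻¹ * g') fun z =>
    smul_eq_of_act_eq (c := s' * s⁻¹) (fun v => ?_) z)
  rw [map_mul, map_inv, act_mul]
  have : act (P.hol g') v = (s' * s⁻¹) • act (P.hol g) v := by
    rw [e, e', smul_smul, mul_assoc, inv_mul_cancel₀ hs, mul_one]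
  rw [this, act_smul, act_inv_act]

lemma th_en_of_br {g : SL(2, ℝ)} {e e' : V2} {l : ℝ} {i : Fin 3}
    (hg : g = P.hol (peripheral i)) (E : Eig g e e' l) :
    M.H.th (i + 2) e = 0 ∧ M.H.th (i + 2) e' = 0 := by
  subst hg
  rw [M.hex.th_eq_zero_iff, M.hex.th_eq_zero_iff, E.left, E.right, br_smul_right, br_smul_right,
    br_self, br_self]
  simp

lemma exists_en {g : SL(2, ℝ)} {e e' : V2} {l : ℝ} {i : Fin 3} (hg : g = P.hol (peripheral i))
    (E : Eig g e e' l) (he : Ideal P.hol e) (he' : Ideal P.hol e') :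
    ∃ s, br e (M.F.en s i) = 0 ∧ br e' (M.F.en (!s) i) = 0 := by
  have hne : br e e' ≠ 0 := by rw [E.br]; exact one_ne_zero
  have e0 := left_ne_zero_of_br hne
  have e0' := right_ne_zero_of_br hne
  obtain ⟨t, t'⟩ := M.th_en_of_br hg E
  obtain ⟨s, hs⟩ := M.F.eq_of_th (M.hex.K_of_ideal e0 he) t
  obtain ⟨s', hs'⟩ := M.F.eq_of_th (M.hex.K_of_ideal e0' he') t'
  refine ⟨s, hs, ?_⟩
  rcases (by decide : ∀ s s' : Bool, s' = s ∨ s' = !s) s s' with rfl | rfl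
  · exact absurd (br_eq_zero_trans (M.en_ne_zero s' i) hs (by rw [br_anticomm, hs', neg_zero])) hne
  · exact hs'

lemma axis_aux (i : Fin 3) : (∀ s, Ideal P.hol (M.F.en s i)) ∧
    geo (M.F.en true i) (M.F.en false i) ⊆ frontier (convexCore P.hol) := by
  obtain ⟨e, e', l, ε, E, -, -, he, he', hf, -⟩ := P.exists_eig i
  obtain ⟨s, h1, h2⟩ := M.exists_en rfl E he he'
  have hne : br e e' ≠ 0 := by rw [E.br]; exact one_ne_zero
  have e0 := left_ne_zero_of_br hne
  have e0' := right_ne_zero_of_br hne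
  have i1 := he.congr e0 (M.en_ne_zero s i) h1
  have i2 := he'.congr e0' (M.en_ne_zero _ i) h2
  rw [geo_congr e0 (M.en_ne_zero s i) e0' (M.en_ne_zero _ i) h1 h2] at hf
  cases s
  · exact ⟨fun t => by cases t <;> assumption, by rw [geo_comm]; exact hf⟩
  · exact ⟨fun t => by cases t <;> assumption, hf⟩

lemma ideal_en (s : Bool) (i : Fin 3) : Ideal P.hol (M.F.en s i) := (M.axis_aux i).1 s

lemma axis_subset_frontier (i : Fin 3) :
    geo (M.F.en true i) (M.F.en false i) ⊆ frontier (convexCore P.hol) := (M.axis_aux i).2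

/-- A peripheral element has only two fixed ideal points, so every parametrized axis has the ends of
the frame; `s` is the end towards which the given parametrization points. -/
lemma exists_of_isAxis {i : Fin 3} {α : ℝ → ℍ} (hα : IsAxis (P.hol (peripheral i)) α) :
    ∃ (k : SL(2, ℝ)) (l : ℝ) (s : Bool), l ^ 2 ≠ 1 ∧ (∀ t, α t = k • iexp t) ∧
      Eig (P.hol (peripheral i)) (act k e1) (act k e2) l ∧
      br (act k e1) (M.F.en s i) = 0 ∧ br (act k e2) (M.F.en (!s) i) = 0 ∧
      range α = geo (M.F.en true i) (M.F.en false i) := by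
  obtain ⟨k, l, hl, hk, E, hr⟩ := eig_of_isAxis hα
  obtain ⟨f, f', l', -, E', hl', -, hf, hf', -, -⟩ := P.exists_eig i
  have hne : br (act k e1) (act k e2) ≠ 0 := by rw [E.br]; exact one_ne_zero
  have hne' : br f f' ≠ 0 := by rw [E'.br]; exact one_ne_zero
  have key : ∀ v : V2, v ≠ 0 → br v (act (P.hol (peripheral i)) v) = 0 → Ideal P.hol v := by
    intro v hv h
    rcases E'.br_eq_zero hl' h with h | h
    · exact hf.congr (left_ne_zero_of_br hne') hv h
    · exact hf'.congr (right_ne_zero_of_br hne') hv h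
  have u0 := left_ne_zero_of_br hne
  have u0' := right_ne_zero_of_br hne
  obtain ⟨s, h1, h2⟩ := M.exists_en rfl E
    (key _ u0 (by rw [E.left, br_smul_right, br_self, mul_zero]))
    (key _ u0' (by rw [E.right, br_smul_right, br_self, mul_zero]))
  refine ⟨k, l, s, hl, hk, E, h1, h2, ?_⟩
  rw [hr, geo_congr u0 (M.en_ne_zero s i) u0' (M.en_ne_zero _ i) h1 h2]
  cases s
  · exact geo_comm _ _
  · rfl

/-- The stabilizer of an end of a boundary axis is generated by the translation along this axis. -/
lemma act_en {g : FreeGroup (Fin 2)} {s s' : Bool} {i i' : Fin 3}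
    (h : br (act (P.hol g) (M.F.en s i)) (M.F.en s' i') = 0) :
    i = i' ∧ s = s' ∧ ∃ n : ℤ, g = peripheral i ^ n := by
  obtain ⟨w, hw, hr⟩ := M.hex.exists_word g
  obtain ⟨w', hc, hr', he⟩ := M.H.exists_reduced w
  have hrep := hr.congr hr'
  obtain ⟨c, hc0, e⟩ := hrep
  rw [e, br_smul_left, mul_eq_zero, or_iff_right hc0] at h
  obtain ⟨rfl, h2, -⟩ := M.F.stab h
  have hw' := he.2 hw
  have hl := (Hex.stab_of_chain hc (Hex.Frame.dist_hd s i) (Hex.Frame.dist_hd s' i) (M.F.K _ _) (M.F.K _ _)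
    (M.F.th _ _) (M.F.th _ _) (M.F.nf_hd _ _) (M.F.nf_hd _ _) h).2.2
  obtain ⟨n, hn⟩ := M.hex.exists_zpow hw' hl
  exact ⟨rfl, h2.1 hw', n, M.rep_unique (hr.congr hr') hn⟩

/-- The reflected vector still has coordinate zero, hence is an end of the same axis, and `stab` for
a word of odd length says that it is the other one. -/
lemma br_xa_en (s : Bool) (i l : Fin 3) (hl : l ≠ i + 2) :
    br (M.H.xa l (M.F.en s i)) (M.F.en (!s) i) = 0 := by
  obtain ⟨s', h⟩ := M.F.eq_of_th ((M.F.K s i).xa l) (by rw [M.H.th_xa_ne hl, M.F.th])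
  have h2 := (M.F.stab (w := [l]) h).2.1
  rcases (by decide : ∀ s s' : Bool, s' = s ∨ s' = !s) s s' with rfl | rfl
  · simp at h2
  · exact h

/-- The chosen end of the `i`-th axis. -/
def p (ε : Fin 3 → Bool) (i : Fin 3) : V2 := M.F.en (ε i) i

/-- The second endpoint of the leaves of the two kinds. -/
def tip (ε : Fin 3 → Bool) (b : Bool) (i : Fin 3) : V2 :=
  if b then act (P.hol (peripheral (i + 2))) (M.p ε i) else M.p ε (i + 1)

/-- The leaves of the first kind join two boundary components, those of the second kind have both
ends at the same boundary component. -/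
def base (ε : Fin 3 → Bool) (b : Bool) (i : Fin 3) : Set ℍ := geo (M.p ε i) (M.tip ε b i)

lemma ideal_p (ε : Fin 3 → Bool) (i : Fin 3) : Ideal P.hol (M.p ε i) := M.ideal_en _ _

lemma p_ne_zero (ε : Fin 3 → Bool) (i : Fin 3) : M.p ε i ≠ 0 := M.en_ne_zero _ _

lemma ideal_tip (ε : Fin 3 → Bool) (b : Bool) (i : Fin 3) : Ideal P.hol (M.tip ε b i) := by
  cases b
  · exact M.ideal_p ε (i + 1)
  · exact (M.ideal_p ε i).act _

lemma act_ne_zero_of_ne (g : SL(2, ℝ)) {v : V2} (hv : v ≠ 0) : act g v ≠ 0 := fun h => hv <| by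
  rw [← act_inv_act g v, h]; ext i; fin_cases i <;> simp [act]

lemma tip_ne_zero (ε : Fin 3 → Bool) (b : Bool) (i : Fin 3) : M.tip ε b i ≠ 0 := by
  cases b
  · exact M.p_ne_zero ε (i + 1)
  · exact act_ne_zero_of_ne _ (M.p_ne_zero ε i)

lemma vert_nil (ε : Fin 3 → Bool) (i : Fin 3) : M.F.vert ε [] i = M.p ε i := by
  simp [Hex.Frame.vert, p]

/-- The word whose vertex is the second endpoint. -/
def tw (b : Bool) (i : Fin 3) : List (Fin 3) × Fin 3 := if b then ([i + 2], i) else ([], i + 1)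

/-- The peripheral element `i + 2` is the product of the reflections `i + 2` and `i`; the reflection
`i` exchanges the ends of the `i`-th axis, which is the switch built into `vert` for odd words. -/
lemma br_tip (ε : Fin 3 → Bool) (b : Bool) (i : Fin 3) :
    br (M.tip ε b i) (M.F.vert ε (tw b i).1 (tw b i).2) = 0 := by
  cases b
  · change br (M.p ε (i + 1)) (M.F.vert ε [] (i + 1)) = 0
    rw [vert_nil, br_self]
  · obtain ⟨s, hs, e⟩ := M.hex.peripheral (i + 2)
    change br (act (P.hol (peripheral (i + 2))) (M.p ε i)) (M.F.vert ε [i + 2] i) = 0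
    rw [e, br_smul_left, (by decide : ∀ i : Fin 3, i + 2 + 1 = i) i]
    have : M.F.vert ε [i + 2] i = M.H.xa (i + 2) (M.F.en (!(ε i)) i) := by simp [Hex.Frame.vert]
    rw [this, M.H.br_xa, p, M.br_xa_en _ _ _ ((by decide : ∀ i : Fin 3, i ≠ i + 2) i)]
    simp

lemma cr_congr {u u' v v' a a' b b' : V2} (hu : u ≠ 0) (hu' : u' ≠ 0) (hv : v ≠ 0) (hv' : v' ≠ 0)
    (ha : a ≠ 0) (ha' : a' ≠ 0) (hb : b ≠ 0) (hb' : b' ≠ 0)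
    (e1 : br u u' = 0) (e2 : br v v' = 0) (e3 : br a a' = 0) (e4 : br b b' = 0) :
    ∃ c : ℝ, 0 < c ∧ cr u' v' a' b' = c * cr u v a b := by
  obtain ⟨k1, h1, rfl⟩ := exists_ne_zero_smul_of_br_eq_zero hu hu' e1
  obtain ⟨k2, h2, rfl⟩ := exists_ne_zero_smul_of_br_eq_zero hv hv' e2
  obtain ⟨k3, h3, rfl⟩ := exists_ne_zero_smul_of_br_eq_zero ha ha' e3
  obtain ⟨k4, h4, rfl⟩ := exists_ne_zero_smul_of_br_eq_zero hb hb' e4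
  refine ⟨(k1 * k2 * k3 * k4) ^ 2, by positivity, ?_⟩
  simp only [cr, br_smul_left, br_smul_right]; ring

lemma vert_ne_zero (ε : Fin 3 → Bool) (w : List (Fin 3)) (i : Fin 3) : M.F.vert ε w i ≠ 0 :=
  (M.F.vert_K ε w i).1

lemma br_base_ne_zero (ε : Fin 3 → Bool) (b : Bool) (i : Fin 3) :
    br (M.p ε i) (M.tip ε b i) ≠ 0 := by
  cases b
  · intro h
    exact (by decide : ∀ i : Fin 3, i ≠ i + 1) i (M.F.stab (w := []) h).1
  · intro h
    refine br_ne_zero_of_cr_neg (M.F.cr_SE_neg ε i) ?_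
    rw [vert_nil]
    exact br_eq_zero_trans (M.tip_ne_zero ε true i) h (M.br_tip ε true i)

/-- Leaves do not cross unless they are of complementary types. -/
def Compat : Bool → Fin 3 → Bool → Fin 3 → Prop
  | false, _, false, _ => True
  | true, i, false, j => j ≠ i + 1
  | false, i, true, j => i ≠ j + 1
  | true, i, true, j => i = j

/-- Transfers noncrossing from arcs between gap points to leaves. -/
lemma cr_word_nonneg (ε : Fin 3 → Bool) {b b' : Bool} {i j : Fin 3} {w : List (Fin 3)} (hw : Even w.length)
    (hx : 0 ≤ cr (M.F.x i) (M.H.run (tw b i).1 (M.F.x (tw b i).2)) (M.H.run w (M.F.x j))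
      (M.H.run w (M.H.run (tw b' j).1 (M.F.x (tw b' j).2)))) :
    0 ≤ cr (M.p ε i) (M.tip ε b i) (M.H.run w (M.p ε j)) (M.H.run w (M.tip ε b' j)) := by
  rw [← M.H.run_append] at hx
  have h1 := M.F.cr_vert_nonneg ε (w₁ := []) (w₃ := w) hx
  rw [M.F.vert_append ε hw, vert_nil, (by rfl : w = [] ++ w), M.F.vert_append ε hw, vert_nil] at h1
  obtain ⟨c, hc, e⟩ := cr_congr (M.p_ne_zero ε i) (M.p_ne_zero ε i) (M.tip_ne_zero ε b i)
    (M.vert_ne_zero ε _ _) (M.H.run_ne_zero w (M.p_ne_zero ε j)) (M.H.run_ne_zero w (M.p_ne_zero ε j))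
    (M.H.run_ne_zero w (M.tip_ne_zero ε b' j)) (M.H.run_ne_zero w (M.vert_ne_zero ε _ _))
    (br_self _) (M.br_tip ε b i) (br_self _) (by rw [M.H.br_run, M.br_tip, mul_zero])
  rw [List.nil_append] at h1
  rw [e] at h1
  exact nonneg_of_mul_nonneg_right h1 hc

lemma cr_rep {w : List (Fin 3)} {g : SL(2, ℝ)} (h : M.H.Rep w g) (u v u' v' : V2) :
    ∃ c : ℝ, 0 < c ∧ cr u v (act g u') (act g v') = c * cr u v (M.H.run w u') (M.H.run w v') := by
  obtain ⟨s, hs, e⟩ := h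
  refine ⟨s ^ 4, by positivity, ?_⟩
  simp only [e, cr, br_smul_right]; ring

/-- The three cases are `cr_EE`, `cr_SE` and `cr_SS`; the case of an edge against a self-arc is
reversed by means of the inverse element. -/
lemma cr_base_nonneg (ε : Fin 3 → Bool) {b b' : Bool} {i j : Fin 3} (h : Compat b i b' j)
    (g : FreeGroup (Fin 2)) :
    0 ≤ cr (M.p ε i) (M.tip ε b i) (act (P.hol g) (M.p ε j)) (act (P.hol g) (M.tip ε b' j)) := by
  have red : ∀ {b b' : Bool} {i j : Fin 3}, Compat b i b' j → (b = false → b' = false) →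
      ∀ g : FreeGroup (Fin 2), 0 ≤ cr (M.p ε i) (M.tip ε b i) (act (P.hol g) (M.p ε j))
        (act (P.hol g) (M.tip ε b' j)) := by
    intro b b' i j h hb g
    obtain ⟨w, hw, hr⟩ := M.hex.exists_word g
    obtain ⟨c, hc, e⟩ := M.cr_rep hr (M.p ε i) (M.tip ε b i) (M.p ε j) (M.tip ε b' j)
    rw [e]
    refine mul_nonneg hc.le (M.cr_word_nonneg ε hw ?_)
    cases b <;> cases b'
    · exact M.F.cr_EE w i j
    · simp at hb
    · exact M.F.cr_SE w i j ((by decide : ∀ i j : Fin 3, j ≠ i + 1 → i = j ∨ i = j + 1) i j h)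
    · obtain rfl : i = j := h
      exact M.F.cr_SS w i
  by_cases hb : b = false → b' = false
  · exact red h hb g
  · have h' : b = false ∧ b' = true := by cases b <;> cases b' <;> simp_all
    obtain ⟨rfl, rfl⟩ := h'
    have := red (b := true) (b' := false) (i := j) (j := i) h (by simp) g⁻¹
    rw [cr_comm, ← cr_act (P.hol g⁻¹)]
    rw [map_inv] at this ⊢
    rwa [act_inv_act, act_inv_act]

lemma base_disjoint (ε : Fin 3 → Bool) {b b' : Bool} {i j : Fin 3} (h : Compat b i b' j)
    (g : FreeGroup (Fin 2)) (hne : M.base ε b i ≠ (fun z => P.hol g • z) '' M.base ε b' j) :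
    Disjoint (M.base ε b i) ((fun z => P.hol g • z) '' M.base ε b' j) := by
  rw [Set.disjoint_left]
  intro z hz hz'
  unfold base at *
  rw [image_geo] at hz' hne
  rcases cr_of_mem (M.br_base_ne_zero ε b i) (by rw [br_act]; exact M.br_base_ne_zero ε b' j) hz hz'
    with h' | h'
  · exact absurd (M.cr_base_nonneg ε h g) (not_le.2 h')
  · exact hne h'

lemma cr_base_neg_aux (ε : Fin 3 → Bool) (i : Fin 3) :
    cr (M.p ε i) (M.tip ε true i) (M.p ε (i + 1)) (M.p ε (i + 2)) < 0 ∧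
    cr (M.p ε i) (M.tip ε true i) (M.p ε (i + 1)) (M.tip ε true (i + 1)) < 0 := by
  have key : ∀ {u v a b u' v' a' b' : V2}, u ≠ 0 → u' ≠ 0 → v ≠ 0 → v' ≠ 0 → a ≠ 0 → a' ≠ 0 →
      b ≠ 0 → b' ≠ 0 → br u u' = 0 → br v v' = 0 → br a a' = 0 → br b b' = 0 →
      cr u' v' a' b' < 0 → cr u v a b < 0 := by
    intro u v a b u' v' a' b' h1 h2 h3 h4 h5 h6 h7 h8 e1 e2 e3 e4 h
    obtain ⟨c, hc, e⟩ := cr_congr h1 h2 h3 h4 h5 h6 h7 h8 e1 e2 e3 e4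
    rw [e] at h
    exact neg_of_mul_neg_right h hc.le
  have t1 := M.br_tip ε true (i + 1)
  change br _ (M.F.vert ε [i + 1 + 2] (i + 1)) = 0 at t1
  rw [(by decide : ∀ i : Fin 3, i + 1 + 2 = i) i] at t1
  constructor
  · refine key (M.p_ne_zero _ _) (M.vert_ne_zero _ _ _) (M.tip_ne_zero _ _ _) (M.vert_ne_zero _ _ _)
      (M.p_ne_zero _ _) (M.vert_ne_zero _ _ _) (M.p_ne_zero _ _) (M.vert_ne_zero _ _ _) ?_
      (M.br_tip ε true i) ?_ ?_ (M.F.cr_SE_neg ε i) <;> rw [vert_nil, br_self]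
  · refine key (M.p_ne_zero _ _) (M.vert_ne_zero _ _ _) (M.tip_ne_zero _ _ _) (M.vert_ne_zero _ _ _)
      (M.p_ne_zero _ _) (M.vert_ne_zero _ _ _) (M.tip_ne_zero _ _ _) (M.vert_ne_zero _ _ _) ?_
      (M.br_tip ε true i) ?_ t1 (M.F.cr_SS_neg ε i) <;> rw [vert_nil, br_self]

lemma cr_base_neg (ε : Fin 3 → Bool) {b b' : Bool} {i j : Fin 3} (h : ¬ Compat b i b' j) :
    cr (M.p ε i) (M.tip ε b i) (M.p ε j) (M.tip ε b' j) < 0 := by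
  cases b <;> cases b'
  · exact absurd trivial h
  · obtain rfl : i = j + 1 := by simpa [Compat] using h
    rw [cr_comm]
    simpa [tip, (by decide : ∀ j : Fin 3, j + 1 + 1 = j + 2) j] using (M.cr_base_neg_aux ε j).1
  · obtain rfl : j = i + 1 := by simpa [Compat] using h
    simpa [tip, (by decide : ∀ j : Fin 3, j + 1 + 1 = j + 2) i] using (M.cr_base_neg_aux ε i).1
  · rcases (by decide : ∀ i j : Fin 3, i ≠ j → j = i + 1 ∨ i = j + 1) i j h with rfl | rfl
    · exact (M.cr_base_neg_aux ε i).2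
    · rw [cr_comm]
      exact (M.cr_base_neg_aux ε j).2

lemma base_subset_core (ε : Fin 3 → Bool) (b : Bool) (i : Fin 3) :
    M.base ε b i ⊆ convexCore P.hol :=
  (M.ideal_p ε i).geo_subset (M.ideal_tip ε b i) (M.br_base_ne_zero ε b i)

/-- Each candidate crosses another one. The ends of the latter are ideal points of the core on both
sides, so the former lies in the interior of the core. -/
lemma base_subset_cover (ε : Fin 3 → Bool) (b : Bool) (i : Fin 3) : M.base ε b i ⊆ P.cover := by
  obtain ⟨b', j, h⟩ : ∃ b' j, ¬ Compat b i b' j := by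
    cases b
    · refine ⟨true, i + 2, ?_⟩
      simp only [Compat, not_not]
      exact (by decide : ∀ i : Fin 3, i = i + 2 + 1) i
    · exact ⟨false, i + 1, by simp [Compat]⟩
  have hneg := M.cr_base_neg ε h
  obtain ⟨p', hp, hp'⟩ := M.ideal_p ε j
  obtain ⟨q', hq, hq'⟩ := M.ideal_tip ε b' j
  refine geo_subset_interior_of_ideal (geodConvex_convexCore _) (M.br_base_ne_zero ε b i) hp hq
    (M.base_subset_core ε b i) hp' hq' (lt_of_eq_of_lt ?_ hneg)
  unfold cr; ring

lemma smul_mem_cover (g : FreeGroup (Fin 2)) {z : ℍ} (hz : z ∈ P.cover) : P.hol g • z ∈ P.cover := by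
  refine smul_mem_interior_of_preimage (P.hol g) ?_
  exact interior_mono (fun w hw => smul_mem_convexCore _ g hw) hz

lemma act_p {ε ε' : Fin 3 → Bool} {g : FreeGroup (Fin 2)} {i j : Fin 3}
    (h : br (act (P.hol g) (M.p ε i)) (M.p ε' j) = 0) :
    i = j ∧ ε i = ε' j ∧ ∃ n : ℤ, g = peripheral i ^ n := M.act_en h

/-- The translates of leaves ending at a given end of an axis. -/
lemma act_tip {ε ε' : Fin 3 → Bool} {g : FreeGroup (Fin 2)} {b : Bool} {i j : Fin 3}
    (h : br (act (P.hol g) (M.tip ε b i)) (M.p ε' j) = 0) :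
    ε j = ε' j ∧ ((b = false ∧ i + 1 = j ∧ ∃ n : ℤ, g = peripheral j ^ n) ∨
      (b = true ∧ i = j ∧ ∃ n : ℤ, g = peripheral j ^ n * (peripheral (j + 2))⁻¹)) := by
  cases b
  · obtain ⟨h1, h2, h3⟩ := M.act_p (ε := ε) h
    subst h1
    exact ⟨h2, Or.inl ⟨rfl, rfl, h3⟩⟩
  · change br (act (P.hol g) (act (P.hol (peripheral (i + 2))) (M.p ε i))) (M.p ε' j) = 0 at h
    rw [← act_mul, ← map_mul] at h
    obtain ⟨h1, h2, n, h3⟩ := M.act_p h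
    subst h1
    exact ⟨h2, Or.inr ⟨rfl, rfl, n, by rw [← h3, mul_inv_cancel_right]⟩⟩

/-- Geodesics of the first kind join ends of two different axes; the others join an end of an axis
to its image under the peripheral element `m + 2`. The direction `ε` is read off from the ends and
arbitrary elsewhere. -/
lemma exists_base_of_kind {u v : V2} (hu : M.H.K u) (hv : M.H.K v) (h : M.H.Kind u v) :
    ∃ ε b i, geo u v = M.base ε b i := by
  have th' : ∀ {k : Fin 3} {v : V2}, M.H.K v → M.H.th k v = 0 →
      ∃ s, br v (M.F.en s (k + 1)) = 0 := fun {k v} hv h =>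
    M.F.eq_of_th hv (by rwa [(by decide : ∀ k : Fin 3, k + 1 + 2 = k) k])
  have one : ∀ {u v : V2} {i : Fin 3} {s s' : Bool}, M.H.K u → M.H.K v → br u (M.F.en s i) = 0 →
      br v (M.F.en s' (i + 1)) = 0 → ∃ ε b i, geo u v = M.base ε b i := by
    intro u v i s s' hu hv h h'
    refine ⟨fun j => if j = i then s else s', false, i,
      geo_congr hu.1 (M.p_ne_zero _ _) hv.1 (M.tip_ne_zero _ _ _) ?_ ?_⟩
    · simpa [p] using h
    · simpa [p, tip, (by decide : ∀ i : Fin 3, i + 1 ≠ i) i] using h'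
  have two : ∀ {u v : V2}, M.H.K u → M.H.K v → (∃ i k, i ≠ k ∧ M.H.th k v = 0 ∧
      br u (M.H.xa k (M.H.xa i v)) = 0) → ∃ ε b i, geo u v = M.base ε b i := by
    rintro u v hu hv ⟨i, k, hik, h1, h2⟩
    obtain ⟨m, rfl⟩ : ∃ m, k = m + 2 := ⟨k + 1, (by decide : ∀ k : Fin 3, k = k + 1 + 2) k⟩
    obtain ⟨s, hs⟩ := M.F.eq_of_th hv h1
    refine ⟨fun _ => s, true, m, ?_⟩
    rw [geo_comm]
    refine geo_congr hv.1 (M.p_ne_zero _ _) hu.1 (M.tip_ne_zero _ _ _) hs ?_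
    have a1 : br (M.H.xa i v) (M.H.xa i (M.F.en s m)) = 0 := by rw [M.H.br_xa, hs, neg_zero]
    have a2 := br_eq_zero_trans (M.H.xa_ne_zero i (M.en_ne_zero s m)) a1 (M.br_xa_en s m i hik)
    have a3 : br (M.H.xa (m + 2) (M.H.xa i v)) (M.H.xa (m + 2) (M.F.en (!s) m)) = 0 := by
      rw [M.H.br_xa, a2, neg_zero]
    have a4 : br (M.H.xa (m + 2) (M.F.en (!s) m)) (M.tip (fun _ => s) true m) = 0 := by
      have := M.br_tip (fun _ => s) true m
      change br _ (M.F.vert (fun _ => s) [m + 2] m) = 0 at this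
      rw [br_anticomm, neg_eq_zero]
      simpa [Hex.Frame.vert] using this
    exact br_eq_zero_trans (M.H.xa_ne_zero _ (M.H.xa_ne_zero _ hv.1)) h2
      (br_eq_zero_trans (M.H.xa_ne_zero _ (M.en_ne_zero _ _)) a3 a4)
  rcases h with ⟨i, j, hij, h1, h2⟩ | h | h
  · obtain ⟨s, hs⟩ := th' hu h1
    obtain ⟨s', hs'⟩ := th' hv h2
    rcases (by decide : ∀ i j : Fin 3, i ≠ j → j + 1 = i + 1 + 1 ∨ i + 1 = j + 1 + 1) i j hij with e | e
    · rw [e] at hs'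
      exact one hu hv hs hs'
    · rw [e] at hs
      rw [geo_comm]
      exact one hv hu hs' hs
  · exact two hu hv h
  · rw [geo_comm]
    exact two hv hu h

variable {M} in
-- Both ends are limit points because the leaf lies in the convex core, and disjointness of the
-- lifted leaves is the simplicity required for `Leaf.classify`.
lemma exists_base (Λ : P.MeasuredLamination) {ℓ : Set ℍ} (hℓ : ℓ ∈ Λ.leaves) :
    ∃ ε b i g, ℓ = (fun z => P.hol g • z) '' M.base ε b i := by
  obtain ⟨u, v, huv, rfl⟩ := (Λ.isGeodesic ℓ hℓ).exists_geo
  have hvu : br v u ≠ 0 := by rw [br_anticomm]; exact neg_ne_zero.2 huv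
  have hcore : geo u v ⊆ convexCore P.hol := (Λ.subset_cover _ hℓ).trans interior_subset
  have hu : M.H.K u := M.hex.K_of_ideal (left_ne_zero_of_br huv) ⟨v, huv, hcore⟩
  have hv : M.H.K v := M.hex.K_of_ideal (right_ne_zero_of_br huv) ⟨u, hvu, by rwa [geo_comm]⟩
  have leaf : M.H.Leaf u v := by
    refine ⟨hu, hv, huv, fun w hw => ?_⟩
    obtain ⟨g, hg⟩ := M.hex.exists_rep hw
    by_contra hcon
    have hneg := not_le.1 hcon
    have h1 := Λ.leaves_invariant g _ hℓ
    rw [hg.image_geo] at h1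
    by_cases he : geo u v = geo (M.H.run w u) (M.H.run w v)
    · rcases eq_endpoints_of_geo_eq huv he with ⟨a, -⟩ | ⟨a, -⟩ <;> simp [cr, a] at hneg
    · exact (Set.not_disjoint_iff_nonempty_inter.2 (geo_inter_of_cr_neg hneg))
        (Λ.disjoint _ hℓ _ h1 he)
  rcases leaf.classify M.hex.hasEnds with ⟨w, hw, h⟩ | ⟨w, k, hw, h1, h2⟩
  · obtain ⟨g, hg⟩ := M.hex.exists_rep hw
    obtain ⟨ε, b, i, h⟩ := M.exists_base_of_kind (hu.run w) (hv.run w) h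
    rw [← hg.image_geo] at h
    refine ⟨ε, b, i, g⁻¹, ?_⟩
    rw [← h, image_image]
    simp
  -- Both ends belong to one boundary axis, so a translate of the leaf is this axis, which lies on
  -- the frontier of the core and not in the interior.
  · exfalso
    obtain ⟨g, hg⟩ := M.hex.exists_rep hw
    have hk : k = k + 1 + 2 := (by decide : ∀ k : Fin 3, k = k + 1 + 2) k
    rw [hk] at h1 h2
    obtain ⟨s, hs⟩ := M.F.eq_of_th (hu.run w) h1
    obtain ⟨s', hs'⟩ := M.F.eq_of_th (hv.run w) h2
    have hne : br (M.H.run w u) (M.H.run w v) ≠ 0 := by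
      rw [M.H.br_run]; exact mul_ne_zero (pow_ne_zero _ (by norm_num)) huv
    have hgeo := geo_congr (hu.run w).1 (M.en_ne_zero _ _) (hv.run w).1 (M.en_ne_zero _ _) hs hs'
    have hss : s' = !s := by
      rcases (by decide : ∀ s s' : Bool, s' = s ∨ s' = !s) s s' with rfl | rfl
      · exact absurd (br_eq_zero_trans (M.en_ne_zero s' _) hs (by rw [br_anticomm, hs', neg_zero])) hne
      · rfl
    subst hss
    have hax : geo (M.F.en s (k + 1)) (M.F.en (!s) (k + 1)) ⊆ frontier (convexCore P.hol) := by
      cases s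
      · rw [geo_comm]; exact M.axis_subset_frontier _
      · exact M.axis_subset_frontier _
    have hin := Λ.subset_cover _ (Λ.leaves_invariant g _ hℓ)
    rw [hg.image_geo, hgeo] at hin
    obtain ⟨z, hz, -⟩ := exists_rep_geo (M.br_en_ne_zero (k + 1) s) one_pos one_pos
    exact (hax hz).2 (hin hz)

end Model

end HyperbolicPants

/-! ### Local finiteness -/

/-- A geodesic whose two ends are asymptotic to geodesics in a set stays close to this set outside
of a compact arc. -/
lemma exists_compact_arc {u v u' v' : V2} (huv : br u v ≠ 0) (hu : br u u' ≠ 0) (hv : br v v' ≠ 0)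
    {δ : ℝ} (hδ : 0 < δ) : ∃ C : Set ℍ, IsCompact C ∧ ∀ z ∈ geo u v, z ∉ C →
      ∃ y ∈ geo u u' ∪ geo v v', dist z y < δ := by
  obtain ⟨k, h1, h2, h3⟩ := exists_geo_eq_image huv
  have end' : ∀ {g : SL(2, ℝ)} {u u' : V2}, br u u' ≠ 0 → br u (act g e1) = 0 →
      ∃ T : ℝ, ∀ t ≥ T, ∃ y ∈ geo u u', dist (g • iexp t) y < δ := by
    intro g u u' hu h
    obtain ⟨γ, -, hr, ht⟩ := asymptoticTo_geo hu h
    obtain ⟨T, hT⟩ := eventually_atTop.1 (ht.eventually_lt_const hδ)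
    exact ⟨T, fun t ht => ⟨γ t, hr ▸ mem_range_self t, by rw [dist_comm]; exact hT t ht⟩⟩
  obtain ⟨T, hT⟩ := end' hu (by rw [h1, br_self] : br u (act k e1) = 0)
  obtain ⟨T', hT'⟩ := end' hv (g := k * rotS) (by
    rw [act_mul, act_rotS_e1, h2, br_smul_right, br_self, mul_zero])
  refine ⟨(fun t => k • iexp t) '' Icc (-T') T, isCompact_Icc.image ?_, fun z hz hzC => ?_⟩
  · exact ((isometry_smul ℍ k).comp isometry_iexp).continuous
  · rw [h3, geo_act_e] at hz
    obtain ⟨t, rfl⟩ := hz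
    have ht : ¬ (-T' ≤ t ∧ t ≤ T) := fun h => hzC ⟨t, h, rfl⟩
    rw [not_and_or, not_le, not_le] at ht
    rcases ht with ht | ht
    · obtain ⟨y, hy, h⟩ := hT' (-t) (by linarith)
      rw [← congrFun (smul_iexp_neg k) (-t), neg_neg] at h
      exact ⟨y, Or.inr hy, h⟩
    · obtain ⟨y, hy, h⟩ := hT t ht.le
      exact ⟨y, Or.inl hy, h⟩

namespace HyperbolicPants

variable (P : HyperbolicPants)

/-- A discrete subgroup acts properly discontinuously, and the holonomy is injective. -/
lemma finite_translates {C B : Set ℍ} (hC : IsCompact C) (hB : IsCompact B) :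
    {g | (((fun z => P.hol g • z) '' C) ∩ B).Nonempty}.Finite := by
  have := P.discrete
  have h := ProperlyDiscontinuousSMul.finite_disjoint_inter_image (Γ := P.hol.range) hC hB
  have hi : Function.Injective P.hol.rangeRestrict :=
    P.hol.rangeRestrict_injective_iff.2 P.hol_injective
  refine (h.preimage hi.injOn).subset fun g hg => ?_
  exact hg

namespace Model

variable {P} (M : P.Model)

lemma cover_disjoint_axis (s : Bool) (i : Fin 3) :
    ∀ z ∈ geo (M.F.en s i) (M.F.en (!s) i), z ∉ P.cover := by
  intro z hz
  have : z ∈ frontier (convexCore P.hol) := by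
    cases s
    · rw [geo_comm] at hz; exact M.axis_subset_frontier i hz
    · exact M.axis_subset_frontier i hz
  exact this.2

lemma smul_not_mem_cover (g : FreeGroup (Fin 2)) {z : ℍ} (hz : z ∉ P.cover) :
    P.hol g • z ∉ P.cover := fun h => hz <| by
  have := smul_mem_cover g⁻¹ h
  rwa [map_inv, inv_smul_smul] at this

lemma exists_axis_at_tip (ε : Fin 3 → Bool) (b : Bool) (i : Fin 3) :
    ∃ v', br (M.tip ε b i) v' ≠ 0 ∧ ∀ z ∈ geo (M.tip ε b i) v', z ∉ P.cover := by
  cases b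
  · exact ⟨_, M.br_en_ne_zero _ _, M.cover_disjoint_axis _ _⟩
  · refine ⟨act (P.hol (peripheral (i + 2))) (M.F.en (!(ε i)) i), ?_, ?_⟩
    · change br (act _ (M.F.en (ε i) i)) _ ≠ 0
      rw [br_act]
      exact M.br_en_ne_zero _ _
    · change ∀ z ∈ geo (act _ (M.F.en (ε i) i)) _, z ∉ P.cover
      rw [← image_geo]
      rintro _ ⟨z, hz, rfl⟩
      exact smul_not_mem_cover _ (M.cover_disjoint_axis _ _ z hz)

/-- Outside a compact arc the leaf is within `δ` of translates of boundary axes, which avoid the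
interior, while the `δ`-neighbourhood of `B` stays inside. So only the compact arc can reach `B`,
and proper discontinuity applies. -/
lemma finite_base (ε : Fin 3 → Bool) (b : Bool) (i : Fin 3) {B : Set ℍ} (hB : IsCompact B)
    (hBc : B ⊆ P.cover) :
    {g | (((fun z => P.hol g • z) '' M.base ε b i) ∩ B).Nonempty}.Finite := by
  obtain ⟨δ, hδ, hth⟩ := hB.exists_thickening_subset_open isOpen_interior hBc
  obtain ⟨v', hv, hv'⟩ := M.exists_axis_at_tip ε b i
  obtain ⟨C, hC, h⟩ := exists_compact_arc (M.br_base_ne_zero ε b i)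
    (M.br_en_ne_zero i (ε i)) hv hδ
  refine (P.finite_translates hC hB).subset ?_
  rintro g ⟨_, ⟨z, hz, rfl⟩, hzB⟩
  refine ⟨_, ⟨z, ?_, rfl⟩, hzB⟩
  by_contra hzC
  obtain ⟨y, hy, hd⟩ := h z hz hzC
  have hyc : y ∉ P.cover := by
    rcases hy with hy | hy
    · exact M.cover_disjoint_axis _ _ y hy
    · exact hv' y hy
  refine smul_not_mem_cover g hyc (hth (Metric.mem_thickening_iff.2 ⟨_, hzB, ?_⟩))
  rw [dist_comm] at hd
  simpa only [dist_smul] using hd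

end Model

/-- Only finitely many of the sets meet a given compact subset of the cover. -/
def LocFinite (P : HyperbolicPants) (𝓛 : Set (Set ℍ)) : Prop :=
  ∀ B : Set ℍ, IsCompact B → B ⊆ P.cover → {ℓ ∈ 𝓛 | (ℓ ∩ B).Nonempty}.Finite

variable {P}

lemma Model.locFinite (M : P.Model) {𝓛 : Set (Set ℍ)}
    (h : ∀ ℓ ∈ 𝓛, ∃ ε b i g, ℓ = (fun z => P.hol g • z) '' M.base ε b i) : P.LocFinite 𝓛 := by
  intro B hB hBc
  have hf : (⋃ x : (Fin 3 → Bool) × Bool × Fin 3, (fun g => (fun z => P.hol g • z) ''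
      M.base x.1 x.2.1 x.2.2) '' {g | (((fun z => P.hol g • z) '' M.base x.1 x.2.1 x.2.2) ∩
      B).Nonempty}).Finite := finite_iUnion fun x => (M.finite_base _ _ _ hB hBc).image _
  refine hf.subset ?_
  rintro ℓ ⟨hℓ, hne⟩
  obtain ⟨ε, b, i, g, rfl⟩ := h ℓ hℓ
  exact mem_iUnion.2 ⟨⟨ε, b, i⟩, g, hne, rfl⟩

lemma MeasuredLamination.locFinite (Λ : P.MeasuredLamination) : P.LocFinite Λ.leaves := by
  obtain ⟨M⟩ := P.exists_model
  exact M.locFinite fun ℓ hℓ => M.exists_base Λ hℓ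

end HyperbolicPants

/-! ### Differential calculus of transverse arcs -/

/-- The differential of the function `bq · u v`. -/
def dbq (z : ℍ) (u v : V2) (w : ℂ) : ℝ :=
  2 * (u 1 * v 1) * (z.re * w.re + z.im * w.im) - (u 0 * v 1 + u 1 * v 0) * w.re

lemma hasDerivAt_re {f : ℝ → ℍ} {w : ℂ} {t : ℝ} (h : HasDerivAt (fun t => (f t : ℂ)) w t) :
    HasDerivAt (fun t => (f t).re) w.re t :=
  (Complex.reCLM.hasFDerivAt.comp_hasDerivAt t h :)

lemma hasDerivAt_im {f : ℝ → ℍ} {w : ℂ} {t : ℝ} (h : HasDerivAt (fun t => (f t : ℂ)) w t) :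
    HasDerivAt (fun t => (f t).im) w.im t :=
  (Complex.imCLM.hasFDerivAt.comp_hasDerivAt t h :)

lemma hasDerivAt_bq {f : ℝ → ℍ} {w : ℂ} {t : ℝ} (h : HasDerivAt (fun t => (f t : ℂ)) w t) (u v : V2) :
    HasDerivAt (fun t => bq (f t) u v) (dbq (f t) u v w) t := by
  have hr := hasDerivAt_re h
  have hi := hasDerivAt_im h
  have := (((hr.fun_pow 2).add (hi.fun_pow 2)).const_mul (u 1 * v 1)).sub
    (hr.const_mul (u 0 * v 1 + u 1 * v 0)) |>.add_const (u 0 * v 0)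
  refine this.congr_deriv ?_
  simp only [dbq]; norm_num; ring

lemma denom_ne_zero' (g : SL(2, ℝ)) (z : ℍ) : (g 1 0 : ℂ) * z + g 1 1 ≠ 0 := fun h => by
  have := dn_eq g z
  rw [h, map_zero] at this
  exact (dn_pos g z).ne this

lemma hasDerivAt_smul {f : ℝ → ℍ} {w : ℂ} {t : ℝ} (h : HasDerivAt (fun t => (f t : ℂ)) w t)
    (g : SL(2, ℝ)) : HasDerivAt (fun t => ((g • f t : ℍ) : ℂ))
      (w / ((g 1 0 : ℂ) * f t + g 1 1) ^ 2) t := by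
  have hd := denom_ne_zero' g (f t)
  have h1 := ((h.const_mul (g 0 0 : ℂ)).add_const (g 0 1 : ℂ)).fun_div
    ((h.const_mul (g 1 0 : ℂ)).add_const (g 1 1 : ℂ)) hd
  simp only [coe_sl_smul]
  refine h1.congr_deriv ?_
  congr 1
  have := g.2
  rw [Matrix.det_fin_two] at this
  have h2 : (g 0 0 : ℂ) * g 1 1 - g 0 1 * g 1 0 = 1 := by exact_mod_cast this
  linear_combination w * h2

lemma contDiff_smul {E : Type*} [NormedAddCommGroup E] [NormedSpace ℝ E] {f : E → ℍ}
    (h : ContDiff ℝ 1 (fun t => (f t : ℂ))) (g : SL(2, ℝ)) :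
    ContDiff ℝ 1 (fun t => ((g • f t : ℍ) : ℂ)) := by
  simp only [coe_sl_smul, div_eq_mul_inv]
  exact ((contDiff_const.mul h).add contDiff_const).mul
    (((contDiff_const.mul h).add contDiff_const).inv fun t => denom_ne_zero' g (f t))

lemma coe_iexp (t : ℝ) : (iexp t : ℂ) = (Real.exp t : ℂ) * Complex.I := by
  apply Complex.ext
  · simp
  · simp [-Complex.ofReal_exp]

lemma hasDerivAt_iexp (t : ℝ) :
    HasDerivAt (fun t => (iexp t : ℂ)) ((Real.exp t : ℂ) * Complex.I) t := by
  simp only [coe_iexp]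
  exact ((Real.hasDerivAt_exp t).ofReal_comp).mul_const Complex.I

lemma contDiff_iexp : ContDiff ℝ 1 (fun t => (iexp t : ℂ)) := by
  simp only [coe_iexp]
  exact (Complex.ofRealCLM.contDiff.comp Real.contDiff_exp).mul contDiff_const

lemma Isometry.exists_hasDerivAt {γ : ℝ → ℍ} (hγ : Isometry γ) (s : ℝ) :
    ∃ τ : ℂ, τ ≠ 0 ∧ HasDerivAt (fun s => (γ s : ℂ)) τ s := by
  obtain ⟨k, hk⟩ := Isometry.exists_eq_smul_iexp hγ
  simp only [hk]
  refine ⟨_, ?_, hasDerivAt_smul (hasDerivAt_iexp s) k⟩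
  refine div_ne_zero (mul_ne_zero ?_ Complex.I_ne_zero) (pow_ne_zero _ (denom_ne_zero' _ _))
  exact_mod_cast (Real.exp_pos s).ne'

/-- A nonzero linear form on the plane vanishing on `τ` vanishes exactly on the multiples of `τ`. -/
lemma linearIndependent_iff_of_kernel {A B : ℝ} (h0 : A ≠ 0 ∨ B ≠ 0) {τ w : ℂ} (hτ : τ ≠ 0)
    (h : A * τ.re + B * τ.im = 0) :
    LinearIndependent ℝ ![τ, w] ↔ A * w.re + B * w.im ≠ 0 := by
  rw [LinearIndependent.pair_iff]
  constructor
  · intro hl hw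
    have hdet : τ.re * w.im - τ.im * w.re = 0 := by
      rcases h0 with h0 | h0
      · refine mul_left_cancel₀ h0 ?_
        linear_combination w.im * h - τ.im * hw
      · refine mul_left_cancel₀ h0 ?_
        linear_combination τ.re * hw - w.re * h
    have h1 := (hl w.re (-τ.re) (by
      apply Complex.ext <;> simp
      · ring
      · linear_combination -hdet)).2
    have h2 := (hl w.im (-τ.im) (by
      apply Complex.ext <;> simp
      · linear_combination hdet
      · ring)).2
    exact hτ (Complex.ext (by simpa using h1) (by simpa using h2))
  · intro hw s t hst
    have hr : s * τ.re + t * w.re = 0 := by simpa using congrArg Complex.re hst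
    have hi : s * τ.im + t * w.im = 0 := by simpa using congrArg Complex.im hst
    have ht : t = 0 := by
      have : t * (A * w.re + B * w.im) = 0 := by linear_combination A * hr + B * hi - s * h
      exact (mul_eq_zero.1 this).resolve_right hw
    refine ⟨?_, ht⟩
    subst ht
    rw [zero_smul, add_zero] at hst
    exact (smul_eq_zero.1 hst).resolve_right hτ

/-- The geodesic is a regular zero set of `bq · u v`, so transversality means that the derivative of
this function along the arc does not vanish. -/
lemma transverse_iff {u v : V2} (huv : br u v ≠ 0) {z : ℍ} {w : ℂ} :
    (∀ γ : ℝ → ℍ, Isometry γ → range γ = geo u v → ∀ s, γ s = z →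
      LinearIndependent ℝ ![deriv (fun s => (γ s : ℂ)) s, w]) ↔
    (z ∈ geo u v → dbq z u v w ≠ 0) := by
  have key : ∀ γ : ℝ → ℍ, Isometry γ → range γ = geo u v → ∀ s, γ s = z →
      (LinearIndependent ℝ ![deriv (fun s => (γ s : ℂ)) s, w] ↔ dbq z u v w ≠ 0) := by
    intro γ hγ hr s hs
    obtain ⟨τ, hτ, hd⟩ := Isometry.exists_hasDerivAt hγ s
    rw [hd.deriv]
    have e : ∀ w : ℂ, dbq z u v w = (2 * (u 1 * v 1) * z.re - (u 0 * v 1 + u 1 * v 0)) * w.re +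
        2 * (u 1 * v 1) * z.im * w.im := fun w => by unfold dbq; ring
    have h0 : dbq z u v τ = 0 := by
      have h1 := hasDerivAt_bq hd u v
      have h2 : (fun t => bq (γ t) u v) = fun _ => 0 := by
        funext t
        have : γ t ∈ geo u v := hr ▸ mem_range_self t
        exact this
      rw [h2, hs] at h1
      exact h1.unique (hasDerivAt_const s 0)
    rw [e] at h0 ⊢
    refine linearIndependent_iff_of_kernel ?_ hτ h0
    by_contra hcon
    push Not at hcon
    have h1 : u 1 * v 1 = 0 := by
      have := z.im_pos.ne'
      have h2 := hcon.2
      simpa [this] using h2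
    have h2 : u 0 * v 1 + u 1 * v 0 = 0 := by
      have := hcon.1
      rw [h1] at this
      linarith
    apply huv
    unfold br
    rcases mul_eq_zero.1 h1 with h | h <;> rw [h] at h2 ⊢ <;> linarith
  constructor
  · intro h hz
    obtain ⟨k, -, -, hk⟩ := exists_geo_eq_image huv
    rw [geo_act_e] at hk
    have hi : Isometry fun t => k • iexp t := (isometry_smul ℍ k).comp isometry_iexp
    rw [hk] at hz
    obtain ⟨s, hs⟩ := hz
    exact (key _ hi hk.symm s hs).1 (h _ hi hk.symm s hs)
  · intro h γ hγ hr s hs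
    exact (key γ hγ hr s hs).2 (h (by rw [← hr, ← hs]; exact mem_range_self s))

/-! ### Affine coordinates -/

/-- Coordinates in which geodesic segments are affine. -/
def aff (z : ℍ) : ℝ × ℝ := (z.re, np z)

/-- The inverse of `aff`. -/
def unaff (x : ℝ × ℝ) : ℂ := ⟨x.1, Real.sqrt (x.2 - x.1 ^ 2)⟩

lemma unaff_aff (z : ℍ) : unaff (aff z) = z := by
  apply Complex.ext
  · rfl
  · change Real.sqrt (z.re ^ 2 + z.im ^ 2 - z.re ^ 2) = z.im
    rw [add_sub_cancel_left, Real.sqrt_sq z.im_pos.le]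

lemma continuous_aff : Continuous aff := by
  unfold aff np
  have h1 : Continuous fun z : ℍ => z.re := UpperHalfPlane.continuous_re
  have h2 : Continuous fun z : ℍ => z.im := UpperHalfPlane.continuous_im
  fun_prop

lemma isInducing_aff : Topology.IsInducing aff := by
  have h1 : Continuous unaff := by
    unfold unaff
    have : (fun x : ℝ × ℝ => (⟨x.1, Real.sqrt (x.2 - x.1 ^ 2)⟩ : ℂ)) =
        fun x => (x.1 : ℂ) + (Real.sqrt (x.2 - x.1 ^ 2) : ℂ) * Complex.I := by
      funext x; apply Complex.ext <;> simp
    rw [this]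
    fun_prop
  refine Topology.IsInducing.of_comp continuous_aff h1 ?_
  rw [show unaff ∘ aff = ((↑) : ℍ → ℂ) from funext unaff_aff]
  exact UpperHalfPlane.isEmbedding_coe.isInducing

lemma exists_ball_subset {z : ℍ} {U : Set ℍ} (h : U ∈ 𝓝 z) :
    ∃ r > 0, ∀ w : ℍ, aff w ∈ Metric.ball (aff z) r → w ∈ U := by
  rw [isInducing_aff.nhds_eq_comap] at h
  obtain ⟨r, hr, h⟩ := (Metric.nhds_basis_ball.comap aff).mem_iff.1 h
  exact ⟨r, hr, fun w hw => h hw⟩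

lemma ball_mem_nhds_aff (z : ℍ) {r : ℝ} (hr : 0 < r) : aff ⁻¹' Metric.ball (aff z) r ∈ 𝓝 z :=
  continuous_aff.continuousAt.preimage_mem_nhds (Metric.ball_mem_nhds _ hr)

/-- Affine form of `bq`. -/
lemma bq_eq_aff (z : ℍ) (u v : V2) :
    bq z u v = u 1 * v 1 * (aff z).2 - (u 0 * v 1 + u 1 * v 0) * (aff z).1 + u 0 * v 0 := rfl

/-- In affine coordinates, moving `z` by a small vector amounts to moving both endpoints of the
segment by the same vector. -/
lemma geodConvex_interior {S : Set ℍ} (h : GeodConvex S) : GeodConvex (interior S) := by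
  intro x hx y hy z hz
  obtain ⟨s, t, hs, ht, hst, h1, h2⟩ : ∃ s t : ℝ, 0 ≤ s ∧ 0 ≤ t ∧ s + t = 1 ∧
      z.re = s * x.re + t * y.re ∧ np z = s * np x + t * np y := by
    obtain ⟨s, t, hs, ht, h⟩ := mem_segm_iff.1 hz
    have a := h e2 e2
    have b := h e1 e2
    have c := h e1 e1
    simp [bq] at a b c
    exact ⟨s, t, hs, ht, c.symm, by linarith, a⟩
  obtain ⟨r, hr, hx'⟩ := exists_ball_subset (mem_interior_iff_mem_nhds.1 hx)
  obtain ⟨r', hr', hy'⟩ := exists_ball_subset (mem_interior_iff_mem_nhds.1 hy)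
  have hopen : ∀ x : ℍ, ∀ᶠ d : ℝ × ℝ in 𝓝 0, (x.re + d.1) ^ 2 < np x + d.2 := fun x => by
    have h1 : Continuous fun d : ℝ × ℝ => (x.re + d.1) ^ 2 := by fun_prop
    have h2 : Continuous fun d : ℝ × ℝ => np x + d.2 := by fun_prop
    exact h1.continuousAt.eventually_lt h2.continuousAt (by simpa using np_gt x)
  have hev : ∀ᶠ d : ℝ × ℝ in 𝓝 0, (x.re + d.1) ^ 2 < np x + d.2 ∧ (y.re + d.1) ^ 2 < np y + d.2 ∧
      d ∈ Metric.ball (0 : ℝ × ℝ) r ∧ d ∈ Metric.ball (0 : ℝ × ℝ) r' :=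
    by
    filter_upwards [hopen x, hopen y, Metric.ball_mem_nhds _ hr, Metric.ball_mem_nhds _ hr'] with
      d a b c e using ⟨a, b, c, e⟩
  rw [mem_interior_iff_mem_nhds]
  have hc : ContinuousAt (fun z' : ℍ => aff z' - aff z) z :=
    (continuous_aff.sub continuous_const).continuousAt
  rw [ContinuousAt, sub_self] at hc
  filter_upwards [hc.eventually hev] with z' hz'
  obtain ⟨a, b, c, d⟩ := hz'
  obtain ⟨x', x1, x2⟩ := exists_re_np a
  obtain ⟨y', y1, y2⟩ := exists_re_np b
  have ex : aff x' = aff x + (aff z' - aff z) := Prod.ext x1 x2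
  have ey : aff y' = aff y + (aff z' - aff z) := Prod.ext y1 y2
  refine h x' (hx' x' ?_) y' (hy' y' ?_) (mem_segm_of_affine hs ht hst ?_ ?_)
  · rw [ex, Metric.mem_ball, dist_self_add_left, ← dist_zero_right]; exact c
  · rw [ey, Metric.mem_ball, dist_self_add_left, ← dist_zero_right]; exact d
  · rw [x1, y1]
    simp only [aff, Prod.fst_sub]
    rw [h1]; linear_combination (s * x.re + t * y.re - z'.re) * hst
  · rw [x2, y2]
    simp only [aff, Prod.snd_sub]
    rw [h2]; linear_combination (s * np x + t * np y - np z') * hst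

lemma contDiff_aff {E : Type*} [NormedAddCommGroup E] [NormedSpace ℝ E] {G : E → ℍ}
    (h : ContDiff ℝ 1 (fun t => (G t : ℂ))) : ContDiff ℝ 1 (fun t => aff (G t)) := by
  have hr : ContDiff ℝ 1 fun t => (G t).re := Complex.reCLM.contDiff.comp h
  have hi : ContDiff ℝ 1 fun t => (G t).im := Complex.imCLM.contDiff.comp h
  exact hr.prodMk ((hr.pow 2).add (hi.pow 2))

lemma contDiff_of_aff {E : Type*} [NormedAddCommGroup E] [NormedSpace ℝ E] {G : E → ℍ}
    (h : ContDiff ℝ 1 (fun t => aff (G t))) : ContDiff ℝ 1 (fun t => (G t : ℂ)) := by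
  have e : (fun t => (G t : ℂ)) = fun t => (((aff (G t)).1 : ℝ) : ℂ) +
      ((Real.sqrt ((aff (G t)).2 - (aff (G t)).1 ^ 2) : ℝ) : ℂ) * Complex.I := by
    funext t
    rw [← unaff_aff (G t)]
    apply Complex.ext <;> simp [unaff]
  rw [e]
  have h1 : ContDiff ℝ 1 fun t => (aff (G t)).1 := contDiff_fst.comp h
  have h2 : ContDiff ℝ 1 fun t => (aff (G t)).2 := contDiff_snd.comp h
  have h3 : ContDiff ℝ 1 fun t => Real.sqrt ((aff (G t)).2 - (aff (G t)).1 ^ 2) :=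
    (h2.sub (h1.pow 2)).sqrt fun t => (sub_pos.2 (np_gt (G t))).ne'
  exact (Complex.ofRealCLM.contDiff.comp h1).add
    ((Complex.ofRealCLM.contDiff.comp h3).mul contDiff_const)

/-- The point of affine coordinates `x`. -/
def ofAff (x : ℝ × ℝ) : ℍ := if h : x.1 ^ 2 < x.2 then (exists_re_np h).choose else I

lemma aff_ofAff {x : ℝ × ℝ} (h : x.1 ^ 2 < x.2) : aff (ofAff x) = x := by
  rw [ofAff, dif_pos h]
  exact Prod.ext (exists_re_np h).choose_spec.1 (exists_re_np h).choose_spec.2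

lemma aff_convex (x y : ℍ) {c : ℝ} (h0 : 0 ≤ c) (h1 : c ≤ 1) :
    aff (ofAff ((1 - c) • aff x + c • aff y)) = (1 - c) • aff x + c • aff y := by
  obtain ⟨z, -, h2, h3⟩ := exists_mem_segm x y (sub_nonneg.2 h1) h0 (by ring)
  refine aff_ofAff ?_
  have e : (1 - c) • aff x + c • aff y = aff z := Prod.ext h2.symm h3.symm
  rw [e]
  exact np_gt z

lemma continuous_dbq {f : ℝ → ℍ} (hf : ContDiff ℝ 1 (fun t => (f t : ℂ))) (u v : V2) :
    Continuous fun t => dbq (f t) u v (deriv (fun t => (f t : ℂ)) t) := by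
  have h1 : Continuous fun t => (f t : ℂ) := hf.continuous
  have h2 := hf.continuous_deriv le_rfl
  have hr : Continuous fun t => (f t).re := Complex.continuous_re.comp h1
  have hi : Continuous fun t => (f t).im := Complex.continuous_im.comp h1
  have hr' := Complex.continuous_re.comp h2
  have hi' := Complex.continuous_im.comp h2
  unfold dbq
  exact (continuous_const.mul ((hr.mul hr').add (hi.mul hi'))).sub (continuous_const.mul hr')

lemma hasDerivAt_coe {f : ℝ → ℍ} (hf : ContDiff ℝ 1 (fun t => (f t : ℂ))) (t : ℝ) :
    HasDerivAt (fun t => (f t : ℂ)) (deriv (fun t => (f t : ℂ)) t) t :=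
  (hf.differentiable one_ne_zero t).hasDerivAt

lemma continuous_of_contDiff {f : ℝ → ℍ} (hf : ContDiff ℝ 1 (fun t => (f t : ℂ))) :
    Continuous f := UpperHalfPlane.isEmbedding_coe.continuous_iff.2 hf.continuous

lemma continuous_bq (u v : V2) : Continuous fun z : ℍ => bq z u v := by
  simp only [bq_eq_aff]
  have h1 := continuous_fst.comp continuous_aff
  have h2 := continuous_snd.comp continuous_aff
  exact ((continuous_const.mul h2).sub (continuous_const.mul h1)).add continuous_const

lemma isClosed_geo (u v : V2) : IsClosed (geo u v) :=
  isClosed_eq (continuous_bq u v) continuous_const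

lemma strictMonoOn_bq {f : ℝ → ℍ} {u v : V2} {a b : ℝ} (hf : ContDiff ℝ 1 (fun t => (f t : ℂ)))
    (h : ∀ t ∈ Icc a b, 0 < dbq (f t) u v (deriv (fun t => (f t : ℂ)) t)) :
    StrictMonoOn (fun t => bq (f t) u v) (Icc a b) := by
  refine strictMonoOn_of_deriv_pos (convex_Icc a b)
    ((continuous_bq u v).comp (continuous_of_contDiff hf)).continuousOn fun t ht => ?_
  rw [interior_Icc] at ht
  rw [(hasDerivAt_bq (hasDerivAt_coe hf t) u v).deriv]
  exact h t ⟨ht.1.le, ht.2.le⟩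

/-- A small arc in `U` crossing the geodesic with endpoints `u` and `v`. -/
structure SArc (u v : V2) (U : Set ℍ) (h : ℝ → ℍ) : Prop where
  contDiff : ContDiff ℝ 1 (fun t => (h t : ℂ))
  mem : ∀ t ∈ Icc (0 : ℝ) 1, h t ∈ U
  pos : ∀ t ∈ Icc (0 : ℝ) 1, 0 < dbq (h t) u v (deriv (fun t => (h t : ℂ)) t)
  left : bq (h 0) u v < 0
  right : 0 < bq (h 1) u v

namespace SArc

variable {u v : V2} {U : Set ℍ} {h h' : ℝ → ℍ}

/-- The affine homotopy of two arcs. -/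
def mix (h h' : ℝ → ℍ) (p : ℝ × ℝ) : ℍ :=
  ofAff ((1 - Real.smoothTransition p.1) • aff (h p.2) + Real.smoothTransition p.1 • aff (h' p.2))

/-- The smooth transition takes values in `[0, 1]` at every real time, so the combination is convex
and the homotopy is `C¹` on the whole plane, as the definition requires. -/
lemma aff_mix (h h' : ℝ → ℍ) (p : ℝ × ℝ) : aff (mix h h' p) =
    (1 - Real.smoothTransition p.1) • aff (h p.2) + Real.smoothTransition p.1 • aff (h' p.2) :=
  aff_convex _ _ (Real.smoothTransition.nonneg _) (Real.smoothTransition.le_one _)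

lemma bq_mix (h h' : ℝ → ℍ) (p : ℝ × ℝ) (u v : V2) : bq (mix h h' p) u v =
    (1 - Real.smoothTransition p.1) * bq (h p.2) u v +
      Real.smoothTransition p.1 * bq (h' p.2) u v := by
  simp only [bq_eq_aff, aff_mix, Prod.fst_add, Prod.snd_add, Prod.smul_fst, Prod.smul_snd,
    smul_eq_mul]
  ring

lemma aff_injective : Function.Injective aff := fun _ _ h =>
  eq_of_re_np (congrArg Prod.fst h) (congrArg Prod.snd h)

lemma mix_zero (h h' : ℝ → ℍ) (t : ℝ) : mix h h' (0, t) = h t :=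
  aff_injective (by rw [aff_mix]; simp)

lemma mix_one (h h' : ℝ → ℍ) (t : ℝ) : mix h h' (1, t) = h' t :=
  aff_injective (by rw [aff_mix]; simp)

lemma contDiff_mix (a : ContDiff ℝ 1 (fun t => (h t : ℂ))) (a' : ContDiff ℝ 1 (fun t => (h' t : ℂ))) :
    ContDiff ℝ 1 (fun p => (mix h h' p : ℂ)) := by
  refine contDiff_of_aff ?_
  simp only [aff_mix]
  have hs : ContDiff ℝ 1 fun p : ℝ × ℝ => Real.smoothTransition p.1 :=
    (Real.smoothTransition.contDiff (n := 1)).comp contDiff_fst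
  have h1 : ContDiff ℝ 1 fun p : ℝ × ℝ => aff (h p.2) := (contDiff_aff a).comp contDiff_snd
  have h2 : ContDiff ℝ 1 fun p : ℝ × ℝ => aff (h' p.2) := (contDiff_aff a').comp contDiff_snd
  exact ((contDiff_const.sub hs).smul h1).add (hs.smul h2)

/-- Since `bq` is affine in these coordinates, all conditions defining an `SArc` in an affine ball
are preserved by convex combinations. -/
lemma mix_sArc {p : ℝ × ℝ} {r : ℝ} (a : SArc u v (aff ⁻¹' Metric.ball p r) h)
    (a' : SArc u v (aff ⁻¹' Metric.ball p r) h') (s : ℝ) :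
    SArc u v (aff ⁻¹' Metric.ball p r) (fun t => mix h h' (s, t)) := by
  have h0 := Real.smoothTransition.nonneg s
  have h1 := Real.smoothTransition.le_one s
  have hpos : ∀ x y : ℝ, 0 < x → 0 < y →
      0 < (1 - Real.smoothTransition s) * x + Real.smoothTransition s * y := fun x y hx hy =>
    (convex_Ioi (0 : ℝ)) hx hy (sub_nonneg.2 h1) h0 (by ring)
  have hc : ContDiff ℝ 1 (fun t => (mix h h' (s, t) : ℂ)) :=
    (contDiff_mix a.contDiff a'.contDiff).comp (contDiff_const.prodMk contDiff_id)
  refine ⟨hc, fun t ht => ?_, fun t ht => ?_, ?_, ?_⟩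
  · rw [mem_preimage, aff_mix]
    exact convex_ball _ _ (a.mem t ht) (a'.mem t ht) (sub_nonneg.2 h1) h0 (by ring)
  · have d := hasDerivAt_bq (hasDerivAt_coe hc t) u v
    have d1 := (hasDerivAt_bq (hasDerivAt_coe a.contDiff t) u v).const_mul
      (1 - Real.smoothTransition s)
    have d2 := (hasDerivAt_bq (hasDerivAt_coe a'.contDiff t) u v).const_mul
      (Real.smoothTransition s)
    simp only [bq_mix] at d
    rw [d.unique (d1.add d2)]
    exact hpos _ _ (a.pos t ht) (a'.pos t ht)
  · rw [bq_mix]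
    have := hpos _ _ (neg_pos.2 a.left) (neg_pos.2 a'.left)
    linarith
  · rw [bq_mix]
    exact hpos _ _ a.right a'.right

end SArc

/-! ### Transverse arcs and locally finite families of geodesics -/

namespace HyperbolicPants

variable {P : HyperbolicPants} {𝓛 : Set (Set ℍ)}

/-- In a compact neighbourhood only finitely many closed leaves have to be avoided. -/
lemma exists_leaf_nhds (hg : ∀ ℓ ∈ 𝓛, IsCompleteGeodesic ℓ) (hf : P.LocFinite 𝓛) {p : ℍ}
    (hp : p ∈ P.cover) :
    ∃ U ∈ 𝓝 p, U ⊆ P.cover ∧ ∀ ℓ ∈ 𝓛, (ℓ ∩ U).Nonempty → p ∈ ℓ := by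
  obtain ⟨B, hB, hpB, hBc⟩ := exists_compact_subset isOpen_interior hp
  have hfin : {ℓ ∈ 𝓛 | (ℓ ∩ B).Nonempty ∧ p ∉ ℓ}.Finite :=
    (hf B hB hBc).subset fun ℓ h => ⟨h.1, h.2.1⟩
  have hcl : IsClosed (⋃₀ {ℓ ∈ 𝓛 | (ℓ ∩ B).Nonempty ∧ p ∉ ℓ}) := by
    rw [sUnion_eq_biUnion]
    refine hfin.isClosed_biUnion fun ℓ h => ?_
    obtain ⟨u, v, -, rfl⟩ := (hg ℓ h.1).exists_geo
    exact isClosed_geo u v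
  refine ⟨interior B ∩ (⋃₀ {ℓ ∈ 𝓛 | (ℓ ∩ B).Nonempty ∧ p ∉ ℓ})ᶜ,
    inter_mem (isOpen_interior.mem_nhds hpB) (hcl.isOpen_compl.mem_nhds ?_),
    fun z hz => hBc (interior_subset hz.1), ?_⟩
  · rintro ⟨ℓ, h, h'⟩
    exact h.2.2 h'
  · rintro ℓ hℓ ⟨z, hz, hz1, hz2⟩
    by_contra hpℓ
    exact hz2 ⟨ℓ, ⟨hℓ, ⟨z, hz, interior_subset hz1⟩, hpℓ⟩, hz⟩

lemma isTransverseParam_of {f : ℝ → ℍ} (h1 : ContDiff ℝ 1 (fun t => (f t : ℂ)))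
    (h2 : InjOn f (Icc 0 1)) (h3 : ∀ t ∈ Icc (0 : ℝ) 1, f t ∈ P.cover)
    (h4 : ∀ t ∈ Icc (0 : ℝ) 1, deriv (fun t => (f t : ℂ)) t ≠ 0)
    (h5 : ∀ t ∈ Icc (0 : ℝ) 1, ∀ ℓ ∈ 𝓛, f t ∈ ℓ → ∃ u v, br u v ≠ 0 ∧ ℓ = geo u v ∧
      dbq (f t) u v (deriv (fun t => (f t : ℂ)) t) ≠ 0) : P.IsTransverseParam 𝓛 f := by
  refine ⟨h1, h2, h3, h4, fun t ht γ hγ hr s hs => ?_⟩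
  obtain ⟨u, v, huv, he, hd⟩ := h5 t ht _ hr (hs ▸ mem_range_self s)
  exact (transverse_iff huv).2 (fun _ => hd) γ hγ he s hs

namespace IsTransverseParam

variable {f : ℝ → ℍ}

lemma dbq_ne_zero (h : P.IsTransverseParam 𝓛 f) {u v : V2} (huv : br u v ≠ 0) (hℓ : geo u v ∈ 𝓛)
    {t : ℝ} (ht : t ∈ Icc (0 : ℝ) 1) (hm : f t ∈ geo u v) :
    dbq (f t) u v (deriv (fun t => (f t : ℂ)) t) ≠ 0 :=
  (transverse_iff huv).1 (fun γ hγ hr s hs => h.transverse t ht γ hγ (hr ▸ hℓ) s hs) hm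

/-- Affine reparametrizations of parts of a transverse arc. -/
lemma comp_affine (hg : ∀ ℓ ∈ 𝓛, IsCompleteGeodesic ℓ) (h : P.IsTransverseParam 𝓛 f) {a c : ℝ}
    (hc : c ≠ 0) (hm : ∀ t ∈ Icc (0 : ℝ) 1, a + c * t ∈ Icc (0 : ℝ) 1) :
    P.IsTransverseParam 𝓛 (fun t => f (a + c * t)) := by
  have hd : ∀ t, HasDerivAt (fun t => (f (a + c * t) : ℂ))
      (c • deriv (fun t => (f t : ℂ)) (a + c * t)) t := fun t => by
    have h1 : HasDerivAt (fun t : ℝ => a + c * t) c t := by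
      simpa using ((hasDerivAt_id t).const_mul c).const_add a
    exact (hasDerivAt_coe h.contDiff (a + c * t)).scomp t h1
  have hc' : ContDiff ℝ 1 fun t : ℝ => a + c * t := by fun_prop
  refine isTransverseParam_of (h.contDiff.comp hc') (fun t ht t' ht' e => ?_)
    (fun t ht => h.mem_cover _ (hm t ht)) (fun t ht => ?_) fun t ht ℓ hℓ hf => ?_
  · have := h.injOn (hm t ht) (hm t' ht') e
    exact mul_left_cancel₀ hc (add_left_cancel this)
  · rw [(hd t).deriv]
    exact smul_ne_zero hc (h.regular _ (hm t ht))
  · obtain ⟨u, v, huv, rfl⟩ := (hg ℓ hℓ).exists_geo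
    refine ⟨u, v, huv, rfl, ?_⟩
    have := h.dbq_ne_zero huv hℓ (hm t ht) hf
    rw [(hd t).deriv]
    intro h0
    refine this (mul_left_cancel₀ hc ?_)
    rw [mul_zero, ← h0]
    simp only [dbq, Complex.real_smul, Complex.re_ofReal_mul, Complex.im_ofReal_mul]; ring

/-- Transversality makes the zeros of `bq` along the arc isolated, and they form a compact set. -/
lemma finite_inter (h : P.IsTransverseParam 𝓛 f) {u v : V2} (huv : br u v ≠ 0) (hℓ : geo u v ∈ 𝓛) :
    {t ∈ Icc (0 : ℝ) 1 | f t ∈ geo u v}.Finite := by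
  have hcl : IsClosed {t ∈ Icc (0 : ℝ) 1 | f t ∈ geo u v} :=
    isClosed_Icc.inter ((isClosed_geo u v).preimage (continuous_of_contDiff h.contDiff))
  refine (isCompact_Icc.of_isClosed_subset hcl fun t ht => ht.1).finite ?_
  refine isDiscrete_iff_discreteTopology.2 (discreteTopology_subtype_iff.2 fun t ht => ?_)
  have hev := (hasDerivAt_bq (hasDerivAt_coe h.contDiff t) u v).eventually_ne
    (c := 0) (h.dbq_ne_zero huv hℓ ht.1 ht.2)
  rw [inf_principal_eq_bot]
  filter_upwards [hev] with s hs hs'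
  exact hs hs'.2

lemma isCompact_image (h : P.IsTransverseParam 𝓛 f) : IsCompact (f '' Icc 0 1) :=
  isCompact_Icc.image (continuous_of_contDiff h.contDiff)

lemma image_subset_cover (h : P.IsTransverseParam 𝓛 f) : f '' Icc 0 1 ⊆ P.cover := by
  rintro _ ⟨t, ht, rfl⟩
  exact h.mem_cover t ht

lemma finite_inter_leaf (hg : ∀ ℓ ∈ 𝓛, IsCompleteGeodesic ℓ) (h : P.IsTransverseParam 𝓛 f)
    {ℓ : Set ℍ} (hℓ : ℓ ∈ 𝓛) : (f '' Icc 0 1 ∩ ℓ).Finite := by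
  obtain ⟨u, v, huv, rfl⟩ := (hg ℓ hℓ).exists_geo
  refine ((h.finite_inter huv hℓ).image f).subset ?_
  rintro _ ⟨⟨t, ht, rfl⟩, h⟩
  exact ⟨t, ⟨ht, h⟩, rfl⟩

lemma finite_inter_support (hg : ∀ ℓ ∈ 𝓛, IsCompleteGeodesic ℓ) (hf : P.LocFinite 𝓛)
    (h : P.IsTransverseParam 𝓛 f) : (f '' Icc 0 1 ∩ ⋃₀ 𝓛).Finite := by
  refine ((hf _ h.isCompact_image h.image_subset_cover).biUnion
    (t := fun ℓ => f '' Icc 0 1 ∩ ℓ) fun ℓ hℓ => h.finite_inter_leaf hg hℓ.1).subset ?_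
  rintro z ⟨hz, ℓ, hℓ, hzℓ⟩
  exact mem_biUnion (x := ℓ) ⟨hℓ, z, hzℓ, hz⟩ ⟨hz, hzℓ⟩

end IsTransverseParam

/-- A neighbourhood meeting no geodesic of `𝓛` but the one with endpoints `u` and `v`. -/
def Only (P : HyperbolicPants) (𝓛 : Set (Set ℍ)) (u v : V2) (U : Set ℍ) : Prop :=
  U ⊆ P.cover ∧ ∀ ℓ ∈ 𝓛, (ℓ ∩ U).Nonempty → ℓ = geo u v

lemma exists_only (hg : ∀ ℓ ∈ 𝓛, IsCompleteGeodesic ℓ) (hf : P.LocFinite 𝓛)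
    (hdis : ∀ ℓ ∈ 𝓛, ∀ ℓ' ∈ 𝓛, ℓ ≠ ℓ' → Disjoint ℓ ℓ') {u v : V2} (hℓ : geo u v ∈ 𝓛) {p : ℍ}
    (hp : p ∈ P.cover) (hpℓ : p ∈ geo u v) :
    ∃ r > 0, P.Only 𝓛 u v (aff ⁻¹' Metric.ball (aff p) r) := by
  obtain ⟨U, hU, hUc, h⟩ := exists_leaf_nhds hg hf hp
  obtain ⟨r, hr, hb⟩ := exists_ball_subset hU
  refine ⟨r, hr, fun z hz => hUc (hb z hz), ?_⟩
  rintro ℓ hℓ' ⟨z, hz, hzb⟩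
  by_contra hne
  exact Set.disjoint_left.1 (hdis ℓ hℓ' _ hℓ hne) (h ℓ hℓ' ⟨z, hz, hb z hzb⟩) hpℓ

lemma dbq_zero (z : ℍ) (u v : V2) : dbq z u v 0 = 0 := by simp [dbq]

variable {u v : V2} {U : Set ℍ} {h h' : ℝ → ℍ}

lemma _root_.PantsLamination.SArc.isTransverseParam (a : SArc u v U h) (huv : br u v ≠ 0)
    (hU : P.Only 𝓛 u v U) : P.IsTransverseParam 𝓛 h := by
  refine isTransverseParam_of a.contDiff (fun t ht t' ht' e => ?_) (fun t ht => hU.1 (a.mem t ht))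
    (fun t ht h0 => ?_) fun t ht ℓ hℓ hf => ⟨u, v, huv, hU.2 ℓ hℓ ⟨_, hf, a.mem t ht⟩, (a.pos t ht).ne'⟩
  · exact (strictMonoOn_bq a.contDiff a.pos).injOn ht ht' (by simp only [e])
  · have := a.pos t ht
    rw [h0, dbq_zero] at this
    exact lt_irrefl _ this

/-- The endpoints stay strictly on their sides of the only leaf met by the ball, so they never lie
on a leaf. -/
lemma isTransverseHomotopy_mix {p : ℝ × ℝ} {r : ℝ} (a : SArc u v (aff ⁻¹' Metric.ball p r) h)
    (a' : SArc u v (aff ⁻¹' Metric.ball p r) h') (huv : br u v ≠ 0)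
    (hU : P.Only 𝓛 u v (aff ⁻¹' Metric.ball p r)) :
    P.IsTransverseHomotopy 𝓛 (SArc.mix h h') := by
  have key : ∀ s t, t ∈ Icc (0 : ℝ) 1 → bq (SArc.mix h h' (s, t)) u v ≠ 0 →
      ∀ ℓ ∈ 𝓛, SArc.mix h h' (s, t) ∉ ℓ := fun s t ht hne ℓ hℓ hm => by
    obtain rfl := hU.2 ℓ hℓ ⟨_, hm, (a.mix_sArc a' s).mem t ht⟩
    exact hne hm
  have h0 : (0 : ℝ) ∈ Icc (0 : ℝ) 1 := by simp
  have h1 : (1 : ℝ) ∈ Icc (0 : ℝ) 1 := by simp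
  refine ⟨SArc.contDiff_mix a.contDiff a'.contDiff,
    fun s _ => (a.mix_sArc a' s).isTransverseParam huv hU, fun s _ ℓ hℓ => ?_, fun s _ ℓ hℓ => ?_⟩
  · exact iff_of_false (key s 0 h0 (a.mix_sArc a' s).left.ne ℓ hℓ)
      (key 0 0 h0 (a.mix_sArc a' 0).left.ne ℓ hℓ)
  · exact iff_of_false (key s 1 h1 (a.mix_sArc a' s).right.ne' ℓ hℓ)
      (key 0 1 h1 (a.mix_sArc a' 0).right.ne' ℓ hℓ)

end HyperbolicPants

/-! ### The weights of the leaves -/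

lemma hasDerivAt_comp_affine {f : ℝ → ℍ} (hf : ContDiff ℝ 1 (fun t => (f t : ℂ))) (a c t : ℝ) :
    HasDerivAt (fun t => (f (a + c * t) : ℂ)) (c • deriv (fun t => (f t : ℂ)) (a + c * t)) t := by
  have h1 : HasDerivAt (fun t : ℝ => a + c * t) c t := by
    simpa using ((hasDerivAt_id t).const_mul c).const_add a
  exact (hasDerivAt_coe hf (a + c * t)).scomp t h1

lemma dbq_smul (z : ℍ) (u v : V2) (c : ℝ) (w : ℂ) : dbq z u v (c • w) = c * dbq z u v w := by
  simp only [dbq, Complex.real_smul, Complex.re_ofReal_mul, Complex.im_ofReal_mul]; ring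

lemma image_comp_affine (f : ℝ → ℍ) {a b : ℝ} (hab : a < b) :
    (fun t => f (a + (b - a) * t)) '' Icc 0 1 = f '' Icc a b := by
  rw [← image_image f (fun t => a + (b - a) * t)]
  congr 1
  have := Set.image_affine_Icc' (sub_pos.2 hab) a 0 1
  simp only [add_comm _ a] at this
  rw [this]
  simp

lemma image_reverse (f : ℝ → ℍ) : (fun t => f (1 + -1 * t)) '' Icc 0 1 = f '' Icc 0 1 := by
  rw [← image_image f (fun t => 1 + -1 * t)]
  congr 1
  ext t
  constructor
  · rintro ⟨s, hs, rfl⟩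
    exact ⟨by linarith [hs.2], by linarith [hs.1]⟩
  · intro ht
    exact ⟨1 - t, ⟨by linarith [ht.2], by linarith [ht.1]⟩, by ring⟩

/-- The arc is `p + η sin (t - 1/2) d` in affine coordinates, with `d` the gradient of `bq`. The
sine keeps it in a small ball at all real times and has positive derivative on `[0, 1]`. -/
lemma exists_sArc_at {u v : V2} (huv : br u v ≠ 0) {p : ℍ} (hp : p ∈ geo u v) {r : ℝ} (hr : 0 < r) :
    ∃ g, SArc u v (aff ⁻¹' Metric.ball (aff p) r) g ∧ g (1 / 2) = p := by
  set d : ℝ × ℝ := (-(u 0 * v 1 + u 1 * v 0), u 1 * v 1) with hd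
  set N := (u 1 * v 1) ^ 2 + (u 0 * v 1 + u 1 * v 0) ^ 2 with hN
  have hNpos : 0 < N := by
    by_contra hcon
    have h1 : u 1 * v 1 = 0 := by nlinarith [sq_nonneg (u 1 * v 1), sq_nonneg (u 0 * v 1 + u 1 * v 0)]
    have h2 : u 0 * v 1 + u 1 * v 0 = 0 := by
      nlinarith [sq_nonneg (u 1 * v 1), sq_nonneg (u 0 * v 1 + u 1 * v 0)]
    apply huv
    unfold br
    rcases mul_eq_zero.1 h1 with h | h <;> rw [h] at h2 ⊢ <;> linarith
  obtain ⟨r', hr', hb⟩ : ∃ r' > 0, ∀ x ∈ Metric.ball (aff p) r', x.1 ^ 2 < x.2 := by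
    have : IsOpen {x : ℝ × ℝ | x.1 ^ 2 < x.2} := isOpen_lt (by fun_prop) (by fun_prop)
    exact Metric.isOpen_iff.1 this (aff p) (np_gt p)
  obtain ⟨η, hη, hη1, hη2⟩ : ∃ η > 0, η * ‖d‖ < r ∧ η * ‖d‖ < r' := by
    refine ⟨min r r' / (‖d‖ + 1), by positivity, ?_⟩
    have h3 : min r r' / (‖d‖ + 1) * ‖d‖ < min r r' := by
      rw [div_mul_eq_mul_div, div_lt_iff₀ (by positivity)]
      have : 0 < min r r' := lt_min hr hr'
      nlinarith
    exact ⟨h3.trans_le (min_le_left _ _), h3.trans_le (min_le_right _ _)⟩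
  set x : ℝ → ℝ × ℝ := fun t => aff p + (η * Real.sin (t - 1 / 2)) • d with hx
  have hdist : ∀ t, dist (x t) (aff p) ≤ η * ‖d‖ := fun t => by
    rw [hx, dist_self_add_left, norm_smul, norm_mul, Real.norm_eq_abs, Real.norm_eq_abs, abs_of_pos hη]
    have := Real.abs_sin_le_one (t - 1 / 2)
    exact mul_le_mul_of_nonneg_right (by nlinarith) (norm_nonneg d)
  have haff : ∀ t, aff (ofAff (x t)) = x t := fun t =>
    aff_ofAff (hb _ ((hdist t).trans_lt hη2))
  have hbq : ∀ t, bq (ofAff (x t)) u v = η * Real.sin (t - 1 / 2) * N := fun t => by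
    have h0 : bq p u v = 0 := hp
    rw [bq_eq_aff] at h0 ⊢
    rw [haff]
    simp only [hx, hd, hN, Prod.fst_add, Prod.snd_add, Prod.smul_fst, Prod.smul_snd, smul_eq_mul]
    linear_combination h0
  have hc : ContDiff ℝ 1 fun t => (ofAff (x t) : ℂ) := by
    refine contDiff_of_aff ?_
    have h1 : ContDiff ℝ 1 fun t : ℝ => η * Real.sin (t - 1 / 2) := by fun_prop
    have h2 : ContDiff ℝ 1 x := contDiff_const.add (h1.smul contDiff_const)
    rwa [show (fun t => aff (ofAff (x t))) = x from funext haff]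
  have hpi := Real.pi_gt_three
  refine ⟨fun t => ofAff (x t), ⟨hc, fun t _ => ?_, fun t ht => ?_, ?_, ?_⟩, ?_⟩
  · rw [mem_preimage, haff]
    exact (hdist t).trans_lt hη1
  · have d1 := hasDerivAt_bq (hasDerivAt_coe hc t) u v
    simp only [hbq] at d1
    have d2 : HasDerivAt (fun t => η * Real.sin (t - 1 / 2) * N) (η * Real.cos (t - 1 / 2) * N) t := by
      have := (((hasDerivAt_id t).sub_const (1 / 2)).sin.const_mul η).mul_const N
      simpa using this
    rw [d1.unique d2]
    have := Real.cos_pos_of_mem_Ioo (x := t - 1 / 2) ⟨by linarith [ht.1], by linarith [ht.2]⟩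
    positivity
  · rw [hbq]
    have : Real.sin (0 - 1 / 2) < 0 :=
      Real.sin_neg_of_neg_of_neg_pi_lt (by norm_num) (by linarith)
    have := mul_pos hη hNpos
    nlinarith
  · rw [hbq]
    have : 0 < Real.sin (1 - 1 / 2) := Real.sin_pos_of_pos_of_lt_pi (by norm_num) (by linarith)
    positivity
  · refine SArc.aff_injective ?_
    rw [haff]; simp [hx]

namespace HyperbolicPants

variable {P : HyperbolicPants}

namespace MeasuredLamination

variable (Λ : P.MeasuredLamination) {u v : V2} {U : Set ℍ} {f g g' : ℝ → ℍ}

lemma restrict_singleton {c c' : Set ℍ} (hc : P.IsTransverseArc Λ.leaves c)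
    (hc' : P.IsTransverseArc Λ.leaves c') (h : c' ⊆ c) {p : ℍ} (hp : p ∈ c') :
    Λ.μ c' {p} = Λ.μ c {p} := by
  rw [Λ.μ_restrict c c' hc hc' h, Measure.restrict_apply (measurableSet_singleton p),
    inter_eq_left.2 (singleton_subset_iff.2 hp)]

/-- A short piece of the arc around the intersection meets no other leaf point, so its total mass is
the atom there. When the leaf is crossed in the negative sense, the arc is reversed. -/
lemma exists_sArc (hf : P.IsTransverseParam Λ.leaves f) (huv : br u v ≠ 0) (hℓ : geo u v ∈ Λ.leaves)
    {t : ℝ} (ht : t ∈ Icc (0 : ℝ) 1) (hm : f t ∈ geo u v) (hU : U ∈ 𝓝 (f t))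
    (hO : P.Only Λ.leaves u v U) :
    ∃ g, SArc u v U g ∧ Λ.μ (g '' Icc 0 1) univ = Λ.μ (f '' Icc 0 1) {f t} := by
  have red : ∀ {f : ℝ → ℍ} {t : ℝ}, P.IsTransverseParam Λ.leaves f → t ∈ Icc (0 : ℝ) 1 →
      f t ∈ geo u v → U ∈ 𝓝 (f t) → 0 < dbq (f t) u v (deriv (fun t => (f t : ℂ)) t) →
      ∃ g, SArc u v U g ∧ Λ.μ (g '' Icc 0 1) univ = Λ.μ (f '' Icc 0 1) {f t} := by
    intro f t hf ht hm hU hpos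
    have ev1 := (continuous_of_contDiff hf.contDiff).continuousAt.eventually_mem hU
    have ev2 := (continuous_dbq hf.contDiff u v).continuousAt.eventually_mem (Ioi_mem_nhds hpos)
    obtain ⟨δ, hδ, hball⟩ := Metric.nhds_basis_closedBall.mem_iff.1 (ev1.and ev2)
    rw [Real.closedBall_eq_Icc] at hball
    have hmono := strictMonoOn_bq hf.contDiff fun s hs => (hball hs).2
    have hlt : t - δ < t + δ := by linarith
    have hz : bq (f t) u v = 0 := hm
    have htI : t ∈ Icc (t - δ) (t + δ) := ⟨by linarith, by linarith⟩
    have hmap : ∀ s ∈ Icc (0 : ℝ) 1, t - δ + (t + δ - (t - δ)) * s ∈ Icc (t - δ) (t + δ) :=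
      fun s hs => ⟨by nlinarith [hs.1], by nlinarith [hs.2]⟩
    have arc : SArc u v U (fun s => f (t - δ + (t + δ - (t - δ)) * s)) := by
      refine ⟨hf.contDiff.comp (by fun_prop), fun s hs => (hball (hmap s hs)).1, fun s hs => ?_, ?_, ?_⟩
      · rw [(hasDerivAt_comp_affine hf.contDiff _ _ s).deriv, dbq_smul]
        exact mul_pos (sub_pos.2 hlt) (hball (hmap s hs)).2
      · exact (hmono (hmap 0 (by simp)) htI (by linarith)).trans_eq hz
      · exact hz.symm.trans_lt (hmono htI (hmap 1 (by simp)) (by linarith))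
    refine ⟨_, arc, ?_⟩
    have arcT := arc.isTransverseParam huv hO
    -- If `t` is an endpoint of the arc, the short piece uses values of `f` outside `[0, 1]`. The
    -- two arcs are then compared through their common subarc.
    set a := max 0 (t - δ) with ha
    set b := min 1 (t + δ) with hb
    have hat : a ≤ t := max_le ht.1 (by linarith)
    have htb : t ≤ b := le_min ht.2 (by linarith)
    have hab : a < b := by
      refine max_lt (lt_min one_pos ?_) (lt_min ?_ hlt) <;> linarith [ht.1, ht.2]
    have sub1 : Icc a b ⊆ Icc 0 1 := Icc_subset_Icc (le_max_left _ _) (min_le_left _ _)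
    have sub2 : Icc a b ⊆ Icc (t - δ) (t + δ) := Icc_subset_Icc (le_max_right _ _) (min_le_right _ _)
    have mid : P.IsTransverseArc Λ.leaves (f '' Icc a b) := by
      refine ⟨_, hf.comp_affine Λ.isGeodesic (sub_pos.2 hab).ne' (a := a) fun s hs => sub1 ?_,
        image_comp_affine f hab⟩
      exact ⟨by nlinarith [hs.1], by nlinarith [hs.2]⟩
    have img := image_comp_affine f hlt
    have hp : f t ∈ f '' Icc a b := ⟨t, ⟨hat, htb⟩, rfl⟩
    rw [← Λ.restrict_singleton ⟨f, hf, rfl⟩ mid (image_mono sub1) hp,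
      Λ.restrict_singleton ⟨_, arcT, rfl⟩ mid (by rw [img]; exact image_mono sub2) hp]
    rw [← measure_add_measure_compl (measurableSet_singleton (f t))]
    refine (congrArg _ ?_).trans (add_zero _)
    refine measure_mono_null ?_ Measure.measure_compl_support
    rw [Λ.μ_support _ ⟨_, arcT, rfl⟩, img, compl_subset_compl]
    rintro _ ⟨⟨s, hs, rfl⟩, ℓ, hℓ', hsℓ⟩
    obtain rfl := hO.2 ℓ hℓ' ⟨_, hsℓ, (hball hs).1⟩
    have hz' : bq (f s) u v = 0 := hsℓ
    rw [mem_singleton_iff, hmono.injOn hs htI (hz'.trans hz.symm)]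
  rcases lt_or_gt_of_ne (hf.dbq_ne_zero huv hℓ ht hm) with h | h
  · have e : (1 : ℝ) + -1 * (1 - t) = t := by ring
    have := red (f := fun t => f (1 + -1 * t)) (t := 1 - t)
      (hf.comp_affine Λ.isGeodesic (by norm_num) fun s hs => ⟨by linarith [hs.2], by linarith [hs.1]⟩)
      ⟨by linarith [ht.2], by linarith [ht.1]⟩ (by rwa [e]) (by rwa [e]) (by
        rw [(hasDerivAt_comp_affine hf.contDiff _ _ _).deriv, dbq_smul, e]; linarith)
    rwa [image_reverse, e] at this
  · exact red hf ht hm hU h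

lemma mass_sArc_eq {p : ℝ × ℝ} {r : ℝ} (a : SArc u v (aff ⁻¹' Metric.ball p r) g)
    (a' : SArc u v (aff ⁻¹' Metric.ball p r) g') (huv : br u v ≠ 0)
    (hU : P.Only Λ.leaves u v (aff ⁻¹' Metric.ball p r)) :
    Λ.μ (g '' Icc 0 1) univ = Λ.μ (g' '' Icc 0 1) univ := by
  have := Λ.μ_homotopy _ (isTransverseHomotopy_mix a a' huv hU)
  simpa only [SArc.mix_zero, SArc.mix_one] using this

/-- Around each point of the leaf, all small arcs crossing the leaf are homotopic, so the atom is
locally constant along the leaf, and the leaf is connected. It is nonzero because the support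
contains the intersection point. -/
lemma exists_wt {ℓ : Set ℍ} (hℓ : ℓ ∈ Λ.leaves) : ∃ w : ENNReal, w ≠ 0 ∧ w ≠ ⊤ ∧
    (∀ c, P.IsTransverseArc Λ.leaves c → ∀ p ∈ c, p ∈ ℓ → Λ.μ c {p} = w) ∧
    ∃ c, P.IsTransverseArc Λ.leaves c ∧ ∃ p ∈ c, p ∈ ℓ := by
  obtain ⟨u, v, huv, rfl⟩ := (Λ.isGeodesic ℓ hℓ).exists_geo
  obtain ⟨k, -, -, hk⟩ := exists_geo_eq_image huv
  rw [geo_act_e] at hk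
  have hγ : Continuous fun t => k • iexp t := ((isometry_smul ℍ k).comp isometry_iexp).continuous
  have hmem : ∀ s, k • iexp s ∈ geo u v := fun s => hk ▸ mem_range_self s
  choose r hr hO using fun s => exists_only Λ.isGeodesic Λ.locFinite Λ.disjoint hℓ
    (Λ.subset_cover _ hℓ (hmem s)) (hmem s)
  choose g hg hgs using fun s => exists_sArc_at huv (hmem s) (hr s)
  set m := fun s => Λ.μ (g s '' Icc 0 1) univ with hm
  have claim : ∀ s, ∀ f t, P.IsTransverseParam Λ.leaves f → t ∈ Icc (0 : ℝ) 1 → f t ∈ geo u v →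
      f t ∈ aff ⁻¹' Metric.ball (aff (k • iexp s)) (r s) → Λ.μ (f '' Icc 0 1) {f t} = m s := by
    intro s f t hf ht htℓ htb
    obtain ⟨g', a, e⟩ := Λ.exists_sArc hf huv hℓ ht htℓ
      ((Metric.isOpen_ball.preimage continuous_aff).mem_nhds htb) (hO s)
    rw [← e]
    exact Λ.mass_sArc_eq a (hg s) huv (hO s)
  have hT := fun s => (hg s).isTransverseParam huv (hO s)
  have half : (1 / 2 : ℝ) ∈ Icc (0 : ℝ) 1 := by norm_num
  have self : ∀ s, k • iexp s ∈ aff ⁻¹' Metric.ball (aff (k • iexp s)) (r s) := fun s =>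
    Metric.mem_ball_self (hr s)
  have hloc : IsLocallyConstant m := by
    rw [IsLocallyConstant.iff_eventually_eq]
    intro s
    have ev := hγ.continuousAt.eventually_mem (ball_mem_nhds_aff (k • iexp s) (hr s))
    filter_upwards [ev] with s' hs'
    have e1 := claim s' (g s') (1 / 2) (hT s') half (by rw [hgs]; exact hmem s')
      (by rw [hgs]; exact self s')
    have e2 := claim s (g s') (1 / 2) (hT s') half (by rw [hgs]; exact hmem s') (by rw [hgs]; exact hs')
    exact e1.symm.trans e2
  refine ⟨m 0, fun h0 => ?_, ?_, fun c hc p hp hpℓ => ?_,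
    ⟨_, ⟨_, hT 0, rfl⟩, g 0 (1 / 2), ⟨_, half, rfl⟩, by rw [hgs]; exact hmem 0⟩⟩
  · have hs := Λ.μ_support _ ⟨_, hT 0, rfl⟩
    rw [Measure.measure_univ_eq_zero.1 h0, Measure.support_zero] at hs
    have : g 0 (1 / 2) ∈ g 0 '' Icc 0 1 ∩ ⋃₀ Λ.leaves :=
      ⟨⟨_, half, rfl⟩, _, hℓ, by rw [hgs]; exact hmem 0⟩
    rw [← hs] at this
    exact this
  · have := Λ.μ_finite (g 0 '' Icc 0 1)
    exact measure_ne_top _ _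
  · obtain ⟨f, hf, rfl⟩ := hc
    obtain ⟨t, ht, rfl⟩ := hp
    obtain ⟨s, hs⟩ : f t ∈ range fun t => k • iexp t := hk ▸ hpℓ
    have := claim s f t hf ht hpℓ (by rw [← hs]; exact self s)
    rw [this, hloc.apply_eq_of_preconnectedSpace s 0]

open Classical in
/-- The transverse measure of a leaf. -/
def wt (ℓ : Set ℍ) : ENNReal := if h : ℓ ∈ Λ.leaves then (Λ.exists_wt h).choose else 0

variable {Λ} {ℓ : Set ℍ}

lemma wt_spec (h : ℓ ∈ Λ.leaves) : Λ.wt ℓ ≠ 0 ∧ Λ.wt ℓ ≠ ⊤ ∧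
    (∀ c, P.IsTransverseArc Λ.leaves c → ∀ p ∈ c, p ∈ ℓ → Λ.μ c {p} = Λ.wt ℓ) ∧
    ∃ c, P.IsTransverseArc Λ.leaves c ∧ ∃ p ∈ c, p ∈ ℓ := by
  rw [wt, dif_pos h]
  exact (Λ.exists_wt h).choose_spec

lemma wt_of_not_mem (h : ℓ ∉ Λ.leaves) : Λ.wt ℓ = 0 := by rw [wt, dif_neg h]

lemma wt_ne_zero_iff : Λ.wt ℓ ≠ 0 ↔ ℓ ∈ Λ.leaves :=
  ⟨fun h => by by_contra h'; exact h (wt_of_not_mem h'), fun h => (wt_spec h).1⟩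

lemma wt_ne_top (Λ : P.MeasuredLamination) (ℓ : Set ℍ) : Λ.wt ℓ ≠ ⊤ := by
  by_cases h : ℓ ∈ Λ.leaves
  · exact (wt_spec h).2.1
  · rw [wt_of_not_mem h]; exact ENNReal.zero_ne_top

/-- The support meets a transverse arc in finitely many points, so the measure is a finite sum of
atoms. -/
lemma measure_eq_sum (Λ : P.MeasuredLamination) {c : Set ℍ} (hc : P.IsTransverseArc Λ.leaves c)
    (A : Set ℍ) : ∃ S : Finset ℍ, (∀ p, p ∈ S ↔ p ∈ A ∩ (c ∩ ⋃₀ Λ.leaves)) ∧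
      Λ.μ c A = ∑ p ∈ S, Λ.μ c {p} := by
  obtain ⟨f, hf, rfl⟩ := hc
  have hfin := hf.finite_inter_support Λ.isGeodesic Λ.locFinite
  set S := f '' Icc 0 1 ∩ ⋃₀ Λ.leaves with hS
  refine ⟨(hfin.subset (s := S) (t := A ∩ S) inter_subset_right).toFinset, by simp [hS], ?_⟩
  rw [sum_measure_singleton, Set.Finite.coe_toFinset]
  refine le_antisymm ?_ (measure_mono inter_subset_left)
  have h0 : Λ.μ (f '' Icc 0 1) (A \ S) = 0 := by
    refine measure_mono_null ?_ Measure.measure_compl_support (μ := Λ.μ (f '' Icc 0 1))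
    rw [Λ.μ_support _ ⟨f, hf, rfl⟩]
    exact fun z hz => hz.2
  calc Λ.μ (f '' Icc 0 1) A = Λ.μ (f '' Icc 0 1) (A ∩ S ∪ A \ S) := by rw [inter_union_sdiff]
    _ ≤ Λ.μ (f '' Icc 0 1) (A ∩ S) + Λ.μ (f '' Icc 0 1) (A \ S) := measure_union_le _ _
    _ = _ := by rw [h0, add_zero]

/-- A measured lamination is determined by its leaves and their weights. -/
theorem ext_wt {Λ Λ' : P.MeasuredLamination} (h : ∀ ℓ, Λ.wt ℓ = Λ'.wt ℓ) : Λ = Λ' := by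
  have hl : Λ.leaves = Λ'.leaves := by
    ext ℓ
    rw [← wt_ne_zero_iff, h, wt_ne_zero_iff]
  have hμ : Λ.μ = Λ'.μ := by
    funext c
    by_cases hc : P.IsTransverseArc Λ.leaves c
    · have hc' : P.IsTransverseArc Λ'.leaves c := hl ▸ hc
      ext A -
      obtain ⟨S, h1, h2⟩ := Λ.measure_eq_sum hc A
      obtain ⟨S', h1', h2'⟩ := Λ'.measure_eq_sum hc' A
      have hSS : S = S' := by ext p; rw [h1, h1', hl]
      rw [h2, h2', hSS]
      refine Finset.sum_congr rfl fun p hp => ?_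
      obtain ⟨-, hpc, ℓ, hℓ, hpℓ⟩ := (h1' p).1 hp
      rw [(wt_spec hℓ).2.2.1 c hc' p hpc hpℓ, ← h,
        (wt_spec (hl.symm ▸ hℓ : ℓ ∈ Λ.leaves)).2.2.1 c hc p hpc hpℓ]
    · rw [Λ.μ_junk c hc, Λ'.μ_junk c (hl ▸ hc)]
  cases Λ
  cases Λ'
  simp only at hl hμ
  subst hl hμ
  rfl

lemma image_mem_leaves_iff (g : FreeGroup (Fin 2)) :
    (fun z => P.hol g • z) '' ℓ ∈ Λ.leaves ↔ ℓ ∈ Λ.leaves := by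
  refine ⟨fun h => ?_, Λ.leaves_invariant g ℓ⟩
  have := Λ.leaves_invariant g⁻¹ _ h
  rw [image_image] at this
  simpa using this

lemma wt_image (g : FreeGroup (Fin 2)) : Λ.wt ((fun z => P.hol g • z) '' ℓ) = Λ.wt ℓ := by
  by_cases h : ℓ ∈ Λ.leaves
  · obtain ⟨h1, -, h3, c, hc, p, hp, hpℓ⟩ := wt_spec h
    have h' := Λ.leaves_invariant g ℓ h
    have hinj : Function.Injective fun z : ℍ => P.hol g • z := MulAction.injective (P.hol g)
    have hmeas : Measurable fun z : ℍ => P.hol g • z := (continuous_const_smul (P.hol g)).measurable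
    have e : Λ.μ ((fun z => P.hol g • z) '' c) {P.hol g • p} = Λ.wt ℓ := by
      rw [Λ.μ_invariant, Measure.map_apply hmeas (measurableSet_singleton _), ← h3 c hc p hp hpℓ]
      congr 1
      ext z
      simp
    -- Otherwise the translated measure would be zero by convention, against the nonzero atom in
    -- `e`.
    have hc' : P.IsTransverseArc Λ.leaves ((fun z => P.hol g • z) '' c) := by
      by_contra hcon
      rw [Λ.μ_junk _ hcon] at e
      exact h1 e.symm
    rw [← e]
    exact ((wt_spec h').2.2.1 _ hc' _ ⟨p, hp, rfl⟩ ⟨p, hpℓ, rfl⟩).symm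
  · rw [wt_of_not_mem h, wt_of_not_mem (mt (image_mem_leaves_iff g).1 h)]

end MeasuredLamination

end HyperbolicPants

/-! ### Continuation of nondegenerate zeros -/

/-- A family of functions on `[0,1]` with nondegenerate zeros. -/
structure ZeroFamily (φ ψ : ℝ → ℝ → ℝ) : Prop where
  cont : Continuous fun p : ℝ × ℝ => φ p.1 p.2
  cont_deriv : Continuous fun p : ℝ × ℝ => ψ p.1 p.2
  deriv : ∀ s t, HasDerivAt (φ s) (ψ s t) t
  ne : ∀ s ∈ Icc (0 : ℝ) 1, ∀ t ∈ Icc (0 : ℝ) 1, φ s t = 0 → ψ s t ≠ 0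
  left : ∀ s ∈ Icc (0 : ℝ) 1, (φ s 0 = 0 ↔ φ 0 0 = 0)
  right : ∀ s ∈ Icc (0 : ℝ) 1, (φ s 1 = 0 ↔ φ 0 1 = 0)

namespace ZeroFamily

variable {φ ψ : ℝ → ℝ → ℝ}

lemma neg (h : ZeroFamily φ ψ) : ZeroFamily (fun s t => -φ s t) (fun s t => -ψ s t) where
  cont := h.cont.neg
  cont_deriv := h.cont_deriv.neg
  deriv s t := (h.deriv s t).neg
  ne s hs t ht h0 := neg_ne_zero.2 (h.ne s hs t ht (neg_eq_zero.1 h0))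
  left s hs := by simpa using h.left s hs
  right s hs := by simpa using h.right s hs

/-- On a small interval the functions stay strictly monotone, and the intermediate value theorem
provides the zero. At an endpoint of `[0, 1]` the zero cannot enter or leave, because being zero
there does not depend on `s`. -/
lemma exists_unique_near (h : ZeroFamily φ ψ) {s₀ t₀ : ℝ} (hs : s₀ ∈ Icc (0 : ℝ) 1)
    (ht : t₀ ∈ Icc (0 : ℝ) 1) (h0 : φ s₀ t₀ = 0) {U : Set ℝ} (hU : U ∈ 𝓝 t₀) :
    ∃ V ⊆ U, IsOpen V ∧ t₀ ∈ V ∧ ∀ᶠ s in 𝓝[Icc 0 1] s₀, ∃ t ∈ V ∩ Icc 0 1, φ s t = 0 ∧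
      ∀ t' ∈ V ∩ Icc 0 1, φ s t' = 0 → t' = t := by
  wlog hpos : 0 < ψ s₀ t₀ generalizing φ ψ with H
  · have hneg : ψ s₀ t₀ < 0 := lt_of_le_of_ne (not_lt.1 hpos) (h.ne s₀ hs t₀ ht h0)
    simpa using H h.neg (by simpa using h0) (neg_pos.2 hneg)
  have ev := h.cont_deriv.continuousAt.eventually_mem (x := (s₀, t₀)) (Ioi_mem_nhds hpos)
  rw [nhds_prod_eq] at ev
  obtain ⟨pa, ha, pb, hb, hab⟩ := eventually_prod_iff.1 ev
  have hin : ∀ᶠ t in 𝓝 t₀, t ∈ U ∧ pb t ∧ (t₀ ∈ Ioo (0 : ℝ) 1 → t ∈ Ioo (0 : ℝ) 1) := by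
    refine (eventually_mem_set.2 hU).and (hb.and ?_)
    by_cases hi : t₀ ∈ Ioo (0 : ℝ) 1
    · filter_upwards [isOpen_Ioo.mem_nhds hi] with t ht _ using ht
    · exact Eventually.of_forall fun t h => absurd h hi
  obtain ⟨δ, hδ, hball⟩ := Metric.nhds_basis_closedBall.mem_iff.1 hin
  rw [Real.closedBall_eq_Icc] at hball
  have hmono : ∀ s, pa s → StrictMonoOn (φ s) (Icc (t₀ - δ) (t₀ + δ)) := fun s hs => by
    refine strictMonoOn_of_deriv_pos (convex_Icc _ _)
      (fun t _ => (h.deriv s t).continuousAt.continuousWithinAt) fun t ht => ?_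
    rw [interior_Icc] at ht
    rw [(h.deriv s t).deriv]
    exact hab hs (hball ⟨ht.1.le, ht.2.le⟩).2.1
  have hI : t₀ ∈ Icc (t₀ - δ) (t₀ + δ) := ⟨by linarith, by linarith⟩
  have hl : t₀ - δ ∈ Icc (t₀ - δ) (t₀ + δ) := ⟨by linarith, by linarith⟩
  have hr : t₀ + δ ∈ Icc (t₀ - δ) (t₀ + δ) := ⟨by linarith, by linarith⟩
  have hcs : ∀ t, Continuous fun s => φ s t := fun t =>
    h.cont.comp (continuous_id.prodMk continuous_const)
  have ev1 : ∀ᶠ s in 𝓝 s₀, φ s (t₀ - δ) < 0 := (hcs _).continuousAt.eventually_lt_const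
    (h0 ▸ hmono s₀ ha.self_of_nhds hl hI (by linarith))
  have ev2 : ∀ᶠ s in 𝓝 s₀, 0 < φ s (t₀ + δ) := (hcs _).continuousAt.eventually_const_lt
    (h0 ▸ hmono s₀ ha.self_of_nhds hI hr (by linarith))
  refine ⟨Ioo (t₀ - δ) (t₀ + δ), fun t ht => (hball ⟨ht.1.le, ht.2.le⟩).1, isOpen_Ioo,
    ⟨by linarith, by linarith⟩, ?_⟩
  filter_upwards [nhdsWithin_le_nhds ha, nhdsWithin_le_nhds ev1, nhdsWithin_le_nhds ev2,
    self_mem_nhdsWithin] with s pas hs1 hs2 hsI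
  have uniq : ∀ t ∈ Ioo (t₀ - δ) (t₀ + δ), φ s t = 0 →
      ∀ t' ∈ Ioo (t₀ - δ) (t₀ + δ) ∩ Icc 0 1, φ s t' = 0 → t' = t := fun t ht h1 t' ht' h2 =>
    (hmono s pas).injOn ⟨ht'.1.1.le, ht'.1.2.le⟩ ⟨ht.1.le, ht.2.le⟩ (h2.trans h1.symm)
  have hI' : t₀ ∈ Ioo (t₀ - δ) (t₀ + δ) := ⟨by linarith, by linarith⟩
  by_cases hi : t₀ ∈ Ioo (0 : ℝ) 1
  · obtain ⟨t, ht, hz⟩ := intermediate_value_Icc (by linarith : t₀ - δ ≤ t₀ + δ)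
      (fun t _ => (h.deriv s t).continuousAt.continuousWithinAt) ⟨hs1.le, hs2.le⟩
    have ht' : t ∈ Ioo (t₀ - δ) (t₀ + δ) := by
      refine ⟨lt_of_le_of_ne ht.1 ?_, lt_of_le_of_ne ht.2 ?_⟩
      · rintro rfl; exact hs1.ne hz
      · rintro rfl; exact hs2.ne' hz
    have := (hball ht).2.2 hi
    exact ⟨t, ⟨ht', this.1.le, this.2.le⟩, hz, uniq t ht' hz⟩
  · refine ⟨t₀, ⟨hI', ht⟩, ?_, uniq t₀ hI' ?_⟩ <;>
    · have : t₀ = 0 ∨ t₀ = 1 := by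
        rw [mem_Ioo, not_and_or, not_lt, not_lt] at hi
        exact hi.imp (fun h => le_antisymm h ht.1) fun h => le_antisymm ht.2 h
      rcases this with rfl | rfl
      · exact (h.left s hsI).2 ((h.left s₀ hs).1 h0)
      · exact (h.right s hsI).2 ((h.right s₀ hs).1 h0)

/-- The zeros at time `s`. -/
def zeros (φ : ℝ → ℝ → ℝ) (s : ℝ) : Set ℝ := {t ∈ Icc (0 : ℝ) 1 | φ s t = 0}

lemma finite_zeros (h : ZeroFamily φ ψ) {s : ℝ} (hs : s ∈ Icc (0 : ℝ) 1) : (zeros φ s).Finite := by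
  have hc : Continuous (φ s) := continuous_iff_continuousAt.2 fun t => (h.deriv s t).continuousAt
  have hcl : IsClosed (zeros φ s) := isClosed_Icc.inter (isClosed_eq hc continuous_const)
  refine (isCompact_Icc.of_isClosed_subset hcl fun t ht => ht.1).finite ?_
  refine isDiscrete_iff_discreteTopology.2 (discreteTopology_subtype_iff.2 fun t ht => ?_)
  rw [inf_principal_eq_bot]
  filter_upwards [(h.deriv s t).eventually_ne (c := 0) (h.ne s hs t ht.1 ht.2)] with x hx hx'
  exact hx hx'.2

/-- Each zero continues uniquely in its own neighbourhood, and by compactness no new zeros appear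
elsewhere. -/
lemma eventually_encard (h : ZeroFamily φ ψ) {s₀ : ℝ} (hs : s₀ ∈ Icc (0 : ℝ) 1) :
    ∀ᶠ s in 𝓝[Icc 0 1] s₀, (zeros φ s).encard = (zeros φ s₀).encard := by
  have hfin := h.finite_zeros hs
  obtain ⟨U, hU, hdis⟩ := hfin.t2_separation
  choose! V hVU hVo hVm hV using fun t (ht : t ∈ zeros φ s₀) =>
    h.exists_unique_near hs ht.1 ht.2 ((hU t).2.mem_nhds (hU t).1)
  have ev1 : ∀ᶠ s in 𝓝[Icc 0 1] s₀, ∀ t₀ ∈ zeros φ s₀, ∃ t ∈ V t₀ ∩ Icc 0 1, φ s t = 0 ∧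
      ∀ t' ∈ V t₀ ∩ Icc 0 1, φ s t' = 0 → t' = t := (eventually_all_finite hfin).2 hV
  have hR : IsCompact (Icc (0 : ℝ) 1 \ ⋃ t₀ ∈ zeros φ s₀, V t₀) :=
    isCompact_Icc.diff (isOpen_biUnion hVo)
  have ev2 : ∀ᶠ s in 𝓝 s₀, ∀ t ∈ Icc (0 : ℝ) 1 \ ⋃ t₀ ∈ zeros φ s₀, V t₀, φ s t ≠ 0 := by
    refine hR.eventually_forall_of_forall_eventually fun t ht => ?_
    refine h.cont.continuousAt.eventually_ne (x := (s₀, t)) fun h0 => ht.2 ?_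
    exact mem_biUnion (x := t) ⟨ht.1, h0⟩ (hVm t ⟨ht.1, h0⟩)
  filter_upwards [ev1, nhdsWithin_le_nhds ev2] with s h1 h2
  choose! β hβ hβ0 hβu using h1
  have hinj : InjOn β (zeros φ s₀) := fun t ht t' ht' e => by
    by_contra hne
    refine Set.disjoint_left.1 (hdis ht ht' hne) (hVU t ht (hβ t ht).1) ?_
    rw [e]
    exact hVU t' ht' (hβ t' ht').1
  have himg : β '' zeros φ s₀ = zeros φ s := by
    ext t
    constructor
    · rintro ⟨t₀, ht₀, rfl⟩
      exact ⟨(hβ t₀ ht₀).2, hβ0 t₀ ht₀⟩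
    · intro ht
      by_cases hm : t ∈ ⋃ t₀ ∈ zeros φ s₀, V t₀
      · obtain ⟨t₀, ht₀, hm⟩ := mem_iUnion₂.1 hm
        exact ⟨t₀, ht₀, (hβu t₀ ht₀ t ⟨hm, ht.1⟩ ht.2).symm⟩
      · exact absurd ht.2 (h2 t ⟨ht.1, hm⟩)
  rw [← himg, hinj.encard_image]

theorem encard_zeros_eq (h : ZeroFamily φ ψ) : (zeros φ 0).encard = (zeros φ 1).encard := by
  have hloc : IsLocallyConstant fun s : Icc (0 : ℝ) 1 => (zeros φ s).encard := by
    rw [IsLocallyConstant.iff_eventually_eq]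
    intro s
    have := h.eventually_encard s.2
    rw [nhdsWithin_eq_map_subtype_coe s.2] at this
    exact this
  have := Subtype.preconnectedSpace (isPreconnected_Icc (a := (0 : ℝ)) (b := 1))
  exact hloc.apply_eq_of_preconnectedSpace ⟨0, by simp⟩ ⟨1, by simp⟩

end ZeroFamily

namespace HyperbolicPants

variable {P : HyperbolicPants} {𝓛 : Set (Set ℍ)}

/-- Transversality says that the zeros of `bq` along the arcs are nondegenerate, and the stratum
conditions are the endpoint conditions of a `ZeroFamily`. -/
lemma IsTransverseHomotopy.encard_inter {F : ℝ × ℝ → ℍ} (hF : P.IsTransverseHomotopy 𝓛 F) {u v : V2}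
    (huv : br u v ≠ 0) (hℓ : geo u v ∈ 𝓛) :
    ((fun t => F (0, t)) '' Icc 0 1 ∩ geo u v).encard =
      ((fun t => F (1, t)) '' Icc 0 1 ∩ geo u v).encard := by
  have hFc : Continuous F := UpperHalfPlane.isEmbedding_coe.continuous_iff.2 hF.contDiff.continuous
  have hslice : ∀ s, ContDiff ℝ 1 fun t => (F (s, t) : ℂ) := fun s =>
    hF.contDiff.comp (contDiff_const.prodMk contDiff_id)
  have hder : ∀ p : ℝ × ℝ, deriv (fun t => (F (p.1, t) : ℂ)) p.2 =
      fderiv ℝ (fun p => (F p : ℂ)) p (0, 1) := fun p => by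
    have h1 : HasDerivAt (fun t : ℝ => (p.1, t)) ((0, 1) : ℝ × ℝ) p.2 :=
      (hasDerivAt_const p.2 p.1).prodMk (hasDerivAt_id p.2)
    have h2 : HasFDerivAt (fun p => (F p : ℂ)) (fderiv ℝ (fun p => (F p : ℂ)) p) (p.1, p.2) :=
      (hF.contDiff.differentiable one_ne_zero p).hasFDerivAt
    exact (h2.comp_hasDerivAt p.2 h1).deriv
  have Z : ZeroFamily (fun s t => bq (F (s, t)) u v)
      (fun s t => dbq (F (s, t)) u v (deriv (fun t => (F (s, t) : ℂ)) t)) := by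
    refine ⟨(continuous_bq u v).comp hFc, ?_, fun s t => hasDerivAt_bq (hasDerivAt_coe (hslice s) t) u v,
      fun s hs t ht h0 => (hF.transverse s hs).dbq_ne_zero huv hℓ ht h0,
      fun s hs => hF.left_stratum s hs _ hℓ, fun s hs => hF.right_stratum s hs _ hℓ⟩
    simp only [hder]
    have hc := (hF.contDiff.continuous_fderiv one_ne_zero).clm_apply
      (continuous_const (y := ((0, 1) : ℝ × ℝ)))
    have hr' := Complex.continuous_re.comp hc
    have hi' := Complex.continuous_im.comp hc
    have hr := Complex.continuous_re.comp hF.contDiff.continuous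
    have hi := Complex.continuous_im.comp hF.contDiff.continuous
    exact (continuous_const.mul ((hr.mul hr').add (hi.mul hi'))).sub (continuous_const.mul hr')
  have key : ∀ s ∈ Icc (0 : ℝ) 1, ((fun t => F (s, t)) '' Icc 0 1 ∩ geo u v).encard =
      (ZeroFamily.zeros (fun s t => bq (F (s, t)) u v) s).encard := fun s hs => by
    have hinj : InjOn (fun t => F (s, t)) (ZeroFamily.zeros (fun s t => bq (F (s, t)) u v) s) :=
      (hF.transverse s hs).injOn.mono fun t ht => ht.1
    rw [← hinj.encard_image]
    congr 1
    ext z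
    constructor
    · rintro ⟨⟨t, ht, rfl⟩, hz⟩
      exact ⟨t, ⟨ht, hz⟩, rfl⟩
    · rintro ⟨t, ht, rfl⟩
      exact ⟨⟨t, ht.1, rfl⟩, ht.2⟩
  rw [key 0 (by simp), key 1 (by simp), Z.encard_zeros_eq]

end HyperbolicPants

namespace HyperbolicPants

/-! ### Laminations with given weights -/

/-- A locally finite invariant system of weighted disjoint geodesics. -/
structure WtSys (P : HyperbolicPants) where
  w : Set ℍ → ENNReal
  ne_top : ∀ ℓ, w ℓ ≠ ⊤
  isGeodesic : ∀ ℓ, w ℓ ≠ 0 → IsCompleteGeodesic ℓ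
  subset_cover : ∀ ℓ, w ℓ ≠ 0 → ℓ ⊆ P.cover
  disjoint : ∀ ℓ, w ℓ ≠ 0 → ∀ ℓ', w ℓ' ≠ 0 → ℓ ≠ ℓ' → Disjoint ℓ ℓ'
  locFinite : P.LocFinite {ℓ | w ℓ ≠ 0}
  inv : ∀ g ℓ, w ((fun z => P.hol g • z) '' ℓ) = w ℓ

namespace WtSys

variable {P : HyperbolicPants} (W : P.WtSys)

/-- The geodesics of non-zero weight. -/
def leaves : Set (Set ℍ) := {ℓ | W.w ℓ ≠ 0}

/-- The weighted counting measure of the intersections with the leaves. -/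
def cnt (c : Set ℍ) : Measure ℍ :=
  Measure.sum fun ℓ : Set ℍ => W.w ℓ • (Measure.count.restrict (c ∩ ℓ))

lemma cnt_apply (c : Set ℍ) {A : Set ℍ} (hA : MeasurableSet A) :
    W.cnt c A = ∑' ℓ, W.w ℓ * Measure.count (A ∩ (c ∩ ℓ)) := by
  rw [cnt, Measure.sum_apply _ hA]
  refine tsum_congr fun ℓ => ?_
  rw [Measure.smul_apply, Measure.restrict_apply hA, smul_eq_mul]

variable {W}

lemma finite_inter {c : Set ℍ} (hc : P.IsTransverseArc W.leaves c) : (c ∩ ⋃₀ W.leaves).Finite := by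
  obtain ⟨f, hf, rfl⟩ := hc
  exact hf.finite_inter_support W.isGeodesic W.locFinite

lemma cnt_inter (c : Set ℍ) (hc : P.IsTransverseArc W.leaves c) {ℓ : Set ℍ} (h : ℓ ∈ W.leaves) :
    (c ∩ ℓ).Finite := (finite_inter hc).subset fun _ hz => ⟨hz.1, ℓ, h, hz.2⟩

lemma isFinite_cnt {c : Set ℍ} (hc : P.IsTransverseArc W.leaves c) : IsFiniteMeasure (W.cnt c) := by
  refine ⟨?_⟩
  rw [cnt_apply _ _ MeasurableSet.univ]
  simp only [univ_inter]
  obtain ⟨f, hf, rfl⟩ := id hc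
  have hfin : {ℓ ∈ W.leaves | (ℓ ∩ f '' Icc 0 1).Nonempty}.Finite :=
    W.locFinite _ hf.isCompact_image hf.image_subset_cover
  rw [tsum_eq_sum (s := hfin.toFinset)]
  · refine ENNReal.sum_lt_top.2 fun ℓ hℓ => ?_
    have hm : ℓ ∈ W.leaves := ((Set.Finite.mem_toFinset _).1 hℓ).1
    exact ENNReal.mul_lt_top (W.ne_top ℓ).lt_top
      (Measure.count_apply_lt_top.2 (cnt_inter _ hc hm))
  · intro ℓ hℓ
    rw [Set.Finite.mem_toFinset] at hℓ
    by_cases h0 : W.w ℓ = 0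
    · rw [h0, zero_mul]
    · have : f '' Icc 0 1 ∩ ℓ = ∅ := by
        by_contra hne
        exact hℓ ⟨h0, by rw [inter_comm]; exact nonempty_iff_ne_empty.2 hne⟩
      rw [this, measure_empty, mul_zero]

lemma cnt_singleton {c : Set ℍ} {p : ℍ} (hp : p ∈ c) {ℓ : Set ℍ}
    (hℓ : ℓ ∈ W.leaves) (hpℓ : p ∈ ℓ) : W.cnt c {p} = W.w ℓ := by
  rw [cnt_apply _ _ (measurableSet_singleton p), tsum_eq_single ℓ]
  · rw [inter_eq_left.2 (singleton_subset_iff.2 (show p ∈ c ∩ ℓ from ⟨hp, hpℓ⟩)), Measure.count_singleton, mul_one]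
  · intro ℓ' hne
    by_cases h0 : W.w ℓ' = 0
    · rw [h0, zero_mul]
    · have : {p} ∩ (c ∩ ℓ') = ∅ := by
        refine eq_empty_of_forall_notMem ?_
        rintro z ⟨rfl, -, hz⟩
        exact Set.disjoint_left.1 (W.disjoint ℓ' h0 ℓ hℓ hne) hz hpℓ
      rw [this, measure_empty, mul_zero]

lemma support_cnt {c : Set ℍ} (hc : P.IsTransverseArc W.leaves c) :
    (W.cnt c).support = c ∩ ⋃₀ W.leaves := by
  ext p
  constructor
  · intro hp
    by_contra hcon
    have hcl := (finite_inter hc).isClosed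
    rw [Measure.mem_support_iff_forall] at hp
    refine (hp _ (hcl.isOpen_compl.mem_nhds hcon)).ne' ?_
    rw [cnt_apply _ _ hcl.isOpen_compl.measurableSet, ENNReal.tsum_eq_zero]
    intro ℓ
    by_cases h0 : W.w ℓ = 0
    · rw [h0, zero_mul]
    · have : (c ∩ ⋃₀ W.leaves)ᶜ ∩ (c ∩ ℓ) = ∅ := by
        refine eq_empty_of_forall_notMem ?_
        rintro z ⟨h1, h2, h3⟩
        exact h1 ⟨h2, ℓ, h0, h3⟩
      rw [this, measure_empty, mul_zero]
  · rintro ⟨hp, ℓ, hℓ, hpℓ⟩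
    rw [Measure.mem_support_iff_forall]
    intro U hU
    refine lt_of_lt_of_le (pos_iff_ne_zero.2 hℓ) ?_
    rw [← cnt_singleton hp hℓ hpℓ]
    exact measure_mono (singleton_subset_iff.2 (mem_of_mem_nhds hU))

lemma restrict_cnt {c c' : Set ℍ} (hm : MeasurableSet c') (h : c' ⊆ c) :
    W.cnt c' = (W.cnt c).restrict c' := by
  rw [cnt, cnt, Measure.restrict_sum _ hm]
  congr 1
  funext ℓ
  rw [Measure.restrict_smul, Measure.restrict_restrict hm, ← inter_assoc, inter_eq_left.2 h]

lemma count_smul_image (g : SL(2, ℝ)) (A : Set ℍ) :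
    (Measure.count ((fun z => g • z) '' A) : ENNReal) = Measure.count A :=
  Measure.count_injective_image (MulAction.injective g) A

lemma cnt_image (g : FreeGroup (Fin 2)) (c : Set ℍ) :
    W.cnt ((fun z => P.hol g • z) '' c) = (W.cnt c).map (fun z => P.hol g • z) := by
  have hinj : Function.Injective fun z : ℍ => P.hol g • z := MulAction.injective (P.hol g)
  have hmeas : Measurable fun z : ℍ => P.hol g • z := (continuous_const_smul (P.hol g)).measurable
  have hcancel : ∀ (h : SL(2, ℝ)) (ℓ : Set ℍ), (fun z => h⁻¹ • z) '' ((fun z => h • z) '' ℓ) = ℓ :=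
    fun h ℓ => by rw [image_image]; simp
  let e : Set ℍ ≃ Set ℍ :=
    { toFun := fun ℓ => (fun z => P.hol g • z) '' ℓ
      invFun := fun ℓ => (fun z => (P.hol g)⁻¹ • z) '' ℓ
      left_inv := fun ℓ => hcancel _ ℓ
      right_inv := fun ℓ => by simpa using hcancel (P.hol g)⁻¹ ℓ }
  ext A hA
  rw [Measure.map_apply hmeas hA, cnt_apply _ _ hA, cnt_apply _ _ (hmeas hA), ← e.tsum_eq]
  refine tsum_congr fun ℓ => ?_
  change W.w ((fun z => P.hol g • z) '' ℓ) * _ = _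
  rw [W.inv, ← count_smul_image (P.hol g) (_ ∩ (c ∩ ℓ)), image_inter hinj, image_inter hinj,
    image_preimage_eq _ (MulAction.surjective (P.hol g))]
  rfl

/-- By `bq_smul'` the two functions along the arc differ by the positive factor `dn`, so at a common
zero their derivatives vanish together. -/
lemma _root_.PantsLamination.dbq_eq_zero_of_smul {f : ℝ → ℍ} (hf : ContDiff ℝ 1 (fun t => (f t : ℂ)))
    (g : SL(2, ℝ)) {u v : V2} {t : ℝ} (hz : g • f t ∈ geo u v)
    (h : dbq (g • f t) u v (deriv (fun t => ((g • f t : ℍ) : ℂ)) t) = 0) :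
    dbq (f t) (act g⁻¹ u) (act g⁻¹ v) (deriv (fun t => (f t : ℂ)) t) = 0 := by
  have d1 := hasDerivAt_bq (hasDerivAt_coe (contDiff_smul hf g) t) u v
  rw [h] at d1
  have d2 := hasDerivAt_bq (hasDerivAt_coe hf t) (act g⁻¹ u) (act g⁻¹ v)
  have d3 : HasDerivAt (fun t => dn g (f t)) _ t :=
    ((((hasDerivAt_re (hasDerivAt_coe hf t)).const_mul _).add_const _).fun_pow 2).add
      (((hasDerivAt_im (hasDerivAt_coe hf t)).const_mul _).fun_pow 2)
  have e : ∀ s, bq (f s) (act g⁻¹ u) (act g⁻¹ v) = dn g (f s) * bq (g • f s) u v := fun s => by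
    rw [bq_smul', mul_div_cancel₀ _ (dn_pos _ _).ne']
  have d4 := d3.mul d1
  rw [mul_zero, add_zero, show bq (g • f t) u v = 0 from hz, mul_zero] at d4
  exact d2.unique (d4.congr_of_eventuallyEq (Eventually.of_forall e))

lemma isTransverseParam_smul {f : ℝ → ℍ} (hf : P.IsTransverseParam W.leaves f)
    (g : FreeGroup (Fin 2)) : P.IsTransverseParam W.leaves (fun t => P.hol g • f t) := by
  have hd := fun t => hasDerivAt_smul (hasDerivAt_coe hf.contDiff t) (P.hol g)
  refine isTransverseParam_of (contDiff_smul hf.contDiff _)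
    (fun t ht t' ht' e => hf.injOn ht ht' (MulAction.injective (P.hol g) e))
    (fun t ht => Model.smul_mem_cover g (hf.mem_cover t ht)) (fun t ht => ?_) fun t ht ℓ hℓ hm => ?_
  · rw [(hd t).deriv]
    exact div_ne_zero (hf.regular t ht) (pow_ne_zero _ (denom_ne_zero' _ _))
  · obtain ⟨u, v, huv, rfl⟩ := (W.isGeodesic ℓ hℓ).exists_geo
    refine ⟨u, v, huv, rfl, fun h0 => ?_⟩
    have hmg := hm
    rw [mem_geo_smul'] at hm
    have hm' : geo (act (P.hol g)⁻¹ u) (act (P.hol g)⁻¹ v) ∈ W.leaves := by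
      rw [← image_geo, ← map_inv]
      change W.w _ ≠ 0
      rw [W.inv]
      exact hℓ
    have huv' : br (act (P.hol g)⁻¹ u) (act (P.hol g)⁻¹ v) ≠ 0 := by rwa [br_act]
    exact hf.dbq_ne_zero huv' hm' ht hm (dbq_eq_zero_of_smul hf.contDiff _ hmg h0)

variable (W) in
open Classical in
/-- The measured lamination with given weights. -/
def lamination : P.MeasuredLamination where
  leaves := W.leaves
  isGeodesic := W.isGeodesic
  subset_cover := W.subset_cover
  disjoint ℓ h ℓ' h' := W.disjoint ℓ h ℓ' h'
  closed := by
    rintro p ⟨hp, hc⟩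
    obtain ⟨U, hU, -, h⟩ := exists_leaf_nhds W.isGeodesic W.locFinite hc
    obtain ⟨z, hz, ℓ, hℓ, hzℓ⟩ := mem_closure_iff_nhds.1 hp U hU
    exact ⟨ℓ, hℓ, h ℓ hℓ ⟨z, hzℓ, hz⟩⟩
  leaves_invariant g ℓ h := by
    change W.w _ ≠ 0
    rw [W.inv]
    exact h
  μ c := if P.IsTransverseArc W.leaves c then W.cnt c else 0
  μ_junk c hc := if_neg hc
  μ_finite c := by
    split_ifs with hc
    · exact isFinite_cnt hc
    · infer_instance
  μ_support c hc := by rw [if_pos hc]; exact support_cnt hc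
  μ_restrict c c' hc hc' h := by
    rw [if_pos hc, if_pos hc']
    obtain ⟨f, hf, rfl⟩ := hc'
    exact restrict_cnt hf.isCompact_image.measurableSet h
  μ_homotopy F hF := by
    rw [if_pos ⟨_, hF.transverse 0 (by simp), rfl⟩, if_pos ⟨_, hF.transverse 1 (by simp), rfl⟩,
      cnt_apply _ _ MeasurableSet.univ, cnt_apply _ _ MeasurableSet.univ]
    refine tsum_congr fun ℓ => ?_
    by_cases h0 : W.w ℓ = 0
    · rw [h0, zero_mul, zero_mul]
    · obtain ⟨u, v, huv, rfl⟩ := (W.isGeodesic ℓ h0).exists_geo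
      have := hF.encard_inter huv h0
      have h1 := cnt_inter _ ⟨_, hF.transverse 0 (by simp), rfl⟩ h0
      have h2 := cnt_inter _ ⟨_, hF.transverse 1 (by simp), rfl⟩ h0
      rw [univ_inter, univ_inter, Measure.count_apply h1.measurableSet,
        Measure.count_apply h2.measurableSet, this]
  μ_invariant g c := by
    have hiff : P.IsTransverseArc W.leaves ((fun z => P.hol g • z) '' c) ↔
        P.IsTransverseArc W.leaves c := by
      have himp : ∀ g c, P.IsTransverseArc W.leaves c →
          P.IsTransverseArc W.leaves ((fun z => P.hol g • z) '' c) := by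
        rintro g _ ⟨f, hf, rfl⟩
        exact ⟨_, isTransverseParam_smul hf g, (image_image _ _ _).symm⟩
      refine ⟨fun h => ?_, himp g c⟩
      have := himp g⁻¹ _ h
      rw [image_image] at this
      simpa using this
    by_cases hc : P.IsTransverseArc W.leaves c
    · rw [if_pos hc, if_pos (hiff.2 hc), cnt_image]
    · rw [if_neg hc, if_neg (mt hiff.1 hc), Measure.map_zero]

lemma wt_lamination (ℓ : Set ℍ) : W.lamination.wt ℓ = W.w ℓ := by
  by_cases h : ℓ ∈ W.lamination.leaves
  · obtain ⟨-, -, h3, c, hc, p, hp, hpℓ⟩ := MeasuredLamination.wt_spec h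
    rw [← h3 c hc p hp hpℓ]
    have : W.lamination.μ c = W.cnt c := if_pos hc
    rw [this]
    exact cnt_singleton hp h hpℓ
  · rw [MeasuredLamination.wt_of_not_mem h]
    exact (not_not.1 h).symm

end WtSys

end HyperbolicPants

/-! ### Collars of the boundary -/

lemma segm_affine {x y z : ℍ} (h : z ∈ segm x y) : ∃ t : ℝ, 0 ≤ t ∧ t ≤ 1 ∧
    z.re = x.re + t * (y.re - x.re) ∧ np z = np x + t * (np y - np x) := by
  obtain ⟨s, t, hs, ht, hb⟩ := mem_segm_iff.1 h
  have h1 := hb e1 e1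
  have h2 := hb e1 e2
  have h3 := hb e2 e2
  simp only [bq, e1, e2, Matrix.cons_val_zero, Matrix.cons_val_one] at h1 h2 h3
  have h4 : s = 1 - t := by linarith
  subst h4
  refine ⟨t, ht, by linarith, by linarith, ?_⟩
  unfold np
  linarith

/-- The nearest point of the axis is `i |z|`, at a distance whose hyperbolic cosine is `|z| / Im z`.
-/
lemma infDist_iexp_lt_iff {z : ℍ} {r : ℝ} (hr : 0 < r) :
    Metric.infDist z (range iexp) < r ↔ np z < Real.cosh r ^ 2 * z.im ^ 2 := by
  have him := z.im_pos
  rw [Metric.infDist_lt_iff (range_nonempty _)]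
  constructor
  · rintro ⟨_, ⟨t, rfl⟩, h⟩
    have h1 := cosh_dist_iexp_ge z t
    have h2 : Real.cosh (dist z (iexp t)) < Real.cosh r :=
      Real.cosh_lt_cosh.2 (by rwa [abs_of_nonneg dist_nonneg, abs_of_pos hr])
    have h3 : Real.cosh (dist z (iexp t)) ^ 2 < Real.cosh r ^ 2 :=
      pow_lt_pow_left₀ h2 (Real.cosh_pos _).le two_ne_zero
    have h4 := mul_lt_mul_of_pos_right (h1.trans_lt h3) (pow_pos him 2)
    refine lt_of_eq_of_lt ?_ h4
    unfold np
    field_simp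
    ring
  · intro h
    have hn : 0 < np z := by unfold np; positivity
    refine ⟨_, ⟨Real.log (Real.sqrt (np z)), rfl⟩, ?_⟩
    have hs := Real.sqrt_pos.2 hn
    have hsq := Real.sq_sqrt hn.le
    rw [← abs_of_nonneg (dist_nonneg (x := z)), ← abs_of_pos hr, ← Real.cosh_lt_cosh,
      UpperHalfPlane.cosh_dist]
    have e : dist (z : ℂ) (iexp (Real.log (Real.sqrt (np z)))) ^ 2 =
        2 * np z - 2 * Real.sqrt (np z) * z.im := by
      rw [Complex.dist_eq, ← Complex.normSq_eq_norm_sq, Complex.normSq_apply]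
      simp only [Complex.sub_re, Complex.sub_im, coe_re, coe_im, iexp_re, iexp_im,
        Real.exp_log hs]
      have : np z = z.re ^ 2 + z.im ^ 2 := rfl
      linear_combination hsq - this
    rw [e, iexp_im, Real.exp_log hs]
    have hc := Real.cosh_pos r
    have e2 : 1 + (2 * np z - 2 * Real.sqrt (np z) * z.im) / (2 * z.im * Real.sqrt (np z)) =
        Real.sqrt (np z) / z.im := by
      field_simp
      linear_combination -hsq
    rw [e2, div_lt_iff₀ him]
    refine lt_of_pow_lt_pow_left₀ 2 (by positivity) ?_
    rw [hsq]
    linarith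

lemma infDist_smul_range (k : SL(2, ℝ)) (z : ℍ) :
    Metric.infDist z (range fun t => k • iexp t) = Metric.infDist (k⁻¹ • z) (range iexp) := by
  rw [show (range fun t => k • iexp t) = (fun z => k • z) '' range iexp from range_comp _ _]
  conv_lhs => rw [← smul_inv_smul k z]
  exact Metric.infDist_image (isometry_smul ℍ k)

/-- In affine coordinates the collar is given by an inequality between a linear function and a
multiple of the square of the other coordinate, a convex condition. -/
lemma geodConvex_collar (k : SL(2, ℝ)) {r : ℝ} (hr : 0 < r) :
    GeodConvex {z | Metric.infDist z (range fun t => k • iexp t) < r} := by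
  simp only [infDist_smul_range]
  refine geodConvex_preimage (S := {z | Metric.infDist z (range iexp) < r}) ?_ k⁻¹
  intro x hx y hy z hz
  simp only [mem_ofPred_eq, infDist_iexp_lt_iff hr] at hx hy ⊢
  obtain ⟨t, ht0, ht1, h1, h2⟩ := segm_affine hz
  have hc : 1 ≤ Real.cosh r ^ 2 := one_le_pow₀ (Real.one_le_cosh r)
  have ei : ∀ w : ℍ, w.im ^ 2 = np w - w.re ^ 2 := fun w => by unfold np; ring
  rw [ei] at hx hy ⊢
  set C := Real.cosh r ^ 2
  have key : C * z.re ^ 2 ≤ C * ((1 - t) * x.re ^ 2 + t * y.re ^ 2) := by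
    refine mul_le_mul_of_nonneg_left ?_ (by linarith)
    rw [h1]
    have := mul_nonneg (mul_nonneg ht0 (sub_nonneg.2 ht1)) (sq_nonneg (x.re - y.re))
    linarith
  rw [h2]
  rcases ht0.eq_or_lt with rfl | ht
  · linarith
  · have a1 := mul_lt_mul_of_pos_left hy ht
    have a2 := mul_le_mul_of_nonneg_left hx.le (sub_nonneg.2 ht1)
    linarith

lemma diag_smul {m : SL(2, ℝ)} {l : ℝ} (hl : l ≠ 0) (h1 : act m e1 = l • e1)
    (h2 : act m e2 = l⁻¹ • e2) (z : ℍ) : (m • z).re = l ^ 2 * z.re ∧ (m • z).im = l ^ 2 * z.im := by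
  have a := congrFun h1 0
  have b := congrFun h1 1
  have c := congrFun h2 0
  have d := congrFun h2 1
  simp [act, e1, e2] at a b c d
  rw [sl_re, sl_im, dn, a, b, c, d]
  constructor <;> field_simp <;> ring

/-- The half-open interval from `1` to `q` is a fundamental domain for multiplication by `q`.
Writing it as `(x - 1) / (q - 1) ∈ [0, 1)` treats `q < 1` and `q > 1` alike and matches the
parameter along the loop. -/
lemma exists_zpow_mem {q β : ℝ} (hq : 0 < q) (hq1 : q ≠ 1) (hβ : 0 < β) :
    ∃ n : ℤ, 0 ≤ (q ^ n * β - 1) / (q - 1) ∧ (q ^ n * β - 1) / (q - 1) < 1 := by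
  rcases lt_or_gt_of_ne hq1 with h | h
  · obtain ⟨n, h1, h2⟩ := exists_mem_Ioc_zpow hβ ((one_lt_inv₀ hq).2 h)
    refine ⟨n + 1, ?_, ?_⟩
    · refine div_nonneg_of_nonpos (sub_nonpos.2 ?_) (by linarith)
      rw [inv_zpow'] at h2
      calc q ^ (n + 1) * β ≤ q ^ (n + 1) * q ^ (-(n + 1)) := by gcongr
        _ = 1 := by rw [← zpow_add₀ hq.ne']; simp
    · rw [div_lt_one_of_neg (by linarith), sub_lt_sub_iff_right]
      rw [inv_zpow'] at h1
      calc q = q ^ (n + 1) * q ^ (-n) := by rw [← zpow_add₀ hq.ne']; simp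
        _ < q ^ (n + 1) * β := by gcongr
  · obtain ⟨n, h1, h2⟩ := exists_mem_Ico_zpow hβ h
    refine ⟨-n, ?_, ?_⟩
    · refine div_nonneg (sub_nonneg.2 ?_) (by linarith)
      calc 1 = q ^ (-n) * q ^ n := by rw [← zpow_add₀ hq.ne']; simp
        _ ≤ q ^ (-n) * β := by gcongr
    · rw [div_lt_one (by linarith), sub_lt_sub_iff_right]
      calc q ^ (-n) * β < q ^ (-n) * q ^ (n + 1) := by gcongr
        _ = q := by rw [← zpow_add₀ hq.ne']; simp

lemma zpow_eq_zero_of_mem {q β : ℝ} (hq : 0 < q) (hq1 : q ≠ 1) {n : ℤ}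
    (h0 : 0 ≤ (β - 1) / (q - 1)) (h1 : (β - 1) / (q - 1) < 1)
    (h2 : 0 ≤ (q ^ n * β - 1) / (q - 1)) (h3 : (q ^ n * β - 1) / (q - 1) < 1) : n = 0 := by
  have aux : ∀ {q β : ℝ} {n : ℤ}, 1 < q → 1 ≤ β → β < q → 1 ≤ q ^ n * β → q ^ n * β < q →
      n = 0 := by
    intro q β n hq hb hb' hn hn'
    have hq0 : 0 < q := by linarith
    have hz : 0 < q ^ n := zpow_pos hq0 n
    have u : q ^ n < q ^ (1 : ℤ) := by
      rw [zpow_one]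
      nlinarith
    have v : q ^ (-1 : ℤ) < q ^ n := by
      rw [zpow_neg_one, inv_lt_iff_one_lt_mul₀' hq0]
      nlinarith
    have := (zpow_lt_zpow_iff_right₀ hq).1 u
    have := (zpow_lt_zpow_iff_right₀ hq).1 v
    omega
  rcases lt_or_gt_of_ne hq1 with h | h
  · have hq' : q - 1 < 0 := by linarith
    rw [div_lt_one_of_neg hq', sub_lt_sub_iff_right] at h1 h3
    have h0' : β ≤ 1 := by
      by_contra hc
      exact absurd h0 (not_le.2 (div_neg_of_pos_of_neg (by linarith) hq'))
    have h2' : q ^ n * β ≤ 1 := by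
      by_contra hc
      exact absurd h2 (not_le.2 (div_neg_of_pos_of_neg (by linarith) hq'))
    have e : q⁻¹ ^ n * β⁻¹ = (q ^ n * β)⁻¹ := by rw [inv_zpow, mul_inv]
    refine aux (q := q⁻¹) (β := β⁻¹) ((one_lt_inv₀ hq).2 h) ((one_le_inv₀ (hq.trans h1)).2 h0')
      (inv_strictAnti₀ hq h1) ?_ ?_
    · rw [e]; exact (one_le_inv₀ (hq.trans h3)).2 h2'
    · rw [e]; exact inv_strictAnti₀ hq h3
  · have hq' : 0 < q - 1 := by linarith
    rw [div_lt_one hq', sub_lt_sub_iff_right] at h1 h3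
    rw [le_div_iff₀ hq'] at h0 h2
    exact aux h (by linarith) h1 (by linarith) h3

/-- Different leaves are disjoint, and for equal leaves `cr` vanishes. -/
lemma HyperbolicPants.MeasuredLamination.cr_nonneg {P : HyperbolicPants} (Λ : P.MeasuredLamination)
    {u v u' v' : V2} (huv : br u v ≠ 0) (h : geo u v ∈ Λ.leaves) (h' : geo u' v' ∈ Λ.leaves) :
    0 ≤ cr u v u' v' := by
  by_contra hcr
  push Not at hcr
  have heq : geo u v = geo u' v' := by
    by_contra hne
    obtain ⟨w, hw1, hw2⟩ := geo_inter_of_cr_neg hcr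
    exact Set.disjoint_left.1 (Λ.disjoint _ h _ h' hne) hw1 hw2
  rcases eq_endpoints_of_geo_eq huv heq with ⟨h1, -⟩ | ⟨h1, -⟩ <;> simp [cr, h1] at hcr

lemma exists_zpow_lt {q ε : ℝ} (hq1 : q ≠ 1) (hε : 0 < ε) : ∃ n : ℤ, q ^ n < ε := by
  rcases lt_or_gt_of_ne hq1 with h | h
  · obtain ⟨n, hn⟩ := exists_pow_lt_of_lt_one hε h
    exact ⟨n, by rwa [zpow_natCast]⟩
  · obtain ⟨n, hn⟩ := exists_pow_lt_of_lt_one hε (inv_lt_one_of_one_lt₀ h)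
    exact ⟨-n, by rwa [zpow_neg, ← inv_zpow, zpow_natCast]⟩

/-! ### Boundary axes in normal position -/

namespace HyperbolicPants.Model

variable {P : HyperbolicPants} (M : P.Model)

/-- `k` maps the imaginary axis to the `i`-th boundary axis, and infinity to the end `s` of it. -/
structure AxisFrame (i : Fin 3) (k : SL(2, ℝ)) (l : ℝ) (s : Bool) : Prop where
  ne : l ^ 2 ≠ 1
  eig : Eig (P.hol (peripheral i)) (act k e1) (act k e2) l
  left : br (act k e1) (M.F.en s i) = 0
  right : br (act k e2) (M.F.en (!s) i) = 0

variable {M} {i : Fin 3} {k : SL(2, ℝ)} {l : ℝ} {s : Bool}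

namespace AxisFrame

lemma swap (h : M.AxisFrame i k l s) : M.AxisFrame i (k * rotS) l⁻¹ (!s) := by
  have e : act (k * rotS) e1 = act k e2 := by rw [act_mul, act_rotS_e1]
  have e' : act (k * rotS) e2 = (-1 : ℝ) • act k e1 := by
    rw [act_mul, act_rotS_e2, ← act_smul, neg_one_smul]
  refine ⟨?_, ⟨?_, inv_ne_zero h.eig.ne, ?_, ?_⟩, ?_, ?_⟩
  · rw [inv_pow, ne_eq, inv_eq_one]
    exact h.ne
  · rw [e, e', br_smul_right, br_anticomm, h.eig.br]
    norm_num
  · rw [e, h.eig.right]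
  · rw [e', act_smul, h.eig.left, inv_inv, smul_comm]
  · rw [e, h.right]
  · rw [e', br_smul_left, Bool.not_not, h.left, mul_zero]

lemma left_ne (h : M.AxisFrame i k l s) : act k e1 ≠ 0 :=
  left_ne_zero_of_br (by rw [h.eig.br]; exact one_ne_zero)

lemma right_ne (h : M.AxisFrame i k l s) : act k e2 ≠ 0 :=
  right_ne_zero_of_br (by rw [h.eig.br]; exact one_ne_zero)

lemma geo_eq (h : M.AxisFrame i k l s) :
    geo (act k e1) (act k e2) = geo (M.F.en true i) (M.F.en false i) := by
  rw [geo_congr h.left_ne (M.en_ne_zero s i) h.right_ne (M.en_ne_zero _ i) h.left h.right]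
  cases s
  · exact geo_comm _ _
  · rfl

lemma act_zpow (h : M.AxisFrame i k l s) (n : ℤ) :
    act (P.hol (peripheral i ^ n)) (act k e1) = l ^ n • act k e1 ∧
      act (P.hol (peripheral i ^ n)) (act k e2) = l⁻¹ ^ n • act k e2 := by
  have aux : ∀ (v : V2) (c : ℝ), c ≠ 0 → act (P.hol (peripheral i)) v = c • v →
      act (P.hol (peripheral i ^ n)) v = c ^ n • v := by
    intro v c hc hv
    rw [map_zpow]
    have hv' : act (P.hol (peripheral i))⁻¹ v = c⁻¹ • v := by
      have := congrArg (act (P.hol (peripheral i))⁻¹) hv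
      rw [act_inv_act, act_smul] at this
      rw [eq_inv_smul_iff₀ hc, ← this]
    induction n using Int.induction_on with
    | zero => simp [act, funext_iff, Fin.forall_fin_two]
    | succ n ih => rw [zpow_add_one, act_mul, hv, act_smul, ih, smul_smul, zpow_add_one₀ hc, mul_comm]
    | pred n ih => rw [zpow_sub_one, act_mul, hv', act_smul, ih, smul_smul, zpow_sub_one₀ hc, mul_comm]
  exact ⟨aux _ _ h.eig.ne h.eig.left, aux _ _ (inv_ne_zero h.eig.ne) h.eig.right⟩

/-- The boundary translation in normal form. -/
lemma conj_smul (h : M.AxisFrame i k l s) (n : ℤ) (z : ℍ) :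
    (k⁻¹ • P.hol (peripheral i ^ n) • z).re = (l ^ 2) ^ n * (k⁻¹ • z).re ∧
      (k⁻¹ • P.hol (peripheral i ^ n) • z).im = (l ^ 2) ^ n * (k⁻¹ • z).im := by
  have e : k⁻¹ • P.hol (peripheral i ^ n) • z =
      (k⁻¹ * P.hol (peripheral i ^ n) * k) • (k⁻¹ • z) := by
    rw [mul_smul, mul_smul, smul_inv_smul]
  have e' : (l ^ 2) ^ n = (l ^ n) ^ 2 := by rw [← zpow_natCast, ← zpow_natCast, zpow_comm]
  rw [e, e']
  refine diag_smul (zpow_ne_zero n h.eig.ne) ?_ ?_ _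
  · rw [act_mul, act_mul, (h.act_zpow n).1, act_smul, act_inv_act]
  · rw [act_mul, act_mul, (h.act_zpow n).2, act_smul, act_inv_act, inv_zpow]

/-- The core is on one side of the axis, and interior points are not on the axis itself. -/
lemma exists_side (h : M.AxisFrame i k l s) :
    ∃ σ : ℝ, ∀ z ∈ P.cover, 0 < σ * (k⁻¹ • z).re := by
  have hne : br (act k e1) (act k e2) ≠ 0 := by rw [h.eig.br]; exact one_ne_zero
  obtain ⟨ε, hε, hs⟩ := one_side_of_geo_subset_frontier (geodConvex_convexCore _)
    (isClosed_convexCore _) hne (by rw [h.geo_eq]; exact M.axis_subset_frontier i)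
  refine ⟨-ε, fun z hz => ?_⟩
  have e : bq z (act k e1) (act k e2) = -(k⁻¹ • z).re / dn k (k⁻¹ • z) := by
    rw [← bq_e1_e2, ← bq_smul, smul_inv_smul]
  have h1 := hs z (interior_subset hz)
  have h2 : bq z (act k e1) (act k e2) ≠ 0 := fun h0 => by
    refine M.cover_disjoint_axis true i z ?_ hz
    change z ∈ geo (M.F.en true i) (M.F.en false i)
    rw [← h.geo_eq]
    exact h0
  have hε0 : ε ≠ 0 := by rcases hε with rfl | rfl <;> norm_num
  have h3 := lt_of_le_of_ne h1 (mul_ne_zero hε0 h2).symm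
  have hd := dn_pos k (k⁻¹ • z)
  rw [e] at h3
  have h4 := mul_pos h3 hd
  field_simp at h4
  linarith

end AxisFrame

/-- Leaves near the boundary spiral around it. -/
lemma AxisFrame.exists_collar (h : M.AxisFrame i k l s) (Λ : P.MeasuredLamination) :
    ∃ r > 0, ∀ ℓ ∈ Λ.leaves, (∃ x ∈ ℓ, Metric.infDist x (range fun t => k • iexp t) < r) →
      ∃ u v, br u v ≠ 0 ∧ ℓ = geo u v ∧ (br u (act k e1) = 0 ∨ br u (act k e2) = 0) := by
  have hl0 := h.eig.ne
  have hl2 : 0 < l ^ 2 := by positivity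
  have hκ : 0 < 4 / (l + l⁻¹) ^ 2 := by
    have : l + l⁻¹ ≠ 0 := fun h0 => by
      have : l * (l + l⁻¹) = 0 := by rw [h0, mul_zero]
      rw [mul_add, mul_inv_cancel₀ hl0] at this
      nlinarith
    positivity
  -- The collar has width `r` with `sinh r = 2 / |l + l⁻¹|`.
  set κ := 4 / (l + l⁻¹) ^ 2 with hκd
  have hr : 0 < Real.arsinh (Real.sqrt κ) := Real.arsinh_pos_iff.2 (Real.sqrt_pos.2 hκ)
  refine ⟨_, hr, fun ℓ hℓ ⟨z, hz, hzr⟩ => ?_⟩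
  obtain ⟨u, v, huv, rfl⟩ := (Λ.isGeodesic ℓ hℓ).exists_geo
  by_cases c1 : br u (act k e1) = 0
  · exact ⟨u, v, huv, rfl, Or.inl c1⟩
  by_cases c2 : br u (act k e2) = 0
  · exact ⟨u, v, huv, rfl, Or.inr c2⟩
  have hvu : br v u ≠ 0 := by rw [br_anticomm]; exact neg_ne_zero.2 huv
  by_cases c3 : br v (act k e1) = 0
  · exact ⟨v, u, hvu, geo_comm _ _, Or.inl c3⟩
  by_cases c4 : br v (act k e2) = 0
  · exact ⟨v, u, hvu, geo_comm _ _, Or.inr c4⟩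
  exfalso
  obtain ⟨a, rfl⟩ : ∃ a, u = act k a := ⟨_, (act_act_inv k u).symm⟩
  obtain ⟨b, rfl⟩ : ∃ b, v = act k b := ⟨_, (act_act_inv k v).symm⟩
  have hτ : ∀ a : V2, act (P.hol (peripheral i)) (act k a) = act k ![l * a 0, l⁻¹ * a 1] := by
    intro a
    have e : a = a 0 • e1 + a 1 • e2 := by
      ext j; fin_cases j <;> simp [e1, e2]
    have e' : (![l * a 0, l⁻¹ * a 1] : V2) = (l * a 0) • e1 + (l⁻¹ * a 1) • e2 := by
      ext j; fin_cases j <;> simp [e1, e2]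
    rw [e', act_add, act_smul, act_smul]
    conv_lhs => rw [e]
    rw [act_add, act_add, act_smul, act_smul, act_smul, act_smul, h.eig.left, h.eig.right,
      smul_smul, smul_smul, mul_comm, mul_comm (a 1)]
  simp only [br_act] at c1 c2 c3 c4
  -- A leaf in the interior does not cross the boundary axis.
  have hAB : 0 < a 0 * a 1 * b 0 * b 1 := by
    simp only [br, e1, e2, Matrix.cons_val_zero, Matrix.cons_val_one] at c1 c2 c3 c4
    have n0 : a 0 * a 1 * b 0 * b 1 ≠ 0 := by
      refine mul_ne_zero (mul_ne_zero (mul_ne_zero ?_ ?_) ?_) ?_ <;> (rintro h0; simp_all)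
    by_contra hcon
    have hcr : cr e1 e2 a b < 0 := by
      rw [cr_e]; exact lt_of_le_of_ne (not_lt.1 hcon) n0
    rw [← cr_act k] at hcr
    obtain ⟨w, hw1, hw2⟩ := geo_inter_of_cr_neg hcr
    rw [h.geo_eq] at hw1
    exact M.cover_disjoint_axis true i w hw1 (Λ.subset_cover _ hℓ hw2)
  have hdis : 0 ≤ cr a b ![l * a 0, l⁻¹ * a 1] ![l * b 0, l⁻¹ * b 1] := by
    have hℓ' := Λ.leaves_invariant (peripheral i) _ hℓ
    rw [image_geo, hτ, hτ] at hℓ'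
    rw [← cr_act k]
    exact Λ.cr_nonneg huv hℓ hℓ'
  -- Disjointness from the translate by the boundary element bounds how far the two ends are apart.
  have hle : (a 0 * b 1 - a 1 * b 0) ^ 2 ≤ a 0 * a 1 * b 0 * b 1 * (l - l⁻¹) ^ 2 := by
    have e : cr a b ![l * a 0, l⁻¹ * a 1] ![l * b 0, l⁻¹ * b 1] =
        a 0 * a 1 * b 0 * b 1 * (l - l⁻¹) ^ 2 *
          (a 0 * a 1 * b 0 * b 1 * (l - l⁻¹) ^ 2 - (a 0 * b 1 - a 1 * b 0) ^ 2) := by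
      simp only [cr, br, Matrix.cons_val_zero, Matrix.cons_val_one]
      field_simp
      ring
    rw [e] at hdis
    have hl : l - l⁻¹ ≠ 0 := fun h0 => h.ne (by
      have : l * (l - l⁻¹) = 0 := by rw [h0, mul_zero]
      rw [mul_sub, mul_inv_cancel₀ hl0] at this
      linarith)
    exact sub_nonneg.1 (nonneg_of_mul_nonneg_right hdis (by positivity))
  have hm : k⁻¹ • z ∈ geo a b := by
    rw [mem_geo_smul', inv_inv]
    exact hz
  rw [infDist_smul_range, infDist_iexp_lt_iff hr, Real.cosh_sq, Real.sinh_arsinh,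
    Real.sq_sqrt hκ.le] at hzr
  set w := k⁻¹ • z
  have ei : w.im ^ 2 = np w - w.re ^ 2 := by unfold np; ring
  have hnp : 0 < np w := (sq_nonneg _).trans_lt (np_gt w)
  have hb : np w * (a 1 * b 1) + a 0 * b 0 = w.re * (a 0 * b 1 + a 1 * b 0) := by
    have : bq w a b = 0 := hm
    unfold bq at this
    unfold np
    linarith
  -- The inequality of arithmetic and geometric means applied to the equation of the geodesic.
  have hAM : 4 * np w * (a 0 * a 1 * b 0 * b 1) ≤ w.re ^ 2 * (a 0 * b 1 + a 1 * b 0) ^ 2 := by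
    rw [← mul_pow, ← hb]
    have := sq_nonneg (np w * (a 1 * b 1) - a 0 * b 0)
    linarith
  have hsum : (a 0 * b 1 + a 1 * b 0) ^ 2 ≤ a 0 * a 1 * b 0 * b 1 * (l + l⁻¹) ^ 2 := by
    have e : (l + l⁻¹) ^ 2 = (l - l⁻¹) ^ 2 + 4 := by field_simp; ring
    rw [e]
    linarith
  have hfin : 4 * np w ≤ w.re ^ 2 * (l + l⁻¹) ^ 2 := by
    refine le_of_mul_le_mul_right (hAM.trans ?_) hAB
    have := mul_le_mul_of_nonneg_left hsum (sq_nonneg w.re)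
    linarith
  have hκ2 : κ * np w ≤ w.re ^ 2 := by
    have hp : 0 < (l + l⁻¹) ^ 2 := by
      by_contra h0
      rw [le_antisymm (not_lt.1 h0) (sq_nonneg _), mul_zero] at hfin
      linarith
    rw [hκd, div_mul_eq_mul_div, div_le_iff₀ hp]
    exact hfin
  rw [ei] at hzr
  have := mul_nonneg hκ.le (sq_nonneg w.re)
  linarith

end HyperbolicPants.Model

namespace HyperbolicPants.Model

/-! ### All leaves which spiral around a boundary component do so in the same direction -/

variable {P : HyperbolicPants} {M : P.Model} {i : Fin 3} {k : SL(2, ℝ)} {l : ℝ} {s : Bool}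

lemma exists_axisFrame (M : P.Model) (i : Fin 3) (s : Bool) :
    ∃ k l, M.AxisFrame i k l s := by
  obtain ⟨α, hα, -⟩ := P.boundary i
  obtain ⟨k, l, s', hl, -, E, h1, h2, -⟩ := M.exists_of_isAxis hα
  have F : M.AxisFrame i k l s' := ⟨hl, E, h1, h2⟩
  by_cases hs : s' = s
  · exact ⟨k, l, hs ▸ F⟩
  · have : (!s') = s := by revert hs; cases s <;> cases s' <;> decide
    exact ⟨_, _, this ▸ F.swap⟩

/-- With the axis vertical, one leaf is a vertical line and the other a half-circle starting at `0`,
both on the same side. A boundary translation expands the half-circle beyond the line, so that the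
two cross. -/
lemma AxisFrame.not_both (h : M.AxisFrame i k l s) {Λ : P.MeasuredLamination} {v v' : V2}
    (hv : br (act k e1) v ≠ 0) (hv' : br (act k e2) v' ≠ 0) (hℓ : geo (act k e1) v ∈ Λ.leaves)
    (hℓ' : geo (act k e2) v' ∈ Λ.leaves) : False := by
  have hl0 := h.eig.ne
  have haxis : geo (act k e1) (act k e2) ∉ Λ.leaves := fun hm => by
    obtain ⟨z, hz⟩ : (geo (act k e1) (act k e2)).Nonempty := by
      rw [geo_act_e]; exact range_nonempty _
    have h1 := Λ.subset_cover _ hm hz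
    rw [h.geo_eq] at hz
    exact M.cover_disjoint_axis true i z hz h1
  have hw : br (act k e2) v ≠ 0 := fun h0 => haxis <| by
    rwa [geo_congr h.left_ne h.left_ne h.right_ne (right_ne_zero_of_br hv) (br_self _) h0]
  have hw' : br (act k e1) v' ≠ 0 := fun h0 => haxis <| by
    rwa [geo_comm, geo_congr h.right_ne h.right_ne h.left_ne (right_ne_zero_of_br hv') (br_self _) h0]
  obtain ⟨a, rfl⟩ : ∃ a, v = act k a := ⟨_, (act_act_inv k v).symm⟩
  obtain ⟨b, rfl⟩ : ∃ b, v' = act k b := ⟨_, (act_act_inv k v').symm⟩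
  rw [br_act] at hv hv' hw hw'
  obtain ⟨σ, hσ⟩ := h.exists_side
  have pt : ∀ {u v : V2}, br (act k u) (act k v) ≠ 0 → geo (act k u) (act k v) ∈ Λ.leaves →
      ∃ w : ℍ, bq w u v = 0 ∧ 0 < σ * w.re := by
    intro u v huv hm
    obtain ⟨γ, -, hγ⟩ := Λ.isGeodesic _ hm
    have hz : γ 0 ∈ geo (act k u) (act k v) := hγ ▸ mem_range_self 0
    refine ⟨k⁻¹ • γ 0, ?_, hσ _ (Λ.subset_cover _ hm hz)⟩
    change k⁻¹ • γ 0 ∈ geo u v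
    rwa [mem_geo_smul', inv_inv]
  obtain ⟨w, hw1, hw2⟩ := pt (by rwa [br_act]) hℓ
  obtain ⟨z, hz1, hz2⟩ := pt (by rwa [br_act]) hℓ'
  simp only [bq, br, e1, e2, Matrix.cons_val_zero, Matrix.cons_val_one] at hw1 hz1 hv hv' hw hw'
  have pa : 0 < σ * (a 0 * a 1) := by
    have : 0 < a 1 ^ 2 := by
      refine lt_of_le_of_ne (sq_nonneg _) (Ne.symm (pow_ne_zero 2 fun h0 => hv ?_))
      rw [h0]; ring
    have := mul_pos this hw2
    linear_combination this - (σ * a 1) * hw1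
  have pb : 0 < σ * (b 0 * b 1) := by
    have h0 : 0 < b 0 ^ 2 := by
      refine lt_of_le_of_ne (sq_nonneg _) (Ne.symm (pow_ne_zero 2 fun h0 => hv' ?_))
      rw [h0]; ring
    have h1 := mul_pos h0 hz2
    have h2 : 0 < z.re ^ 2 + z.im ^ 2 := by have := z.im_pos; positivity
    refine pos_of_mul_pos_left (b := z.re ^ 2 + z.im ^ 2) ?_ h2.le
    linear_combination h1 - (σ * b 0) * hz1
  have pab : 0 < a 0 * a 1 * (b 0 * b 1) := by
    refine pos_of_mul_pos_left (b := σ ^ 2) ?_ (sq_nonneg _)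
    exact (mul_pos pa pb).trans_eq (by ring)
  have pX : 0 < (a 0 * b 1) ^ 2 := by
    refine lt_of_le_of_ne (sq_nonneg _) (Ne.symm (pow_ne_zero 2 fun h0 => ?_))
    rw [show a 0 * a 1 * (b 0 * b 1) = a 0 * b 1 * (a 1 * b 0) by ring, h0, zero_mul] at pab
    exact pab.false
  -- The power is chosen so that the crossing number computed in `e` is negative.
  obtain ⟨n, hn⟩ := exists_zpow_lt h.ne (div_pos pab pX)
  rw [lt_div_iff₀ pX] at hn
  have hm := Λ.leaves_invariant (peripheral i ^ (-n)) _ hℓ'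
  obtain ⟨t1, t2⟩ := h.act_zpow (-n)
  have eb : act (P.hol (peripheral i ^ (-n))) (act k b) = act k ![l ^ (-n) * b 0, l⁻¹ ^ (-n) * b 1] := by
    have e : b = b 0 • e1 + b 1 • e2 := by ext j; fin_cases j <;> simp [e1, e2]
    have e' : (![l ^ (-n) * b 0, l⁻¹ ^ (-n) * b 1] : V2) =
        (b 0 * l ^ (-n)) • e1 + (b 1 * l⁻¹ ^ (-n)) • e2 := by
      ext j; fin_cases j <;> simp [e1, e2, mul_comm]
    rw [e', act_add, act_smul, act_smul]
    conv_lhs => rw [e]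
    rw [act_add, act_add, act_smul, act_smul, act_smul, act_smul, t1, t2, smul_smul, smul_smul]
  rw [image_geo, t2, eb, geo_smul_left (zpow_ne_zero _ (inv_ne_zero hl0))] at hm
  have := Λ.cr_nonneg (by rw [br_act]; simpa [br, e1] using hv) hℓ hm
  rw [cr_act] at this
  have e : cr e1 a e2 ![l ^ (-n) * b 0, l⁻¹ ^ (-n) * b 1] =
      (l ^ 2) ^ n * (a 0 * b 1) ^ 2 - a 0 * a 1 * (b 0 * b 1) := by
    have e1' : l⁻¹ ^ (-n) = l ^ n := by rw [inv_zpow', neg_neg]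
    have e2' : l ^ (-n) = (l ^ n)⁻¹ := zpow_neg _ _
    have e3' : (l ^ 2) ^ n = (l ^ n) ^ 2 := by rw [← zpow_natCast, ← zpow_natCast, zpow_comm]
    have := zpow_ne_zero n hl0
    simp only [cr, br, e1, e2, Matrix.cons_val_zero, Matrix.cons_val_one, e1', e2', e3']
    field_simp
    ring
  rw [e] at this
  linarith

/-- The direction `ε` of spiraling at each boundary component is the one of the leaves. -/
def Adapted (M : P.Model) (Λ : P.MeasuredLamination) (ε : Fin 3 → Bool) : Prop :=
  ∀ ℓ ∈ Λ.leaves, ∃ b i g, ℓ = (fun z => P.hol g • z) '' M.base ε b i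

lemma base_congr (M : P.Model) {ε ε' : Fin 3 → Bool} {b : Bool} {i : Fin 3} (h : ε i = ε' i)
    (h' : b = false → ε (i + 1) = ε' (i + 1)) : M.base ε b i = M.base ε' b i := by
  cases b <;> simp_all [base, tip, p]

/-- By `not_both` leaves end at no more than one of the two ends of each axis; `ε` picks this end
and is arbitrary if there is none. -/
lemma exists_adapted (M : P.Model) (Λ : P.MeasuredLamination) : ∃ ε, M.Adapted Λ ε := by
  classical
  let E : Bool → Fin 3 → Prop := fun s i =>
    ∃ v, br (M.F.en s i) v ≠ 0 ∧ geo (M.F.en s i) v ∈ Λ.leaves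
  have hE : ∀ i, E true i → E false i → False := by
    rintro i ⟨v, hv, h⟩ ⟨v', hv', h'⟩
    obtain ⟨k, l, F⟩ := M.exists_axisFrame i true
    have c : ∀ {u u' v : V2}, u ≠ 0 → u' ≠ 0 → br u u' = 0 → br u' v ≠ 0 → br u v ≠ 0 :=
      fun hu hu' h0 hne h1 => hne (br_eq_zero_trans hu (by rw [br_anticomm, h0, neg_zero]) h1)
    refine F.not_both (Λ := Λ) (c F.left_ne (M.en_ne_zero _ _) F.left hv)
      (c F.right_ne (M.en_ne_zero _ _) F.right hv') ?_ ?_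
    · rwa [geo_congr F.left_ne (M.en_ne_zero _ _) (right_ne_zero_of_br hv)
        (right_ne_zero_of_br hv) F.left (br_self _)]
    · rwa [geo_congr F.right_ne (M.en_ne_zero _ _) (right_ne_zero_of_br hv')
        (right_ne_zero_of_br hv') F.right (br_self _)]
  let ε : Fin 3 → Bool := fun i => decide (E true i)
  have hε : ∀ s i, E s i → ε i = s := by
    intro s i hs
    cases s
    · exact decide_eq_false fun h => hE i h hs
    · exact decide_eq_true hs
  refine ⟨ε, fun ℓ hℓ => ?_⟩
  obtain ⟨ε', b, i, g, rfl⟩ := M.exists_base Λ hℓ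
  have hb := (MeasuredLamination.image_mem_leaves_iff g).1 hℓ
  refine ⟨b, i, g, ?_⟩
  rw [M.base_congr (hε _ i ⟨_, M.br_base_ne_zero ε' b i, hb⟩) fun hbf => ?_]
  refine hε _ (i + 1) ⟨M.p ε' i, ?_, ?_⟩
  · have := M.br_base_ne_zero ε' b i
    rw [br_anticomm] at this
    simpa [tip, hbf, p] using this
  · have : M.base ε' b i = geo (M.F.en (ε' (i + 1)) (i + 1)) (M.p ε' i) := by
      rw [base, geo_comm]; simp [tip, hbf, p]
    rwa [← this]

end HyperbolicPants.Model

namespace HyperbolicPants.Model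

/-! ### The leaves which spiral around a boundary component -/

variable {P : HyperbolicPants} (M : P.Model) {ε : Fin 3 → Bool} {i : Fin 3} {Λ : P.MeasuredLamination}

/-- The far end of a lift of a leaf which ends at `M.p ε i`. -/
def far (i : Fin 3) : Bool × Bool → FreeGroup (Fin 2) × Fin 3
  | (false, false) => (1, i + 1)
  | (false, true) => (1, i + 2)
  | (true, false) => (peripheral (i + 2), i)
  | (true, true) => ((peripheral (i + 2))⁻¹, i)

def farEnd (ε : Fin 3 → Bool) (i : Fin 3) (q : Bool × Bool) : V2 :=
  act (P.hol (far i q).1) (M.p ε (far i q).2)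

/-- The lifts of leaves which end at `M.p ε i`, up to the boundary translation. -/
def spiral (ε : Fin 3 → Bool) (i : Fin 3) (q : Bool × Bool) : Set ℍ :=
  geo (M.p ε i) (M.farEnd ε i q)

lemma fin3_add (i : Fin 3) : i + 2 + 1 = i ∧ i + 1 + 2 = i ∧ i + 1 ≠ i + 2 ∧ i + 1 ≠ i ∧ i + 2 ≠ i := by
  revert i; decide

lemma far_true (i : Fin 3) (b : Bool) : (far i (true, b)).2 = i := by cases b <;> rfl

lemma spiral_eq (q : Bool × Bool) : ∃ g, M.spiral ε i q =
    (fun z => P.hol g • z) '' M.base ε q.1 (if q = (false, true) then i + 2 else i) := by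
  match q with
  | (false, false) => exact ⟨1, by simp [spiral, farEnd, far, base, tip]⟩
  | (false, true) =>
    exact ⟨1, by simp [spiral, farEnd, far, base, tip, (fin3_add i).1, geo_comm]⟩
  | (true, false) => exact ⟨1, by simp [spiral, farEnd, far, base, tip]⟩
  | (true, true) =>
    refine ⟨(peripheral (i + 2))⁻¹, ?_⟩
    simp [spiral, farEnd, far, base, tip, image_geo, act_inv_act, geo_comm]

lemma wt_spiral (q : Bool × Bool) : Λ.wt (M.spiral ε i q) =
    Λ.wt (M.base ε q.1 (if q = (false, true) then i + 2 else i)) := by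
  obtain ⟨g, h⟩ := M.spiral_eq (ε := ε) (i := i) q
  rw [h, MeasuredLamination.wt_image]

/-- A homomorphism to the integers that kills the boundary translation at `i` but not the peripheral
element `i + 2`. It distinguishes the two lifts of the self-arc modulo boundary translations. -/
lemma exists_hom (i : Fin 3) : ∃ φ : FreeGroup (Fin 2) →* Multiplicative ℤ,
    φ (peripheral i) = 1 ∧ φ (peripheral (i + 2)) ^ 2 ≠ 1 := by
  fin_cases i
  · exact ⟨FreeGroup.lift ![Multiplicative.ofAdd 0, Multiplicative.ofAdd 1], by simp [peripheral], by simp [peripheral]⟩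
  · exact ⟨FreeGroup.lift ![Multiplicative.ofAdd 1, Multiplicative.ofAdd 0], by simp [peripheral], by simp [peripheral]⟩
  · exact ⟨FreeGroup.lift ![Multiplicative.ofAdd 1, Multiplicative.ofAdd (-1)],
      by simp [peripheral], by simp [peripheral]⟩

lemma br_spiral_ne_zero (q : Bool × Bool) : br (M.p ε i) (M.farEnd ε i q) ≠ 0 := by
  intro h
  rw [farEnd, br_anticomm, neg_eq_zero] at h
  obtain ⟨h1, -, n, hn⟩ := M.act_p h
  obtain ⟨φ, hφ, hφ'⟩ := exists_hom i
  match q with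
  | (false, false) => revert h1; simp [far]
  | (false, true) => revert h1; simp [far]
  | (true, false) =>
    have := congrArg φ hn
    simp only [far, map_zpow, hφ, one_zpow] at this
    exact hφ' (by rw [this, one_pow])
  | (true, true) =>
    have := congrArg φ hn
    simp only [far, map_zpow, map_inv, hφ, one_zpow, inv_eq_one] at this
    exact hφ' (by rw [this, one_pow])

lemma act_zpow_p (n : ℤ) : br (act (P.hol (peripheral i ^ n)) (M.p ε i)) (M.p ε i) = 0 := by
  obtain ⟨k, l, F⟩ := M.exists_axisFrame i (ε i)
  obtain ⟨c, hc, e⟩ := exists_ne_zero_smul_of_br_eq_zero F.left_ne (M.p_ne_zero ε i) F.left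
  rw [e, act_smul, (F.act_zpow n).1, smul_smul, br_smul_left, br_smul_right, br_self, mul_zero,
    mul_zero]

/-- Equality of the geodesics makes the far ends equivalent under an element fixing an axis end. The
far ends belong to different components, or the homomorphism of `exists_hom` separates them. -/
lemma spiral_injective {q q' : Bool × Bool} {n : ℤ}
    (h : (fun z => P.hol (peripheral i ^ n) • z) '' M.spiral ε i q = M.spiral ε i q') : q = q' := by
  rw [spiral, spiral, image_geo] at h
  rcases eq_endpoints_of_geo_eq (by rw [br_act]; exact M.br_spiral_ne_zero q) h with ⟨-, h2⟩ | ⟨h1, -⟩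
  · rw [farEnd, farEnd, ← act_mul, ← map_mul, ← br_act (P.hol (far i q').1)⁻¹, act_inv_act,
      ← act_mul, ← map_inv, ← map_mul] at h2
    obtain ⟨hj, -, m, hm⟩ := M.act_p h2
    obtain ⟨φ, hφ, hφ'⟩ := exists_hom i
    obtain ⟨-, -, n1, n2, n3⟩ := fin3_add i
    match q, q', hj, hm with
    | (false, false), (false, false), _, _ => rfl
    | (false, true), (false, true), _, _ => rfl
    | (true, false), (true, false), _, _ => rfl
    | (true, true), (true, true), _, _ => rfl
    | (false, false), (false, true), hj, _ => exact absurd hj n1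
    | (false, true), (false, false), hj, _ => exact absurd hj n1.symm
    | (false, false), (true, b), hj, _ => exact absurd (hj.trans (far_true i b)) n2
    | (false, true), (true, b), hj, _ => exact absurd (hj.trans (far_true i b)) n3
    | (true, b), (false, false), hj, _ => exact absurd (hj.symm.trans (far_true i b)) n2
    | (true, b), (false, true), hj, _ => exact absurd (hj.symm.trans (far_true i b)) n3
    | (true, false), (true, true), _, hm =>
      have := congrArg φ hm
      simp only [far, map_zpow, map_mul, hφ, one_zpow, inv_inv, one_mul] at this
      exact absurd (by rw [sq]; exact this) hφ'
    | (true, true), (true, false), _, hm =>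
      have := congrArg φ hm
      simp only [far, map_zpow, map_mul, map_inv, hφ, one_zpow, one_mul] at this
      rw [← mul_inv, inv_eq_one] at this
      exact absurd (by rw [sq]; exact this) hφ'
  · refine absurd (br_eq_zero_trans (act_ne_zero_of_ne _ (M.p_ne_zero _ _)) ?_ h1)
      (M.br_spiral_ne_zero q')
    rw [br_anticomm, M.act_zpow_p, neg_zero]

/-- A leaf which ends at an end of the `i`-th axis is one of the above. -/
lemma Adapted.exists_spiral (h : M.Adapted Λ ε) {u v : V2} (huv : br u v ≠ 0)
    (hℓ : geo u v ∈ Λ.leaves) {s : Bool} (hu : br u (M.F.en s i) = 0) :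
    s = ε i ∧ ∃ q, ∃ n : ℤ, geo u v = (fun z => P.hol (peripheral i ^ n) • z) '' M.spiral ε i q := by
  obtain ⟨b, j, g, he⟩ := h _ hℓ
  have he' := he
  rw [base, image_geo] at he
  have hp : ∀ {w : V2}, w ≠ 0 → br u w = 0 → br w (M.p (fun _ => s) i) = 0 := fun hw h0 =>
    br_eq_zero_trans (left_ne_zero_of_br huv) (by rw [br_anticomm, h0, neg_zero]) hu
  rcases eq_endpoints_of_geo_eq huv he with ⟨h1, -⟩ | ⟨h1, -⟩
  · obtain ⟨rfl, h2, n, rfl⟩ := M.act_p (hp (act_ne_zero_of_ne _ (M.p_ne_zero _ _)) h1)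
    refine ⟨h2.symm, (b, false), n, ?_⟩
    rw [he']
    cases b <;> simp [spiral, farEnd, far, base, tip]
  · obtain ⟨h2, ⟨rfl, rfl, n, rfl⟩ | ⟨rfl, rfl, n, rfl⟩⟩ :=
      M.act_tip (hp (act_ne_zero_of_ne _ (M.tip_ne_zero _ _ _)) h1)
    · refine ⟨h2.symm, (false, true), n, ?_⟩
      rw [he']
      simp [spiral, farEnd, far, base, tip, (fin3_add j).2.1, geo_comm]
    · refine ⟨h2.symm, (true, true), n, ?_⟩
      rw [he']
      simp [spiral, farEnd, far, base, tip, image_geo, act_mul, act_inv_act, geo_comm]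

end HyperbolicPants.Model

/-! ### The mass of the loops parallel to a boundary component -/

lemma exists_segm_param {x y : ℍ} (hne : x ≠ y) : ∃ (g : SL(2, ℝ)) (a b : ℝ), a ≠ b ∧
    segm x y = (fun t => g • iexp (a + (b - a) * t)) '' Icc 0 1 := by
  obtain ⟨g, hx, hy⟩ := exists_re_eq_zero x y
  have e : ∀ {z : ℍ}, (g • z).re = 0 → z = g⁻¹ • iexp (Real.log (g • z).im) := fun {z} h => by
    rw [eq_inv_smul_iff]
    exact ext_re_im h (by rw [iexp_im, Real.exp_log (im_pos _)])
  set a := Real.log (g • x).im with ha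
  set b := Real.log (g • y).im with hb
  have hab : a ≠ b := fun h => hne (by rw [e hx, e hy, ← ha, ← hb, h])
  refine ⟨g⁻¹, a, b, hab, ?_⟩
  ext z
  rw [← smul_mem_segm g]
  constructor
  · intro hz
    have hz0 := re_eq_zero_of_mem_segm hx hy hz
    rw [mem_segm_iff_of_re_zero hx hy hz0, ← Real.log_le_log_iff (im_pos _) (im_pos _),
      ← Real.log_le_log_iff (im_pos _) (im_pos _), ← Real.log_le_log_iff (im_pos _) (im_pos _),
      ← Real.log_le_log_iff (im_pos _) (im_pos _)] at hz
    refine ⟨(Real.log (g • z).im - a) / (b - a), ?_, ?_⟩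
    · rcases hab.lt_or_gt with h | h
      · rcases hz with hz | hz
        · exact ⟨div_nonneg (by linarith) (by linarith), by rw [div_le_one (by linarith)]; linarith⟩
        · linarith
      · rcases hz with hz | hz
        · linarith
        · exact ⟨div_nonneg_of_nonpos (by linarith) (by linarith),
            by rw [div_le_one_of_neg (by linarith)]; linarith⟩
    · have : b - a ≠ 0 := sub_ne_zero.2 hab.symm
      simp only
      rw [mul_div_cancel₀ _ this, add_sub_cancel]
      exact (e hz0).symm
  · rintro ⟨t, ⟨h0, h1⟩, rfl⟩
    simp only [smul_inv_smul]
    rw [mem_segm_iff_of_re_zero hx hy (iexp_re _), iexp_im, ← Real.log_le_iff_le_exp (im_pos _),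
      ← Real.le_log_iff_exp_le (im_pos _), ← Real.log_le_iff_le_exp (im_pos _),
      ← Real.le_log_iff_exp_le (im_pos _), ← ha, ← hb]
    rcases hab.lt_or_gt with h | h
    · left; constructor <;> nlinarith
    · right; constructor <;> nlinarith

/-- A geodesic segment is transverse to the geodesics which do not contain it. -/
lemma HyperbolicPants.isTransverseArc_segm {P : HyperbolicPants} {𝓛 : Set (Set ℍ)}
    (hg : ∀ ℓ ∈ 𝓛, IsCompleteGeodesic ℓ) {x y : ℍ} (hne : x ≠ y) (hc : segm x y ⊆ P.cover)
    (h : ∀ ℓ ∈ 𝓛, ¬ segm x y ⊆ ℓ) : P.IsTransverseArc 𝓛 (segm x y) := by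
  obtain ⟨g, a, b, hab, e⟩ := exists_segm_param hne
  have hab' : b - a ≠ 0 := sub_ne_zero.2 hab.symm
  rw [e] at hc h ⊢
  have hd0 : ∀ t, HasDerivAt (fun t => (iexp (a + (b - a) * t) : ℂ))
      ((b - a) • ((Real.exp (a + (b - a) * t) : ℂ) * Complex.I)) t := fun t => by
    have := hasDerivAt_comp_affine contDiff_iexp a (b - a) t
    rwa [(hasDerivAt_iexp _).deriv] at this
  have hcd : ContDiff ℝ 1 (fun t => (iexp (a + (b - a) * t) : ℂ)) :=
    contDiff_iexp.comp (contDiff_const.add (contDiff_const.mul contDiff_id))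
  refine ⟨_, isTransverseParam_of (contDiff_smul hcd g) ?_ (fun t ht => hc ⟨t, ht, rfl⟩)
    (fun t ht => ?_) (fun t ht ℓ hℓ hm => ?_), rfl⟩
  · intro t _ t' _ htt
    have := isometry_iexp.injective (MulAction.injective g htt)
    exact mul_left_cancel₀ hab' (add_left_cancel this)
  · rw [(hasDerivAt_smul (hd0 t) g).deriv]
    refine div_ne_zero (smul_ne_zero hab' (mul_ne_zero ?_ Complex.I_ne_zero))
      (pow_ne_zero _ (denom_ne_zero' _ _))
    exact_mod_cast (Real.exp_pos _).ne'
  · obtain ⟨u, v, huv, rfl⟩ := (hg ℓ hℓ).exists_geo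
    refine ⟨u, v, huv, rfl, fun h0 => h _ hℓ ?_⟩
    have h1 := dbq_eq_zero_of_smul hcd g hm h0
    rw [mem_geo_smul'] at hm
    have hm' : bq _ _ _ = 0 := hm
    rw [bq_eq_of_re_zero (iexp_re _)] at hm'
    rw [(hd0 t).deriv] at h1
    have hex := Real.exp_pos (a + (b - a) * t)
    simp only [dbq, Complex.real_smul, Complex.re_ofReal_mul, Complex.im_ofReal_mul, Complex.I_re,
      Complex.I_im, iexp_re, iexp_im, mul_zero, sub_zero, zero_add, mul_one] at h1
    have hA : act g⁻¹ u 1 * act g⁻¹ v 1 = 0 := by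
      have h2 : Real.exp (a + (b - a) * t) * ((b - a) * Real.exp (a + (b - a) * t)) ≠ 0 :=
        mul_ne_zero hex.ne' (mul_ne_zero hab' hex.ne')
      have := (mul_eq_zero.1 h1).resolve_right h2
      linarith
    rw [hA, zero_mul, zero_add] at hm'
    rintro _ ⟨t', -, rfl⟩
    simp only
    rw [mem_geo_smul']
    change bq _ _ _ = 0
    rw [bq_eq_of_re_zero (iexp_re _), hA, hm']
    ring

namespace HyperbolicPants.Model

variable {P : HyperbolicPants} {M : P.Model} {ε : Fin 3 → Bool} {i : Fin 3}
  {k : SL(2, ℝ)} {l : ℝ} {Λ : P.MeasuredLamination}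

lemma mem_geo_left {k : SL(2, ℝ)} {v : V2} (hv : br (act k e1) v ≠ 0) {z z' : ℍ}
    (hz : z ∈ geo (act k e1) v) : z' ∈ geo (act k e1) v ↔ (k⁻¹ • z').re = (k⁻¹ • z).re := by
  obtain ⟨w, rfl⟩ : ∃ w, v = act k w := ⟨_, (act_act_inv k v).symm⟩
  rw [br_act] at hv
  have e : ∀ z : ℍ, z ∈ geo (act k e1) (act k w) ↔ w 1 * (k⁻¹ • z).re = w 0 := fun z => by
    rw [← smul_inv_smul k z, mem_geo_smul, inv_smul_smul]
    simp only [geo, mem_ofPred_eq, bq, e1, Matrix.cons_val_zero, Matrix.cons_val_one]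
    constructor <;> intro h <;> linarith
  have hw : w 1 ≠ 0 := by simpa [br, e1] using hv
  rw [e] at hz ⊢
  rw [← hz]
  exact ⟨fun h => mul_left_cancel₀ hw h, fun h => by rw [h]⟩

/-- A leaf entering the collar ends at one of the two ends of the axis, and adaptedness excludes the
end not chosen by `ε`. -/
lemma AxisFrame.exists_collar_spiral (h : M.AxisFrame i k l (ε i)) (hΛ : M.Adapted Λ ε) :
    ∃ r > 0, ∀ ℓ ∈ Λ.leaves, (∃ x ∈ ℓ, Metric.infDist x (range fun t => k • iexp t) < r) →
      (∃ v, br (act k e1) v ≠ 0 ∧ ℓ = geo (act k e1) v) ∧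
      ∃ q, ∃ n : ℤ, ℓ = (fun z => P.hol (peripheral i ^ n) • z) '' M.spiral ε i q := by
  obtain ⟨r, hr, H⟩ := h.exists_collar Λ
  refine ⟨r, hr, fun ℓ hℓ hx => ?_⟩
  obtain ⟨u, v, huv, rfl, h1 | h1⟩ := H ℓ hℓ hx
  · have h0 := left_ne_zero_of_br huv
    refine ⟨⟨v, fun hv => huv (br_eq_zero_trans h.left_ne h1 hv),
      geo_congr h0 h.left_ne (right_ne_zero_of_br huv) (right_ne_zero_of_br huv) h1 (br_self _)⟩, ?_⟩
    exact (hΛ.exists_spiral M huv hℓ (br_eq_zero_trans h.left_ne h1 h.left)).2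
  · exact absurd (hΛ.exists_spiral M huv hℓ (br_eq_zero_trans h.right_ne h1 h.right)).1
      (by cases ε i <;> decide)

lemma AxisFrame.br_p (h : M.AxisFrame i k l (ε i)) {v : V2} (hv : br (M.p ε i) v ≠ 0) :
    br (act k e1) v ≠ 0 ∧ geo (M.p ε i) v = geo (act k e1) v := by
  have h1 : br (M.p ε i) (act k e1) = 0 := by rw [br_anticomm, neg_eq_zero]; exact h.left
  refine ⟨fun h0 => hv (br_eq_zero_trans h.left_ne h1 h0), ?_⟩
  exact geo_congr (M.p_ne_zero _ _) h.left_ne (right_ne_zero_of_br hv) (right_ne_zero_of_br hv)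
    h1 (br_self _)

lemma AxisFrame.smul_mem_collar {s : Bool} (h : M.AxisFrame i k l s) {r : ℝ} (hr : 0 < r) {x : ℍ}
    (hx : Metric.infDist x (range fun t => k • iexp t) < r) :
    Metric.infDist (P.hol (peripheral i) • x) (range fun t => k • iexp t) < r := by
  obtain ⟨h1, h2⟩ := h.conj_smul 1 x
  rw [zpow_one, zpow_one] at h1 h2
  rw [infDist_smul_range, infDist_iexp_lt_iff hr] at hx ⊢
  have hl : 0 < (l ^ 2) ^ 2 := by have := h.eig.ne; positivity
  unfold np at hx ⊢
  rw [h1, h2]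
  have := mul_lt_mul_of_pos_left hx hl
  linarith

/-- With the common end at infinity the leaves are vertical lines and the boundary translation
multiplies real parts by `l ^ 2`. -/
lemma AxisFrame.mem_zpow_spiral (h : M.AxisFrame i k l (ε i)) (q : Bool × Bool) (n : ℤ) {z z₀ : ℍ}
    (h₀ : z₀ ∈ M.spiral ε i q) :
    z ∈ (fun z => P.hol (peripheral i ^ n) • z) '' M.spiral ε i q ↔
      (k⁻¹ • z).re = (l ^ 2) ^ n * (k⁻¹ • z₀).re := by
  obtain ⟨hv, e⟩ := h.br_p (M.br_spiral_ne_zero q)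
  rw [← spiral] at e
  generalize M.farEnd ε i q = v at hv e
  rw [e] at h₀ ⊢
  have hz₀ : P.hol (peripheral i ^ n) • z₀ ∈
      geo (act (P.hol (peripheral i ^ n)) (act k e1)) (act (P.hol (peripheral i ^ n)) v) :=
    (mem_geo_smul _ _ _ _).2 h₀
  have hb : br (act k e1) (act (P.hol (peripheral i ^ n)) v) ≠ 0 := by
    intro h0
    rw [← br_act (P.hol (peripheral i ^ n)), (h.act_zpow n).1, br_smul_left, h0, mul_zero] at hv
    exact hv rfl
  rw [image_geo]
  rw [(h.act_zpow n).1, geo_smul_left (zpow_ne_zero _ h.eig.ne)] at hz₀ ⊢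
  rw [mem_geo_left hb hz₀, (h.conj_smul n z₀).1]

/-- The segment from a point to its boundary translate is a graph over the boundary axis. -/
lemma AxisFrame.segm_injOn (h : M.AxisFrame i k l (ε i)) {x y : ℍ} (hx : x ∈ P.cover)
    (hy : y = P.hol (peripheral i) • x) : (k⁻¹ • x).re ≠ 0 ∧ x ≠ y ∧
      (∀ z ∈ segm x y, ∀ z' ∈ segm x y, (k⁻¹ • z).re = (k⁻¹ • z').re → z = z') ∧
      ∀ z ∈ segm x y \ {y}, 0 ≤ ((k⁻¹ • z).re / (k⁻¹ • x).re - 1) / (l ^ 2 - 1) ∧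
        ((k⁻¹ • z).re / (k⁻¹ • x).re - 1) / (l ^ 2 - 1) < 1 := by
  obtain ⟨σ, hσ⟩ := h.exists_side
  have hl1 : l ^ 2 - 1 ≠ 0 := sub_ne_zero.2 h.ne
  have hyre := h.conj_smul 1 x
  rw [zpow_one, zpow_one, ← hy] at hyre
  have hR := hσ x hx
  set R := (k⁻¹ • x).re with hRd
  have hR0 : R ≠ 0 := fun h0 => by rw [h0, mul_zero] at hR; exact hR.false
  have hpar : ∀ z ∈ segm x y, ∃ t : ℝ, 0 ≤ t ∧ t ≤ 1 ∧ (k⁻¹ • z).re = R + t * ((l ^ 2 - 1) * R) ∧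
      np (k⁻¹ • z) = np (k⁻¹ • x) + t * (np (k⁻¹ • y) - np (k⁻¹ • x)) := by
    intro z hz
    obtain ⟨t, h0, h1, h2, h3⟩ := segm_affine ((smul_mem_segm k⁻¹).2 hz)
    refine ⟨t, h0, h1, ?_, h3⟩
    rw [h2, hyre.1, ← hRd]
    ring
  have hinj : ∀ z ∈ segm x y, ∀ z' ∈ segm x y, (k⁻¹ • z).re = (k⁻¹ • z').re → z = z' := by
    intro z hz z' hz' e
    obtain ⟨t, -, -, h1, h2⟩ := hpar z hz
    obtain ⟨t', -, -, h1', h2'⟩ := hpar z' hz'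
    have htt : t = t' := by
      rw [h1, h1'] at e
      exact mul_right_cancel₀ (mul_ne_zero hl1 hR0) (add_left_cancel e)
    exact MulAction.injective k⁻¹ (eq_of_re_np e (by rw [h2, h2', htt]))
  have hys : y ∈ segm x y := by simp [segm]
  have hxy : x ≠ y := fun e => by
    have h1 := hyre.1
    rw [← e, ← hRd] at h1
    exact mul_ne_zero hl1 hR0 (by linarith)
  have hpos : ∀ z ∈ segm x y \ {y}, 0 ≤ ((k⁻¹ • z).re / R - 1) / (l ^ 2 - 1) ∧
      ((k⁻¹ • z).re / R - 1) / (l ^ 2 - 1) < 1 := by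
    rintro z ⟨hz, hzy⟩
    obtain ⟨t, h0, h1, h2, h3⟩ := hpar z hz
    have e : ((k⁻¹ • z).re / R - 1) / (l ^ 2 - 1) = t := by
      rw [h2]; field_simp; ring
    rw [e]
    refine ⟨h0, lt_of_le_of_ne h1 fun ht => hzy ?_⟩
    refine hinj z hz y hys ?_
    rw [h2, hyre.1, ht]
    ring
  exact ⟨hR0, hxy, hinj, hpos⟩

/-- Real parts along the segment, half-open at `y`, run through the fundamental domain of
multiplication by `l ^ 2`. The translate whose real part falls into it meets the segment;
`mem_spiral_unique` is the uniqueness. -/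
lemma AxisFrame.exists_mem_spiral (h : M.AxisFrame i k l (ε i)) {x y : ℍ} (hx : x ∈ P.cover)
    (hy : y = P.hol (peripheral i) • x) (q : Bool × Bool) (hq : M.spiral ε i q ∈ Λ.leaves) :
    ∃ (n : ℤ) (p : ℍ), p ∈ segm x y \ {y} ∧
      p ∈ (fun z => P.hol (peripheral i ^ n) • z) '' M.spiral ε i q := by
  obtain ⟨σ, hσ⟩ := h.exists_side
  have hR := hσ x hx
  have hl0 : 0 < l ^ 2 := by have := h.eig.ne; positivity
  have hl1 : l ^ 2 - 1 ≠ 0 := sub_ne_zero.2 h.ne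
  have hσ0 : σ ≠ 0 := fun h0 => by rw [h0, zero_mul] at hR; exact hR.false
  have hyre := h.conj_smul 1 x
  rw [zpow_one, zpow_one, ← hy] at hyre
  obtain ⟨hR0, -⟩ := h.segm_injOn hx hy
  set R := (k⁻¹ • x).re with hRd
  obtain ⟨γ, -, hγ⟩ := Λ.isGeodesic _ hq
  have hz₀ : γ 0 ∈ M.spiral ε i q := hγ ▸ mem_range_self 0
  have hβ : 0 < (k⁻¹ • γ 0).re / R := by
    have := div_pos (hσ _ (Λ.subset_cover _ hq hz₀)) hR
    rwa [mul_div_mul_left _ _ hσ0] at this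
  obtain ⟨n, hn0, hn1⟩ := exists_zpow_mem hl0 h.ne hβ
  set t := ((l ^ 2) ^ n * ((k⁻¹ • γ 0).re / R) - 1) / (l ^ 2 - 1) with ht
  obtain ⟨w, hw, hw1, -⟩ := exists_mem_segm (k⁻¹ • x) (k⁻¹ • y) (sub_nonneg.2 hn1.le) hn0 (by ring)
  have hwre : (k⁻¹ • k • w).re = (l ^ 2) ^ n * (k⁻¹ • γ 0).re := by
    rw [inv_smul_smul, hw1, hyre.1, ← hRd, ht]
    field_simp
    ring
  have hws : k • w ∈ segm x y := by rwa [← smul_mem_segm k⁻¹, inv_smul_smul]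
  refine ⟨n, k • w, ⟨hws, fun hwy => ?_⟩, (h.mem_zpow_spiral q n hz₀).2 hwre⟩
  have h1 := hyre.1
  rw [← show k • w = y from hwy, inv_smul_smul, hw1, ← hRd, hyre.1] at h1
  have h2 : (1 - t) * ((l ^ 2 - 1) * R) = 0 := by linear_combination -h1
  rcases mul_eq_zero.1 h2 with h3 | h3
  · linarith
  · exact mul_ne_zero hl1 hR0 h3

lemma AxisFrame.mem_spiral_unique (h : M.AxisFrame i k l (ε i)) {x y : ℍ} (hx : x ∈ P.cover)
    (hy : y = P.hol (peripheral i) • x) (q : Bool × Bool) (hq : M.spiral ε i q ∈ Λ.leaves)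
    (n m : ℤ) {p p' : ℍ} (hp : p ∈ segm x y \ {y}) (hp' : p' ∈ segm x y \ {y})
    (hpn : p ∈ (fun z => P.hol (peripheral i ^ n) • z) '' M.spiral ε i q)
    (hpm : p' ∈ (fun z => P.hol (peripheral i ^ m) • z) '' M.spiral ε i q) : p = p' := by
  have hl0 : 0 < l ^ 2 := by have := h.eig.ne; positivity
  obtain ⟨-, -, hinj, hpos⟩ := h.segm_injOn hx hy
  obtain ⟨γ, -, hγ⟩ := Λ.isGeodesic _ hq
  have hz₀ : γ 0 ∈ M.spiral ε i q := hγ ▸ mem_range_self 0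
  rw [h.mem_zpow_spiral q _ hz₀] at hpn hpm
  have e : (k⁻¹ • p').re / (k⁻¹ • x).re = (l ^ 2) ^ (m - n) * ((k⁻¹ • p).re / (k⁻¹ • x).re) := by
    rw [hpn, hpm, ← mul_div_assoc, ← mul_assoc, ← zpow_add₀ hl0.ne', sub_add_cancel]
  obtain ⟨a1, a2⟩ := hpos p hp
  obtain ⟨b1, b2⟩ := hpos p' hp'
  rw [e] at b1 b2
  have hmn := zpow_eq_zero_of_mem hl0 h.ne a1 a2 b1 b2
  refine hinj p hp.1 p' hp'.1 ?_
  rw [hpn, hpm, sub_eq_zero.1 hmn]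

/-- The loops close to the boundary are transverse to the leaves and meet each spiraling leaf
once. -/
lemma AxisFrame.exists_mass (h : M.AxisFrame i k l (ε i)) (hΛ : M.Adapted Λ ε) :
    ∃ r > 0, (∀ ℓ ∈ Λ.leaves, (∃ x ∈ ℓ, Metric.infDist x (range fun t => k • iexp t) < r) →
      ∃ v, br (act k e1) v ≠ 0 ∧ ℓ = geo (act k e1) v) ∧
    ∀ x ∈ P.cover, Metric.infDist x (range fun t => k • iexp t) < r →
      P.IsTransverseArc Λ.leaves (segm x (P.hol (peripheral i) • x)) ∧
      Λ.μ (segm x (P.hol (peripheral i) • x))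
        (segm x (P.hol (peripheral i) • x) \ {P.hol (peripheral i) • x}) =
        ∑ q, Λ.wt (M.spiral ε i q) := by
  classical
  obtain ⟨r, hr, H⟩ := h.exists_collar_spiral hΛ
  refine ⟨r, hr, fun ℓ hℓ hx => (H ℓ hℓ hx).1, fun x hx hxr => ?_⟩
  obtain ⟨y, hy⟩ : ∃ y, y = P.hol (peripheral i) • x := ⟨_, rfl⟩
  have hyc : y ∈ P.cover := hy ▸ smul_mem_cover _ hx
  have hyr : Metric.infDist y (range fun t => k • iexp t) < r := hy ▸ h.smul_mem_collar hr hxr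
  rw [← hy]
  obtain ⟨-, hxy, hinj, -⟩ := h.segm_injOn hx hy
  have hcov : segm x y ⊆ P.cover := geodConvex_interior (geodConvex_convexCore _) _ hx _ hyc
  have hcol : ∀ z ∈ segm x y, Metric.infDist z (range fun t => k • iexp t) < r :=
    geodConvex_collar k hr _ hxr _ hyr
  have hxs : x ∈ segm x y := by simp [segm]
  have hys : y ∈ segm x y := by simp [segm]
  have hT : P.IsTransverseArc Λ.leaves (segm x y) := by
    refine isTransverseArc_segm Λ.isGeodesic hxy hcov fun ℓ hℓ hsub => hxy ?_
    obtain ⟨⟨v, hv, rfl⟩, -⟩ := H ℓ hℓ ⟨x, hsub hxs, hxr⟩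
    exact hinj x hxs y hys ((mem_geo_left hv (hsub hys)).1 (hsub hxs))
  refine ⟨hT, ?_⟩
  obtain ⟨S, hS, hsum⟩ := Λ.measure_eq_sum hT (segm x y \ {y})
  rw [hsum, ← Finset.sum_filter_ne_zero (s := (Finset.univ : Finset (Bool × Bool)))]
  have hL : ∀ q ∈ Finset.univ.filter fun q => Λ.wt (M.spiral ε i q) ≠ 0,
      M.spiral ε i q ∈ Λ.leaves := fun q hq =>
    MeasuredLamination.wt_ne_zero_iff.1 (Finset.mem_filter.1 hq).2
  have hiL : ∀ q, M.spiral ε i q ∈ Λ.leaves → ∀ n : ℤ,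
      (fun z => P.hol (peripheral i ^ n) • z) '' M.spiral ε i q ∈ Λ.leaves := fun q hq n =>
    Λ.leaves_invariant _ _ hq
  have hex := fun q (hq : M.spiral ε i q ∈ Λ.leaves) => h.exists_mem_spiral hx hy q hq
  choose n p hp hpn using hex
  symm
  refine Finset.sum_bij (fun q hq => p q (hL q hq)) ?_ ?_ ?_ ?_
  · intro q hq
    exact (hS _).2 ⟨hp q _, (hp q _).1, _, hiL q (hL q hq) _, hpn q _⟩
  · intro q hq q' hq' e
    have heq : (fun z => P.hol (peripheral i ^ n q (hL q hq)) • z) '' M.spiral ε i q =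
        (fun z => P.hol (peripheral i ^ n q' (hL q' hq')) • z) '' M.spiral ε i q' := by
      by_contra hne
      have h2 := hpn q' (hL q' hq')
      rw [← e] at h2
      exact Set.disjoint_left.1 (Λ.disjoint _ (hiL q (hL q hq) _) _ (hiL q' (hL q' hq') _) hne)
        (hpn q (hL q hq)) h2
    refine M.spiral_injective (n := n q (hL q hq) - n q' (hL q' hq')) (i := i) (ε := ε) ?_
    have e2 := congrArg (fun A => (fun z => P.hol (peripheral i ^ (-n q' (hL q' hq'))) • z) '' A) heq
    simp only [image_image, ← mul_smul, ← map_mul, ← zpow_add, neg_add_cancel, zpow_zero, map_one,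
      one_smul, image_id'] at e2
    rwa [neg_add_eq_sub] at e2
  · intro z hz
    obtain ⟨hz1, hz2, ℓ, hℓ, hzℓ⟩ := (hS z).1 hz
    obtain ⟨-, q, m, rfl⟩ := H ℓ hℓ ⟨z, hzℓ, hcol z hz2⟩
    have hq : M.spiral ε i q ∈ Λ.leaves := (MeasuredLamination.image_mem_leaves_iff _).1 hℓ
    refine ⟨q, Finset.mem_filter.2 ⟨Finset.mem_univ _, MeasuredLamination.wt_ne_zero_iff.2 hq⟩, ?_⟩
    exact h.mem_spiral_unique hx hy q hq _ m (hp q hq) hz1 (hpn q hq) hzℓ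
  · intro q hq
    have hq' := hL q hq
    rw [(MeasuredLamination.wt_spec (hiL q hq' (n q hq'))).2.2.1 _ hT _ (hp q _).1 (hpn q _),
      MeasuredLamination.wt_image]

end HyperbolicPants.Model

namespace HyperbolicPants.Model

/-! ### Signed masses -/

variable {P : HyperbolicPants} (M : P.Model) {i : Fin 3} {Λ : P.MeasuredLamination} {α : ℝ → ℍ}

/-- The sum of the weights of the leaves spiraling around a boundary component. -/
def mass (Λ : P.MeasuredLamination) (ε : Fin 3 → Bool) (i : Fin 3) : ℝ :=
  (∑ q, Λ.wt (M.spiral ε i q)).toReal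

variable {M}

lemma mass_nonneg {ε : Fin 3 → Bool} : 0 ≤ M.mass Λ ε i := ENNReal.toReal_nonneg

lemma ofReal_mass {ε : Fin 3 → Bool} :
    ENNReal.ofReal (M.mass Λ ε i) = ∑ q, Λ.wt (M.spiral ε i q) :=
  ENNReal.ofReal_toReal (ENNReal.sum_ne_top.2 fun _ _ => Λ.wt_ne_top _)

/-- The end `s` towards which `α` points does not depend on the lamination. Leaves ending there are
positive; for the other end the frame is reversed by the half-turn. -/
lemma exists_hasSignedMass (hα : IsAxis (P.hol (peripheral i)) α) :
    ∃ s : Bool, ∀ (Λ : P.MeasuredLamination) (ε : Fin 3 → Bool), M.Adapted Λ ε →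
      Λ.HasSignedMass i α ((if ε i = s then 1 else -1) * M.mass Λ ε i) := by
  obtain ⟨k, l, s, hl, hk, E, h1, h2, -⟩ := M.exists_of_isAxis hα
  have F : M.AxisFrame i k l s := ⟨hl, E, h1, h2⟩
  obtain rfl : α = fun t => k • iexp t := funext hk
  have asym : ∀ {k : SL(2, ℝ)} {v : V2}, br (act k e1) v ≠ 0 →
      AsymptoticTo (geo (act k e1) v) (fun t => k • iexp t) := fun hv =>
    asymptoticTo_geo hv (br_self _)
  refine ⟨s, fun Λ ε hΛ => ?_⟩
  by_cases hs : ε i = s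
  · obtain ⟨r, hr, H, H'⟩ := AxisFrame.exists_mass (hs ▸ F) hΛ
    rw [if_pos hs, one_mul]
    refine ⟨r, hr, fun ℓ hℓ hx => ?_, fun x hx hxr => ?_⟩
    · obtain ⟨v, hv, rfl⟩ := H ℓ hℓ hx
      exact ⟨Or.inl (asym hv), fun _ => asym hv, fun hm => absurd hm (not_lt.2 mass_nonneg)⟩
    · rw [abs_of_nonneg mass_nonneg, ofReal_mass]
      exact H' x hx hxr
  · have hs' : (!s) = ε i := by revert hs; cases s <;> cases ε i <;> decide
    obtain ⟨r, hr, H, H'⟩ := AxisFrame.exists_mass (hs' ▸ F.swap) hΛ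
    rw [if_neg hs, neg_one_mul]
    have hran : (range fun t => (k * rotS) • iexp t) = range fun t => k • iexp t := by
      rw [← smul_iexp_neg]
      exact (Equiv.neg ℝ).surjective.range_comp (fun t => k • iexp t)
    rw [hran] at H H'
    refine ⟨r, hr, fun ℓ hℓ hx => ?_, fun x hx hxr => ?_⟩
    · obtain ⟨v, hv, rfl⟩ := H ℓ hℓ hx
      have := asym hv
      rw [← smul_iexp_neg] at this
      exact ⟨Or.inr this, fun hm => absurd hm (not_lt.2 (neg_nonpos.2 mass_nonneg)), fun _ => this⟩
    · rw [abs_neg, abs_of_nonneg mass_nonneg, ofReal_mass]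
      exact H' x hx hxr

/-- Without points of the interior in each collar, the condition on the mass would be empty. -/
lemma AxisFrame.exists_mem_cover_near {k : SL(2, ℝ)} {l : ℝ} {s : Bool} (F : M.AxisFrame i k l s)
    {r : ℝ} (hr : 0 < r) :
    ∃ x ∈ P.cover, Metric.infDist x (range fun t => k • iexp t) < r := by
  obtain ⟨σ, hσ⟩ := F.exists_side
  obtain ⟨z, hz⟩ : (M.base (fun _ => true) false 0).Nonempty := by
    obtain ⟨γ, -, hγ⟩ := isCompleteGeodesic_geo (M.br_base_ne_zero (fun _ => true) false 0)
    exact ⟨γ 0, by rw [base, ← hγ]; exact mem_range_self 0⟩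
  have hzc := M.base_subset_cover _ _ _ hz
  have haxis : geo e1 e2 ⊆ (fun z : ℍ => k • z) ⁻¹' convexCore P.hol := fun w hw => by
    rw [← mem_geo_smul k, F.geo_eq] at hw
    exact (isClosed_convexCore _).frontier_subset (M.axis_subset_frontier i hw)
  obtain ⟨w, hw, hwr⟩ := exists_mem_interior_near_axis
    (S := (fun z : ℍ => k • z) ⁻¹' convexCore P.hol) (w := k⁻¹ • z)
    (geodConvex_preimage (geodConvex_convexCore _) k) haxis
    (by rw [mem_preimage, smul_inv_smul]; exact interior_subset hzc)
    (fun h0 => by have := hσ z hzc; rw [h0, mul_zero] at this; exact this.false) hr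
  refine ⟨k • w, smul_mem_interior_of_preimage k hw, ?_⟩
  rwa [infDist_smul_range, inv_smul_smul, ← geo_e_eq_range]

/-- A common loop gives equal absolute values. If the signs differed, a leaf meeting this loop would
be asymptotic to both ends of the axis, hence equal to the axis, which is not in the interior. -/
lemma hasSignedMass_unique (M : P.Model) (hα : IsAxis (P.hol (peripheral i)) α) {m m' : ℝ}
    (h : Λ.HasSignedMass i α m) (h' : Λ.HasSignedMass i α m') : m = m' := by
  obtain ⟨k, l, s, hl, hk, E, h1, h2, -⟩ := M.exists_of_isAxis hα
  have F : M.AxisFrame i k l s := ⟨hl, E, h1, h2⟩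
  obtain rfl : α = fun t => k • iexp t := funext hk
  obtain ⟨r, hr, H1, H2⟩ := h
  obtain ⟨r', hr', H1', H2'⟩ := h'
  have hrr := lt_min hr hr'
  obtain ⟨x, hx, hxr⟩ := F.exists_mem_cover_near hrr
  obtain ⟨hT, hm⟩ := H2 x hx (hxr.trans_le (min_le_left _ _))
  have hm' := (H2' x hx (hxr.trans_le (min_le_right _ _))).2
  rw [hm] at hm'
  have habs := (ENNReal.ofReal_eq_ofReal_iff (abs_nonneg _) (abs_nonneg _)).1 hm'
  by_contra hne
  obtain rfl : m = -m' := (abs_eq_abs.1 habs).resolve_left hne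
  have hm0 : m' ≠ 0 := fun h0 => hne (by rw [h0, neg_zero])
  obtain ⟨S, hS, hsum⟩ := Λ.measure_eq_sum hT (segm x (P.hol (peripheral i) • x) \
    {P.hol (peripheral i) • x})
  rw [hm] at hsum
  have hSne : S.Nonempty := by
    by_contra h0
    rw [Finset.not_nonempty_iff_eq_empty.1 h0, Finset.sum_empty, ENNReal.ofReal_eq_zero,
      abs_neg] at hsum
    exact hm0 (abs_nonpos_iff.1 hsum)
  obtain ⟨p, hp⟩ := hSne
  obtain ⟨-, hps, ℓ, hℓ, hpℓ⟩ := (hS p).1 hp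
  have hpr := geodConvex_collar k hrr _ hxr _ (F.smul_mem_collar hrr hxr) hps
  obtain ⟨-, a1, a2⟩ := H1 ℓ hℓ ⟨p, hpℓ, lt_of_lt_of_le hpr (min_le_left _ _)⟩
  obtain ⟨-, b1, b2⟩ := H1' ℓ hℓ ⟨p, hpℓ, lt_of_lt_of_le hpr (min_le_right _ _)⟩
  have hboth : AsymptoticTo ℓ (fun t => k • iexp t) ∧ AsymptoticTo ℓ (fun t => k • iexp (-t)) := by
    rcases lt_or_gt_of_ne hm0 with h | h
    · exact ⟨a1 (by linarith), b2 h⟩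
    · exact ⟨b1 h, a2 (by linarith)⟩
  rw [smul_iexp_neg] at hboth
  obtain ⟨u, v, huv, rfl⟩ := (Λ.isGeodesic ℓ hℓ).exists_geo
  have c1 := br_eq_zero_of_asymptoticTo hboth.1
  have c2 := br_eq_zero_of_asymptoticTo hboth.2
  rw [act_mul, act_rotS_e1] at c2
  have hu := left_ne_zero_of_br huv
  have hv := right_ne_zero_of_br huv
  have hne' : br (act k e1) (act k e2) ≠ 0 := by rw [F.eig.br]; exact one_ne_zero
  have key : ∀ {w : V2}, w ≠ 0 → br w (act k e1) = 0 → br w (act k e2) = 0 → False :=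
    fun hw e e' => hne' (br_eq_zero_trans hw (by rw [br_anticomm, e, neg_zero]) e')
  have haxis : geo u v = geo (M.F.en true i) (M.F.en false i) := by
    rw [← F.geo_eq]
    rcases c1 with c1 | c1 <;> rcases c2 with c2 | c2
    · exact (key hu c1 c2).elim
    · exact geo_congr hu F.left_ne hv F.right_ne c1 c2
    · rw [geo_comm]
      exact geo_congr hv F.left_ne hu F.right_ne c1 c2
    · exact (key hv c1 c2).elim
  have hpc := Λ.subset_cover _ hℓ hpℓ
  rw [haxis] at hpℓ
  exact M.cover_disjoint_axis true i p hpℓ hpc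

end HyperbolicPants.Model

namespace HyperbolicPants.Model

/-! ### Weights and signed masses -/

variable {P : HyperbolicPants} {M : P.Model} {i : Fin 3} {Λ Λ' : P.MeasuredLamination}
  {ε : Fin 3 → Bool} {b : Bool}

/-- Weights of the leaves of the two types which are only non-zero on disjoint leaves. -/
structure CompatWeights (c : Bool → Fin 3 → ℝ) : Prop where
  nonneg : ∀ b i, 0 ≤ c b i
  compat : ∀ b i b' j, c b i ≠ 0 → c b' j ≠ 0 → Compat b i b' j

/-- The mass of a boundary component. -/
def massOf (c : Bool → Fin 3 → ℝ) (i : Fin 3) : ℝ := c false i + c false (i + 2) + 2 * c true i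

/-- Half the defect in the triangle inequality. -/
def defect (m : Fin 3 → ℝ) (i : Fin 3) : ℝ := (m i - m (i + 1) - m (i + 2)) / 2

lemma fin3_add_two_two (i : Fin 3) : i + 2 + 2 = i + 1 ∧ i + 1 + 1 = i + 2 := by revert i; decide

lemma defect_massOf (c : Bool → Fin 3 → ℝ) (i : Fin 3) : defect (massOf c) i =
    c true i - c false (i + 1) - c true (i + 1) - c true (i + 2) := by
  rw [defect, massOf, massOf, massOf, (fin3_add i).2.1, (fin3_add_two_two i).1]
  ring

/-- The defect is the weight of the self-arc at `i` minus the weights of the three arcs incompatible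
with it. Either the first or all the others vanish. -/
lemma CompatWeights.true_eq {c : Bool → Fin 3 → ℝ} (h : CompatWeights c) (i : Fin 3) :
    c true i = max 0 (defect (massOf c) i) := by
  rw [defect_massOf]
  obtain ⟨-, -, n1, n2, n3⟩ := fin3_add i
  by_cases h0 : c true i = 0
  · rw [h0, max_eq_left]
    linarith [h.nonneg false (i + 1), h.nonneg true (i + 1), h.nonneg true (i + 2)]
  · have h1 : c false (i + 1) = 0 := by
      by_contra hc
      exact h.compat true i false (i + 1) h0 hc rfl
    have h2 : c true (i + 1) = 0 := by
      by_contra hc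
      exact n2 (h.compat true (i + 1) true i hc h0)
    have h3 : c true (i + 2) = 0 := by
      by_contra hc
      exact n3 (h.compat true (i + 2) true i hc h0)
    rw [h1, h2, h3, sub_zero, sub_zero, sub_zero, max_eq_right (h.nonneg _ _)]

/-- The masses determine the self-arc weights by `true_eq`, and then the edge weights by
`defect_massOf`. -/
lemma CompatWeights.ext {c c' : Bool → Fin 3 → ℝ} (h : CompatWeights c) (h' : CompatWeights c')
    (hm : ∀ i, massOf c i = massOf c' i) : c = c' := by
  have hm' : massOf c = massOf c' := funext hm
  have ht : ∀ i, c true i = c' true i := fun i => by rw [h.true_eq, h'.true_eq, hm']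
  have hf : ∀ i, c false (i + 1) = c' false (i + 1) := fun i => by
    have h1 := defect_massOf c i
    have h2 := defect_massOf c' i
    rw [hm', h2, ht, ht, ht] at h1
    linarith
  funext b i
  cases b
  · have := hf (i + 2)
    rwa [(fin3_add i).1] at this
  · exact ht i

lemma max_aux {x y z : ℝ} (hxy : x + y ≤ 0) (hyz : y + z ≤ 0) (hxz : x + z ≤ 0) :
    0 ≤ max 0 z - max 0 x - max 0 y - z ∧ (0 < z → max 0 z - max 0 x - max 0 y - z = 0) := by
  rcases max_cases 0 x with ⟨h1, h1'⟩ | ⟨h1, h1'⟩ <;>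
    rcases max_cases 0 y with ⟨h2, h2'⟩ | ⟨h2, h2'⟩ <;>
    rcases max_cases 0 z with ⟨h3, h3'⟩ | ⟨h3, h3'⟩ <;>
    rw [h1, h2, h3] <;> refine ⟨?_, fun _ => ?_⟩ <;> linarith

/-- The sum of two defects is minus a mass, so at most one defect is positive. The self-arcs receive
the positive parts of the defects. -/
lemma exists_compatWeights (m : Fin 3 → ℝ) (hm : ∀ i, 0 ≤ m i) :
    ∃ c, CompatWeights c ∧ ∀ i, massOf c i = m i := by
  set D := defect m with hD
  have hd : ∀ i, D (i + 1) + D (i + 2) = -m i := fun i => by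
    simp only [hD, defect, (fin3_add i).1, (fin3_add i).2.1, fin3_add_two_two]
    ring
  have hpair : ∀ i j, i ≠ j → D i + D j ≤ 0 := by
    intro i j hij
    have h0 := hm
    have := hd 0
    have := hd 1
    have := hd 2
    fin_cases i <;> fin_cases j <;> simp_all <;> linarith [h0 0, h0 1, h0 2]
  -- The relation `defect_massOf` at `j + 2`, solved for the weight of the edge `j`.
  let f : Fin 3 → ℝ := fun j => max 0 (D (j + 2)) - max 0 (D j) - max 0 (D (j + 1)) - D (j + 2)
  have hf : ∀ j, 0 ≤ f j ∧ (0 < D (j + 2) → f j = 0) := fun j => by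
    obtain ⟨-, -, n1, n2, n3⟩ := fin3_add j
    exact max_aux (hpair _ _ n2.symm) (hpair _ _ n1) (hpair _ _ n3.symm)
  have hmax : ∀ i, max 0 (D i) ≠ 0 → 0 < D i := fun i h => by
    by_contra hc
    exact h (max_eq_left (not_lt.1 hc))
  have hft : ∀ i, max 0 (D i) ≠ 0 → f (i + 1) = 0 := fun i h => (hf (i + 1)).2 <| by
    rw [(fin3_add i).2.1]
    exact hmax i h
  refine ⟨fun b i => if b then max 0 (D i) else f i, ⟨?_, ?_⟩, fun i => ?_⟩
  · rintro (_ | _) i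
    · exact (hf i).1
    · exact le_max_left _ _
  · rintro (_ | _) i (_ | _) j h h'
    · trivial
    · rintro rfl
      exact h (hft j h')
    · rintro rfl
      exact h' (hft i h)
    · by_contra hij
      have := hpair i j hij
      linarith [hmax i h, hmax j h']
  · simp only [massOf, f, (fin3_add i).1, fin3_add_two_two, if_true, Bool.false_eq_true, if_false]
    linarith [hd i]

/-- The weights of a measured lamination on the leaves of the two types. -/
def weights (M : P.Model) (Λ : P.MeasuredLamination) (ε : Fin 3 → Bool) (b : Bool) (i : Fin 3) : ℝ :=
  (Λ.wt (M.base ε b i)).toReal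

lemma mem_leaves_of_weights (h : M.weights Λ ε b i ≠ 0) : M.base ε b i ∈ Λ.leaves := by
  rw [← MeasuredLamination.wt_ne_zero_iff]
  intro h0
  exact h (by rw [weights, h0, ENNReal.toReal_zero])

/-- Incompatible candidates cross, so they are not both leaves. -/
lemma compatWeights (M : P.Model) (Λ : P.MeasuredLamination) (ε : Fin 3 → Bool) :
    CompatWeights (M.weights Λ ε) := by
  refine ⟨fun _ _ => ENNReal.toReal_nonneg, fun b i b' j h h' => ?_⟩
  by_contra hc
  exact absurd (M.cr_base_neg ε hc) (not_lt.2 (Λ.cr_nonneg (M.br_base_ne_zero ε b i)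
    (mem_leaves_of_weights h) (mem_leaves_of_weights h')))

/-- Of the four classes of lifts at a boundary component, two are lifts of the same self-arc, one
for each of its ends; this is the factor `2` in `massOf`. -/
lemma mass_eq (M : P.Model) (Λ : P.MeasuredLamination) (ε : Fin 3 → Bool) (i : Fin 3) :
    M.mass Λ ε i = massOf (M.weights Λ ε) i := by
  rw [mass, ENNReal.toReal_sum fun _ _ => Λ.wt_ne_top _, Fintype.sum_prod_type]
  simp only [Fintype.sum_bool, M.wt_spiral, massOf, weights]
  simp
  ring

lemma Adapted.ext (h : M.Adapted Λ ε) (h' : M.Adapted Λ' ε) (hm : ∀ i, M.mass Λ ε i = M.mass Λ' ε i) :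
    Λ = Λ' := by
  have hw := (M.compatWeights Λ ε).ext (M.compatWeights Λ' ε) fun i => by
    rw [← M.mass_eq, ← M.mass_eq, hm]
  have hb : ∀ b i, Λ.wt (M.base ε b i) = Λ'.wt (M.base ε b i) := fun b i =>
    (ENNReal.toReal_eq_toReal_iff' (Λ.wt_ne_top _) (Λ'.wt_ne_top _)).1 (congrFun (congrFun hw b) i)
  refine MeasuredLamination.ext_wt fun ℓ => ?_
  by_cases hℓ : ∃ b i g, ℓ = (fun z => P.hol g • z) '' M.base ε b i
  · obtain ⟨b, i, g, rfl⟩ := hℓ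
    rw [MeasuredLamination.wt_image, MeasuredLamination.wt_image, hb]
  · rw [MeasuredLamination.wt_of_not_mem fun hm => hℓ (h ℓ hm),
      MeasuredLamination.wt_of_not_mem fun hm => hℓ (h' ℓ hm)]

/-- The direction of spiraling only matters where the mass is not zero. -/
lemma Adapted.congr {ε' : Fin 3 → Bool} (h : M.Adapted Λ ε)
    (hε : ∀ i, M.mass Λ ε i ≠ 0 → ε i = ε' i) : M.Adapted Λ ε' := by
  intro ℓ hℓ
  obtain ⟨b, i, g, rfl⟩ := h ℓ hℓ
  have hb := (MeasuredLamination.image_mem_leaves_iff g).1 hℓ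
  have hpos : 0 < M.weights Λ ε b i :=
    ENNReal.toReal_pos (MeasuredLamination.wt_ne_zero_iff.2 hb) (Λ.wt_ne_top _)
  have hc := (M.compatWeights Λ ε).nonneg
  refine ⟨b, i, g, ?_⟩
  rw [M.base_congr (hε i ?_) fun hbf => hε (i + 1) ?_]
  · rw [M.mass_eq, massOf]
    have := hc false i
    have := hc false (i + 2)
    have := hc true i
    cases b <;> linarith
  · subst hbf
    rw [M.mass_eq, massOf, (fin3_add i).2.1]
    have := hc false (i + 1)
    have := hc true (i + 1)
    linarith

/-- The six candidates are pairwise inequivalent. When the far end is sent to the near end, the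
translate is a spiral with second index `true`, which differs from the ones with `false`. -/
lemma image_base_injective {b b' : Bool} {i j : Fin 3} {g : FreeGroup (Fin 2)}
    (h : (fun z => P.hol g • z) '' M.base ε b i = M.base ε b' j) : b = b' ∧ i = j := by
  have hs : ∀ b i, M.base ε b i = M.spiral ε i (b, false) := fun b i => by
    cases b <;> simp [spiral, farEnd, far, base, tip]
  have h' := h
  rw [base, base, image_geo] at h
  rcases eq_endpoints_of_geo_eq (by rw [br_act]; exact M.br_base_ne_zero ε b i) h with
    ⟨h1, -⟩ | ⟨-, h1⟩
  · obtain ⟨rfl, -, n, rfl⟩ := M.act_p h1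
    rw [hs, hs] at h'
    exact ⟨congrArg Prod.fst (M.spiral_injective h'), rfl⟩
  · exfalso
    rw [hs b' j] at h'
    obtain ⟨-, ⟨rfl, rfl, n, rfl⟩ | ⟨rfl, rfl, n, rfl⟩⟩ := M.act_tip h1
    · have e : M.base ε false i = M.spiral ε (i + 1) (false, true) := by
        simp [spiral, farEnd, far, base, tip, (fin3_add i).2.1, geo_comm]
      rw [e] at h'
      exact Bool.false_ne_true (congrArg Prod.snd (M.spiral_injective h')).symm
    · have e : (fun z => P.hol (peripheral i ^ n * (peripheral (i + 2))⁻¹) • z) '' M.base ε true i =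
          (fun z => P.hol (peripheral i ^ n) • z) '' M.spiral ε i (true, true) := by
        simp [spiral, farEnd, far, base, tip, image_geo, act_mul, act_inv_act, geo_comm]
      rw [e] at h'
      exact Bool.false_ne_true (congrArg Prod.snd (M.spiral_injective h')).symm

end HyperbolicPants.Model

/-! ### Realization of given weights -/

namespace HyperbolicPants.Model

variable {P : HyperbolicPants} (M : P.Model) {ε : Fin 3 → Bool} {c : Bool → Fin 3 → ℝ}

open Classical in
/-- The weight of a geodesic which is a lift of one of the leaves of given weights. -/
def baseWt (ε : Fin 3 → Bool) (c : Bool → Fin 3 → ℝ) (ℓ : Set ℍ) : ENNReal :=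
  ∑ q : Bool × Fin 3, if ∃ g, ℓ = (fun z => P.hol g • z) '' M.base ε q.1 q.2
    then ENNReal.ofReal (c q.1 q.2) else 0

lemma baseWt_image (b : Bool) (i : Fin 3) (g : FreeGroup (Fin 2)) :
    M.baseWt ε c ((fun z => P.hol g • z) '' M.base ε b i) = ENNReal.ofReal (c b i) := by
  rw [baseWt, Finset.sum_eq_single (b, i)]
  · exact if_pos ⟨g, rfl⟩
  · rintro ⟨b', j⟩ - hne
    refine if_neg fun ⟨g', hg'⟩ => hne ?_
    have e : (fun z => P.hol (g'⁻¹ * g) • z) '' M.base ε b i = M.base ε b' j := by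
      have := congrArg (fun A => (fun z => P.hol g'⁻¹ • z) '' A) hg'
      simpa only [image_image, ← mul_smul, ← map_mul, inv_mul_cancel, map_one, one_smul,
        image_id'] using this
    obtain ⟨rfl, rfl⟩ := M.image_base_injective e
    rfl
  · exact fun h => absurd (Finset.mem_univ _) h

lemma exists_of_baseWt {ℓ : Set ℍ} (h : M.baseWt ε c ℓ ≠ 0) :
    ∃ b i g, ℓ = (fun z => P.hol g • z) '' M.base ε b i ∧ c b i ≠ 0 := by
  obtain ⟨q, -, hq⟩ := Finset.exists_ne_zero_of_sum_ne_zero h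
  by_cases hg : ∃ g, ℓ = (fun z => P.hol g • z) '' M.base ε q.1 q.2
  · obtain ⟨g, hg'⟩ := id hg
    refine ⟨_, _, g, hg', fun h0 => hq ?_⟩
    rw [if_pos hg, h0, ENNReal.ofReal_zero]
  · exact absurd (if_neg hg) hq

/-- The system of weights on the lifts of compatible leaves. -/
def wtSys (ε : Fin 3 → Bool) (hc : CompatWeights c) : P.WtSys where
  w := M.baseWt ε c
  ne_top ℓ := ENNReal.sum_ne_top.2 fun q _ => by
    split_ifs
    · exact ENNReal.ofReal_ne_top
    · exact ENNReal.zero_ne_top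
  isGeodesic ℓ h := by
    obtain ⟨b, i, g, rfl, -⟩ := M.exists_of_baseWt h
    rw [base, image_geo]
    exact isCompleteGeodesic_geo (by rw [br_act]; exact M.br_base_ne_zero ε b i)
  subset_cover ℓ h := by
    obtain ⟨b, i, g, rfl, -⟩ := M.exists_of_baseWt h
    rintro _ ⟨z, hz, rfl⟩
    exact smul_mem_cover g (M.base_subset_cover _ _ _ hz)
  disjoint ℓ h ℓ' h' hne := by
    obtain ⟨b, i, g, rfl, hb⟩ := M.exists_of_baseWt h
    obtain ⟨b', j, g', rfl, hb'⟩ := M.exists_of_baseWt h'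
    have e : (fun z => P.hol g' • z) '' M.base ε b' j = (fun z => P.hol g • z) ''
        ((fun z => P.hol (g⁻¹ * g') • z) '' M.base ε b' j) := by
      simp only [image_image, ← mul_smul, ← map_mul, mul_inv_cancel_left]
    rw [e] at hne ⊢
    exact (disjoint_image_iff (MulAction.injective (P.hol g))).2
      (M.base_disjoint ε (hc.compat _ _ _ _ hb hb') _ fun h0 => hne (by rw [← h0]))
  locFinite := M.locFinite fun ℓ h => by
    obtain ⟨b, i, g, h, -⟩ := M.exists_of_baseWt h
    exact ⟨ε, b, i, g, h⟩
  inv g ℓ := by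
    refine Finset.sum_congr rfl fun q _ => ?_
    congr 1
    refine propext ⟨fun ⟨g', h⟩ => ⟨g⁻¹ * g', ?_⟩, fun ⟨g', h⟩ => ⟨g * g', ?_⟩⟩
    · have := congrArg (fun A => (fun z => P.hol g⁻¹ • z) '' A) h
      simpa only [image_image, ← mul_smul, ← map_mul, inv_mul_cancel, map_one, one_smul,
        image_id'] using this
    · rw [h, image_image]
      simp only [← mul_smul, ← map_mul]

lemma exists_lamination (ε : Fin 3 → Bool) (hc : CompatWeights c) :
    ∃ Λ : P.MeasuredLamination, M.Adapted Λ ε ∧ ∀ i, M.mass Λ ε i = massOf c i := by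
  refine ⟨(M.wtSys ε hc).lamination, fun ℓ hℓ => ?_, fun i => ?_⟩
  · obtain ⟨b, i, g, h, -⟩ := M.exists_of_baseWt hℓ
    exact ⟨b, i, g, h⟩
  · rw [mass_eq]
    congr 1
    funext b i
    rw [weights, WtSys.wt_lamination]
    have := M.baseWt_image (ε := ε) (c := c) b i 1
    simp only [map_one, one_smul, image_id'] at this
    change (M.baseWt ε c _).toReal = _
    rw [this, ENNReal.toReal_ofReal (hc.nonneg b i)]

end HyperbolicPants.Model

end PantsLamination

end

/-- On a hyperbolic pair of pants `P` with a chosen positive way `α i` of spiraling around each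
boundary component, the signed masses of the boundary components are well defined for each measured
geodesic lamination, and the map `F` which sends a lamination to its signed masses is a bijection
onto `ℝ³`. -/
theorem mainTheorem8 (P : PantsLamination.HyperbolicPants) (α : Fin 3 → ℝ → ℍ)
    (hα : ∀ i, PantsLamination.IsAxis (P.hol (PantsLamination.peripheral i)) (α i)) :
    ∃ F : P.MeasuredLamination → (Fin 3 → ℝ),
      (∀ (Λ : P.MeasuredLamination) (i : Fin 3) (m : ℝ),
        Λ.HasSignedMass i (α i) m ↔ m = F Λ i) ∧
      Function.Bijective F := by
  obtain ⟨M⟩ := P.exists_model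
  choose s hs using fun i => M.exists_hasSignedMass (hα i)
  choose ε hε using M.exists_adapted
  let F : P.MeasuredLamination → Fin 3 → ℝ := fun Λ i =>
    (if ε Λ i = s i then 1 else -1) * M.mass Λ (ε Λ) i
  have hF : ∀ Λ i m, Λ.HasSignedMass i (α i) m ↔ m = F Λ i := fun Λ i m =>
    ⟨fun h => M.hasSignedMass_unique (hα i) h (hs i Λ _ (hε Λ)), fun h => h ▸ hs i Λ _ (hε Λ)⟩
  -- By uniqueness of the signed mass, its absolute value can be computed with any adapted
  -- directions.
  have habs : ∀ Λ i ε', M.Adapted Λ ε' → |F Λ i| = M.mass Λ ε' i := fun Λ i ε' h' => by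
    rw [← (hF Λ i _).1 (hs i Λ ε' h'), abs_mul, abs_of_nonneg (M.mass_nonneg (Λ := Λ))]
    split_ifs <;> simp
  refine ⟨F, hF, fun Λ Λ' h => ?_, fun y => ?_⟩
  -- The two laminations may come with different directions where the mass vanishes; where it does
  -- not, equal signed masses force equal directions.
  · have hΛ' : M.Adapted Λ' (ε Λ) := (hε Λ').congr fun i hi => ?_
    · refine (hε Λ).ext hΛ' fun i => ?_
      rw [← habs Λ i _ (hε Λ), ← habs Λ' i _ hΛ', h]
    · have hm : M.mass Λ (ε Λ) i = M.mass Λ' (ε Λ') i := by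
        rw [← habs Λ i _ (hε Λ), ← habs Λ' i _ (hε Λ'), h]
      have hi' := congrFun h i
      simp only [F, hm] at hi'
      have hsgn := mul_right_cancel₀ hi hi'
      by_contra hne
      revert hsgn
      cases h1 : ε Λ i <;> cases h2 : ε Λ' i <;> cases s i <;> simp_all <;> norm_num
  · obtain ⟨c, hc, hm⟩ :=
      PantsLamination.HyperbolicPants.Model.exists_compatWeights (fun i => |y i|) fun i => abs_nonneg _
    -- The weights realize the absolute values, and the directions follow the signs, with an
    -- arbitrary choice where `y i = 0`.
    obtain ⟨Λ, hΛ, hΛm⟩ := M.exists_lamination (fun i => if 0 ≤ y i then s i else !(s i)) hc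
    refine ⟨Λ, funext fun i => ?_⟩
    rw [← (hF Λ i _).1 (hs i Λ _ hΛ), hΛm, hm]
    rcases le_or_gt 0 (y i) with h | h
    · simp [h, abs_of_nonneg h]
    · simp [not_le.2 h, abs_of_neg h]
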